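/- **Conventions.** Let $K$ be a field of characteristic $p\neq 2$ ($p=0$ is allowed). Let $\mathfrak{g}(A)$ be the Lie superalgebra over $\mathbb{C}$ with the Cartan matrix $$A=\begin{pmatrix}0&1&0\\-1&2&-3\\0&-1&2\end{pmatrix},$$ that is, the Lie superalgebra with odd generators $X_1^\pm$, even generators $X_2^\pm,X_3^\pm$ and relations $[X_i^+,X_j^-]=\delta_{ij}H_i$, $[H_i,H_j]=0$, $[H_i,X_j^\pm]=\pm a_{ij}X_j^\pm$, factored by its largest ideal that meets the span of the $H_i$ in zero. Its Chevalley $\mathbb{Z}$-form is the smallest additive subgroup that contains all $X_i^\pm$ and is closed under the bracket and under all $(\operatorname{ad}X_i^\pm)^m/m!$; $\mathfrak{g}=\mathfrak{ag}(2)$ over $K$ is the tensor product of this $\mathbb{Z}$-form with $K$. It is $\mathbb{Z}$-graded by $\deg X_1^\pm=\pm1$, $\deg X_2^\pm=\deg X_3^\pm=0$; write $\mathfrak{g}=\bigoplus_k\mathfrak{g}_k$ and $\mathfrak{g}_-=\bigoplus_{k<0}\mathfrak{g}_k$. The contact Lie superalgebra $\mathfrak{k}(1|7)$ is the space of generating functions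 in divided powers $t^{(a)}$ of one even variable $t$ and seven odd variables $v_i,w_i$ ($i=1,3,4$), $u$, with the contact bracket of the form $\alpha=dt-\sum_i(v_idw_i+w_idv_i)+2u\,du$. It is graded by $\deg f-2$, where $\deg t=2$ and each odd variable has degree $1$. For $p>0$ and $N\ge1$, $\mathfrak{k}(1;N|7)$ is its subalgebra spanned by the functions with powers $t^{(a)}$, $a<p^N$; for $p=0$ put $\mathfrak{k}(1;N|7)=\mathfrak{k}(1|7)$. For a non-positively graded subalgebra $\mathfrak{n}_{\le 0}$ of $\mathfrak{k}(1;N|7)$, the Cartan–Tanaka–Shchepochkina (CTS) prolong is the largest graded subalgebra of $\mathfrak{k}(1;N|7)$ with non-positive part $\mathfrak{n}_{\le0}$. If $P=\bigoplus_k P_k$ is a CTS prolong and $\mathfrak{h}_1\subset P_1$ is a $P_0$-submodule, the partial prolong of $\mathfrak{h}_1$ is $\bigoplus_{k\le0}P_k\oplus\bigoplus_{k\ge1}\mathfrak{h}_k$ with $\mathfrak{h}_k=\{D\in P_k: [D,P_{-1}]\subset\mathfrak{h}_{k-1}\}$ for $k\ge2$. **Theorem 4.2.** There is an embedding $\mathfrak{g}=\mathfrak{ag}(2)\hookrightarrow\mathfrak{k}(1|7)$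 of $\mathbb{Z}$-graded Lie superalgebras with image in $\mathfrak{k}(1;N|7)$ for every $N\ge1$ and with $\mathfrak{g}_-=\mathfrak{k}(1|7)_-$, such that the following holds. 1. If $p=0$ or $p>3$, then for every $N\ge 1$ the CTS prolong of $\bigoplus_{k\le0}\mathfrak{g}_k$ in $\mathfrak{k}(1;N|7)$ is $\mathfrak{ag}(2)$. 2. Let $p=3$. The subalgebra of $\mathfrak{g}_0$ generated by $X_2^\pm$ and $[X_2^\pm,X_3^\pm]$ is isomorphic to $\mathfrak{psl}(3)$, the centre $\mathfrak{z}$ of $\mathfrak{g}_0$ is one-dimensional and these two subalgebras meet in zero; put $\widetilde{\mathfrak{g}}_0=\mathfrak{psl}(3)\oplus\mathfrak{z}$. For every $N\ge1$ let $\mathrm{Bj}(1;N|7)$ be the CTS prolong of $\mathfrak{g}_-\oplus\widetilde{\mathfrak{g}}_0$ in $\mathfrak{k}(1;N|7)$. Then $\mathrm{Bj}(1;N|7)$ is a simple Lie superalgebra of superdimension $(8\cdot3^N\,|\,8\cdot3^N)$; the CTS prolong of $\bigoplus_{k\le 0}\mathfrak{g}_k$ in $\mathfrak{k}(1;N|7)$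 is $\mathfrak{g}_0+\mathrm{Bj}(1;N|7)$, and $\mathrm{Bj}(1;N|7)$ is an ideal in it. 3. Let $p=3$. The component of degree $1$ of $\mathrm{Bj}(1;N|7)$ does not depend on $N$. It is the direct sum of two irreducible $\widetilde{\mathfrak{g}}_0$-modules, one of dimension $1$ and one, $\mathfrak{g}_1''$, of dimension $7$, and $[\mathfrak{g}_1'',\mathfrak{g}_{-1}]=\widetilde{\mathfrak{g}}_0$. The partial prolong $\mathfrak{bj}$ of $\mathfrak{g}_1''$ in $\mathrm{Bj}(1;N|7)$ is the same for all $N\ge1$; it is a simple Lie superalgebra of superdimension $(10|14)$, and its even part is isomorphic to $\mathfrak{sl}(2)\oplus\mathfrak{psl}(3)$. -/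

import Mathlib

open scoped TensorProduct

noncomputable section

namespace SuperLie

/-! ### Lie superalgebras -/

/-- A module with a bilinear bracket and two parity subspaces (`par 0` even, `par 1` odd).
The axioms of a Lie superalgebra are stated in `IsLieSuperalgebra` below. -/
class SuperBracket (R L : Type*) [CommRing R] [AddCommGroup L] [Module R L] where
  br : L →ₗ[R] L →ₗ[R] L
  par : ZMod 2 → Submodule R L

/-- The sign `(-1)^(i j)` for parities `i`, `j`. -/
def koszul (i j : ZMod 2) : ℤ := (-1) ^ (i.val * j.val)

section Axioms

variable {R L : Type*} [CommRing R] [AddCommGroup L] [Module R L] [SuperBracket R L]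

open SuperBracket

/-- The subspace `S` is closed under the bracket. -/
def BracketClosed (S : Submodule R L) : Prop :=
  ∀ x ∈ S, ∀ y ∈ S, br (R := R) x y ∈ S

/-- With the bracket and the parity of the ambient module, the subspace `S` is a Lie superalgebra
(the last axiom is needed in characteristic 3; the axioms are the usual ones if 2 is invertible). -/
structure IsLieSuperalgebra (S : Submodule R L) : Prop where
  closed : BracketClosed S
  sup_par : (S ⊓ par 0) ⊔ (S ⊓ par 1) = S
  inf_par : S ⊓ par 0 ⊓ par 1 = ⊥
  br_par : ∀ i j : ZMod 2, ∀ x ∈ S ⊓ par i, ∀ y ∈ S ⊓ par j, br (R := R) x y ∈ par (R := R) (i + j)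
  skew : ∀ i j : ZMod 2, ∀ x ∈ S ⊓ par i, ∀ y ∈ S ⊓ par j,
    br (R := R) x y = -(koszul i j • br (R := R) y x)
  jacobi : ∀ i j : ZMod 2, ∀ x ∈ S ⊓ par i, ∀ y ∈ S ⊓ par j, ∀ z ∈ S,
    br (R := R) x (br (R := R) y z) =
      br (R := R) (br (R := R) x y) z + koszul i j • br (R := R) y (br (R := R) x z)
  cube : ∀ x ∈ S ⊓ par 1, br (R := R) x (br (R := R) x x) = 0

/-- `S` is a simple Lie superalgebra: it is not abelian, and its only ideals (which are graded
subspaces, as always for superalgebras) are `0` and `S`. -/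
structure IsSimpleLieSuperalgebra (S : Submodule R L) : Prop where
  isLie : IsLieSuperalgebra S
  nonabelian : ∃ x ∈ S, ∃ y ∈ S, br (R := R) x y ≠ 0
  simple : ∀ I : Submodule R L, I ≤ S → (I ⊓ par 0) ⊔ (I ⊓ par 1) = I →
    (∀ x ∈ S, ∀ y ∈ I, br (R := R) x y ∈ I) → I = ⊥ ∨ I = S

/-- The subspace `V` is stable under the adjoint action of `S`. -/
def StableUnder (S V : Submodule R L) : Prop :=
  ∀ x ∈ S, ∀ v ∈ V, br (R := R) x v ∈ V

/-- `V` is an irreducible module over `S` with respect to the adjoint action. -/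
def IrreducibleUnder (S V : Submodule R L) : Prop :=
  StableUnder S V ∧ V ≠ ⊥ ∧ ∀ W : Submodule R L, W ≤ V → StableUnder S W → W = ⊥ ∨ W = V

/-- The subalgebra generated by a set. -/
def generatedBy (X : Set L) : Submodule R L :=
  sInf {S : Submodule R L | X ⊆ S ∧ BracketClosed S}

end Axioms

/-! ### Lie superalgebras with Cartan matrix, over `ℂ`

The Chevalley generators are indexed by `Fin n × Bool`: `(i, true)` is `X_i^+` and `(i, false)` is
`X_i^-`. -/

section Cartan

variable {n : ℕ}

/-- The free nonassociative algebra on the Chevalley generators. -/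
abbrev FreeAlg (n : ℕ) : Type := FreeNonUnitalNonAssocAlgebra ℂ (Fin n × Bool)

/-- A nonassociative monomial as an element of the free algebra. -/
def word (w : FreeMagma (Fin n × Bool)) : FreeAlg n := MonoidAlgebra.single w 1

/-- The parity of a monomial; `X_i^±` has parity `π i`. -/
def wordParity (π : Fin n → ZMod 2) : FreeMagma (Fin n × Bool) → ZMod 2
  | FreeMagma.of g => π g.1
  | FreeMagma.mul a b => wordParity π a + wordParity π b

/-- The degree of a monomial; `X_i^±` has degree `± r i`. -/
def wordDeg (r : Fin n → ℤ) : FreeMagma (Fin n × Bool) → ℤ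
  | FreeMagma.of g => if g.2 then r g.1 else -r g.1
  | FreeMagma.mul a b => wordDeg r a + wordDeg r b

/-- `X_i^+` for `s = true`, `X_i^-` for `s = false`, in the free algebra. -/
def genX (i : Fin n) (s : Bool) : FreeAlg n := word (FreeMagma.of (i, s))

/-- `H_i = [X_i^+, X_i^-]` in the free algebra. -/
def genH (i : Fin n) : FreeAlg n := genX i true * genX i false

/-- The relations: super skew-symmetry, the super Jacobi identity, and
`[X_i^+, X_j^-] = δ_ij H_i`, `[H_i, H_j] = 0`, `[H_i, X_j^±] = ± a_ij X_j^±`. -/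
inductive Rel (A : Matrix (Fin n) (Fin n) ℤ) (π : Fin n → ZMod 2) : FreeAlg n → Prop
  | skew (a b : FreeMagma (Fin n × Bool)) :
      Rel A π (word a * word b + koszul (wordParity π a) (wordParity π b) • (word b * word a))
  | jacobi (a b c : FreeMagma (Fin n × Bool)) :
      Rel A π (word a * (word b * word c) - (word a * word b) * word c
        - koszul (wordParity π a) (wordParity π b) • (word b * (word a * word c)))
  | mixed (i j : Fin n) (h : i ≠ j) : Rel A π (genX i true * genX j false)
  | cartan (i j : Fin n) : Rel A π (genH i * genH j)
  | plus (i j : Fin n) : Rel A π (genH i * genX j true - A i j • genX j true)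
  | minus (i j : Fin n) : Rel A π (genH i * genX j false + A i j • genX j false)

/-- Two-sided ideals of the free algebra. -/
def IsIdeal (J : Submodule ℂ (FreeAlg n)) : Prop :=
  ∀ x, ∀ y ∈ J, x * y ∈ J ∧ y * x ∈ J

/-- The ideal generated by the relations. -/
def relIdeal (A : Matrix (Fin n) (Fin n) ℤ) (π : Fin n → ZMod 2) : Submodule ℂ (FreeAlg n) :=
  sInf {J | IsIdeal J ∧ ∀ x, Rel A π x → x ∈ J}

/-- The span of the `H_i`. -/
def spanH (n : ℕ) : Submodule ℂ (FreeAlg n) := Submodule.span ℂ (Set.range genH)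

/-- The sum of all ideals that contain the relations and that, modulo the relations, meet the span
of the `H_i` in zero. (If `A` is invertible, all ideals are sums of weight spaces for the `H_i`
modulo the relations, so this is the largest such ideal.) -/
def maxIdeal (A : Matrix (Fin n) (Fin n) ℤ) (π : Fin n → ZMod 2) : Submodule ℂ (FreeAlg n) :=
  sSup {J | IsIdeal J ∧ relIdeal A π ≤ J ∧ J ⊓ (spanH n ⊔ relIdeal A π) ≤ relIdeal A π}

theorem isIdeal_maxIdeal (A : Matrix (Fin n) (Fin n) ℤ) (π : Fin n → ZMod 2) :
    IsIdeal (maxIdeal A π) := by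
  intro x
  have h1 : maxIdeal A π ≤ (maxIdeal A π).comap (LinearMap.mulLeft ℂ x) :=
    sSup_le fun J hJ y hy =>
      (le_sSup (a := J) hJ : J ≤ maxIdeal A π) (hJ.1 x y hy).1
  have h2 : maxIdeal A π ≤ (maxIdeal A π).comap (LinearMap.mulRight ℂ x) :=
    sSup_le fun J hJ y hy =>
      (le_sSup (a := J) hJ : J ≤ maxIdeal A π) (hJ.1 x y hy).2
  exact fun y hy => ⟨h1 hy, h2 hy⟩

/-- The Lie superalgebra `𝔤(A)` over `ℂ` with Cartan matrix `A` and parities `π`. -/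
def CartanAlg (A : Matrix (Fin n) (Fin n) ℤ) (π : Fin n → ZMod 2) : Type :=
  FreeAlg n ⧸ maxIdeal A π

instance (A : Matrix (Fin n) (Fin n) ℤ) (π : Fin n → ZMod 2) : AddCommGroup (CartanAlg A π) :=
  inferInstanceAs (AddCommGroup (FreeAlg n ⧸ maxIdeal A π))

instance (A : Matrix (Fin n) (Fin n) ℤ) (π : Fin n → ZMod 2) : Module ℂ (CartanAlg A π) :=
  inferInstanceAs (Module ℂ (FreeAlg n ⧸ maxIdeal A π))

/-- The projection of the free algebra onto `𝔤(A)`. -/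
def proj (A : Matrix (Fin n) (Fin n) ℤ) (π : Fin n → ZMod 2) : FreeAlg n →ₗ[ℂ] CartanAlg A π :=
  (maxIdeal A π).mkQ

/-- The bracket of `𝔤(A)`: it is induced by the product of the free algebra. -/
def cartanBr (A : Matrix (Fin n) (Fin n) ℤ) (π : Fin n → ZMod 2) :
    CartanAlg A π →ₗ[ℂ] CartanAlg A π →ₗ[ℂ] CartanAlg A π :=
  (maxIdeal A π).liftQ
    { toFun := fun x => (maxIdeal A π).mapQ (maxIdeal A π) (LinearMap.mulLeft ℂ x)
        (fun y hy => (isIdeal_maxIdeal A π x y hy).1)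
      map_add' := fun x y => Submodule.linearMap_qext _ <| LinearMap.ext fun z =>
        congrArg (maxIdeal A π).mkQ (add_mul x y z)
      map_smul' := fun c x => Submodule.linearMap_qext _ <| LinearMap.ext fun z =>
        congrArg (maxIdeal A π).mkQ (smul_mul_assoc c x z) }
    (fun x hx => LinearMap.mem_ker.2 <| Submodule.linearMap_qext _ <| LinearMap.ext fun z =>
      (Submodule.Quotient.mk_eq_zero _).2 (isIdeal_maxIdeal A π z x hx).2)

theorem cartanBr_proj (A : Matrix (Fin n) (Fin n) ℤ) (π : Fin n → ZMod 2) (x y : FreeAlg n) :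
    cartanBr A π (proj A π x) (proj A π y) = proj A π (x * y) := rfl

instance (A : Matrix (Fin n) (Fin n) ℤ) (π : Fin n → ZMod 2) :
    SuperBracket ℂ (CartanAlg A π) where
  br := cartanBr A π
  par i := Submodule.span ℂ {x | ∃ w, wordParity π w = i ∧ x = proj A π (word w)}

/-- The component of degree `k` of `𝔤(A)` in the grading `deg X_i^± = ± r i`. -/
def cartanDeg (A : Matrix (Fin n) (Fin n) ℤ) (π : Fin n → ZMod 2) (r : Fin n → ℤ) (k : ℤ) :
    Submodule ℂ (CartanAlg A π) :=
  Submodule.span ℂ {x | ∃ w, wordDeg r w = k ∧ x = proj A π (word w)}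

/-- The conditions on a `ℤ`-lattice in `𝔤(A)`: it contains the Chevalley generators and it is closed
under the bracket and under the divided powers `(ad X_i^±)^m / m!`. -/
structure IsAdmissible (A : Matrix (Fin n) (Fin n) ℤ) (π : Fin n → ZMod 2)
    (M : Submodule ℤ (CartanAlg A π)) : Prop where
  gen : ∀ i s, proj A π (genX i s) ∈ M
  br : ∀ x ∈ M, ∀ y ∈ M, cartanBr A π x y ∈ M
  divPow : ∀ i s, ∀ m : ℕ, ∀ x ∈ M,
    ((m.factorial : ℂ)⁻¹) • (((cartanBr A π (proj A π (genX i s))) ^ m) x) ∈ M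

/-- The Chevalley `ℤ`-form of `𝔤(A)`: the smallest admissible lattice. -/
def zForm (A : Matrix (Fin n) (Fin n) ℤ) (π : Fin n → ZMod 2) : Submodule ℤ (CartanAlg A π) :=
  sInf {M | IsAdmissible A π M}

theorem isAdmissible_zForm (A : Matrix (Fin n) (Fin n) ℤ) (π : Fin n → ZMod 2) :
    IsAdmissible A π (zForm A π) where
  gen i s := Submodule.mem_sInf.2 fun _ hM => hM.gen i s
  br x hx y hy := Submodule.mem_sInf.2 fun M hM =>
    hM.br x (Submodule.mem_sInf.1 hx M hM) y (Submodule.mem_sInf.1 hy M hM)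
  divPow i s m x hx := Submodule.mem_sInf.2 fun M hM =>
    hM.divPow i s m x (Submodule.mem_sInf.1 hx M hM)

/-- The bracket of the `ℤ`-form. -/
def zBr (A : Matrix (Fin n) (Fin n) ℤ) (π : Fin n → ZMod 2) :
    zForm A π →ₗ[ℤ] zForm A π →ₗ[ℤ] zForm A π :=
  LinearMap.mk₂ ℤ (fun x y => ⟨cartanBr A π x y, (isAdmissible_zForm A π).br x x.2 y y.2⟩)
    (fun x y z => by ext; simp)
    (fun c x y => by ext; simp)
    (fun x y z => by ext; simp)
    (fun c x y => by ext; simp)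

/-- `X_i^±` as an element of the `ℤ`-form. -/
def zX (A : Matrix (Fin n) (Fin n) ℤ) (π : Fin n → ZMod 2) (i : Fin n) (s : Bool) : zForm A π :=
  ⟨proj A π (genX i s), (isAdmissible_zForm A π).gen i s⟩

end Cartan

/-! ### The Lie superalgebra `𝔞𝔤(2)` over a field -/

/-- The first Cartan matrix of `𝔞𝔤(2)`. -/
def agMatrix : Matrix (Fin 3) (Fin 3) ℤ := !![0, 1, 0; -1, 2, -3; 0, -1, 2]

/-- For this Cartan matrix, `X_1^±` are odd and the other generators are even. -/
def agParity : Fin 3 → ZMod 2 := ![1, 0, 0]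

/-- The grading `r = (1, 0, 0)`. -/
def agR : Fin 3 → ℤ := ![1, 0, 0]

/-- `𝔞𝔤(2)` over the field `K`: the scalar extension to `K` of the Chevalley `ℤ`-form, i.e. the
structure constants are reduced modulo the characteristic. -/
abbrev AG2 (K : Type*) [Field K] : Type _ := K ⊗[ℤ] (zForm agMatrix agParity)

section AG2

variable (K : Type*) [Field K]

instance : SuperBracket K (AG2 K) where
  br := LinearMap.BilinMap.baseChange K (zBr agMatrix agParity)
  par i := Submodule.span K {z | ∃ x : zForm agMatrix agParity,
    (x : CartanAlg agMatrix agParity) ∈ SuperBracket.par (R := ℂ) i ∧ z = 1 ⊗ₜ[ℤ] x}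

/-- The component of degree `k` of `𝔞𝔤(2)`. -/
def agDeg (k : ℤ) : Submodule K (AG2 K) :=
  Submodule.span K {z | ∃ x : zForm agMatrix agParity,
    (x : CartanAlg agMatrix agParity) ∈ cartanDeg agMatrix agParity agR k ∧ z = 1 ⊗ₜ[ℤ] x}

/-- The Chevalley generators of `𝔞𝔤(2)`; the index runs from `0`. -/
def agX (i : Fin 3) (s : Bool) : AG2 K := 1 ⊗ₜ[ℤ] zX agMatrix agParity i s

/-- The subalgebra generated by `X_2^±` and `[X_2^±, X_3^±]` (in the numbering from `1`), where
`X_2^±` and `X_3^±` are the generators of `𝔤(2)` for the short and for the long simple root. -/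
def agShort : Submodule K (AG2 K) :=
  generatedBy {x | ∃ s : Bool, x = agX K 1 s ∨
    x = SuperBracket.br (R := K) (agX K 1 s) (agX K 2 s)}

/-- The centre of the component of degree `0`. -/
def agCentre : Submodule K (AG2 K) where
  carrier := {x | x ∈ agDeg K 0 ∧ ∀ y ∈ agDeg K 0, SuperBracket.br (R := K) x y = 0}
  add_mem' := fun hx hy => ⟨add_mem hx.1 hy.1, fun y h => by
    rw [map_add, LinearMap.add_apply, hx.2 y h, hy.2 y h, add_zero]⟩
  zero_mem' := ⟨zero_mem _, fun y _ => by rw [map_zero, LinearMap.zero_apply]⟩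
  smul_mem' := fun c x hx => ⟨Submodule.smul_mem _ c hx.1, fun y h => by
    rw [map_smul, LinearMap.smul_apply, hx.2 y h, smul_zero]⟩

end AG2

/-! ### The contact Lie superalgebra `𝔨(1;N|7)` in generating functions -/

/-- Divided powers in one even variable `t` and seven odd variables, with basis `t^(a) θ_S`. The odd
variables `θ_0, …, θ_6` are `v_1, v_3, v_4, w_1, w_3, w_4, u`, and `θ_S` is the product of the `θ_i`,
`i ∈ S`, in increasing order. -/
abbrev DPAlg (K : Type*) [Field K] : Type _ := (ℕ × Finset (Fin 7)) →₀ K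

section Contact

variable (K : Type*) [Field K]

/-- `(-1)` to the number of pairs `(i, j) ∈ S × T` with `j < i`. -/
def shuffleSign (S T : Finset (Fin 7)) : ℤ :=
  (-1) ^ ((S ×ˢ T).filter fun q => q.2 < q.1).card

/-- The product:
`t^(a) θ_S · t^(b) θ_T = ± binom(a + b, a) t^(a+b) θ_{S ∪ T}`, and `0` unless `S`, `T` are disjoint. -/
def dpMul : DPAlg K →ₗ[K] DPAlg K →ₗ[K] DPAlg K :=
  Finsupp.linearCombination K fun m => Finsupp.linearCombination K fun l =>
    if Disjoint m.2 l.2 then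
      Finsupp.single (m.1 + l.1, m.2 ∪ l.2)
        ((shuffleSign m.2 l.2 : K) * ((m.1 + l.1).choose m.1 : K))
    else 0

/-- The derivation `∂_t`, with `∂_t t^(a) = t^(a-1)`. -/
def dT : DPAlg K →ₗ[K] DPAlg K :=
  Finsupp.linearCombination K fun m =>
    if m.1 = 0 then 0 else Finsupp.single (m.1 - 1, m.2) 1

/-- The odd (left) derivation `∂/∂θ_i`. -/
def dTheta (i : Fin 7) : DPAlg K →ₗ[K] DPAlg K :=
  Finsupp.linearCombination K fun m =>
    if i ∈ m.2 then Finsupp.single (m.1, m.2.erase i) (shuffleSign {i} (m.2.erase i) : K) else 0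

/-- The Euler operator `E = ∑ θ_i ∂/∂θ_i`. -/
def euler : DPAlg K →ₗ[K] DPAlg K :=
  Finsupp.linearCombination K fun m => Finsupp.single m (m.2.card : K)

/-- The operator `f ↦ (-1)^{p(f)} f`. -/
def signOp : DPAlg K →ₗ[K] DPAlg K :=
  Finsupp.linearCombination K fun m => Finsupp.single m ((-1) ^ m.2.card)

/-- The involution `v_i ↔ w_i`, `u ↔ u` of the odd variables. -/
def dualIdx : Fin 7 → Fin 7 := ![3, 4, 5, 0, 1, 2, 6]

/-- The nonzero entries of the inverse of the Gram matrix of the odd part of the contact form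
`α = dt - ∑ (v_i dw_i + w_i dv_i) + 2 u du`. -/
def poissonCoeff : Fin 7 → K := ![-1, -1, -1, -1, -1, -1, 2⁻¹]

/-- The contact bracket for `α = dt - ∑ (v_i dw_i + w_i dv_i) + 2 u du`:
`{f, g} = (2 - E)f · ∂_t g - ∂_t f · (2 - E)g
  + (-1)^{p(f)} (- ∑ (∂f/∂v_i ∂g/∂w_i + ∂f/∂w_i ∂g/∂v_i) + ½ ∂f/∂u ∂g/∂u)`.
The function `f` stands for the contact vector field
`K_f = (2 - E)(f) ∂_t + ∂_t(f) E
  + (-1)^{p(f)} (- ∑ (∂f/∂v_i ∂/∂w_i + ∂f/∂w_i ∂/∂v_i) + ½ ∂f/∂u ∂/∂u)`. -/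
def contactBr : DPAlg K →ₗ[K] DPAlg K →ₗ[K] DPAlg K :=
  LinearMap.mk₂ K
    (fun f g => dpMul K ((2 : K) • f - euler K f) (dT K g) - dpMul K (dT K f) ((2 : K) • g - euler K g)
      + ∑ i : Fin 7, poissonCoeff K i •
          dpMul K (dTheta K i (signOp K f)) (dTheta K (dualIdx i) g))
    (fun f f' g => by
      simp only [map_add, smul_add, LinearMap.add_apply, map_sub, LinearMap.sub_apply,
        Finset.sum_add_distrib]
      abel)
    (fun c f g => by
      simp only [map_smul, LinearMap.smul_apply, map_sub, LinearMap.sub_apply, smul_add, smul_sub,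
        Finset.smul_sum, smul_comm c])
    (fun f g g' => by
      simp only [map_add, smul_add, map_sub, Finset.sum_add_distrib]
      abel)
    (fun c f g => by
      simp only [map_smul, map_sub, smul_add, smul_sub, Finset.smul_sum, smul_comm c])

instance : SuperBracket K (DPAlg K) where
  br := contactBr K
  par i := Finsupp.supported K K {m | (m.2.card : ZMod 2) = i}

/-- The component of degree `k`: `deg t = 2`, the odd variables have degree `1`, and the vector field
`K_f` has degree `deg f - 2`. -/
def contactDeg (k : ℤ) : Submodule K (DPAlg K) :=
  Finsupp.supported K K {m | 2 * (m.1 : ℤ) + (m.2.card : ℤ) - 2 = k}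

/-- The contact superalgebra `𝔨(1;N|7)` over a field of characteristic `p`: the exponents of `t` are
less than `p ^ N`. In characteristic `0` there is no restriction, and this is `𝔨(1|7)`. -/
def contactAlg (p N : ℕ) : Submodule K (DPAlg K) :=
  Finsupp.supported K K {m | p = 0 ∨ m.1 < p ^ N}

end Contact

/-! ### Prolongs -/

section Prolong

variable {K : Type*} [Field K]

open SuperBracket

/-- `S` is a graded subalgebra of `V` whose component of degree `k` is `g k` for every `k ≤ 0`. -/
structure HasNonpositivePart (V : Submodule K (DPAlg K)) (g : ℤ → Submodule K (DPAlg K))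
    (S : Submodule K (DPAlg K)) : Prop where
  le : S ≤ V
  closed : BracketClosed S
  graded : ⨆ k : ℤ, S ⊓ contactDeg K k = S
  nonpos : ∀ k ≤ 0, S ⊓ contactDeg K k = g k

/-- `P` is the Cartan–Tanaka–Shchepochkina prolong in `V` of the nonpositive part `⨁_{k ≤ 0} g k`:
the largest graded subalgebra of `V` with this nonpositive part. -/
def IsCTSProlong (V : Submodule K (DPAlg K)) (g : ℤ → Submodule K (DPAlg K))
    (P : Submodule K (DPAlg K)) : Prop :=
  IsGreatest {S | HasNonpositivePart V g S} P

/-- The components of positive degree of the partial prolong; `partialComp P h n` has degree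
`n + 1`. -/
def partialComp (P h : Submodule K (DPAlg K)) : ℕ → Submodule K (DPAlg K)
  | 0 => h
  | n + 1 =>
    { carrier := {D | D ∈ P ⊓ contactDeg K (n + 2) ∧
        ∀ x ∈ P ⊓ contactDeg K (-1), br (R := K) D x ∈ partialComp P h n}
      add_mem' := fun ha hb => ⟨add_mem ha.1 hb.1, fun x hx => by
        rw [map_add, LinearMap.add_apply]
        exact add_mem (ha.2 x hx) (hb.2 x hx)⟩
      zero_mem' := ⟨zero_mem _, fun x _ => by
        rw [map_zero, LinearMap.zero_apply]
        exact zero_mem _⟩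
      smul_mem' := fun c a ha => ⟨Submodule.smul_mem _ c ha.1, fun x hx => by
        rw [map_smul, LinearMap.smul_apply]
        exact Submodule.smul_mem _ c (ha.2 x hx)⟩ }

/-- The partial prolong: the nonpositive part of the prolong `P`, together with the subspace `h` of
its component of degree `1` and everything in `P` of degree at least `2` that `h` allows. -/
def partialProlong (P h : Submodule K (DPAlg K)) : Submodule K (DPAlg K) :=
  (⨆ (k : ℤ) (_ : k ≤ 0), P ⊓ contactDeg K k) ⊔ ⨆ n : ℕ, partialComp P h n

/-- `φ` is an embedding of `𝔞𝔤(2)` into the contact superalgebra that respects the brackets, the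
parities and the `ℤ`-gradings, and that identifies the negative parts. -/
structure IsContactEmbedding (φ : AG2 K →ₗ[K] DPAlg K) : Prop where
  inj : Function.Injective φ
  map_br : ∀ x y, φ (br (R := K) x y) = br (R := K) (φ x) (φ y)
  map_par : ∀ i, (par i : Submodule K (AG2 K)).map φ ≤ par i
  map_deg : ∀ k, (agDeg K k).map φ ≤ contactDeg K k
  map_neg : ∀ k < 0, (agDeg K k).map φ = contactDeg K k

/-- The components of the image of `𝔞𝔤(2)`. -/
def gPart (φ : AG2 K →ₗ[K] DPAlg K) (k : ℤ) : Submodule K (DPAlg K) := (agDeg K k).map φ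

/-- The same components, but with the component of degree `0` replaced by the image of the sum of
`agShort` and of the centre of the component of degree `0`. -/
def gTilde (φ : AG2 K →ₗ[K] DPAlg K) (k : ℤ) : Submodule K (DPAlg K) :=
  if k = 0 then (agShort K ⊔ agCentre K).map φ else gPart φ k

/-- The superspace `S` has superdimension `a|b`. -/
def HasSdim (S : Submodule K (DPAlg K)) (a b : ℕ) : Prop :=
  FiniteDimensional K S ∧
  Module.finrank K (S ⊓ par 0 : Submodule K (DPAlg K)) = a ∧
  Module.finrank K (S ⊓ par 1 : Submodule K (DPAlg K)) = b

/-- The Lie algebra `𝔰𝔩(m)`. -/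
abbrev SL (K : Type*) [Field K] (m : ℕ) : Type _ := LieAlgebra.SpecialLinear.sl (Fin m) K

/-- The Lie algebra `𝔭𝔰𝔩(3)`: the quotient of `𝔰𝔩(3)` by its centre. -/
abbrev PSL3 (K : Type*) [Field K] : Type _ := SL K 3 ⧸ LieAlgebra.center K (SL K 3)

/-- The subspace `S`, with the ambient bracket, is isomorphic to the Lie algebra `M`. -/
def IsIsoToLie (S : Submodule K (DPAlg K)) (M : Type*) [LieRing M] [LieAlgebra K M] : Prop :=
  ∃ e : M →ₗ[K] DPAlg K, Function.Injective e ∧ LinearMap.range e = S ∧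
    ∀ x y, e ⁅x, y⁆ = br (R := K) (e x) (e y)

end Prolong

end SuperLie

end

open SuperLie

/-! Everything rests on one property of `𝔨(1|7)`. Bracketing with an odd variable `θ_i` is the
operator `dOp i`, that is, `θ_i ∂_t` minus a multiple of the derivative in the dual variable. It is
a superderivation of the bracket (`dOp_contactBr`), and an element of degree at least `-1` that is
killed by all `dOp i` is zero (`eq_zero_of_dOp_eq_zero`). Hence statements in degree `k` can be
tested in degree `k - 1`. The Jacobi identity is proved in this way, and prolongs are computed
degree by degree: `f` is admitted in degree `k ≥ 1` as soon as all `dOp i f` are admitted in degree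
`k - 1`.

The embedding is given by 31 explicit generating functions. Over `ℂ` the free algebra on the
Chevalley generators maps onto their span, and `ker_evFree` identifies the kernel with the ideal
that defines `𝔤(A)`. The kernel meets the span of the `H_i` trivially modulo the relations.
Conversely, by the triangular decomposition, an ideal with this property has no weight zero part
modulo the relations, whereas bracketing with a root vector of opposite weight would produce one
from any element outside the kernel. The lattice spanned by the 31 elements is reached by divided
powers of the generators and is stable under them, so it is the Chevalley form (`zForm_le_zSpan`);
base change gives the embedding over `K`, and reading off coordinates requires only that 2 be
invertible.

In degrees one, two and three the prolong is the solution space of a finite integral linear system.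
All pivots of the elimination divide 64, except one in degree one that divides `192 = 64 · 3`. So
for `p ≠ 3` the solutions are the elements of `𝔞𝔤(2)`; degree three is empty, and therefore all
higher degrees are.

For `p = 3` the exceptional pivot leaves one cubic element free in degree one. The prolong is then
spanned by sixteen sequences `fam a j` with `∂_t (fam (a+1) j) = fam a j`, on which each `dOp i`
acts through combinations of `∂_t`-derivatives. That nothing else occurs is
`mem_famSpan_of_dOp_mem`: `∂_t f` can be integrated inside the families, and the remaining
difference, constant in `t`, is excluded by its degree or, in degree two, by the square of `dOp i`.
The same criterion gives closure under the bracket by induction on the degree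
(`contactBr_mem_of_prolongPart`). In degree zero the short roots of `𝔤(2)` span an ideal modulo 3, a
copy of `𝔭𝔰𝔩(3)`; this is why the smaller degree zero part is natural.

For simplicity, a nonzero ideal is stable under the `dOp i` and so contains `1`
(`one_mem_of_dOp_stable`), then `t`, which acts by the degree, and then everything. The algebra `𝔟𝔧`
is the span of the 24 basis elements of `𝔞𝔤(2)` that survive: once the cubic is forbidden in degree
one, the systems in degrees two and three leave nothing outside `𝔞𝔤(2)`.

All finite verifications are computations with lists of integers. Writing `2u` for the last variable
removes the only denominator of the bracket; `eval_br` and `eval_eq_zero` transfer the results to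
`K`. -/

noncomputable section

namespace SuperLie

/-! ### Signs from reordering odd variables. -/

section Signs

/-- As a product over pairs the sign is visibly multiplicative in each argument; the rules for
unions and for exchanging the arguments follow from this form. -/
theorem shuffleSign_eq_prod (S T : Finset (Fin 7)) :
    shuffleSign S T = ∏ i ∈ S, ∏ j ∈ T, if j < i then (-1 : ℤ) else 1 := by
  rw [← Finset.prod_product', shuffleSign, Finset.prod_ite]
  simp

theorem shuffleSign_union_left {S S' : Finset (Fin 7)} (h : Disjoint S S') (T : Finset (Fin 7)) :
    shuffleSign (S ∪ S') T = shuffleSign S T * shuffleSign S' T := by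
  simp only [shuffleSign_eq_prod, Finset.prod_union h]

theorem shuffleSign_union_right {T T' : Finset (Fin 7)} (S : Finset (Fin 7)) (h : Disjoint T T') :
    shuffleSign S (T ∪ T') = shuffleSign S T * shuffleSign S T' := by
  simp only [shuffleSign_eq_prod, Finset.prod_union h, Finset.prod_mul_distrib]

theorem shuffleSign_mul_swap {S T : Finset (Fin 7)} (h : Disjoint S T) :
    shuffleSign S T * shuffleSign T S = (-1) ^ (S.card * T.card) := by
  rw [shuffleSign_eq_prod, shuffleSign_eq_prod, Finset.prod_comm (s := T), ← Finset.prod_mul_distrib,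
    mul_comm S.card, pow_mul]
  simp only [← Finset.prod_mul_distrib]
  rw [← Finset.prod_const]
  refine Finset.prod_congr rfl fun i hi => ?_
  rw [← Finset.prod_const]
  refine Finset.prod_congr rfl fun j hj => ?_
  have hij : i ≠ j := fun e => Finset.disjoint_left.1 h hi (e ▸ hj)
  rcases lt_or_gt_of_ne hij with h1 | h1 <;> simp [h1, h1.not_gt]

theorem shuffleSign_mul_self (S T : Finset (Fin 7)) : shuffleSign S T * shuffleSign S T = 1 := by
  rw [shuffleSign, ← pow_add, ← two_mul, pow_mul]; simp

theorem shuffleSign_swap {S T : Finset (Fin 7)} (h : Disjoint S T) :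
    shuffleSign S T = (-1) ^ (S.card * T.card) * shuffleSign T S := by
  rw [← shuffleSign_mul_swap h, mul_assoc, shuffleSign_mul_self, mul_one]

end Signs

/-! ### The supercommutative product and the operators on it. -/

section Operators

variable {K : Type*} [Field K]

/-- The monomial `t^(a) θ_S`. -/
def mono (K : Type*) [Field K] (a : ℕ) (S : Finset (Fin 7)) : DPAlg K := Finsupp.single (a, S) 1

theorem single_eq_smul_mono (a : ℕ) (S : Finset (Fin 7)) (x : K) :
    (Finsupp.single (a, S) x : DPAlg K) = x • mono K a S := by
  simp [mono]

@[elab_as_elim]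
theorem dp_induction {P : DPAlg K → Prop} (f : DPAlg K) (h0 : P 0)
    (hadd : ∀ f g, P f → P g → P (f + g)) (hm : ∀ (x : K) a S, P (x • mono K a S)) : P f := by
  induction f using Finsupp.induction_linear with
  | zero => exact h0
  | add f g hf hg => exact hadd f g hf hg
  | single m x => rw [show m = (m.1, m.2) from rfl, single_eq_smul_mono]; exact hm _ _ _

theorem linear_ext_mono {V : Type*} [AddCommGroup V] [Module K V] {A B : DPAlg K →ₗ[K] V}
    (h : ∀ a S, A (mono K a S) = B (mono K a S)) : A = B := by
  ext ⟨a, S⟩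
  exact h a S

theorem bilinear_ext_mono {V : Type*} [AddCommGroup V] [Module K V]
    {A B : DPAlg K →ₗ[K] DPAlg K →ₗ[K] V}
    (h : ∀ a S b T, A (mono K a S) (mono K b T) = B (mono K a S) (mono K b T)) (f g : DPAlg K) :
    A f g = B f g := by
  rw [linear_ext_mono fun a S => linear_ext_mono fun b T => h a S b T]

theorem dpMul_mono (a b : ℕ) (S T : Finset (Fin 7)) :
    dpMul K (mono K a S) (mono K b T) = if Disjoint S T then
      ((shuffleSign S T : K) * ((a + b).choose a : K)) • mono K (a + b) (S ∪ T) else 0 := by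
  simp only [dpMul, mono, Finsupp.linearCombination_single, one_smul]
  split_ifs <;> simp

theorem dT_mono (a : ℕ) (S : Finset (Fin 7)) :
    dT K (mono K a S) = if a = 0 then 0 else mono K (a - 1) S := by
  simp [dT, mono]

theorem dT_mono_zero (S : Finset (Fin 7)) : dT K (mono K 0 S) = 0 := by simp [dT_mono]

theorem dT_mono_succ (a : ℕ) (S : Finset (Fin 7)) :
    dT K (mono K (a + 1) S) = mono K a S := by simp [dT_mono]

theorem dTheta_mono (i : Fin 7) (a : ℕ) (S : Finset (Fin 7)) :
    dTheta K i (mono K a S) =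
      if i ∈ S then (shuffleSign {i} (S.erase i) : K) • mono K a (S.erase i) else 0 := by
  simp only [dTheta, mono, Finsupp.linearCombination_single, one_smul]
  split_ifs <;> simp

theorem euler_mono (a : ℕ) (S : Finset (Fin 7)) :
    euler K (mono K a S) = (S.card : K) • mono K a S := by
  simp [euler, mono]

theorem signOp_mono (a : ℕ) (S : Finset (Fin 7)) :
    signOp K (mono K a S) = ((-1) ^ S.card : K) • mono K a S := by
  simp [signOp, mono]

/-- Left multiplication by `θ_i`. -/
def mulTheta (K : Type*) [Field K] (i : Fin 7) : DPAlg K →ₗ[K] DPAlg K := dpMul K (mono K 0 {i})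

theorem mulTheta_mono (i : Fin 7) (a : ℕ) (S : Finset (Fin 7)) :
    mulTheta K i (mono K a S) =
      if i ∈ S then 0 else (shuffleSign {i} S : K) • mono K a (insert i S) := by
  rw [mulTheta, dpMul_mono]
  by_cases h : i ∈ S <;> simp [h]

theorem insert_sign {i : Fin 7} {S : Finset (Fin 7)} (h : i ∉ S) (T : Finset (Fin 7)) :
    shuffleSign T (insert i S) = shuffleSign T {i} * shuffleSign T S := by
  rw [Finset.insert_eq, shuffleSign_union_right _ (by simpa using h)]

theorem insert_sign_left {i : Fin 7} {S : Finset (Fin 7)} (h : i ∉ S) (T : Finset (Fin 7)) :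
    shuffleSign (insert i S) T = shuffleSign {i} T * shuffleSign S T := by
  rw [Finset.insert_eq, shuffleSign_union_left (by simpa using h)]

theorem sign_singletons {i j : Fin 7} (h : i ≠ j) :
    shuffleSign {i} {j} = -shuffleSign {j} {i} := by
  rw [shuffleSign_swap (by simpa using h)]; simp

theorem cast_sign_mul_self (S T : Finset (Fin 7)) :
    (shuffleSign S T : K) * (shuffleSign S T : K) = 1 := by
  exact_mod_cast congrArg (Int.cast : ℤ → K) (shuffleSign_mul_self S T)

theorem mono_insert {i : Fin 7} {S : Finset (Fin 7)} (h : i ∉ S) (a : ℕ) :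
    mono K a (insert i S) = (shuffleSign {i} S : K) • mulTheta K i (mono K a S) := by
  rw [mulTheta_mono, if_neg h, smul_smul, cast_sign_mul_self, one_smul]

/-- A linear identity holds if it holds on the monomials without `θ_i` and on `θ_i` times those. -/
theorem linear_ext_theta (i : Fin 7) {V : Type*} [AddCommGroup V] [Module K V]
    {A B : DPAlg K →ₗ[K] V}
    (h : ∀ a S, i ∉ S → A (mono K a S) = B (mono K a S))
    (h' : ∀ a S, i ∉ S → A (mulTheta K i (mono K a S)) = B (mulTheta K i (mono K a S))) :
    A = B := by
  refine linear_ext_mono fun a S => ?_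
  by_cases hi : i ∈ S
  · have := h' a (S.erase i) (Finset.notMem_erase i S)
    rw [← Finset.insert_erase hi, mono_insert (Finset.notMem_erase i S), map_smul, map_smul, this]
  · exact h a S hi

theorem mulTheta_sq (i : Fin 7) (f : DPAlg K) : mulTheta K i (mulTheta K i f) = 0 := by
  have : mulTheta K i ∘ₗ mulTheta K i = 0 := linear_ext_mono fun a S => by
    simp only [LinearMap.comp_apply, mulTheta_mono]
    split_ifs <;> simp [mulTheta_mono]
  exact LinearMap.congr_fun this f

theorem dTheta_of_notMem {i : Fin 7} {S : Finset (Fin 7)} (h : i ∉ S) (a : ℕ) :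
    dTheta K i (mono K a S) = 0 := by rw [dTheta_mono, if_neg h]

theorem dTheta_mulTheta_of_notMem {i : Fin 7} {S : Finset (Fin 7)} (h : i ∉ S) (a : ℕ) :
    dTheta K i (mulTheta K i (mono K a S)) = mono K a S := by
  rw [mulTheta_mono, if_neg h, map_smul, dTheta_mono, if_pos (Finset.mem_insert_self i S),
    Finset.erase_insert h, smul_smul, cast_sign_mul_self, one_smul]

theorem dTheta_mulTheta_self (i : Fin 7) (f : DPAlg K) :
    dTheta K i (mulTheta K i f) = f - mulTheta K i (dTheta K i f) := by
  have : dTheta K i ∘ₗ mulTheta K i = LinearMap.id - mulTheta K i ∘ₗ dTheta K i :=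
    linear_ext_theta i
      (fun a S h => by simp [dTheta_mulTheta_of_notMem h, dTheta_of_notMem h])
      (fun a S h => by simp [dTheta_mulTheta_of_notMem h, mulTheta_sq])
  exact LinearMap.congr_fun this f

theorem mulTheta_mulTheta (i j : Fin 7) (f : DPAlg K) :
    mulTheta K i (mulTheta K j f) = -mulTheta K j (mulTheta K i f) := by
  by_cases hij : i = j
  · subst hij; simp [mulTheta_sq]
  have : mulTheta K i ∘ₗ mulTheta K j = -(mulTheta K j ∘ₗ mulTheta K i) :=
    linear_ext_mono fun a S => by
      have hji : j ≠ i := fun e => hij e.symm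
      by_cases h1 : i ∈ S
      · by_cases h2 : j ∈ S <;> simp [mulTheta_mono, h1, h2]
      by_cases h2 : j ∈ S
      · simp [mulTheta_mono, h1, h2]
      simp only [LinearMap.comp_apply, LinearMap.neg_apply, mulTheta_mono, h1, h2, if_false,
        map_smul, Finset.mem_insert, hij, hji, or_false, insert_sign h1, insert_sign h2,
        sign_singletons hij, Finset.insert_comm j i, smul_smul, ← neg_smul]
      congr 1; push_cast; ring
  exact LinearMap.congr_fun this f

theorem dTheta_mulTheta_of_ne {i j : Fin 7} (hij : i ≠ j) (f : DPAlg K) :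
    dTheta K i (mulTheta K j f) = -mulTheta K j (dTheta K i f) := by
  have : dTheta K i ∘ₗ mulTheta K j = -(mulTheta K j ∘ₗ dTheta K i) :=
    linear_ext_theta i
      (fun a S h => by
        simp only [LinearMap.comp_apply, LinearMap.neg_apply, dTheta_of_notMem h, map_zero, neg_zero]
        rw [mulTheta_mono]
        split_ifs
        · simp
        · rw [map_smul, dTheta_of_notMem (by simp [hij, h]), smul_zero])
      (fun a S h => by
        simp only [LinearMap.comp_apply, LinearMap.neg_apply, dTheta_mulTheta_of_notMem h]
        rw [mulTheta_mulTheta, map_neg, dTheta_mulTheta_self]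
        rw [mulTheta_mono (i := j)]
        split_ifs
        · simp
        · rw [map_smul, dTheta_of_notMem (by simp [hij, h])]; simp)
  exact LinearMap.congr_fun this f

/-- With `mulTheta_mulTheta` and `dTheta_dTheta` these are the Clifford relations. Most later
identities for the bracket are derived from such operator relations and not from monomials. -/
theorem dTheta_mulTheta (i j : Fin 7) (f : DPAlg K) :
    dTheta K i (mulTheta K j f) = (if i = j then f else 0) - mulTheta K j (dTheta K i f) := by
  split_ifs with h
  · subst h; exact dTheta_mulTheta_self i f
  · rw [dTheta_mulTheta_of_ne h, zero_sub]

theorem dTheta_sq (i : Fin 7) (f : DPAlg K) : dTheta K i (dTheta K i f) = 0 := by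
  have : dTheta K i ∘ₗ dTheta K i = 0 := linear_ext_mono fun a S => by
    simp only [LinearMap.comp_apply, dTheta_mono]
    split_ifs <;> simp [dTheta_mono]
  exact LinearMap.congr_fun this f

theorem dTheta_dTheta (i j : Fin 7) (f : DPAlg K) :
    dTheta K i (dTheta K j f) = -dTheta K j (dTheta K i f) := by
  by_cases hij : i = j
  · subst hij; simp [dTheta_sq]
  have hz : ∀ a S, i ∉ S → dTheta K i (dTheta K j (mono K a S)) = 0 := fun a S h => by
    rw [dTheta_mono]
    split_ifs
    · rw [map_smul, dTheta_of_notMem (by simp [h]), smul_zero]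
    · simp
  have : dTheta K i ∘ₗ dTheta K j = -(dTheta K j ∘ₗ dTheta K i) :=
    linear_ext_theta i
      (fun a S h => by simp [hz a S h, dTheta_of_notMem h])
      (fun a S h => by
        simp only [LinearMap.comp_apply, LinearMap.neg_apply, dTheta_mulTheta_of_notMem h]
        rw [dTheta_mulTheta_of_ne (Ne.symm hij), map_neg, dTheta_mulTheta_self, hz a S h]
        simp)
  exact LinearMap.congr_fun this f

theorem euler_mulTheta (i : Fin 7) (f : DPAlg K) :
    euler K (mulTheta K i f) = mulTheta K i (euler K f) + mulTheta K i f := by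
  have : euler K ∘ₗ mulTheta K i = mulTheta K i ∘ₗ euler K + mulTheta K i :=
    linear_ext_mono fun a S => by
      simp only [LinearMap.comp_apply, LinearMap.add_apply, euler_mono, map_smul, mulTheta_mono]
      split_ifs with h
      · simp
      · rw [map_smul, euler_mono, Finset.card_insert_of_notMem h]; push_cast; module
  exact LinearMap.congr_fun this f

theorem euler_dTheta (i : Fin 7) (f : DPAlg K) :
    euler K (dTheta K i f) = dTheta K i (euler K f) - dTheta K i f := by
  have : euler K ∘ₗ dTheta K i = dTheta K i ∘ₗ euler K - dTheta K i :=
    linear_ext_theta i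
      (fun a S h => by simp [euler_mono, dTheta_of_notMem h])
      (fun a S h => by
        simp [dTheta_mulTheta_of_notMem h, euler_mono, euler_mulTheta])
  exact LinearMap.congr_fun this f

theorem signOp_mulTheta (i : Fin 7) (f : DPAlg K) :
    signOp K (mulTheta K i f) = -mulTheta K i (signOp K f) := by
  have : signOp K ∘ₗ mulTheta K i = -(mulTheta K i ∘ₗ signOp K) :=
    linear_ext_mono fun a S => by
      simp only [LinearMap.comp_apply, LinearMap.neg_apply, signOp_mono, map_smul, mulTheta_mono]
      split_ifs with h
      · simp
      · rw [map_smul, signOp_mono, Finset.card_insert_of_notMem h, pow_succ]; module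
  exact LinearMap.congr_fun this f

theorem signOp_dTheta (i : Fin 7) (f : DPAlg K) :
    signOp K (dTheta K i f) = -dTheta K i (signOp K f) := by
  have : signOp K ∘ₗ dTheta K i = -(dTheta K i ∘ₗ signOp K) :=
    linear_ext_theta i
      (fun a S h => by simp [signOp_mono, dTheta_of_notMem h])
      (fun a S h => by
        simp [dTheta_mulTheta_of_notMem h, signOp_mono, signOp_mulTheta])
  exact LinearMap.congr_fun this f

theorem signOp_signOp (f : DPAlg K) : signOp K (signOp K f) = f := by
  have : signOp K ∘ₗ signOp K = LinearMap.id :=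
    linear_ext_mono fun a S => by
      simp [signOp_mono, smul_smul, ← mul_pow]
  exact LinearMap.congr_fun this f

theorem dT_mulTheta (i : Fin 7) (f : DPAlg K) :
    dT K (mulTheta K i f) = mulTheta K i (dT K f) := by
  have : dT K ∘ₗ mulTheta K i = mulTheta K i ∘ₗ dT K :=
    linear_ext_mono fun a S => by
      cases a <;> by_cases h : i ∈ S <;> simp [dT_mono, mulTheta_mono, h]
  exact LinearMap.congr_fun this f

theorem dT_dTheta (i : Fin 7) (f : DPAlg K) :
    dT K (dTheta K i f) = dTheta K i (dT K f) := by
  have : dT K ∘ₗ dTheta K i = dTheta K i ∘ₗ dT K :=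
    linear_ext_mono fun a S => by
      cases a <;> by_cases h : i ∈ S <;> simp [dT_mono, dTheta_mono, h]
  exact LinearMap.congr_fun this f

theorem dT_euler (f : DPAlg K) : dT K (euler K f) = euler K (dT K f) := by
  have : dT K ∘ₗ euler K = euler K ∘ₗ dT K :=
    linear_ext_mono fun a S => by cases a <;> simp [dT_mono, euler_mono]
  exact LinearMap.congr_fun this f

theorem dT_signOp (f : DPAlg K) : dT K (signOp K f) = signOp K (dT K f) := by
  have : dT K ∘ₗ signOp K = signOp K ∘ₗ dT K :=
    linear_ext_mono fun a S => by cases a <;> simp [dT_mono, signOp_mono]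
  exact LinearMap.congr_fun this f

theorem mulTheta_dpMul (i : Fin 7) (f g : DPAlg K) :
    mulTheta K i (dpMul K f g) = dpMul K (mulTheta K i f) g := by
  refine bilinear_ext_mono (A := (dpMul K).compr₂ (mulTheta K i)) (B := (dpMul K).comp (mulTheta K i))
    (fun a S b T => ?_) f g
  simp only [LinearMap.compr₂_apply, LinearMap.comp_apply]
  rw [mulTheta_mono, dpMul_mono]
  by_cases h : i ∈ S
  · rw [if_pos h]
    split_ifs
    · simp [mulTheta_mono, h]
    · simp
  · rw [if_neg h, map_smul, LinearMap.smul_apply, dpMul_mono]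
    by_cases hT : i ∈ T
    · simp only [Finset.disjoint_insert_left, hT, not_true, false_and, if_false, smul_zero]
      split_ifs
      · simp [mulTheta_mono, hT]
      · simp
    · simp only [Finset.disjoint_insert_left, hT, not_false_eq_true, true_and]
      split_ifs with hd
      · rw [map_smul, mulTheta_mono, if_neg (by simp [h, hT]), smul_smul, smul_smul,
          shuffleSign_union_right _ hd, insert_sign_left h, Finset.insert_union]
        congr 1; push_cast; ring
      · simp

/-- Moving `θ_i` to the left across `f` costs the parity sign of `f`; together with `mulTheta_dpMul`
this lets every `θ_i` be pulled to the far left of a product. -/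
theorem dpMul_mulTheta (i : Fin 7) (f g : DPAlg K) :
    dpMul K f (mulTheta K i g) = mulTheta K i (dpMul K (signOp K f) g) := by
  refine bilinear_ext_mono (A := (dpMul K).compl₂ (mulTheta K i))
    (B := ((dpMul K).comp (signOp K)).compr₂ (mulTheta K i)) (fun a S b T => ?_) f g
  simp only [LinearMap.compr₂_apply, LinearMap.comp_apply, LinearMap.compl₂_apply, signOp_mono,
    map_smul, LinearMap.smul_apply]
  rw [mulTheta_mono, dpMul_mono]
  by_cases h : i ∈ T
  · rw [if_pos h]
    split_ifs
    · simp [mulTheta_mono, h]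
    · simp
  · rw [if_neg h, map_smul, dpMul_mono]
    by_cases hS : i ∈ S
    · simp only [Finset.disjoint_insert_right, hS, not_true, false_and, if_false, smul_zero]
      split_ifs
      · simp [mulTheta_mono, hS]
      · simp
    · simp only [Finset.disjoint_insert_right, hS, not_false_eq_true, true_and]
      split_ifs with hd
      · rw [map_smul, mulTheta_mono, if_neg (by simp [h, hS]), smul_smul, smul_smul, smul_smul,
          shuffleSign_union_right _ hd, insert_sign h, shuffleSign_swap (S := S) (T := {i})
            (by simpa using hS), Finset.union_insert]
        congr 1; push_cast; simp; ring
      · simp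

theorem dTheta_dpMul_of_notMem {i : Fin 7} {S : Finset (Fin 7)} (h : i ∉ S) (a : ℕ) (g : DPAlg K) :
    dTheta K i (dpMul K (mono K a S) g) = dpMul K (signOp K (mono K a S)) (dTheta K i g) := by
  have hz : ∀ b T, i ∉ T → dTheta K i (dpMul K (mono K a S) (mono K b T)) = 0 := fun b T hT => by
    rw [dpMul_mono]
    split_ifs
    · rw [map_smul, dTheta_of_notMem (by simp [h, hT]), smul_zero]
    · simp
  have : dTheta K i ∘ₗ dpMul K (mono K a S) =
      dpMul K (signOp K (mono K a S)) ∘ₗ dTheta K i := by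
    refine linear_ext_theta i (fun b T hT => ?_) (fun b T hT => ?_)
    · simp [hz b T hT, dTheta_of_notMem hT]
    · simp only [LinearMap.comp_apply, dpMul_mulTheta, dTheta_mulTheta_of_notMem hT,
        dTheta_mulTheta_self, signOp_mono, map_smul, LinearMap.smul_apply, hz b T hT, map_zero,
        sub_zero]
  exact LinearMap.congr_fun this g

theorem dTheta_dpMul (i : Fin 7) (f g : DPAlg K) :
    dTheta K i (dpMul K f g) = dpMul K (dTheta K i f) g + dpMul K (signOp K f) (dTheta K i g) := by
  have : dTheta K i ∘ₗ (dpMul K).flip g =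
      (dpMul K).flip g ∘ₗ dTheta K i + (dpMul K).flip (dTheta K i g) ∘ₗ signOp K := by
    refine linear_ext_theta i (fun a S h => ?_) (fun a S h => ?_)
    · simp [dTheta_dpMul_of_notMem h, dTheta_of_notMem h]
    · simp [← mulTheta_dpMul, dTheta_mulTheta_self, dTheta_dpMul_of_notMem h, dTheta_of_notMem h,
        signOp_mulTheta, sub_eq_add_neg]
  exact LinearMap.congr_fun this f

/-- With divided powers the Leibniz rule is Pascal's rule for the binomial coefficients in the
product. -/
theorem dT_dpMul (f g : DPAlg K) :
    dT K (dpMul K f g) = dpMul K (dT K f) g + dpMul K f (dT K g) := by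
  refine bilinear_ext_mono (A := (dpMul K).compr₂ (dT K))
    (B := (dpMul K).comp (dT K) + (dpMul K).compl₂ (dT K)) (fun a S b T => ?_) f g
  simp only [LinearMap.compr₂_apply, LinearMap.comp_apply, LinearMap.compl₂_apply,
    LinearMap.add_apply]
  by_cases hd : Disjoint S T
  · cases a with
    | zero => cases b <;> simp [dT_mono_zero, dT_mono_succ, dpMul_mono, hd]
    | succ a =>
      cases b with
      | zero => simp [dT_mono_zero, dT_mono_succ, dpMul_mono, hd]
      | succ b =>
        simp only [dT_mono_succ, dpMul_mono, hd, if_true, map_smul]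
        rw [show a + 1 + (b + 1) = (a + 1 + b) + 1 by ring, dT_mono_succ,
          show a + (b + 1) = a + 1 + b by ring, ← add_smul, Nat.choose_succ_succ]
        congr 1; push_cast; ring
  · cases a <;> cases b <;> simp [dT_mono_zero, dT_mono_succ, dpMul_mono, hd]

theorem dpMul_mono_comm (a b : ℕ) (S T : Finset (Fin 7)) :
    dpMul K (mono K a S) (mono K b T) =
      ((-1) ^ (S.card * T.card) : K) • dpMul K (mono K b T) (mono K a S) := by
  rw [dpMul_mono, dpMul_mono]
  by_cases hd : Disjoint S T
  · rw [if_pos hd, if_pos hd.symm, smul_smul, shuffleSign_swap hd, Finset.union_comm T S,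
      add_comm b a, show (a + b).choose b = (a + b).choose a by
        rw [add_comm a b, Nat.choose_symm_add]]
    congr 1; push_cast; ring
  · rw [if_neg hd, if_neg fun h => hd h.symm, smul_zero]

/-! ### The bracket -/

theorem poissonCoeff_dualIdx (i : Fin 7) : poissonCoeff K (dualIdx i) = poissonCoeff K i := by
  fin_cases i <;> rfl

theorem dualIdx_dualIdx (i : Fin 7) : dualIdx (dualIdx i) = i := by
  fin_cases i <;> rfl

theorem contactBr_apply (f g : DPAlg K) : contactBr K f g =
    dpMul K ((2 : K) • f - euler K f) (dT K g) - dpMul K (dT K f) ((2 : K) • g - euler K g)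
      + ∑ i : Fin 7, poissonCoeff K i •
          dpMul K (dTheta K i (signOp K f)) (dTheta K (dualIdx i) g) := rfl

/-- The bracket with `θ_i`. -/
def dOp (K : Type*) [Field K] (i : Fin 7) : DPAlg K →ₗ[K] DPAlg K :=
  mulTheta K i ∘ₗ dT K - poissonCoeff K i • dTheta K (dualIdx i)

theorem dOp_apply (i : Fin 7) (f : DPAlg K) :
    dOp K i f = mulTheta K i (dT K f) - poissonCoeff K i • dTheta K (dualIdx i) f := rfl

theorem dpMul_one (f : DPAlg K) : dpMul K (mono K 0 ∅) f = f := by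
  have : dpMul K (mono K 0 ∅) = LinearMap.id := linear_ext_mono fun a S => by
    simp [dpMul_mono, shuffleSign]
  exact LinearMap.congr_fun this f

theorem contactBr_theta (i : Fin 7) (f : DPAlg K) :
    contactBr K (mono K 0 {i}) f = dOp K i f := by
  rw [contactBr_apply, dOp_apply, euler_mono, dT_mono_zero, signOp_mono]
  have h1 : ((2 : K) • mono K 0 {i} - ((({i} : Finset (Fin 7)).card : ℕ) : K) • mono K 0 {i}) =
      mono K 0 {i} := by
    rw [Finset.card_singleton]; module
  rw [h1, Finset.sum_eq_single i]
  · simp only [map_smul, dTheta_mono, Finset.mem_singleton, if_true]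
    have : shuffleSign {i} (({i} : Finset (Fin 7)).erase i) = 1 := by
      simp [shuffleSign]
    rw [this]
    have he : ({i} : Finset (Fin 7)).erase i = ∅ := by simp
    rw [he]
    simp [dpMul_one, mulTheta, sub_eq_add_neg]
  · intro j _ hj
    rw [map_smul, dTheta_of_notMem (by simpa using hj)]; simp
  · simp

theorem contactBr_one (f : DPAlg K) : contactBr K (mono K 0 ∅) f = (2 : K) • dT K f := by
  rw [contactBr_apply, euler_mono, dT_mono_zero, signOp_mono]
  simp [dTheta_of_notMem, dpMul_one]

/-- `∂_t` is a derivation of the bracket. -/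
theorem dT_contactBr (f g : DPAlg K) :
    dT K (contactBr K f g) = contactBr K (dT K f) g + contactBr K f (dT K g) := by
  simp only [contactBr_apply, map_add, map_sub, map_smul, map_sum, dT_dpMul, dT_euler, dT_dTheta,
    dT_signOp, LinearMap.sub_apply, LinearMap.smul_apply, smul_add,
    Finset.sum_add_distrib]
  module

/-- The derivative in `θ_k` is not a superderivation of the bracket, because it does not commute
with the Euler operator; the last two terms are the defect. The defect in `mulTheta_dT_contactBr`
has the same shape, and the two cancel exactly in the combination `dOp`. -/
theorem dTheta_contactBr (k : Fin 7) (f g : DPAlg K) :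
    dTheta K k (contactBr K f g) =
      contactBr K (dTheta K k f) g + contactBr K (signOp K f) (dTheta K k g) -
        dpMul K (dTheta K k f) (dT K g) + dpMul K (signOp K (dT K f)) (dTheta K k g) := by
  have h1 : ∀ j, dpMul K (dTheta K k (dTheta K j (signOp K f))) (dTheta K (dualIdx j) g) =
      dpMul K (dTheta K j (signOp K (dTheta K k f))) (dTheta K (dualIdx j) g) := fun j => by
    rw [dTheta_dTheta, signOp_dTheta, map_neg, map_neg, map_neg]
  have h2 : ∀ j, dpMul K (signOp K (dTheta K j (signOp K f))) (dTheta K k (dTheta K (dualIdx j) g)) =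
      dpMul K (dTheta K j (signOp K (signOp K f))) (dTheta K (dualIdx j) (dTheta K k g)) := fun j => by
    rw [dTheta_dTheta k, signOp_dTheta, map_neg, map_neg, LinearMap.neg_apply, neg_neg]
  have h3 : ∀ f : DPAlg K, signOp K (euler K f) = euler K (signOp K f) := fun f => by
    have : signOp K ∘ₗ euler K = euler K ∘ₗ signOp K :=
      linear_ext_mono fun a S => by simp [signOp_mono, euler_mono, smul_smul, mul_comm]
    exact LinearMap.congr_fun this f
  simp only [contactBr_apply, map_add, map_sub, map_smul, map_sum, dTheta_dpMul,
    LinearMap.sub_apply, LinearMap.smul_apply, smul_add, Finset.sum_add_distrib, h1, h2,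
    euler_dTheta, dT_dTheta, dT_signOp, h3]
  module

theorem mulTheta_dT_contactBr (i : Fin 7) (f g : DPAlg K) :
    mulTheta K i (dT K (contactBr K f g)) =
      contactBr K (mulTheta K i (dT K f)) g + contactBr K (signOp K f) (mulTheta K i (dT K g)) -
        poissonCoeff K i • (dpMul K (dTheta K (dualIdx i) f) (dT K g)
          - dpMul K (signOp K (dT K f)) (dTheta K (dualIdx i) g)) := by
  have hs : ∀ f g : DPAlg K, ∑ j : Fin 7, poissonCoeff K j •
      dpMul K (dTheta K j (mulTheta K i f)) (dTheta K (dualIdx j) g) =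
      poissonCoeff K i • dpMul K f (dTheta K (dualIdx i) g) - mulTheta K i (∑ j : Fin 7,
        poissonCoeff K j • dpMul K (dTheta K j f) (dTheta K (dualIdx j) g)) := fun f g => by
    simp only [dTheta_mulTheta, map_sub, LinearMap.sub_apply, smul_sub, Finset.sum_sub_distrib,
      map_sum, map_smul, mulTheta_dpMul]
    rw [Finset.sum_eq_single i (fun j _ hj => by simp [hj]) (by simp), if_pos rfl]
  have hs' : ∀ f g : DPAlg K, ∑ j : Fin 7, poissonCoeff K j •
      dpMul K (dTheta K j f) (dTheta K (dualIdx j) (mulTheta K i g)) =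
      poissonCoeff K i • dpMul K (dTheta K (dualIdx i) f) g + mulTheta K i (∑ j : Fin 7,
        poissonCoeff K j • dpMul K (dTheta K j (signOp K f)) (dTheta K (dualIdx j) g)) :=
    fun f g => by
    simp only [dTheta_mulTheta, map_sub, dpMul_mulTheta, smul_add, Finset.sum_add_distrib,
      map_sum, map_smul, signOp_dTheta, map_neg, LinearMap.neg_apply, sub_neg_eq_add]
    rw [Finset.sum_eq_single (dualIdx i) (fun j _ hj => ?_) (by simp), dualIdx_dualIdx, if_pos rfl,
      poissonCoeff_dualIdx]
    rw [if_neg fun h => hj (by rw [← h, dualIdx_dualIdx])]; simp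
  have h3 : ∀ f : DPAlg K, signOp K (euler K f) = euler K (signOp K f) := fun f => by
    have : signOp K ∘ₗ euler K = euler K ∘ₗ signOp K :=
      linear_ext_mono fun a S => by simp [signOp_mono, euler_mono, smul_smul, mul_comm]
    exact LinearMap.congr_fun this f
  rw [dT_contactBr]
  simp only [contactBr_apply, map_add, map_sub, map_smul, euler_mulTheta, signOp_mulTheta,
    dT_mulTheta, map_neg, LinearMap.neg_apply, smul_neg, Finset.sum_neg_distrib, hs, hs',
    LinearMap.sub_apply, LinearMap.add_apply, LinearMap.smul_apply, dT_signOp, h3,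
    signOp_signOp, ← mulTheta_dpMul, dpMul_mulTheta]
  module

/-- `θ_i` acts by a superderivation of the bracket. -/
theorem dOp_contactBr (i : Fin 7) (f g : DPAlg K) :
    dOp K i (contactBr K f g) =
      contactBr K (dOp K i f) g + contactBr K (signOp K f) (dOp K i g) := by
  rw [dOp_apply, dOp_apply, dOp_apply, mulTheta_dT_contactBr, dTheta_contactBr]
  simp only [map_sub, map_smul, LinearMap.sub_apply, LinearMap.smul_apply]
  module

end Operators
end SuperLie
end

noncomputable section

namespace SuperLie

/-! ### The grading and the transitivity of the negative part. -/

section Grading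

variable {K : Type*} [Field K]

@[elab_as_elim]
theorem supported_induction {s : Set (ℕ × Finset (Fin 7))} {P : DPAlg K → Prop} {f : DPAlg K}
    (hf : f ∈ Finsupp.supported K K s) (h0 : P 0) (hadd : ∀ f g, P f → P g → P (f + g))
    (hm : ∀ (x : K) a S, (a, S) ∈ s → P (x • mono K a S)) : P f := by
  rw [Finsupp.supported_eq_span_single] at hf
  induction hf using Submodule.span_induction with
  | mem x hx =>
    obtain ⟨⟨a, S⟩, h, rfl⟩ := hx
    simpa [mono] using hm 1 a S h
  | zero => exact h0
  | add f g _ _ hf hg => exact hadd f g hf hg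
  | smul c f hf' hf =>
    rw [← Finsupp.supported_eq_span_single] at hf'
    clear hf
    rw [← Finsupp.sum_single f, Finsupp.smul_sum]
    refine Finset.sum_induction _ P hadd h0 fun m hm' => ?_
    change P (c • Finsupp.single (m.1, m.2) (f m))
    rw [single_eq_smul_mono, smul_smul]
    exact hm _ _ _ (hf' hm')

theorem mono_mem_supported {s : Set (ℕ × Finset (Fin 7))} {a : ℕ} {S : Finset (Fin 7)}
    (h : (a, S) ∈ s) : mono K a S ∈ Finsupp.supported K K s :=
  Finsupp.single_mem_supported K _ h

theorem mono_mem_contactDeg {a : ℕ} {S : Finset (Fin 7)} {k : ℤ} (h : 2 * (a : ℤ) + S.card - 2 = k) :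
    mono K a S ∈ contactDeg K k := mono_mem_supported h

theorem contactDeg_eq_bot {k : ℤ} (h : k < -2) : contactDeg K k = ⊥ := by
  rw [contactDeg, show {m : ℕ × Finset (Fin 7) | 2 * (m.1 : ℤ) + (m.2.card : ℤ) - 2 = k} = ∅ from
    Set.eq_empty_of_forall_notMem fun m hm => by simp at hm; omega, Finsupp.supported_empty]

theorem coe_negOnePow_natCast (n : ℕ) : ((n : ℤ).negOnePow : ℤ) = (-1) ^ n := by
  rw [Int.negOnePow_def, zpow_natCast]; simp

theorem signOp_of_mem_contactDeg {k : ℤ} {f : DPAlg K} (hf : f ∈ contactDeg K k) :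
    signOp K f = (k.negOnePow : ℤ) • f := by
  refine supported_induction hf (by simp) (fun f g hf hg => by rw [map_add, hf, hg, smul_add])
    fun x a S h => ?_
  rw [map_smul, signOp_mono]
  have h' : 2 * (a : ℤ) + (S.card : ℤ) - 2 = k := h
  have : k.negOnePow = (S.card : ℤ).negOnePow := by
    rw [Int.negOnePow_eq_iff]; exact ⟨a - 1, by omega⟩
  rw [this, coe_negOnePow_natCast, ← Int.cast_smul_eq_zsmul K, smul_comm]
  push_cast
  rfl

theorem dT_mem_contactDeg {k : ℤ} {f : DPAlg K} (hf : f ∈ contactDeg K k) :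
    dT K f ∈ contactDeg K (k - 2) := by
  refine supported_induction hf (by simp) (fun f g hf hg => by rw [map_add]; exact add_mem hf hg)
    fun x a S h => ?_
  have h' : 2 * (a : ℤ) + (S.card : ℤ) - 2 = k := h
  rw [map_smul, dT_mono]
  refine Submodule.smul_mem _ _ ?_
  split_ifs
  · simp
  · exact mono_mem_contactDeg (by omega)

theorem dTheta_mem_contactDeg (i : Fin 7) {k : ℤ} {f : DPAlg K} (hf : f ∈ contactDeg K k) :
    dTheta K i f ∈ contactDeg K (k - 1) := by
  refine supported_induction hf (by simp) (fun f g hf hg => by rw [map_add]; exact add_mem hf hg)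
    fun x a S h => ?_
  have h' : 2 * (a : ℤ) + (S.card : ℤ) - 2 = k := h
  rw [map_smul, dTheta_mono]
  refine Submodule.smul_mem _ _ ?_
  split_ifs with hi
  · refine Submodule.smul_mem _ _ (mono_mem_contactDeg ?_)
    have := Finset.card_erase_add_one hi
    omega
  · simp

theorem dpMul_mem_contactDeg {k l : ℤ} {f g : DPAlg K} (hf : f ∈ contactDeg K k)
    (hg : g ∈ contactDeg K l) : dpMul K f g ∈ contactDeg K (k + l + 2) := by
  refine supported_induction hf (by simp)
    (fun f g hf hg => by rw [map_add, LinearMap.add_apply]; exact add_mem hf hg) fun x a S h => ?_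
  refine supported_induction hg (by simp)
    (fun f g hf hg => by rw [map_add]; exact add_mem hf hg) fun y b T h2 => ?_
  have h' : 2 * (a : ℤ) + (S.card : ℤ) - 2 = k := h
  have h2' : 2 * (b : ℤ) + (T.card : ℤ) - 2 = l := h2
  simp only [map_smul, LinearMap.smul_apply, dpMul_mono]
  refine Submodule.smul_mem _ _ (Submodule.smul_mem _ _ ?_)
  split_ifs with hd
  · refine Submodule.smul_mem _ _ (mono_mem_contactDeg ?_)
    rw [Finset.card_union_of_disjoint hd]; push_cast; omega
  · simp

theorem smul_sub_euler_mem_contactDeg {k : ℤ} {f : DPAlg K} (hf : f ∈ contactDeg K k) :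
    (2 : K) • f - euler K f ∈ contactDeg K k := by
  refine sub_mem (Submodule.smul_mem _ _ hf) ?_
  refine supported_induction hf (by simp) (fun f g hf hg => by rw [map_add]; exact add_mem hf hg)
    fun x a S h => ?_
  rw [map_smul, euler_mono]
  exact Submodule.smul_mem _ _ (Submodule.smul_mem _ _ (mono_mem_contactDeg h))

theorem signOp_mem_contactDeg {k : ℤ} {f : DPAlg K} (hf : f ∈ contactDeg K k) :
    signOp K f ∈ contactDeg K k := by
  rw [signOp_of_mem_contactDeg hf]; exact zsmul_mem hf _

theorem contactBr_mem_contactDeg {k l : ℤ} {f g : DPAlg K} (hf : f ∈ contactDeg K k)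
    (hg : g ∈ contactDeg K l) : contactBr K f g ∈ contactDeg K (k + l) := by
  rw [contactBr_apply]
  refine add_mem (sub_mem ?_ ?_) (sum_mem fun i _ => Submodule.smul_mem _ _ ?_)
  · have := dpMul_mem_contactDeg (smul_sub_euler_mem_contactDeg hf) (dT_mem_contactDeg hg)
    rwa [show k + (l - 2) + 2 = k + l by ring] at this
  · have := dpMul_mem_contactDeg (dT_mem_contactDeg hf) (smul_sub_euler_mem_contactDeg hg)
    rwa [show k - 2 + l + 2 = k + l by ring] at this
  · have := dpMul_mem_contactDeg (dTheta_mem_contactDeg i (signOp_mem_contactDeg hf))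
      (dTheta_mem_contactDeg (dualIdx i) hg)
    rwa [show k - 1 + (l - 1) + 2 = k + l by ring] at this

theorem theta_mem_contactDeg (i : Fin 7) : mono K 0 {i} ∈ contactDeg K (-1) :=
  mono_mem_contactDeg (by simp)

theorem one_mem_contactDeg : mono K 0 ∅ ∈ contactDeg K (-2) := mono_mem_contactDeg (by simp)

theorem dOp_mem_contactDeg (i : Fin 7) {k : ℤ} {f : DPAlg K} (hf : f ∈ contactDeg K k) :
    dOp K i f ∈ contactDeg K (k - 1) := by
  rw [← contactBr_theta, show k - 1 = -1 + k by ring]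
  exact contactBr_mem_contactDeg (theta_mem_contactDeg i) hf

@[elab_as_elim]
theorem contactDeg_neg_one_induction {P : DPAlg K → Prop} {f : DPAlg K}
    (hf : f ∈ contactDeg K (-1)) (h0 : P 0) (hadd : ∀ f g, P f → P g → P (f + g))
    (hm : ∀ (x : K) i, P (x • mono K 0 {i})) : P f := by
  refine supported_induction hf h0 hadd fun x a S h => ?_
  have h' : 2 * (a : ℤ) + (S.card : ℤ) - 2 = -1 := h
  obtain rfl : a = 0 := by omega
  obtain ⟨i, rfl⟩ := Finset.card_eq_one.1 (show S.card = 1 by omega)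
  exact hm x i

theorem contactDeg_neg_two {f : DPAlg K} (hf : f ∈ contactDeg K (-2)) :
    ∃ x : K, f = x • mono K 0 ∅ := by
  refine supported_induction hf ⟨0, by simp⟩
    (fun f g ⟨x, hx⟩ ⟨y, hy⟩ => ⟨x + y, by rw [hx, hy, add_smul]⟩) fun x a S h => ?_
  have h' : 2 * (a : ℤ) + (S.card : ℤ) - 2 = -2 := h
  obtain rfl : a = 0 := by omega
  obtain rfl : S = ∅ := Finset.card_eq_zero.1 (by omega)
  exact ⟨x, rfl⟩

/-- Graded super skew-symmetry. -/
theorem contactBr_skew {k l : ℤ} {f g : DPAlg K} (hf : f ∈ contactDeg K k)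
    (hg : g ∈ contactDeg K l) :
    contactBr K f g = -(((k * l).negOnePow : ℤ) • contactBr K g f) := by
  have hM : ∀ {k l : ℤ} {f g : DPAlg K}, f ∈ contactDeg K k → g ∈ contactDeg K l →
      dpMul K f g = ((k * l).negOnePow : ℤ) • dpMul K g f := fun {k l f g} hf hg => by
    refine supported_induction hf (by simp) (fun f g hf hg => by
      rw [map_add, LinearMap.add_apply, hf, hg, map_add, smul_add]) fun x a S h => ?_
    refine supported_induction hg (by simp) (fun f g hf hg => by
      rw [map_add, hf, hg, map_add, LinearMap.add_apply, smul_add]) fun y b T h2 => ?_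
    have h' : 2 * (a : ℤ) + (S.card : ℤ) - 2 = k := h
    have h2' : 2 * (b : ℤ) + (T.card : ℤ) - 2 = l := h2
    simp only [map_smul, LinearMap.smul_apply]
    rw [dpMul_mono_comm]
    have : (k * l).negOnePow = ((S.card * T.card : ℕ) : ℤ).negOnePow := by
      rw [Int.negOnePow_eq_iff, ← h', ← h2']
      refine ⟨2 * (a - 1) * (b - 1) + (a - 1) * T.card + (b - 1) * S.card, ?_⟩
      push_cast; ring
    rw [this, coe_negOnePow_natCast, ← Int.cast_smul_eq_zsmul K]
    push_cast
    module
  have hE := smul_sub_euler_mem_contactDeg hf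
  have hE' := smul_sub_euler_mem_contactDeg hg
  rw [contactBr_apply, contactBr_apply, hM hE (dT_mem_contactDeg hg), hM (dT_mem_contactDeg hf) hE',
    signOp_of_mem_contactDeg hf, signOp_of_mem_contactDeg hg]
  have e1 : (k * (l - 2)).negOnePow = (k * l).negOnePow := by
    rw [Int.negOnePow_eq_iff]; exact ⟨-k, by ring⟩
  have e2 : ((k - 2) * l).negOnePow = (k * l).negOnePow := by
    rw [Int.negOnePow_eq_iff]; exact ⟨-l, by ring⟩
  have hsum : ∑ i : Fin 7, poissonCoeff K i •
      dpMul K (dTheta K i ((k.negOnePow : ℤ) • f)) (dTheta K (dualIdx i) g) =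
      -(((k * l).negOnePow : ℤ) • ∑ i : Fin 7, poissonCoeff K i •
        dpMul K (dTheta K i ((l.negOnePow : ℤ) • g)) (dTheta K (dualIdx i) f)) := by
    rw [Finset.smul_sum, ← Finset.sum_neg_distrib]
    refine Finset.sum_equiv (Function.Involutive.toPerm dualIdx dualIdx_dualIdx) (by simp)
      fun i _ => ?_
    rw [show (Function.Involutive.toPerm dualIdx dualIdx_dualIdx) i = dualIdx i from rfl]
    simp only [dualIdx_dualIdx, poissonCoeff_dualIdx, map_zsmul, LinearMap.smul_apply]
    rw [hM (dTheta_mem_contactDeg i hf) (dTheta_mem_contactDeg (dualIdx i) hg)]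
    have e3 : (k.negOnePow : ℤ) * (((k - 1) * (l - 1)).negOnePow : ℤ) =
        -(((k * l).negOnePow : ℤ) * (l.negOnePow : ℤ)) := by
      have : k.negOnePow * ((k - 1) * (l - 1)).negOnePow = -((k * l).negOnePow * l.negOnePow) := by
        rw [← Int.negOnePow_add, ← Int.negOnePow_add, ← Int.negOnePow_succ, Int.negOnePow_eq_iff]
        exact ⟨-l, by ring⟩
      exact_mod_cast congrArg (Units.val) this
    rw [smul_comm (((k * l).negOnePow : ℤ)), ← smul_neg, smul_smul, smul_smul, ← neg_smul, e3]
  rw [hsum, e1, e2]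
  module

/-- This is the Jacobi identity for two odd variables, whose bracket is a constant. In particular,
if 2 is invertible, `dT` is generated by the `dOp i`, so stability under all `dOp i` implies
stability under `dT`. -/
theorem dOp_dOp (i j : Fin 7) (f : DPAlg K) :
    dOp K i (dOp K j f) + dOp K j (dOp K i f) =
      if dualIdx i = j then -(2 * poissonCoeff K i) • dT K f else 0 := by
  have h1 : ∀ i j, dOp K i (dOp K j f) = mulTheta K i (mulTheta K j (dT K (dT K f)))
      - poissonCoeff K j • mulTheta K i (dTheta K (dualIdx j) (dT K f))
      - poissonCoeff K i • ((if dualIdx i = j then dT K f else 0)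
        - mulTheta K j (dTheta K (dualIdx i) (dT K f)))
      + (poissonCoeff K i * poissonCoeff K j) • dTheta K (dualIdx i) (dTheta K (dualIdx j) f) :=
    fun i j => by
      simp only [dOp_apply, map_sub, map_smul, dT_mulTheta, dT_dTheta, dTheta_mulTheta, smul_sub,
        smul_smul]
      module
  rw [h1 i j, h1 j i, mulTheta_mulTheta j i, dTheta_dTheta (dualIdx j)]
  by_cases h : dualIdx i = j
  · have h' : dualIdx j = i := by rw [← h, dualIdx_dualIdx]
    rw [if_pos h, if_pos h', if_pos h, ← h, poissonCoeff_dualIdx]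
    module
  · have h' : dualIdx j ≠ i := fun e => h (by rw [← e, dualIdx_dualIdx])
    rw [if_neg h, if_neg h', if_neg h]
    module

theorem dT_apply (f : DPAlg K) (a : ℕ) (S : Finset (Fin 7)) : dT K f (a, S) = f (a + 1, S) := by
  refine dp_induction f (by simp) (fun f g hf hg => by simp [hf, hg]) fun x b T => ?_
  rw [map_smul, dT_mono]
  cases b with
  | zero => simp [mono]
  | succ b => simp [mono, Finsupp.single_apply]

theorem dTheta_apply (i : Fin 7) (f : DPAlg K) (a : ℕ) (S : Finset (Fin 7)) :
    dTheta K i f (a, S) = if i ∈ S then 0 else (shuffleSign {i} S : K) * f (a, insert i S) := by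
  refine dp_induction f (by simp)
    (fun f g hf hg => by
      simp only [map_add, Finsupp.add_apply, hf, hg]; split_ifs <;> ring) fun x b T => ?_
  rw [map_smul, dTheta_mono]
  by_cases hi : i ∈ S
  · rw [if_pos hi]
    split_ifs with h
    · have : T.erase i ≠ S := fun e => Finset.notMem_erase i T (e ▸ hi)
      simp [mono, this]
    · simp
  · rw [if_neg hi]
    by_cases h : i ∈ T
    · rw [if_pos h]
      by_cases e : T = insert i S
      · subst e
        simp [mono, Finset.erase_insert hi, Finsupp.single_apply]; ring_nf; simp; tauto
      · have e' : T.erase i ≠ S := fun e' => e (by rw [← e', Finset.insert_erase h])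
        simp [mono, e, e']
    · have : T ≠ insert i S := fun e => h (e ▸ Finset.mem_insert_self i S)
      simp [h, mono, this]

theorem mulTheta_apply (i : Fin 7) (f : DPAlg K) (a : ℕ) (S : Finset (Fin 7)) :
    mulTheta K i f (a, S) =
      if i ∈ S then (shuffleSign {i} (S.erase i) : K) * f (a, S.erase i) else 0 := by
  refine dp_induction f (by simp)
    (fun f g hf hg => by
      simp only [map_add, Finsupp.add_apply, hf, hg]; split_ifs <;> ring) fun x b T => ?_
  rw [map_smul, mulTheta_mono]
  by_cases hi : i ∈ T
  · have : T ≠ S.erase i := fun e => Finset.notMem_erase i S (e ▸ hi)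
    simp [hi, mono, this]
  · rw [if_neg hi]
    by_cases h : i ∈ S
    · rw [if_pos h]
      by_cases e : T = S.erase i
      · subst e
        simp [mono, Finset.insert_erase h, Finsupp.single_apply]; ring_nf; simp; tauto
      · have e' : insert i T ≠ S := fun e' => e (by rw [← e', Finset.erase_insert hi])
        simp [mono, e, e']
    · have : insert i T ≠ S := fun e => h (e ▸ Finset.mem_insert_self i T)
      simp [h, mono, this]

theorem dOp_coeff (i : Fin 7) (f : DPAlg K) (a : ℕ) (S : Finset (Fin 7)) :
    dOp K i f (a, S) =
      (if i ∈ S then (shuffleSign {i} (S.erase i) : K) * f (a + 1, S.erase i) else 0)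
      - poissonCoeff K i * (if dualIdx i ∈ S then 0 else
          (shuffleSign {dualIdx i} S : K) * f (a, insert (dualIdx i) S)) := by
  rw [dOp_apply, Finsupp.sub_apply, Finsupp.smul_apply, mulTheta_apply, dTheta_apply, dT_apply,
    smul_eq_mul]

theorem poissonCoeff_ne_zero (h2 : (2 : K) ≠ 0) (i : Fin 7) : poissonCoeff K i ≠ 0 := by
  fin_cases i <;> simp [poissonCoeff, h2]

theorem dT_eq_zero_of_dOp_eq_zero (h2 : (2 : K) ≠ 0) {f : DPAlg K} (h : ∀ i, dOp K i f = 0) :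
    dT K f = 0 := by
  -- `v_1` and `w_1` are dual, so the anticommutator of their two operators is a nonzero multiple of
  -- `dT`.
  have := dOp_dOp 0 3 f
  rw [h, h, map_zero, map_zero, add_zero, if_pos (by rfl)] at this
  have h3 : -(2 * poissonCoeff K 0) ≠ 0 := neg_ne_zero.2 (mul_ne_zero h2 (poissonCoeff_ne_zero h2 0))
  exact (smul_eq_zero.1 this.symm).resolve_left h3

/-- An element that commutes with all `θ_i` is constant. -/
theorem eq_smul_one_of_dOp_eq_zero (h2 : (2 : K) ≠ 0) {f : DPAlg K} (h : ∀ i, dOp K i f = 0) :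
    f = f (0, ∅) • mono K 0 ∅ := by
  have hT := dT_eq_zero_of_dOp_eq_zero h2 h
  have hd : ∀ i, dTheta K i f = 0 := fun i => by
    have := h (dualIdx i)
    rw [dOp_apply, hT, map_zero, zero_sub, neg_eq_zero, dualIdx_dualIdx] at this
    exact (smul_eq_zero.1 this).resolve_left (poissonCoeff_ne_zero h2 _)
  ext ⟨a, S⟩
  rw [Finsupp.smul_apply, mono, Finsupp.single_apply, smul_eq_mul]
  cases a with
  | succ a => rw [← dT_apply, hT, Finsupp.zero_apply, if_neg (by simp), mul_zero]
  | zero =>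
    rcases S.eq_empty_or_nonempty with rfl | ⟨i, hi⟩
    · rw [if_pos rfl, mul_one]
    · have := DFunLike.congr_fun (hd i) (0, S.erase i)
      rw [dTheta_apply, if_neg (Finset.notMem_erase i S), Finset.insert_erase hi,
        Finsupp.zero_apply] at this
      have hs : (shuffleSign {i} (S.erase i) : K) ≠ 0 := fun e => by
        have := cast_sign_mul_self (K := K) {i} (S.erase i)
        rw [e, zero_mul] at this; exact zero_ne_one this
      rw [(mul_eq_zero.1 this).resolve_left hs, if_neg, mul_zero]
      intro e
      have e : ∅ = S := (Prod.ext_iff.1 e).2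
      rw [← e] at hi
      exact Finset.notMem_empty i hi

/-- An element of degree at least `-1` that commutes with all `θ_i` vanishes. -/
theorem eq_zero_of_dOp_eq_zero (h2 : (2 : K) ≠ 0) {k : ℤ} (hk : -1 ≤ k) {f : DPAlg K}
    (hf : f ∈ contactDeg K k) (h : ∀ i, dOp K i f = 0) : f = 0 := by
  rw [eq_smul_one_of_dOp_eq_zero h2 h, (Finsupp.mem_supported' K f).1 hf, zero_smul]
  intro h'
  have h' : 2 * ((0 : ℕ) : ℤ) + ((∅ : Finset (Fin 7)).card : ℤ) - 2 = k := h'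
  simp at h'; omega

/-! ### The Jacobi identity -/

theorem dOp_contactBr_of_mem (i : Fin 7) {k : ℤ} {f : DPAlg K} (hf : f ∈ contactDeg K k)
    (g : DPAlg K) : dOp K i (contactBr K f g) =
      contactBr K (dOp K i f) g + (k.negOnePow : ℤ) • contactBr K f (dOp K i g) := by
  rw [dOp_contactBr, signOp_of_mem_contactDeg hf, map_zsmul, LinearMap.smul_apply]

/-- The defect in the Jacobi identity for homogeneous elements of degree `k` and `l`. -/
def jacobiator (K : Type*) [Field K] (k l : ℤ) (f g h : DPAlg K) : DPAlg K :=
  contactBr K f (contactBr K g h) - contactBr K (contactBr K f g) h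
    - ((k * l).negOnePow : ℤ) • contactBr K g (contactBr K f h)

theorem jacobiator_theta (i : Fin 7) (l : ℤ) {g : DPAlg K} (hg : g ∈ contactDeg K l)
    (h : DPAlg K) : jacobiator K (-1) l (mono K 0 {i}) g h = 0 := by
  rw [jacobiator, contactBr_theta, contactBr_theta, contactBr_theta, dOp_contactBr_of_mem i hg,
    neg_one_mul, Int.negOnePow_neg]
  abel

theorem jacobiator_one (l : ℤ) (g h : DPAlg K) : jacobiator K (-2) l (mono K 0 ∅) g h = 0 := by
  have : (-2 * l).negOnePow = 1 := Int.negOnePow_even _ ⟨-l, by ring⟩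
  rw [jacobiator, contactBr_one, contactBr_one, contactBr_one, dT_contactBr, this]
  simp

/-- By skew-symmetry alone the jacobiator is symmetric in its arguments up to sign. With
`jacobiator_cycle` any argument of negative degree can be brought to the first place. -/
theorem jacobiator_swap {k l : ℤ} {f g : DPAlg K} (hf : f ∈ contactDeg K k)
    (hg : g ∈ contactDeg K l) (h : DPAlg K) :
    jacobiator K k l f g h = -(((k * l).negOnePow : ℤ) • jacobiator K l k g f h) := by
  have e : ((k * l).negOnePow : ℤ) * ((k * l).negOnePow : ℤ) = 1 := by
    rw [← Units.val_mul, Int.units_mul_self, Units.val_one]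
  rw [jacobiator, jacobiator, contactBr_skew hf hg, mul_comm l k, smul_sub, smul_sub, smul_smul, e,
    map_neg, map_zsmul]
  simp only [LinearMap.neg_apply, LinearMap.smul_apply]
  module

theorem jacobiator_cycle {k l m : ℤ} {f g h : DPAlg K} (hf : f ∈ contactDeg K k)
    (hg : g ∈ contactDeg K l) (hh : h ∈ contactDeg K m) :
    jacobiator K k l f g h = ((m * (k + l)).negOnePow : ℤ) • jacobiator K m k h f g := by
  have e : ∀ n : ℤ, (n.negOnePow : ℤ) * (n.negOnePow : ℤ) = 1 := fun n => by
    rw [← Units.val_mul, Int.units_mul_self, Units.val_one]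
  rw [jacobiator, jacobiator, contactBr_skew hg hh,
    contactBr_skew (contactBr_mem_contactDeg hf hg) hh,
    contactBr_skew hg (contactBr_mem_contactDeg hf hh),
    contactBr_skew hf hh]
  have e1 : ((k + l) * m).negOnePow = (m * (k + l)).negOnePow := by rw [mul_comm]
  have e2 : (m * (k + l)).negOnePow = (m * k).negOnePow * (m * l).negOnePow := by
    rw [mul_add, Int.negOnePow_add]
  have e3 : (l * (k + m)).negOnePow = (k * l).negOnePow * (m * l).negOnePow := by
    rw [mul_add, Int.negOnePow_add, mul_comm l k, mul_comm l m]
  have e4 : (k * m).negOnePow = (m * k).negOnePow := by rw [mul_comm]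
  have e5 : (l * m).negOnePow = (m * l).negOnePow := by rw [mul_comm]
  rw [e1, e3, e2, e4, e5]
  simp only [map_neg, map_zsmul, LinearMap.neg_apply, LinearMap.smul_apply, Units.val_mul]
  have a1 := e (k * l)
  have a2 := e (m * k)
  generalize (((k * l).negOnePow : ℤˣ) : ℤ) = x at *
  generalize (((m * l).negOnePow : ℤˣ) : ℤ) = y at *
  generalize (((m * k).negOnePow : ℤˣ) : ℤ) = z at *
  match_scalars <;> grind

theorem jacobiator_add_left (k l : ℤ) (f f' g h : DPAlg K) :
    jacobiator K k l (f + f') g h = jacobiator K k l f g h + jacobiator K k l f' g h := by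
  simp only [jacobiator, map_add, LinearMap.add_apply, smul_add]; abel

theorem jacobiator_smul_left (k l : ℤ) (x : K) (f g h : DPAlg K) :
    jacobiator K k l (x • f) g h = x • jacobiator K k l f g h := by
  simp only [jacobiator, map_smul, LinearMap.smul_apply, smul_sub]
  rw [smul_comm x]

theorem jacobiator_zero_left (k l : ℤ) (g h : DPAlg K) : jacobiator K k l 0 g h = 0 := by
  simp [jacobiator]

theorem jacobiator_of_neg {k l : ℤ} (hk : k < 0) {f g : DPAlg K} (hf : f ∈ contactDeg K k)
    (hg : g ∈ contactDeg K l) (h : DPAlg K) : jacobiator K k l f g h = 0 := by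
  rcases lt_or_ge k (-2) with h3 | h3
  · rw [contactDeg_eq_bot h3, Submodule.mem_bot] at hf
    rw [hf, jacobiator_zero_left]
  obtain rfl | rfl : k = -1 ∨ k = -2 := by omega
  · refine contactDeg_neg_one_induction hf (jacobiator_zero_left _ _ _ _)
      (fun f f' hf hf' => by rw [jacobiator_add_left, hf, hf', add_zero]) fun x i => ?_
    rw [jacobiator_smul_left, jacobiator_theta i l hg, smul_zero]
  · obtain ⟨x, rfl⟩ := contactDeg_neg_two hf
    rw [jacobiator_smul_left, jacobiator_one, smul_zero]

theorem jacobiator_mem_contactDeg {k l m : ℤ} {f g h : DPAlg K} (hf : f ∈ contactDeg K k)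
    (hg : g ∈ contactDeg K l) (hh : h ∈ contactDeg K m) :
    jacobiator K k l f g h ∈ contactDeg K (k + l + m) := by
  refine sub_mem (sub_mem ?_ ?_) (zsmul_mem ?_ _)
  · rw [add_assoc]
    exact contactBr_mem_contactDeg hf (contactBr_mem_contactDeg hg hh)
  · exact contactBr_mem_contactDeg (contactBr_mem_contactDeg hf hg) hh
  · rw [add_comm k, add_assoc]
    exact contactBr_mem_contactDeg hg (contactBr_mem_contactDeg hf hh)

/-- A superderivation of the bracket distributes over the jacobiator. Each term on the right has
total degree one less, which drives the induction in `jacobiator_eq_zero`. -/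
theorem dOp_jacobiator (i : Fin 7) {k l : ℤ} {f g : DPAlg K} (hf : f ∈ contactDeg K k)
    (hg : g ∈ contactDeg K l) (h : DPAlg K) :
    dOp K i (jacobiator K k l f g h) = jacobiator K (k - 1) l (dOp K i f) g h +
      (k.negOnePow : ℤ) • jacobiator K k (l - 1) f (dOp K i g) h +
      ((k + l).negOnePow : ℤ) • jacobiator K k l f g (dOp K i h) := by
  have e : ∀ n : ℤ, (n.negOnePow : ℤ) * (n.negOnePow : ℤ) = 1 := fun n => by
    rw [← Units.val_mul, Int.units_mul_self, Units.val_one]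
  simp only [jacobiator, map_sub, map_zsmul, dOp_contactBr_of_mem i hf, dOp_contactBr_of_mem i hg,
    dOp_contactBr_of_mem i (contactBr_mem_contactDeg hf hg), map_add, LinearMap.add_apply,
    LinearMap.smul_apply]
  have e1 : ((k - 1) * l).negOnePow = (k * l).negOnePow * l.negOnePow := by
    rw [← Int.negOnePow_add, Int.negOnePow_eq_iff]; exact ⟨-l, by ring⟩
  have e2 : (k * (l - 1)).negOnePow = (k * l).negOnePow * k.negOnePow := by
    rw [← Int.negOnePow_add, Int.negOnePow_eq_iff]; exact ⟨-k, by ring⟩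
  rw [e1, e2, Int.negOnePow_add]
  simp only [Units.val_mul]
  have a1 := e k
  have a2 := e l
  generalize (((k * l).negOnePow : ℤˣ) : ℤ) = x at *
  generalize ((k.negOnePow : ℤˣ) : ℤ) = y at *
  generalize ((l.negOnePow : ℤˣ) : ℤ) = z at *
  match_scalars <;> grind

/-- Induction on the total degree. An argument of negative degree is a combination of `1` and the
`θ_i`, and there the identity is the derivation property of `dT` and `dOp`. If all degrees are
nonnegative, every `dOp i` kills the jacobiator by induction, and transitivity makes it zero. -/
theorem jacobiator_eq_zero (h2 : (2 : K) ≠ 0) {k l m : ℤ} {f g h : DPAlg K}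
    (hf : f ∈ contactDeg K k) (hg : g ∈ contactDeg K l) (hh : h ∈ contactDeg K m) :
    jacobiator K k l f g h = 0 := by
  -- For `n = 0` the total degree is negative, so at least one argument has negative degree and the
  -- base case needs no descent.
  obtain ⟨n, hn⟩ : ∃ n : ℕ, k + l + m < n := ⟨(k + l + m + 1).toNat, by omega⟩
  induction n generalizing k l m f g h with
  | zero =>
    rcases lt_or_ge k 0 with hk | hk
    · exact jacobiator_of_neg hk hf hg h
    rcases lt_or_ge l 0 with hl | hl
    · rw [jacobiator_swap hf hg, jacobiator_of_neg hl hg hf, smul_zero, neg_zero]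
    · rw [jacobiator_cycle hf hg hh, jacobiator_of_neg (by omega) hh hf, smul_zero]
  | succ n ih =>
    rcases lt_or_ge k 0 with hk | hk
    · exact jacobiator_of_neg hk hf hg h
    rcases lt_or_ge l 0 with hl | hl
    · rw [jacobiator_swap hf hg, jacobiator_of_neg hl hg hf, smul_zero, neg_zero]
    rcases lt_or_ge m 0 with hm | hm
    · rw [jacobiator_cycle hf hg hh, jacobiator_of_neg (by omega) hh hf, smul_zero]
    refine eq_zero_of_dOp_eq_zero h2 (k := k + l + m) (by omega)
      (jacobiator_mem_contactDeg hf hg hh) fun i => ?_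
    rw [dOp_jacobiator i hf hg, ih (dOp_mem_contactDeg i hf) hg hh (by push_cast at hn; omega),
      ih hf (dOp_mem_contactDeg i hg) hh (by push_cast at hn; omega),
      ih hf hg (dOp_mem_contactDeg i hh) (by push_cast at hn; omega)]
    simp

/-- The Jacobi identity for homogeneous elements. -/
theorem contactBr_jacobi (h2 : (2 : K) ≠ 0) {k l m : ℤ} {f g h : DPAlg K}
    (hf : f ∈ contactDeg K k) (hg : g ∈ contactDeg K l) (hh : h ∈ contactDeg K m) :
    contactBr K f (contactBr K g h) = contactBr K (contactBr K f g) h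
      + ((k * l).negOnePow : ℤ) • contactBr K g (contactBr K f h) := by
  have := jacobiator_eq_zero h2 hf hg hh
  rw [jacobiator, sub_sub, sub_eq_zero] at this
  exact this

/-! ### The axioms of a Lie superalgebra -/

open SuperBracket

theorem mem_par_iff {i : ZMod 2} {f : DPAlg K} : f ∈ (par (R := K) i : Submodule K (DPAlg K)) ↔
    f ∈ Finsupp.supported K K {m : ℕ × Finset (Fin 7) | (m.2.card : ZMod 2) = i} := Iff.rfl

theorem koszul_eq_negOnePow {k l : ℤ} {i j : ZMod 2} (hi : (k : ZMod 2) = i)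
    (hj : (l : ZMod 2) = j) : koszul i j = ((k * l).negOnePow : ℤ) := by
  have aux : ∀ k : ℤ, (k : ZMod 2) = 0 ∨ (k : ZMod 2) = 1 := fun k => by
    generalize (k : ZMod 2) = x; revert x; decide
  have even : ∀ k : ℤ, (k : ZMod 2) = 0 → Even k := fun k h =>
    (even_iff_two_dvd).2 ((ZMod.intCast_zmod_eq_zero_iff_dvd k 2).1 h)
  have odd : ∀ k : ℤ, (k : ZMod 2) = 1 → Odd k := fun k h => by
    rw [← Int.not_even_iff_odd, even_iff_two_dvd]
    intro h'
    rw [(ZMod.intCast_zmod_eq_zero_iff_dvd k 2).2 h'] at h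
    exact absurd h (by decide)
  subst hi hj
  rcases aux k with h | h
  · rw [Int.negOnePow_even _ ((even k h).mul_right l), h]; simp [koszul]
  · rcases aux l with h' | h'
    · rw [Int.negOnePow_even _ ((even l h').mul_left k), h']; simp [koszul]
    · rw [Int.negOnePow_odd _ ((odd k h).mul (odd l h')), h, h']; simp [koszul, ZMod.val_one]

theorem par_of_contactDeg {k : ℤ} {f : DPAlg K} (hf : f ∈ contactDeg K k) :
    f ∈ (par (R := K) (k : ZMod 2) : Submodule K (DPAlg K)) := by
  refine Finsupp.supported_mono (fun m hm => ?_) hf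
  have h' : 2 * (m.1 : ℤ) + (m.2.card : ℤ) - 2 = k := hm
  have := congrArg (Int.cast : ℤ → ZMod 2) h'
  push_cast at this
  rw [show (2 : ZMod 2) = 0 from rfl] at this
  simpa using this

/-- Elements of a given parity are sums of homogeneous elements of that parity. -/
@[elab_as_elim]
theorem par_induction {i : ZMod 2} {P : DPAlg K → Prop} {f : DPAlg K}
    (hf : f ∈ (par (R := K) i : Submodule K (DPAlg K))) (h0 : P 0)
    (hadd : ∀ f g, f ∈ (par (R := K) i : Submodule K (DPAlg K)) →
      g ∈ (par (R := K) i : Submodule K (DPAlg K)) → P f → P g → P (f + g))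
    (hm : ∀ (k : ℤ) f, (k : ZMod 2) = i → f ∈ contactDeg K k → P f) : P f := by
  have : f ∈ (par (R := K) i : Submodule K (DPAlg K)) ∧ P f := by
    rw [mem_par_iff] at hf
    refine supported_induction hf ⟨zero_mem _, h0⟩
      (fun f g hf hg => ⟨add_mem hf.1 hg.1, hadd f g hf.1 hg.1 hf.2 hg.2⟩) fun x a S h => ?_
    have hd : x • mono K a S ∈ contactDeg K (2 * (a : ℤ) + S.card - 2) :=
      Submodule.smul_mem _ _ (mono_mem_contactDeg rfl)
    have hk : ((2 * (a : ℤ) + S.card - 2 : ℤ) : ZMod 2) = i := by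
      have h' : (S.card : ZMod 2) = i := h
      push_cast
      rw [show (2 : ZMod 2) = 0 from rfl, h']; ring
    exact ⟨by have := par_of_contactDeg hd; rwa [hk] at this, hm _ _ hk hd⟩
  exact this.2

theorem contactBr_mem_par {i j : ZMod 2} {f g : DPAlg K}
    (hf : f ∈ (par (R := K) i : Submodule K (DPAlg K)))
    (hg : g ∈ (par (R := K) j : Submodule K (DPAlg K))) :
    contactBr K f g ∈ (par (R := K) (i + j) : Submodule K (DPAlg K)) := by
  refine par_induction hf (by simp)
    (fun f f' _ _ h h' => by rw [map_add, LinearMap.add_apply]; exact add_mem h h')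
    fun k f hk hf => ?_
  refine par_induction hg (by simp) (fun f f' _ _ h h' => by rw [map_add]; exact add_mem h h')
    fun l g hl hg => ?_
  have := par_of_contactDeg (contactBr_mem_contactDeg hf hg)
  rwa [Int.cast_add, hk, hl] at this

theorem contactBr_skew_par {i j : ZMod 2} {f g : DPAlg K}
    (hf : f ∈ (par (R := K) i : Submodule K (DPAlg K)))
    (hg : g ∈ (par (R := K) j : Submodule K (DPAlg K))) :
    contactBr K f g = -(koszul i j • contactBr K g f) := by
  refine par_induction hf (by simp)
    (fun f f' _ _ h h' => by rw [map_add, LinearMap.add_apply, h, h', map_add, smul_add, neg_add])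
    fun k f hk hf => ?_
  refine par_induction hg (by simp)
    (fun f f' _ _ h h' => by rw [map_add, h, h', map_add, LinearMap.add_apply, smul_add, neg_add])
    fun l g hl hg => ?_
  rw [koszul_eq_negOnePow hk hl, contactBr_skew hf hg]

theorem contactBr_jacobi_par (h2 : (2 : K) ≠ 0) {i j : ZMod 2} {f g : DPAlg K}
    (hf : f ∈ (par (R := K) i : Submodule K (DPAlg K)))
    (hg : g ∈ (par (R := K) j : Submodule K (DPAlg K))) (h : DPAlg K) :
    contactBr K f (contactBr K g h) = contactBr K (contactBr K f g) h
      + koszul i j • contactBr K g (contactBr K f h) := by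
  refine par_induction hf (by simp)
    (fun f f' _ _ h h' => by
      simp only [map_add, LinearMap.add_apply, h, h', smul_add]; abel)
    fun k f hk hf => ?_
  refine par_induction hg (by simp)
    (fun f f' _ _ h h' => by
      simp only [map_add, LinearMap.add_apply, h, h', smul_add]; abel)
    fun l g hl hg => ?_
  refine dp_induction h (by simp)
    (fun f f' h h' => by simp only [map_add, h, h', smul_add]; abel) fun x a S => ?_
  rw [koszul_eq_negOnePow hk hl]
  exact contactBr_jacobi h2 hf hg (Submodule.smul_mem _ _ (mono_mem_contactDeg rfl))

/-- The polarisation of the cube axiom is a consequence of the Jacobi identity. For `g = f` it only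
says that three times the cube vanishes. -/
theorem contactBr_polarized (h2 : (2 : K) ≠ 0) {f g : DPAlg K}
    (hf : f ∈ (par (R := K) 1 : Submodule K (DPAlg K)))
    (hg : g ∈ (par (R := K) 1 : Submodule K (DPAlg K))) :
    contactBr K g (contactBr K f f) + contactBr K f (contactBr K f g)
      + contactBr K f (contactBr K g f) = 0 := by
  have hk : koszul 1 1 = -1 := by simp [koszul, ZMod.val_one]
  have h1 := contactBr_jacobi_par h2 hf hf g
  have h3 := contactBr_skew_par hf hg
  have h4 := contactBr_skew_par hg (contactBr_mem_par hf hf)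
  have hk' : koszul 1 (1 + 1) = 1 := by rw [show (1 + 1 : ZMod 2) = 0 from rfl]; simp [koszul]
  rw [hk, neg_one_smul, neg_neg] at h3
  rw [hk', one_smul] at h4
  rw [hk, neg_one_smul] at h1
  rw [← h3, h4, add_assoc, neg_add_eq_zero]
  exact (eq_add_neg_iff_add_eq.1 h1).symm

/-- The Jacobi identity yields only `3 [f,[f,f]] = 0`, which is empty in characteristic three.
Polarisation reduces the claim to homogeneous `f`, and there the descent works in every
characteristic other than two: each `dOp i` kills `[f,[f,f]]` by the Jacobi identity for `f`, `f`,
`dOp i f`. -/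
theorem contactBr_cube (h2 : (2 : K) ≠ 0) {f : DPAlg K}
    (hf : f ∈ (par (R := K) 1 : Submodule K (DPAlg K))) :
    contactBr K f (contactBr K f f) = 0 := by
  refine par_induction hf (by simp) (fun f g hf hg h h' => ?_) fun k f hk hf => ?_
  · have e1 := contactBr_polarized h2 hf hg
    have e2 := contactBr_polarized h2 hg hf
    simp only [map_add, LinearMap.add_apply]
    linear_combination (norm := module) h + h' + e1 + e2
  · have hodd : Odd k := by
      rw [← Int.not_even_iff_odd, even_iff_two_dvd]
      intro h'
      rw [(ZMod.intCast_zmod_eq_zero_iff_dvd k 2).2 h'] at hk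
      exact absurd hk (by decide)
    rcases lt_or_ge k (-1) with hlt | hge
    · obtain ⟨r, hr⟩ := hodd
      rw [contactDeg_eq_bot (by omega), Submodule.mem_bot] at hf
      simp [hf]
    have hmem := contactBr_mem_contactDeg hf (contactBr_mem_contactDeg hf hf)
    rcases eq_or_lt_of_le hge with rfl | hlt
    · rw [contactDeg_eq_bot (by norm_num), Submodule.mem_bot] at hmem
      exact hmem
    refine eq_zero_of_dOp_eq_zero h2 (by omega) hmem fun i => ?_
    have hp := par_of_contactDeg hf
    have hD := dOp_mem_contactDeg i hf
    obtain ⟨r, hr⟩ := hodd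
    have s1 : contactBr K f (dOp K i f) = -contactBr K (dOp K i f) f := by
      rw [contactBr_skew hf hD, Int.negOnePow_even _ ⟨r * (2 * r + 1), by rw [hr]; ring⟩]
      simp
    rw [dOp_contactBr_of_mem i hf, dOp_contactBr_of_mem i hf, Int.negOnePow_odd k ⟨r, hr⟩, s1]
    have s2 := contactBr_jacobi h2 hf hf hD
    rw [Int.negOnePow_odd (k * k) ⟨2 * r * r + 2 * r, by rw [hr]; ring⟩, s1] at s2
    have s3 := contactBr_skew hD (contactBr_mem_contactDeg hf hf)
    rw [Int.negOnePow_even _ ⟨(k - 1) * k, by ring⟩] at s3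
    simp only [Units.val_neg, Units.val_one, neg_smul, one_smul, map_neg, neg_neg,
      map_add] at s2 s3 ⊢
    linear_combination (norm := module) s3 + s2

/-- A closed parity-graded subspace is a Lie superalgebra. -/
theorem isLieSuperalgebra_of_closed (h2 : (2 : K) ≠ 0) {S : Submodule K (DPAlg K)}
    (hc : BracketClosed S) (hp : (S ⊓ par 0) ⊔ (S ⊓ par 1) = S) : IsLieSuperalgebra S where
  closed := hc
  sup_par := hp
  inf_par := by
    rw [eq_bot_iff]
    rintro x ⟨⟨-, h0⟩, h1⟩
    rw [Submodule.mem_bot, ← Finsupp.support_eq_empty, Finset.eq_empty_iff_forall_notMem]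
    intro m hm
    have e0 : ((m.2.card : ℕ) : ZMod 2) = 0 := h0 hm
    have e1 : ((m.2.card : ℕ) : ZMod 2) = 1 := h1 hm
    rw [e0] at e1
    exact absurd e1 (by decide)
  br_par _ _ _ hx _ hy := contactBr_mem_par hx.2 hy.2
  skew _ _ _ hx _ hy := contactBr_skew_par hx.2 hy.2
  jacobi _ _ _ hx _ hy z _ := contactBr_jacobi_par h2 hx.2 hy.2 z
  cube _ hx := contactBr_cube h2 hx.2

end Grading
end SuperLie
end

noncomputable section

namespace SuperLie

/-! ### Integral elements in computable form -/

/-- The set of odd variables encoded by the binary digits of a natural number. -/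
def bits (m : ℕ) : Finset (Fin 7) := Finset.univ.filter fun i => m.testBit i

/-- Number of odd variables. -/
def bitCard (m : ℕ) : ℕ := (m.testBit 0).toNat + (m.testBit 1).toNat + (m.testBit 2).toNat +
  (m.testBit 3).toNat + (m.testBit 4).toNat + (m.testBit 5).toNat + (m.testBit 6).toNat

/-- Number of pairs of odd variables that are out of order. -/
def inversions (S T : ℕ) : ℕ :=
  ((List.range 7).map fun i => if S.testBit i then bitCard (T % 2 ^ i) else 0).sum

/-- A list of triples `(a, m, c)` encodes the sum of the `c t^(a) Θ_m`, where `Θ_m` is the product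
of the odd variables encoded by `m`, with the last variable `u` replaced by `2u`. -/
abbrev Code := List (ℕ × ℕ × ℤ)

namespace Code

/-- Multiplication by an integer. -/
def smul (c : ℤ) (z : Code) : Code := z.map fun e => (e.1, e.2.1, c * e.2.2)

/-- Apply a sign. -/
def sgn (e : ℕ) (c : ℤ) : ℤ := if e % 2 = 0 then c else -c

/-- Product of monomials, times `c`. -/
def mulMono (a S b T : ℕ) (c : ℤ) : Code :=
  if (S &&& T) % 128 = 0 then [(a + b, S ||| T, sgn (inversions S T) (c * (a + b).choose a))] else []

/-- The index of the dual variable. -/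
def dualN (i : ℕ) : ℕ := if i = 6 then 6 else (i + 3) % 6

/-- Contribution of the variable `i` to the Poisson part of the bracket. -/
def poissonMono (a S b T i : ℕ) : Code :=
  if S.testBit i && T.testBit (dualN i) then
    mulMono a (S ^^^ 2 ^ i) b (T ^^^ 2 ^ dualN i)
      (sgn (bitCard S + inversions (2 ^ i) (S ^^^ 2 ^ i) +
        inversions (2 ^ dualN i) (T ^^^ 2 ^ dualN i)) (if i = 6 then 2 else -1))
  else []

/-- Bracket of monomials. -/
def brMono (a S b T : ℕ) : Code :=
  (if b = 0 then [] else mulMono a S (b - 1) T (2 - bitCard S)) ++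
  ((if a = 0 then [] else mulMono (a - 1) S b T (bitCard T - 2)) ++
  (List.range 7).flatMap (poissonMono a S b T))

/-- The contact bracket. -/
def br (x y : Code) : Code :=
  x.flatMap fun e => y.flatMap fun e' => smul (e.2.2 * e'.2.2) (brMono e.1 e.2.1 e'.1 e'.2.1)

/-- Add a term to a code, collecting like terms. -/
def insert (e : ℕ × ℕ × ℤ) : Code → Code
  | [] => [e]
  | e' :: z => if e.1 = e'.1 ∧ e.2.1 = e'.2.1 then (e.1, e.2.1, e.2.2 + e'.2.2) :: z
      else e' :: insert e z

/-- Collect like terms. -/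
def norm (z : Code) : Code := z.foldr insert []

/-- All coefficients are divisible by `n`. -/
def isZeroMod (n : ℕ) (z : Code) : Bool := (norm z).all fun e => e.2.2 % n = 0

/-- The coefficient of a monomial. -/
def coeff (z : Code) (a m : ℕ) : ℤ :=
  (z.map fun e => if e.1 = a ∧ e.2.1 % 128 = m % 128 then e.2.2 else 0).sum

end Code

section Eval

variable (K : Type*) [Field K]

/-- The factor for `u ↦ 2u`. -/
def uFactor (m : ℕ) : K := if m.testBit 6 then 2 else 1

/-- A single term. -/
def termValue (e : ℕ × ℕ × ℤ) : DPAlg K := ((e.2.2 : K) * uFactor K e.2.1) • mono K e.1 (bits e.2.1)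

/-- The element encoded by a code. -/
def eval (z : Code) : DPAlg K := (z.map (termValue K)).sum

variable {K}

@[simp] theorem eval_nil : eval K [] = 0 := rfl

@[simp] theorem eval_cons (e : ℕ × ℕ × ℤ) (z : Code) :
    eval K (e :: z) = termValue K e + eval K z := by simp [eval]

@[simp] theorem eval_append (z w : Code) : eval K (z ++ w) = eval K z + eval K w := by
  simp [eval]

theorem eval_smul (c : ℤ) (z : Code) : eval K (Code.smul c z) = (c : K) • eval K z := by
  induction z with
  | nil => simp [Code.smul]
  | cons e z ih =>
    rw [Code.smul, List.map_cons, eval_cons, eval_cons, smul_add, ← ih, ← Code.smul, termValue,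
      termValue, smul_smul]
    congr 2; push_cast; ring

theorem eval_flatMap {α : Type*} (l : List α) (f : α → Code) :
    eval K (l.flatMap f) = (l.map fun x => eval K (f x)).sum := by
  induction l with
  | nil => rfl
  | cons e l ih => simp [ih]

theorem eval_insert (e : ℕ × ℕ × ℤ) (z : Code) :
    eval K (Code.insert e z) = termValue K e + eval K z := by
  induction z with
  | nil => rfl
  | cons e' z ih =>
    rw [Code.insert]
    split_ifs with h
    · rw [eval_cons, eval_cons, ← add_assoc]
      congr 1
      rw [termValue, termValue, termValue, ← h.1, ← h.2, ← add_smul]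
      congr 1; push_cast; ring
    · rw [eval_cons, eval_cons, ih]; abel

theorem eval_norm (z : Code) : eval K (Code.norm z) = eval K z := by
  induction z with
  | nil => rfl
  | cons e z ih => rw [Code.norm, List.foldr_cons, eval_insert, eval_cons, ← ih]; rfl

/-- The passage from computations with integers to `K`. For `n = 0` the test `c % 0 = 0` means `c =
0`, so this covers identities over `ℤ` as well as congruences modulo 3. -/
theorem eval_eq_zero {n : ℕ} (hn : (n : K) = 0) {z : Code} (h : Code.isZeroMod n z = true) :
    eval K z = 0 := by
  rw [← eval_norm]
  rw [Code.isZeroMod, List.all_eq_true] at h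
  generalize Code.norm z = w at h
  induction w with
  | nil => rfl
  | cons e w ih =>
    rw [eval_cons, ih fun x hx => h x (List.mem_cons_of_mem _ hx), add_zero, termValue]
    have h1 := h e List.mem_cons_self
    obtain ⟨d, hd⟩ := Int.dvd_of_emod_eq_zero (by simpa using h1)
    rw [hd]; push_cast; rw [hn]; simp

theorem mem_bits {m : ℕ} {i : Fin 7} : i ∈ bits m ↔ m.testBit i = true := by simp [bits]

theorem card_bits (m : ℕ) : (bits m).card = bitCard m := by
  rw [bits, Finset.card_filter, Fin.sum_univ_seven, bitCard]
  simp only [Bool.toNat, Bool.cond_eq_ite]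
  rfl

theorem shuffleSign_bits (S T : ℕ) : shuffleSign (bits S) (bits T) = (-1) ^ inversions S T := by
  rw [shuffleSign]
  congr 1
  have h1 : ((bits S ×ˢ bits T).filter fun q => q.2 < q.1).card =
      ∑ i : Fin 7, if S.testBit i then bitCard (T % 2 ^ (i : ℕ)) else 0 := by
    rw [Finset.card_filter, Finset.sum_product, bits, Finset.sum_filter]
    refine Finset.sum_congr rfl fun i _ => ?_
    congr 1
    rw [← card_bits, ← Finset.card_filter]
    congr 1
    ext j
    simp [mem_bits, Nat.testBit_mod_two_pow, and_comm]
  rw [h1, inversions, Fin.sum_univ_seven]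
  simp only [List.range_succ, List.range_zero, List.nil_append, List.cons_append, List.map_cons,
    List.map_nil, List.sum_cons, List.sum_nil, add_zero, ← add_assoc]
  rfl

theorem disjoint_bits {S T : ℕ} : Disjoint (bits S) (bits T) ↔ (S &&& T) % 128 = 0 := by
  rw [Finset.disjoint_left]
  constructor
  · intro h
    refine Nat.eq_of_testBit_eq fun i => ?_
    rw [show 128 = 2 ^ 7 from rfl, Nat.testBit_mod_two_pow, Nat.testBit_and, Nat.zero_testBit]
    by_cases hi : i < 7
    · have := @h ⟨i, hi⟩
      simp only [mem_bits] at this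
      cases h1 : S.testBit i <;> cases h2 : T.testBit i <;> simp_all
    · simp [hi]
  · intro h i hi hj
    have := congrArg (fun n => Nat.testBit n i) h
    simp only [show 128 = 2 ^ 7 from rfl, Nat.testBit_mod_two_pow, Nat.testBit_and,
      Nat.zero_testBit] at this
    rw [mem_bits] at hi hj
    simp [hi, hj, i.2] at this

theorem bits_or (S T : ℕ) : bits (S ||| T) = bits S ∪ bits T := by
  ext i; simp [mem_bits]

theorem bits_two_pow (i : Fin 7) : bits (2 ^ (i : ℕ)) = {i} := by
  ext j
  simp [mem_bits, Nat.testBit_two_pow, Fin.ext_iff, eq_comm]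

theorem bits_xor {S : ℕ} {i : Fin 7} (h : S.testBit i = true) :
    bits (S ^^^ 2 ^ (i : ℕ)) = (bits S).erase i := by
  ext j
  simp only [mem_bits, Nat.testBit_xor, Nat.testBit_two_pow, Finset.mem_erase, Fin.ext_iff, ne_eq]
  by_cases e : (i : ℕ) = j
  · rw [← e]; simp [h]
  · simp [e, Ne.symm e]

theorem bits_zero : bits 0 = ∅ := by ext i; simp [mem_bits]

theorem cast_sgn (e : ℕ) (c : ℤ) : ((Code.sgn e c : ℤ) : K) = (-1) ^ e * c := by
  rw [Code.sgn]
  split_ifs with h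
  · rw [Even.neg_one_pow (Nat.even_iff.2 h), one_mul]
  · rw [Odd.neg_one_pow (Nat.odd_iff.2 (by omega))]; push_cast; ring

theorem uFactor_or {S T : ℕ} (h : (S &&& T) % 128 = 0) :
    uFactor K (S ||| T) = uFactor K S * uFactor K T := by
  have h6 : ¬(S.testBit 6 = true ∧ T.testBit 6 = true) := fun hh =>
    Finset.disjoint_left.1 (disjoint_bits.2 h) (mem_bits.2 (show S.testBit (6 : Fin 7) = true from hh.1))
      (mem_bits.2 hh.2)
  simp only [uFactor, Nat.testBit_or]
  cases h1 : S.testBit 6 <;> cases h2 : T.testBit 6 <;> simp_all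

theorem eval_single (e : ℕ × ℕ × ℤ) : eval K [e] = termValue K e := by simp

theorem eval_mulMono (a S b T : ℕ) (c : ℤ) : eval K (Code.mulMono a S b T c) =
    (c * uFactor K S * uFactor K T) • dpMul K (mono K a (bits S)) (mono K b (bits T)) := by
  rw [Code.mulMono, dpMul_mono]
  simp only [disjoint_bits]
  split_ifs with h
  · rw [eval_single, termValue, bits_or, uFactor_or h, cast_sgn, shuffleSign_bits, smul_smul]
    congr 1; push_cast; ring
  · simp

theorem dualN_eq (i : Fin 7) : Code.dualN i = dualIdx i := by fin_cases i <;> rfl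

theorem uFactor_xor {S i : ℕ} (h : i ≠ 6) : uFactor K (S ^^^ 2 ^ i) = uFactor K S := by
  simp [uFactor, Nat.testBit_xor, h]

/-- The factor `uFactor` records that codes are written in `2u`. The coefficient of the last
variable becomes `½ · 2 · 2 = 2`, so brackets of codes have integral coefficients. -/
theorem eval_poissonMono (h2 : (2 : K) ≠ 0) (a S b T : ℕ) (i : Fin 7) :
    eval K (Code.poissonMono a S b T i) = (uFactor K S * uFactor K T * poissonCoeff K i) •
      dpMul K (dTheta K i (signOp K (mono K a (bits S)))) (dTheta K (dualIdx i) (mono K b (bits T))) := by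
  rw [Code.poissonMono, dualN_eq, signOp_mono, map_smul, dTheta_mono, dTheta_mono]
  simp only [mem_bits]
  by_cases hS : S.testBit i = true
  · by_cases hT : T.testBit (dualIdx i) = true
    · rw [if_pos hS, if_pos hT, if_pos (by simp [hS, hT]), eval_mulMono, cast_sgn,
        ← bits_xor hS, ← bits_xor hT, ← bits_two_pow, ← bits_two_pow, shuffleSign_bits,
        shuffleSign_bits, card_bits]
      simp only [map_smul, LinearMap.smul_apply, smul_smul]
      congr 1
      have key : (((if (i : ℕ) = 6 then 2 else -1 : ℤ) : ℤ) : K) * uFactor K (S ^^^ 2 ^ (i : ℕ)) *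
          uFactor K (T ^^^ 2 ^ (dualIdx i : ℕ)) =
            uFactor K S * uFactor K T * poissonCoeff K i := by
        by_cases h6 : i = 6
        · subst h6
          change T.testBit 6 = true at hT
          change S.testBit 6 = true at hS
          change _ * uFactor K (S ^^^ 2 ^ 6) * uFactor K (T ^^^ 2 ^ 6) = _ * _ * (2 : K)⁻¹
          have h64 : Nat.testBit 64 6 = true := rfl
          simp [uFactor, hS, hT, Nat.testBit_xor, h2, h64]
        · have h6' : (i : ℕ) ≠ 6 := fun e => h6 (Fin.ext e)
          have h6'' : (dualIdx i : ℕ) ≠ 6 := by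
            intro e
            have : dualIdx i = 6 := Fin.ext e
            apply h6; rw [← dualIdx_dualIdx i, this]; rfl
          have hp : poissonCoeff K i = -1 := by
            fin_cases i <;> first | rfl | exact absurd rfl h6
          rw [if_neg h6', uFactor_xor h6', uFactor_xor h6'', hp]; push_cast; ring
      push_cast at key ⊢
      rw [pow_add, pow_add]
      linear_combination ((-1) ^ bitCard S * (-1) ^ inversions (2 ^ (i : ℕ)) (S ^^^ 2 ^ (i : ℕ)) *
        (-1) ^ inversions (2 ^ (dualIdx i : ℕ)) (T ^^^ 2 ^ (dualIdx i : ℕ))) * key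
    · simp [hT]
  · simp [hS]

theorem eval_brMono (h2 : (2 : K) ≠ 0) (a S b T : ℕ) :
    eval K (Code.brMono a S b T) = (uFactor K S * uFactor K T) •
      contactBr K (mono K a (bits S)) (mono K b (bits T)) := by
  have e : ∀ x y z : DPAlg K, x - y + z = x + (-y + z) := fun x y z => by abel
  rw [Code.brMono, eval_append, eval_append, eval_flatMap, contactBr_apply, smul_add, smul_sub, e]
  congr 1
  · rw [dT_mono]
    split_ifs
    · simp
    · rw [eval_mulMono, euler_mono, card_bits, ← sub_smul, map_smul, LinearMap.smul_apply, smul_smul]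
      congr 1; push_cast; ring
  congr 1
  · rw [dT_mono]
    split_ifs
    · simp
    · rw [eval_mulMono, euler_mono, card_bits, ← sub_smul, map_smul, smul_smul, ← neg_smul]
      congr 1; push_cast; ring
  · rw [Finset.smul_sum]
    simp only [smul_smul, ← eval_poissonMono h2, Fin.sum_univ_seven, List.range_succ,
      List.range_zero, List.nil_append, List.cons_append, List.map_cons, List.map_nil,
      List.sum_cons, List.sum_nil, add_zero, ← add_assoc]
    rfl

theorem eval_br (h2 : (2 : K) ≠ 0) (x y : Code) :
    eval K (Code.br x y) = contactBr K (eval K x) (eval K y) := by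
  have h1 : ∀ e e' : ℕ × ℕ × ℤ, eval K (Code.smul (e.2.2 * e'.2.2)
      (Code.brMono e.1 e.2.1 e'.1 e'.2.1)) = contactBr K (termValue K e) (termValue K e') := by
    intro e e'
    rw [eval_smul, eval_brMono h2, termValue, termValue]
    simp only [map_smul, LinearMap.smul_apply, smul_smul]
    congr 1; push_cast; ring
  rw [Code.br, eval_flatMap]
  simp only [eval_flatMap, h1]
  induction x with
  | nil => simp
  | cons e x ih =>
    rw [List.map_cons, List.sum_cons, ih, eval_cons, map_add, LinearMap.add_apply]
    congr 1
    clear ih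
    induction y with
    | nil => simp
    | cons e' y ih => rw [List.map_cons, List.sum_cons, ih, eval_cons, map_add]

theorem eval_apply (z : Code) (a m : ℕ) :
    eval K z (a, bits m) = Code.coeff z a m * uFactor K m := by
  have hb : ∀ m', bits m' = bits m ↔ m' % 128 = m % 128 := fun m' => by
    rw [Finset.ext_iff]
    simp only [mem_bits]
    constructor
    · intro h
      refine Nat.eq_of_testBit_eq fun i => ?_
      rw [show 128 = 2 ^ 7 from rfl, Nat.testBit_mod_two_pow, Nat.testBit_mod_two_pow]
      by_cases hi : i < 7
      · have := h ⟨i, hi⟩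
        simp only at this
        rw [Bool.eq_iff_iff.2 this]
      · simp [hi]
    · intro h i
      have := congrArg (fun n => Nat.testBit n i) h
      simp only [show 128 = 2 ^ 7 from rfl, Nat.testBit_mod_two_pow, i.2, decide_true,
        Bool.true_and] at this
      rw [this]
  have hu : ∀ m', m' % 128 = m % 128 → uFactor K m' = uFactor K m := fun m' h => by
    have := (Finset.ext_iff.1 ((hb m').2 h)) 6
    rw [mem_bits, mem_bits] at this
    have e : m'.testBit 6 = m.testBit 6 := Bool.eq_iff_iff.2 this
    rw [uFactor, uFactor, e]
  induction z with
  | nil => simp [Code.coeff]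
  | cons e z ih =>
    rw [eval_cons, Finsupp.add_apply, ih, Code.coeff, Code.coeff, List.map_cons, List.sum_cons,
      termValue, Finsupp.smul_apply, mono, Finsupp.single_apply, smul_eq_mul]
    simp only [Prod.mk.injEq, hb]
    split_ifs with h
    · rw [← hu _ h.2]; push_cast; ring
    · push_cast; ring

theorem eval_mem_contactDeg {z : Code} {k : ℤ}
    (h : (z.all fun e => (2 * (e.1 : ℤ) + bitCard e.2.1 - 2 = k)) = true) :
    eval K z ∈ contactDeg K k := by
  induction z with
  | nil => simp
  | cons e z ih =>
    simp only [List.all_cons, Bool.and_eq_true, decide_eq_true_eq] at h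
    rw [eval_cons]
    refine add_mem (Submodule.smul_mem _ _ (mono_mem_contactDeg ?_)) (ih h.2)
    rw [card_bits]; exact h.1

end Eval
end SuperLie
end

noncomputable section

namespace SuperLie

/-! ### A basis of `𝔞𝔤(2)` in generating functions -/

/-- A basis of the `ℤ`-form; the generators `X_1^+, X_1^-, X_2^+, X_2^-, X_3^+, X_3^-` come first,
and the elements `H_i` have the indices `7`, `10`, `16`. -/
def basList : List Code :=
  [[(0, 13, -1), (0, 22, -1), (0, 88, -1), (1, 4, 2)],
   [(0, 32, 1)],
   [(0, 40, 1), (0, 66, 1)],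
   [(0, 5, -1), (0, 80, 1)],
   [(0, 17, 1)],
   [(0, 10, 1)],
   [(0, 26, 1), (0, 44, 1), (0, 70, 1), (1, 8, 2)],
   [(0, 9, 1), (0, 18, 1), (0, 36, -2), (1, 0, 2)],
   [(0, 1, -1)],
   [(0, 48, -1), (0, 65, 1)],
   [(0, 9, -1), (0, 18, 2), (0, 36, -1)],
   [(0, 6, -1), (0, 72, -1)],
   [(0, 3, 1), (0, 96, 1)],
   [(0, 34, 1)],
   [(0, 24, -1), (0, 68, 1)],
   [(0, 20, -1)],
   [(0, 9, 1), (0, 18, -1)],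
   [(0, 25, 1), (0, 52, -1), (0, 69, 1), (1, 16, -2)],
   [(0, 2, -1)],
   [(0, 7, 2), (0, 56, -2), (1, 64, 2)],
   [(0, 11, 1), (0, 38, -1), (0, 104, -1), (1, 2, -2)],
   [(0, 33, 1)],
   [(0, 64, 1)],
   [(0, 16, -1)],
   [(0, 12, 1)],
   [(0, 19, -1), (0, 37, -1), (0, 112, 1), (1, 1, -2)],
   [(0, 8, 1)],
   [(0, 41, -1), (0, 50, -1), (0, 67, 1), (1, 32, 2)],
   [(0, 4, 1)],
   [(0, 27, 4), (0, 45, 4), (0, 54, 4), (0, 71, 4), (0, 120, -4), (2, 0, 8)],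
   [(0, 0, 1)]]

/-- `(g, m, l)` in position `k` means that the basis element `k + 6` is
`(ad X)^m / m!` applied to the basis element `l`, where `X` is the basis element `g < 6`. -/
def stepList : List (ℕ × ℕ × ℕ) :=
  [(2, 1, 0), (0, 1, 1), (3, 1, 1), (4, 1, 2), (2, 1, 3), (5, 1, 3), (2, 2, 4), (2, 3, 4), (3, 2,
  5), (3, 3, 5), (4, 1, 5), (4, 1, 6), (5, 1, 8), (0, 1, 12), (0, 1, 13), (4, 1, 13), (1, 1, 14),
  (1, 1, 15), (5, 1, 15), (4, 1, 20), (5, 1, 23), (2, 1, 25), (3, 1, 26), (0, 1, 27), (1, 1, 28)]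

/-- The basis elements with the opposite weights. -/
def oppositeList : List ℕ :=
  [1, 0, 3, 2, 5, 4, 8, 7, 6, 11, 7, 9, 14, 15, 12, 13, 7, 18, 17, 22, 23, 24, 19, 20, 21, 26,
  25, 28, 27, 30, 29]

/-- The basis elements. -/
def bas (k : ℕ) : Code := basList.getD k []

namespace Code

/-- The coefficient of a monomial in the original variables. -/
def val (z : Code) (a m : ℕ) : ℤ := coeff z a m * if m.testBit 6 then 2 else 1

/-- Collect like terms and remove zero terms. -/
def clean (z : Code) : Code := (norm z).filter fun e => e.2.2 ≠ 0

/-- Iterated bracket. -/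
def adPow (x : Code) : ℕ → Code → Code
  | 0, y => y
  | n + 1, y => clean (br x (adPow x n y))

end Code

/-- A linear functional, as a combination of coefficients of monomials, that is a multiple of the
coordinate functional for the basis element `k`. -/
def pivot (k : ℕ) : List (ℤ × ℕ × ℕ) :=
  -- The Cartan elements 7, 10 and 16 have monomials in common, so one coefficient does not separate
  -- them. These combinations vanish on the other two Cartan elements.
  if k = 10 then [(-1, 0, 36), (-1, 1, 0)]
  else if k = 16 then [(2, 0, 9), (-3, 1, 0), (-2, 0, 36)]
  else ((bas k).getLast?.map fun e => (1, e.1, e.2.1)).toList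

/-- Value of the functional. -/
def pivotVal (k : ℕ) (z : Code) : ℤ := ((pivot k).map fun q => q.1 * Code.val z q.2.1 q.2.2).sum

/-- Value of the functional for `k` on the basis element `k`. -/
def pivotDen (k : ℕ) : ℤ := pivotVal k (bas k)

/-- The degree of a basis element. -/
def basDeg (k : ℕ) : ℤ := ((bas k).head?.map fun e => 2 * (e.1 : ℤ) + bitCard e.2.1 - 2).getD 0

/-- `z - n ∑ c_k b_k` for integers `c_k` determined by the functionals. -/
def remainder (n : ℤ) (z : Code) : Code :=
  if z.isEmpty then [] else z ++ (List.range 31).flatMap fun k =>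
    let c := pivotVal k z / (n * pivotDen k)
    if c = 0 then [] else Code.smul (-n * c) (bas k)

theorem pivot_check : ((List.range 31).all fun k => (List.range 31).all fun l =>
    decide (pivotVal k (bas l) = if k = l then pivotDen k else 0)) = true := by decide +kernel

/-- Hence the functionals can be normalised whenever 2 is invertible, and `8 / pivotDen k` is an
exact quotient. -/
theorem pivotDen_check : ((List.range 31).all fun k =>
    decide (pivotDen k ∣ 8)) = true := by decide +kernel

theorem basDeg_check : ((List.range 31).all fun k => (bas k).all fun e =>
    decide (2 * (e.1 : ℤ) + bitCard e.2.1 - 2 = basDeg k)) = true := by decide +kernel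

/-- The divisions inside `remainder` are integer divisions and may round; that nothing remains is
what certifies the coefficients. With `n = m!`, as in `divPow_check`, it also certifies divisibility
by `m!`. -/
theorem br_check : ((List.range 31).all fun k => (List.range 31).all fun l =>
    Code.isZeroMod 0 (remainder 1 (Code.clean (Code.br (bas k) (bas l))))) = true := by
  decide +kernel

theorem divPow_check : ((List.range 6).all fun g => (List.range 31).all fun l =>
    [2, 3].all fun m =>
      Code.isZeroMod 0 (remainder (m.factorial : ℤ) (Code.adPow (bas g) m (bas l)))) = true := by
  decide +kernel

/-- This is why only the exponents 2 and 3 have to be examined for the divided powers. -/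
theorem adPow_check : ((List.range 6).all fun g => (List.range 31).all fun l =>
    Code.isZeroMod 0 (Code.adPow (bas g) 4 (bas l))) = true := by decide +kernel

/-- Each basis element after the six generators arises from an earlier one by a divided power of a
generator. So the basis lies in every admissible lattice, not merely in some multiple of it. -/
theorem step_check : ((List.range 25).all fun k =>
    let s := stepList.getD k (0, 0, 0)
    decide (s.1 < 6) && decide (s.2.2 < k + 6) && Code.isZeroMod 0
      (Code.adPow (bas s.1) s.2.1 (bas s.2.2) ++
        Code.smul (-(s.2.1.factorial : ℤ)) (bas (k + 6)))) = true := by decide +kernel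

end SuperLie
end

noncomputable section

namespace SuperLie

/-! ### Triangular decomposition -/

section Triangular

variable {n : ℕ} (A : Matrix (Fin n) (Fin n) ℤ) (π : Fin n → ZMod 2)

theorem isIdeal_relIdeal : IsIdeal (relIdeal A π) := fun x y hy => by
  simp only [relIdeal, Submodule.mem_sInf] at hy ⊢
  exact ⟨fun J hJ => (hJ.1 x y (hy J hJ)).1, fun J hJ => (hJ.1 x y (hy J hJ)).2⟩

variable {A π}

theorem Rel.mem {x : FreeAlg n} (h : Rel A π x) : x ∈ relIdeal A π :=
  Submodule.mem_sInf.2 fun _ hJ => hJ.2 x h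

theorem word_mul_word (a b : FreeMagma (Fin n × Bool)) : word a * word b = word (a * b) := by
  simp [word]

theorem freeAlg_eq_sum (x : FreeAlg n) : x = x.coeff.sum fun w c => c • word w := by
  refine MonoidAlgebra.coeff_injective ?_
  simp only [MonoidAlgebra.coeff_finsuppSum, word, MonoidAlgebra.coeff_smul,
    MonoidAlgebra.coeff_single, Finsupp.smul_single, smul_eq_mul, mul_one, Finsupp.sum_single]

@[elab_as_elim]
theorem freeAlg_induction {P : FreeAlg n → Prop} (x : FreeAlg n) (h0 : P 0)
    (hadd : ∀ x y, P x → P y → P (x + y)) (hw : ∀ (c : ℂ) w, P (c • word w)) : P x := by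
  rw [freeAlg_eq_sum x]
  exact Finset.sum_induction _ P hadd h0 fun w _ => hw _ w

theorem genH_eq_word (i : Fin n) :
    genH i = word (FreeMagma.of (i, true) * FreeMagma.of (i, false)) := word_mul_word _ _

theorem koszul_zero_left (j : ZMod 2) : koszul 0 j = 1 := by simp [koszul]

theorem koszul_zero_right (j : ZMod 2) : koszul j 0 = 1 := by simp [koszul]

theorem wordParity_mul (a b : FreeMagma (Fin n × Bool)) :
    wordParity π (a * b) = wordParity π a + wordParity π b := rfl

theorem wordParity_genH (i : Fin n) :
    wordParity π (FreeMagma.of (i, true) * FreeMagma.of (i, false)) = 0 :=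
  CharTwo.add_self_eq_zero (π i)

/-- The weight of a monomial in the free algebra, in terms of the simple roots. -/
def wordWt : FreeMagma (Fin n × Bool) → Fin n → ℤ
  | FreeMagma.of g => Pi.single g.1 (if g.2 then 1 else -1)
  | FreeMagma.mul a b => wordWt a + wordWt b

theorem wordWt_mul (a b : FreeMagma (Fin n × Bool)) : wordWt (a * b) = wordWt a + wordWt b := rfl

theorem wordWt_of (g : Fin n × Bool) :
    wordWt (FreeMagma.of g) = Pi.single g.1 (if g.2 then 1 else -1) := rfl

theorem jacobi_mem (a b : FreeMagma (Fin n × Bool)) (x : FreeAlg n) :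
    word a * (word b * x) - (word a * word b) * x
      - koszul (wordParity π a) (wordParity π b) • (word b * (word a * x)) ∈ relIdeal A π := by
  refine freeAlg_induction x (by simp) (fun x y hx hy => ?_) fun c w => ?_
  · convert add_mem hx hy using 1
    simp only [mul_add, smul_add]; abel
  · convert Submodule.smul_mem (relIdeal A π) c (Rel.jacobi (A := A) (π := π) a b w).mem using 1
    simp only [mul_smul_comm, smul_sub, smul_comm c]

/-- Modulo the relations `H_i` acts as an even derivation, so its eigenvalues add along a product.
-/
theorem genH_mul_word (i : Fin n) (w : FreeMagma (Fin n × Bool)) :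
    genH i * word w - (A.mulVec (wordWt w) i) • word w ∈ relIdeal A π := by
  induction w with
  | ih1 g =>
    obtain ⟨j, s⟩ := g
    have e : ∀ c : ℤ, A.mulVec (Pi.single j c) i = A i j * c := fun c => by
      simp [Matrix.mulVec_single]
    cases s
    · have := (Rel.minus (A := A) (π := π) i j).mem
      rw [wordWt_of, e]
      simpa [genX] using this
    · have := (Rel.plus (A := A) (π := π) i j).mem
      rw [wordWt_of, e]
      simpa [genX] using this
  | ih2 a b ha hb =>
    have h := jacobi_mem (A := A) (π := π) (FreeMagma.of (i, true) * FreeMagma.of (i, false)) a (word b)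
    rw [wordParity_genH, koszul_zero_left, one_smul, ← genH_eq_word] at h
    have h1 := (isIdeal_relIdeal A π (word b) _ ha).2
    have h2 := (isIdeal_relIdeal A π (word a) _ hb).1
    rw [← word_mul_word, wordWt_mul, Matrix.mulVec_add, Pi.add_apply, add_smul]
    convert add_mem (add_mem h h1) h2 using 1
    simp only [sub_mul, mul_sub, smul_mul_assoc, mul_smul_comm]
    abel

/-- All letters of the monomial have the sign `s`. -/
def OnlySign (s : Bool) : FreeMagma (Fin n × Bool) → Prop
  | FreeMagma.of g => g.2 = s
  | FreeMagma.mul a b => OnlySign s a ∧ OnlySign s b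

/-- Span of the monomials of weight `μ` in letters of sign `s`. -/
def signSpan (s : Bool) (μ : Fin n → ℤ) : Submodule ℂ (FreeAlg n) :=
  Submodule.span ℂ {x | ∃ w, OnlySign s w ∧ wordWt w = μ ∧ x = word w}

/-- The span of the `H_i`, in weight zero. -/
def zeroSpan (μ : Fin n → ℤ) : Submodule ℂ (FreeAlg n) :=
  Submodule.span ℂ {x | μ = 0 ∧ ∃ i, x = genH i}

theorem word_mem_signSpan {s : Bool} {w : FreeMagma (Fin n × Bool)} (h : OnlySign s w) :
    word w ∈ signSpan s (wordWt w) := Submodule.subset_span ⟨w, h, rfl, rfl⟩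

/-- The Cartan part occurs in the hypothesis but not in the conclusion because an `H_i` multiplies a
word by a scalar modulo the relations. -/
theorem mul_word_mem {s : Bool} {μ : Fin n → ℤ} {x : FreeAlg n}
    (hx : x ∈ signSpan s μ ⊔ zeroSpan μ ⊔ relIdeal A π) {w : FreeMagma (Fin n × Bool)}
    (hw : OnlySign s w) :
    x * word w ∈ signSpan s (μ + wordWt w) ⊔ relIdeal A π ∧
      word w * x ∈ signSpan s (μ + wordWt w) ⊔ relIdeal A π := by
  rw [sup_assoc, Submodule.mem_sup] at hx
  obtain ⟨y, hy, z, hz, rfl⟩ := hx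
  rw [Submodule.mem_sup] at hz
  obtain ⟨h, hh, r, hr, rfl⟩ := hz
  have h1 : y * word w ∈ signSpan s (μ + wordWt w) ∧ word w * y ∈ signSpan s (μ + wordWt w) := by
    induction hy using Submodule.span_induction with
    | mem x hx =>
      obtain ⟨v, hv, rfl, rfl⟩ := hx
      rw [word_mul_word, word_mul_word]
      refine ⟨word_mem_signSpan (w := v * w) ⟨hv, hw⟩, ?_⟩
      rw [add_comm]
      exact word_mem_signSpan (w := w * v) ⟨hw, hv⟩
    | zero => simp
    | add x y _ _ hx hy =>
      rw [add_mul, mul_add]; exact ⟨add_mem hx.1 hy.1, add_mem hx.2 hy.2⟩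
    | smul c x _ hx =>
      rw [smul_mul_assoc, mul_smul_comm]
      exact ⟨Submodule.smul_mem _ c hx.1, Submodule.smul_mem _ c hx.2⟩
  have h2 : h * word w ∈ signSpan s (μ + wordWt w) ⊔ relIdeal A π ∧
      word w * h ∈ signSpan s (μ + wordWt w) ⊔ relIdeal A π := by
    induction hh using Submodule.span_induction with
    | mem x hx =>
      obtain ⟨rfl, i, rfl⟩ := hx
      have hl : genH i * word w ∈ signSpan s (0 + wordWt w) ⊔ relIdeal A π := by
        have := genH_mul_word (A := A) (π := π) i w
        rw [← sub_add_cancel (genH i * word w) ((A.mulVec (wordWt w) i) • word w), zero_add]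
        exact add_mem (Submodule.mem_sup_right this)
          (Submodule.mem_sup_left (zsmul_mem (word_mem_signSpan hw) _))
      refine ⟨hl, ?_⟩
      have hs := (Rel.skew (A := A) (π := π) w (FreeMagma.of (i, true) * FreeMagma.of (i, false))).mem
      rw [wordParity_genH, koszul_zero_right, one_smul, ← genH_eq_word] at hs
      rw [← add_sub_cancel_right (word w * genH i) (genH i * word w)]
      exact sub_mem (Submodule.mem_sup_right hs) hl
    | zero => simp
    | add x y _ _ hx hy =>
      rw [add_mul, mul_add]; exact ⟨add_mem hx.1 hy.1, add_mem hx.2 hy.2⟩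
    | smul c x _ hx =>
      rw [smul_mul_assoc, mul_smul_comm]
      exact ⟨Submodule.smul_mem _ c hx.1, Submodule.smul_mem _ c hx.2⟩
  have h3 := isIdeal_relIdeal A π (word w) r hr
  rw [add_mul, add_mul, mul_add, mul_add]
  exact ⟨add_mem (Submodule.mem_sup_left h1.1) (add_mem h2.1 (Submodule.mem_sup_right h3.2)),
    add_mem (Submodule.mem_sup_left h1.2) (add_mem h2.2 (Submodule.mem_sup_right h3.1))⟩

/-- By the Jacobi identity the generator acts on one letter after another. On a single letter of the
opposite sign it gives zero or, up to sign, some `H_i`; on the remaining letters `mul_word_mem`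
absorbs that `H_i`. -/
theorem gen_mul_word_mem (i : Fin n) (s : Bool) {w : FreeMagma (Fin n × Bool)}
    (hw : OnlySign (!s) w) :
    genX i s * word w ∈ signSpan (!s) (wordWt w + wordWt (FreeMagma.of (i, s))) ⊔
      zeroSpan (wordWt w + wordWt (FreeMagma.of (i, s))) ⊔ relIdeal A π := by
  induction w with
  | ih1 g =>
    obtain ⟨j, s'⟩ := g
    obtain rfl : s' = !s := hw
    have hsk := (Rel.skew (A := A) (π := π) (FreeMagma.of (i, s)) (FreeMagma.of (j, !s))).mem
    by_cases hij : i = j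
    · subst hij
      have hz : wordWt (FreeMagma.of (i, !s)) + wordWt (FreeMagma.of (i, s)) = 0 := by
        rw [wordWt_of, wordWt_of, ← Pi.single_add]
        cases s <;> simp
      have hH : genH i ∈ zeroSpan (wordWt (FreeMagma.of (i, !s)) + wordWt (FreeMagma.of (i, s))) :=
        Submodule.subset_span ⟨hz, i, rfl⟩
      cases s
      · exact (Submodule.add_mem_iff_left _ (zsmul_mem
          (Submodule.mem_sup_left (Submodule.mem_sup_right hH)) _)).1 (Submodule.mem_sup_right hsk)
      · exact Submodule.mem_sup_left (Submodule.mem_sup_right hH)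
    · refine Submodule.mem_sup_right ?_
      cases s
      · exact (Submodule.add_mem_iff_left _
          (zsmul_mem (Rel.mixed j i (Ne.symm hij)).mem _)).1 hsk
      · exact (Rel.mixed i j hij).mem
  | ih2 a b ha hb =>
    have hj := jacobi_mem (A := A) (π := π) (FreeMagma.of (i, s)) a (word b)
    have h1 := (mul_word_mem (ha hw.1) hw.2).1
    have h2 := (mul_word_mem (hb hw.2) hw.1).2
    rw [show wordWt a + wordWt (FreeMagma.of (i, s)) + wordWt b =
      wordWt (a * b) + wordWt (FreeMagma.of (i, s)) by rw [wordWt_mul]; abel] at h1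
    rw [show wordWt b + wordWt (FreeMagma.of (i, s)) + wordWt a =
      wordWt (a * b) + wordWt (FreeMagma.of (i, s)) by rw [wordWt_mul]; abel] at h2
    have hle : ∀ μ : Fin n → ℤ, signSpan (!s) μ ⊔ relIdeal A π ≤
        signSpan (!s) μ ⊔ zeroSpan μ ⊔ relIdeal A π := fun μ =>
      sup_le_sup_right le_sup_left _
    rw [← word_mul_word]
    have := add_mem (add_mem (Submodule.mem_sup_right hj) (hle _ h1))
      (zsmul_mem (hle _ h2) (koszul (wordParity π (FreeMagma.of (i, s))) (wordParity π a)))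
    convert this using 1
    simp only [genX]
    abel

/-- The sum of the three parts of the triangular decomposition in weight `μ`. -/
def triSpan (A : Matrix (Fin n) (Fin n) ℤ) (π : Fin n → ZMod 2) (μ : Fin n → ℤ) :
    Submodule ℂ (FreeAlg n) :=
  signSpan true μ ⊔ signSpan false μ ⊔ zeroSpan μ ⊔ relIdeal A π

theorem signSpan_le_triSpan (s : Bool) (μ : Fin n → ℤ) :
    signSpan s μ ⊔ zeroSpan μ ⊔ relIdeal A π ≤ triSpan A π μ := by
  refine sup_le_sup_right (sup_le_sup_right ?_ _) _
  cases s
  · exact le_sup_right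
  · exact le_sup_left

theorem gen_mul_mem_triSpan (i : Fin n) (s : Bool) {μ : Fin n → ℤ} {x : FreeAlg n}
    (hx : x ∈ triSpan A π μ) :
    genX i s * x ∈ triSpan A π (μ + wordWt (FreeMagma.of (i, s))) := by
  have hx' : x ∈ signSpan (!s) μ ⊔ (signSpan s μ ⊔ zeroSpan μ ⊔ relIdeal A π) := by
    refine (le_of_eq ?_ : triSpan A π μ ≤ _) hx
    rw [triSpan, ← sup_assoc, ← sup_assoc]
    congr 2
    cases s
    · rfl
    · exact sup_comm _ _
  obtain ⟨y, hy, z, hz, rfl⟩ := Submodule.mem_sup.1 hx'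
  rw [mul_add]
  refine add_mem ?_ ?_
  · clear hx hx'
    induction hy using Submodule.span_induction with
    | mem x hx =>
      obtain ⟨v, hv, rfl, rfl⟩ := hx
      exact signSpan_le_triSpan _ _ (gen_mul_word_mem i s hv)
    | zero => simp
    | add x y _ _ hx hy => rw [mul_add]; exact add_mem hx hy
    | smul c x _ hx => rw [mul_smul_comm]; exact Submodule.smul_mem _ c hx
  · refine signSpan_le_triSpan s _ ?_
    exact (sup_le_sup_right le_sup_left _ : signSpan s _ ⊔ relIdeal A π ≤ _)
      (mul_word_mem (w := FreeMagma.of (i, s)) hz (rfl : (i, s).2 = s)).2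

theorem word_mul_mem_triSpan (w : FreeMagma (Fin n × Bool)) {μ : Fin n → ℤ} {x : FreeAlg n}
    (hx : x ∈ triSpan A π μ) : word w * x ∈ triSpan A π (μ + wordWt w) := by
  induction w generalizing μ x with
  | ih1 g => exact gen_mul_mem_triSpan g.1 g.2 hx
  | ih2 a b ha hb =>
    have hj := jacobi_mem (A := A) (π := π) a b x
    have h1 := ha (hb hx)
    have h2 := hb (ha hx)
    rw [add_assoc, add_comm (wordWt b), ← wordWt_mul] at h1
    rw [add_assoc, ← wordWt_mul] at h2
    have := sub_mem (sub_mem h1 (zsmul_mem h2 (koszul (wordParity π a) (wordParity π b))))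
      (Submodule.mem_sup_right hj : _ ∈ triSpan A π (μ + wordWt (a * b)))
    rw [← word_mul_word]
    convert this using 1
    abel

/-- The spanning half of the triangular decomposition, sorted by weight. Directness of the sum plays
no role below. -/
theorem word_mem_triSpan (w : FreeMagma (Fin n × Bool)) : word w ∈ triSpan A π (wordWt w) := by
  induction w with
  | ih1 g =>
    exact signSpan_le_triSpan g.2 _
      (Submodule.mem_sup_left (Submodule.mem_sup_left (word_mem_signSpan rfl)))
  | ih2 a b _ hb =>
    rw [← word_mul_word, wordWt_mul, add_comm]
    exact word_mul_mem_triSpan a hb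

/-- The height of a word in letters of one sign is at least one in absolute value, so in weight zero
only the Cartan part of the decomposition is left. -/
theorem onlySign_pos {s : Bool} {w : FreeMagma (Fin n × Bool)} (h : OnlySign s w) :
    1 ≤ (if s then 1 else -1) * ∑ i, wordWt w i := by
  induction w with
  | ih1 g =>
    obtain rfl : g.2 = s := h
    rw [wordWt_of, Finset.sum_pi_single']
    cases g.2 <;> simp
  | ih2 a b ha hb =>
    rw [wordWt_mul]
    simp only [Pi.add_apply, Finset.sum_add_distrib, mul_add]
    have := ha h.1
    have := hb h.2
    omega

theorem signSpan_zero (s : Bool) : signSpan s (0 : Fin n → ℤ) = ⊥ := by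
  rw [signSpan, Submodule.span_eq_bot]
  rintro x ⟨w, hw, h0, rfl⟩
  have := onlySign_pos hw
  rw [h0] at this
  simp at this

/-- A monomial of weight zero is a combination of the `H_i` modulo the relations. -/
theorem word_mem_spanH {w : FreeMagma (Fin n × Bool)} (h : wordWt w = 0) :
    word w ∈ spanH n ⊔ relIdeal A π := by
  have := word_mem_triSpan (A := A) (π := π) w
  rw [h, triSpan, signSpan_zero, signSpan_zero, bot_sup_eq, bot_sup_eq] at this
  refine (sup_le_sup_right (Submodule.span_mono ?_) _ :
    zeroSpan (0 : Fin n → ℤ) ⊔ relIdeal A π ≤ spanH n ⊔ relIdeal A π) this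
  rintro x ⟨-, i, rfl⟩
  exact ⟨i, rfl⟩

/-- The projection to weight zero. -/
def zeroProj (n : ℕ) (x : FreeAlg n) : FreeAlg n :=
  open Classical in x.coeff.sum fun w c => if wordWt w = 0 then c • word w else 0

/-- The operator is the product over `μ ∈ Ω` of `ad H_i` minus its eigenvalue on weight `μ`, where
`i` is chosen so that this eigenvalue is nonzero. Such an `i` exists because `A` is injective on
weights. The product kills the weights in `Ω`, multiplies weight zero by a nonzero constant, and
preserves every ideal. -/
theorem exists_weight_operator (hA : ∀ μ : Fin n → ℤ, A.mulVec μ = 0 → μ = 0)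
    (Ω : Finset (Fin n → ℤ)) (h0 : (0 : Fin n → ℤ) ∉ Ω) :
    ∃ (P : FreeAlg n →ₗ[ℂ] FreeAlg n) (c : ℂ), c ≠ 0 ∧
      (∀ J : Submodule ℂ (FreeAlg n), IsIdeal J → ∀ x ∈ J, P x ∈ J) ∧
      (∀ w, wordWt w ∈ Ω → P (word w) ∈ relIdeal A π) ∧
      (∀ w, wordWt w = 0 → P (word w) - c • word w ∈ relIdeal A π) := by
  classical
  induction Ω using Finset.induction_on with
  | empty => exact ⟨LinearMap.id, 1, one_ne_zero, fun _ _ _ h => h, by simp, by simp⟩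
  | insert μ Ω hμ ih =>
    obtain ⟨P, c, hc, hJ, hΩ, hz⟩ := ih fun h => h0 (Finset.mem_insert_of_mem h)
    have hμ0 : μ ≠ 0 := fun h => h0 (h ▸ Finset.mem_insert_self μ Ω)
    obtain ⟨i, hi⟩ : ∃ i, A.mulVec μ i ≠ 0 := by
      by_contra! h
      exact hμ0 (hA μ (funext h))
    have hR := hJ _ (isIdeal_relIdeal A π)
    set q : ℂ := ((A.mulVec μ i : ℤ) : ℂ) with hq
    have key : ∀ w, P (genH i * word w - q • word w)
        - ((A.mulVec (wordWt w) i : ℂ) - q) • P (word w) ∈ relIdeal A π := fun w => by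
      have h := hR _ (genH_mul_word (A := A) (π := π) i w)
      rw [← Int.cast_smul_eq_zsmul ℂ, map_sub, map_smul] at h
      have e : P (genH i * word w - q • word w)
          - ((A.mulVec (wordWt w) i : ℂ) - q) • P (word w) =
          P (genH i * word w) - ((A.mulVec (wordWt w) i : ℤ) : ℂ) • P (word w) := by
        rw [P.map_sub, P.map_smul, sub_smul, sub_sub_sub_cancel_right]
      rw [e]
      exact h
    refine ⟨P ∘ₗ (LinearMap.mulLeft ℂ (genH i) - q • LinearMap.id),
      -q * c, mul_ne_zero (neg_ne_zero.2 (Int.cast_ne_zero.2 hi)) hc,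
      fun J hI x hx => ?_, fun w hw => ?_, fun w hw => ?_⟩
    · simp only [LinearMap.comp_apply, LinearMap.sub_apply, LinearMap.mulLeft_apply,
        LinearMap.smul_apply, LinearMap.id_apply]
      have h1 := (hI (genH i) x hx).1
      have h2 := J.smul_mem q hx
      exact hJ J hI _ (sub_mem h1 h2)
    · have := key w
      simp only [LinearMap.comp_apply, LinearMap.sub_apply, LinearMap.mulLeft_apply,
        LinearMap.smul_apply, LinearMap.id_apply]
      rcases Finset.mem_insert.1 hw with h | h
      · rwa [h, sub_self, zero_smul, sub_zero] at this
      · exact (Submodule.sub_mem_iff_left _ (Submodule.smul_mem _ _ (hΩ w h))).1 this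
    · have := key w
      rw [hw, Matrix.mulVec_zero, Pi.zero_apply, Int.cast_zero, zero_sub] at this
      simp only [LinearMap.comp_apply, LinearMap.sub_apply, LinearMap.mulLeft_apply,
        LinearMap.smul_apply, LinearMap.id_apply]
      convert add_mem this (Submodule.smul_mem _ (-q) (hz w hw)) using 1
      rw [smul_sub, smul_smul]
      abel

/-- Applying the weight operator shows that an ideal above the relations contains the weight zero
part of each of its elements. That part lies in the span of the `H_i` modulo the relations, and
there the ideal is trivial. -/
theorem zeroProj_mem (hA : ∀ μ : Fin n → ℤ, A.mulVec μ = 0 → μ = 0)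
    {J : Submodule ℂ (FreeAlg n)} (hJ : IsIdeal J) (hR : relIdeal A π ≤ J)
    (hH : J ⊓ (spanH n ⊔ relIdeal A π) ≤ relIdeal A π) {x : FreeAlg n} (hx : x ∈ J) :
    zeroProj n x ∈ relIdeal A π := by
  classical
  obtain ⟨P, c, hc, hP, hΩ, hz⟩ := exists_weight_operator (π := π) hA
    ((x.coeff.support.image wordWt).erase 0) (Finset.notMem_erase _ _)
  have h1 : P x - c • zeroProj n x ∈ relIdeal A π := by
    conv in P x => rw [freeAlg_eq_sum x]
    rw [zeroProj, Finsupp.sum, Finsupp.sum, map_sum, Finset.smul_sum, ← Finset.sum_sub_distrib]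
    refine sum_mem fun w hw => ?_
    rw [map_smul]
    split_ifs with h
    · have := Submodule.smul_mem _ (x.coeff w) (hz w h)
      rwa [smul_sub, smul_comm _ c] at this
    · rw [smul_zero, sub_zero]
      exact Submodule.smul_mem _ _
        (hΩ w (Finset.mem_erase.2 ⟨h, Finset.mem_image_of_mem _ hw⟩))
  have h2 : zeroProj n x ∈ J := by
    have := sub_mem (hP J hJ x hx) (hR h1)
    rw [sub_sub_cancel] at this
    exact (Submodule.smul_mem_iff _ hc).1 this
  refine hH ⟨h2, ?_⟩
  rw [zeroProj, Finsupp.sum]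
  refine sum_mem fun w _ => ?_
  split_ifs with h
  · exact Submodule.smul_mem _ _ (word_mem_spanH h)
  · exact zero_mem _

end Triangular

end SuperLie
end

noncomputable section

namespace SuperLie

/-! ### The basis elements over a field -/

theorem all_range {n : ℕ} {f : ℕ → Bool} (h : (List.range n).all f = true) {k : ℕ} (hk : k < n) :
    f k = true :=
  List.all_eq_true.1 h k (List.mem_range.2 hk)

theorem sum_map_range {M : Type*} [AddCommMonoid M] (n : ℕ) (f : ℕ → M) :
    ((List.range n).map f).sum = ∑ i : Fin n, f i := by
  induction n with
  | zero => rfl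
  | succ n ih => simp [List.range_succ, Fin.sum_univ_castSucc, ih]

section Basis

variable (K : Type*) [Field K]

/-- The basis element with index `k`. -/
def basElt (k : ℕ) : DPAlg K := eval K (bas k)

/-- The functional given by `pivot k`. -/
def pivotFun (k : ℕ) : DPAlg K →ₗ[K] K :=
  ((pivot k).map fun q => (q.1 : K) • Finsupp.lapply (q.2.1, bits q.2.2)).sum

variable {K}

theorem eval_val (z : Code) (a m : ℕ) : eval K z (a, bits m) = (Code.val z a m : K) := by
  rw [eval_apply, Code.val, uFactor]
  push_cast
  rfl

theorem pivotFun_apply (k : ℕ) (f : DPAlg K) :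
    pivotFun K k f = ((pivot k).map fun q => (q.1 : K) * f (q.2.1, bits q.2.2)).sum := by
  rw [pivotFun]
  generalize pivot k = l
  induction l with
  | nil => rfl
  | cons q l ih => rw [List.map_cons, List.sum_cons, LinearMap.add_apply, ih]; rfl

theorem pivotFun_eval (k : ℕ) (z : Code) : pivotFun K k (eval K z) = (pivotVal k z : K) := by
  rw [pivotFun_apply, pivotVal]
  simp only [eval_val]
  generalize pivot k = l
  induction l with
  | nil => simp
  | cons q l ih => simp [ih]

theorem pivotFun_eq_zero {k : ℕ} {s : Set (ℕ × Finset (Fin 7))} {f : DPAlg K}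
    (hf : f ∈ Finsupp.supported K K s) (h : ∀ q ∈ pivot k, (q.2.1, bits q.2.2) ∉ s) :
    pivotFun K k f = 0 := by
  rw [pivotFun_apply]
  refine List.sum_eq_zero fun x hx => ?_
  obtain ⟨q, hq, rfl⟩ := List.mem_map.1 hx
  rw [(Finsupp.mem_supported' K f).1 hf _ (h q hq), mul_zero]

theorem pivotFun_basElt {k l : ℕ} (hk : k < 31) (hl : l < 31) :
    pivotFun K k (basElt K l) = if k = l then (pivotDen k : K) else 0 := by
  rw [basElt, pivotFun_eval, of_decide_eq_true (all_range (all_range pivot_check hk) hl)]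
  split_ifs <;> simp

theorem pivotDen_ne_zero (h2 : (2 : K) ≠ 0) {k : ℕ} (hk : k < 31) : (pivotDen k : K) ≠ 0 := by
  obtain ⟨c, hc⟩ := of_decide_eq_true (all_range pivotDen_check hk)
  intro h
  have := congrArg (Int.cast : ℤ → K) hc
  push_cast at this
  rw [h, zero_mul] at this
  exact pow_ne_zero 3 h2 (by linear_combination this)

theorem pivotFun_sum {k : Fin 31} (c : Fin 31 → K) :
    pivotFun K k (∑ l, c l • basElt K l) = c k * (pivotDen k : K) := by
  rw [map_sum, Finset.sum_eq_single k]
  · rw [map_smul, pivotFun_basElt k.2 k.2, if_pos rfl, smul_eq_mul]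
  · intro l _ hl
    rw [map_smul, pivotFun_basElt k.2 l.2, if_neg fun h => hl (Fin.ext h.symm), smul_zero]
  · simp

theorem linearIndependent_basElt (h2 : (2 : K) ≠ 0) :
    LinearIndependent K fun k : Fin 31 => basElt K k := by
  refine Fintype.linearIndependent_iff.2 fun c hc k => ?_
  have := pivotFun_sum (k := k) c
  rw [hc, map_zero] at this
  exact (mul_eq_zero.1 this.symm).resolve_right (pivotDen_ne_zero h2 k.2)

theorem eval_clean (z : Code) : eval K (Code.clean z) = eval K z := by
  rw [Code.clean, ← eval_norm z]
  generalize Code.norm z = w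
  induction w with
  | nil => rfl
  | cons e w ih =>
    rw [List.filter_cons]
    split_ifs with h
    · rw [eval_cons, ih, eval_cons]
    · have : e.2.2 = 0 := by simpa using h
      rw [ih, eval_cons, termValue, this]
      simp

theorem eval_adPow (h2 : (2 : K) ≠ 0) (x y : Code) (n : ℕ) :
    eval K (Code.adPow x n y) = ((contactBr K (eval K x)) ^ n) (eval K y) := by
  induction n with
  | zero => rfl
  | succ n ih => rw [Code.adPow, eval_clean, eval_br h2, ih, pow_succ', Module.End.mul_apply]

theorem eval_remainder (n : ℤ) (z : Code) : eval K (remainder n z) =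
    eval K z - (n : K) • ∑ k : Fin 31, ((pivotVal k z / (n * pivotDen k) : ℤ) : K) • basElt K k := by
  rw [remainder]
  split_ifs with h
  · rw [List.isEmpty_iff.1 h]
    have : ∀ k, pivotVal k [] = 0 := fun k => by
      rw [pivotVal]
      exact List.sum_eq_zero fun x hx => by
        obtain ⟨q, -, rfl⟩ := List.mem_map.1 hx
        simp [Code.val, Code.coeff]
    simp [this]
  · rw [eval_append, eval_flatMap, sum_map_range, sub_eq_add_neg, Finset.smul_sum,
      ← Finset.sum_neg_distrib]
    congr 1
    refine Finset.sum_congr rfl fun k _ => ?_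
    dsimp only
    split_ifs with h
    · rw [h, Int.cast_zero, zero_smul, smul_zero, neg_zero]; rfl
    · rw [eval_smul, basElt, smul_smul, ← neg_smul]
      push_cast
      congr 1
      ring

/-- The structure constants. -/
def strCoeff (k l m : ℕ) : ℤ :=
  pivotVal m (Code.clean (Code.br (bas k) (bas l))) / (1 * pivotDen m)

theorem contactBr_basElt (h2 : (2 : K) ≠ 0) {k l : ℕ} (hk : k < 31) (hl : l < 31) :
    contactBr K (basElt K k) (basElt K l) = ∑ m : Fin 31, (strCoeff k l m : K) • basElt K m := by
  have h := eval_eq_zero (K := K) (n := 0) (by simp) (all_range (all_range br_check hk) hl)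
  rw [eval_remainder, eval_clean, eval_br h2, Int.cast_one, one_smul, sub_eq_zero] at h
  exact h

theorem basElt_mem_contactDeg {k : ℕ} (hk : k < 31) : basElt K k ∈ contactDeg K (basDeg k) :=
  eval_mem_contactDeg (by simpa using all_range basDeg_check hk)

/-- The elements `H_i`. -/
def cartanList : List ℕ := [7, 10, 16]

/-- The entries of the Cartan matrix. -/
def agEntry (i j : ℕ) : ℤ := ([[0, 1, 0], [-1, 2, -3], [0, -1, 2]].getD i []).getD j 0

theorem relation_check : ((List.range 3).all fun i => (List.range 3).all fun j =>
    Code.isZeroMod 0 (Code.br (bas (2 * i)) (bas (2 * j + 1)) ++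
      if i = j then Code.smul (-1) (bas (cartanList.getD i 0)) else []) &&
    Code.isZeroMod 0 (Code.br (bas (cartanList.getD i 0)) (bas (cartanList.getD j 0))) &&
    Code.isZeroMod 0 (Code.br (bas (cartanList.getD i 0)) (bas (2 * j)) ++
      Code.smul (-agEntry i j) (bas (2 * j))) &&
    Code.isZeroMod 0 (Code.br (bas (cartanList.getD i 0)) (bas (2 * j + 1)) ++
      Code.smul (agEntry i j) (bas (2 * j + 1)))) = true := by decide +kernel

/-- The functionals of the Cartan elements vanish on the image of each `ad H_i`, so they see weight
zero only. -/
theorem cartan_check : (cartanList.all fun h => cartanList.all fun c => (List.range 31).all fun k =>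
    decide (pivotVal c (Code.br (bas h) (bas k)) = 0)) = true := by decide +kernel

/-- Outside the Cartan elements, bracketing with the element of opposite weight and then reading a
Cartan coordinate detects the coordinate `k` and no other. This nondegenerate pairing makes the
realization faithful. -/
theorem opposite_check : ((List.range 31).all fun k => cartanList.any fun c =>
    decide (c = k) || (decide (oppositeList.getD k 0 < 31) && (List.range 31).all fun l =>
      decide ((pivotVal c (Code.br (bas (oppositeList.getD k 0)) (bas l)) = 0 ↔ k ≠ l)))) = true := by
  decide +kernel

theorem step_degree_check : ((List.range 25).all fun k =>
    let s := stepList.getD k (0, 0, 0)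
    decide (s.2.1 * basDeg s.1 + basDeg s.2.2 = basDeg (k + 6))) = true := by decide +kernel

theorem pivot_degree_check : ((List.range 31).all fun k => (pivot k).all fun q =>
    decide (2 * (q.2.1 : ℤ) + bitCard q.2.2 - 2 = basDeg k)) = true := by decide +kernel

end Basis

end SuperLie
end

noncomputable section

namespace SuperLie

/-! ### The realization of `𝔤(A)` over `ℂ` by contact brackets -/

open SuperBracket

/-- The position of a generator in the list of basis elements. -/
def genIdx (g : Fin 3 × Bool) : ℕ := 2 * g.1 + if g.2 then 0 else 1

theorem genIdx_lt (g : Fin 3 × Bool) : genIdx g < 6 := by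
  rw [genIdx]; split_ifs <;> omega

/-- The value of a monomial. -/
def evWord : FreeMagma (Fin 3 × Bool) → DPAlg ℂ
  | FreeMagma.of g => basElt ℂ (genIdx g)
  | FreeMagma.mul a b => contactBr ℂ (evWord a) (evWord b)

theorem evWord_mul (a b : FreeMagma (Fin 3 × Bool)) :
    evWord (a * b) = contactBr ℂ (evWord a) (evWord b) := rfl

/-- The value of an element of the free algebra. -/
def evFree : FreeAlg 3 →ₗ[ℂ] DPAlg ℂ :=
  Finsupp.linearCombination ℂ evWord ∘ₗ (MonoidAlgebra.coeffLinearEquiv ℂ).toLinearMap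

theorem evFree_word (w : FreeMagma (Fin 3 × Bool)) : evFree (word w) = evWord w := by
  have : (MonoidAlgebra.coeffLinearEquiv ℂ) (word w) = Finsupp.single w (1 : ℂ) := rfl
  rw [evFree, LinearMap.comp_apply, LinearEquiv.coe_coe, this, Finsupp.linearCombination_single,
    one_smul]

theorem evFree_mul (x y : FreeAlg 3) : evFree (x * y) = contactBr ℂ (evFree x) (evFree y) := by
  refine freeAlg_induction x (by simp) (fun x x' h h' => ?_) fun c v => ?_
  · rw [add_mul, map_add, h, h', map_add, map_add, LinearMap.add_apply]
  refine freeAlg_induction y (by simp) (fun y y' h h' => ?_) fun d w => ?_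
  · rw [mul_add, map_add, h, h', map_add, map_add]
  rw [smul_mul_smul_comm, word_mul_word, map_smul, map_smul, map_smul, map_smul, map_smul,
    LinearMap.smul_apply, evFree_word, evFree_word, evFree_word, evWord_mul, mul_comm c d, mul_smul]

theorem evFree_genX (i : Fin 3) (s : Bool) : evFree (genX i s) = basElt ℂ (genIdx (i, s)) :=
  evFree_word _

theorem basDeg_genIdx (g : Fin 3 × Bool) :
    basDeg (genIdx g) = if g.2 then agR g.1 else -agR g.1 := by
  revert g; decide

theorem evWord_mem_contactDeg (w : FreeMagma (Fin 3 × Bool)) :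
    evWord w ∈ contactDeg ℂ (wordDeg agR w) := by
  induction w with
  | ih1 g =>
    have := basElt_mem_contactDeg (K := ℂ) ((genIdx_lt g).trans (by norm_num))
    rwa [basDeg_genIdx] at this
  | ih2 a b ha hb => exact contactBr_mem_contactDeg ha hb

theorem wordParity_eq (w : FreeMagma (Fin 3 × Bool)) :
    wordParity agParity w = ((wordDeg agR w : ℤ) : ZMod 2) := by
  induction w with
  | ih1 g => revert g; decide
  | ih2 a b ha hb =>
    rw [wordParity_mul, ha, hb, ← Int.cast_add]; rfl

theorem evWord_mem_par (w : FreeMagma (Fin 3 × Bool)) :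
    evWord w ∈ (par (R := ℂ) (wordParity agParity w) : Submodule ℂ (DPAlg ℂ)) := by
  rw [wordParity_eq]
  exact par_of_contactDeg (evWord_mem_contactDeg w)

theorem relation_check' (i j : Fin 3) :
    (contactBr ℂ (basElt ℂ (2 * i)) (basElt ℂ (2 * j + 1)) =
      if i = j then basElt ℂ (cartanList.getD i 0) else 0) ∧
    contactBr ℂ (basElt ℂ (cartanList.getD i 0)) (basElt ℂ (cartanList.getD j 0)) = 0 ∧
    contactBr ℂ (basElt ℂ (cartanList.getD i 0)) (basElt ℂ (2 * j)) =
      (agMatrix i j : ℂ) • basElt ℂ (2 * j) ∧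
    contactBr ℂ (basElt ℂ (cartanList.getD i 0)) (basElt ℂ (2 * j + 1)) =
      -((agMatrix i j : ℂ) • basElt ℂ (2 * j + 1)) := by
  have h2 : (2 : ℂ) ≠ 0 := two_ne_zero
  have hA : ∀ i j : Fin 3, agMatrix i j = agEntry i j := fun i j => by
    fin_cases i <;> fin_cases j <;> rfl
  have h := all_range (all_range relation_check i.2) j.2
  simp only [Bool.and_eq_true] at h
  obtain ⟨⟨⟨ha, hb⟩, hc⟩, hd⟩ := h
  have h0 : ((0 : ℕ) : ℂ) = 0 := Nat.cast_zero
  replace ha := eval_eq_zero h0 ha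
  replace hb := eval_eq_zero h0 hb
  replace hc := eval_eq_zero h0 hc
  replace hd := eval_eq_zero h0 hd
  rw [eval_append, eval_br h2] at ha
  rw [eval_br h2] at hb
  rw [eval_append, eval_br h2, eval_smul] at hc hd
  refine ⟨?_, hb, ?_, ?_⟩
  · rw [basElt, basElt, eq_neg_of_add_eq_zero_left ha]
    by_cases h : i = j
    · subst h
      rw [if_pos rfl, if_pos rfl, eval_smul, basElt]; simp
    · rw [if_neg h, if_neg fun h' => h (Fin.ext h'), eval_nil, neg_zero]
  · rw [basElt, basElt, eq_neg_of_add_eq_zero_left hc, hA, Int.cast_neg, neg_smul, neg_neg]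
  · rw [basElt, basElt, eq_neg_of_add_eq_zero_left hd, hA]

theorem evFree_genH (i : Fin 3) : evFree (genH i) = basElt ℂ (cartanList.getD i 0) := by
  have := (relation_check' i i).1
  rw [if_pos rfl] at this
  rw [genH, evFree_mul, evFree_genX, evFree_genX, ← this]
  rfl

theorem isIdeal_ker_evFree : IsIdeal (LinearMap.ker evFree) := fun x y hy => by
  rw [LinearMap.mem_ker] at hy
  simp only [LinearMap.mem_ker, evFree_mul, hy, map_zero, LinearMap.zero_apply, and_self]

theorem Rel.evFree {x : FreeAlg 3} (h : Rel agMatrix agParity x) : evFree x = 0 := by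
  have hp : ∀ i : Fin 3, genIdx (i, true) = 2 * i := fun i => rfl
  have hm : ∀ i : Fin 3, genIdx (i, false) = 2 * i + 1 := fun i => rfl
  cases h with
  | skew a b =>
    rw [map_add, map_zsmul, evFree_mul, evFree_mul, evFree_word, evFree_word,
      contactBr_skew_par (evWord_mem_par a) (evWord_mem_par b), neg_add_cancel]
  | jacobi a b c =>
    rw [map_sub, map_sub, map_zsmul]
    simp only [evFree_mul, evFree_word]
    rw [contactBr_jacobi_par two_ne_zero (evWord_mem_par a) (evWord_mem_par b)]
    abel
  | mixed i j h =>
    rw [evFree_mul, evFree_genX, evFree_genX, hp, hm, (relation_check' i j).1, if_neg h]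
  | cartan i j =>
    rw [evFree_mul, evFree_genH, evFree_genH, (relation_check' i j).2.1]
  | plus i j =>
    rw [map_sub, map_zsmul, evFree_mul, evFree_genX, evFree_genH, hp, (relation_check' i j).2.2.1,
      Int.cast_smul_eq_zsmul, sub_self]
  | minus i j =>
    rw [map_add, map_zsmul, evFree_mul, evFree_genX, evFree_genH, hm, (relation_check' i j).2.2.2,
      Int.cast_smul_eq_zsmul, neg_add_cancel]

theorem relIdeal_le_ker : relIdeal agMatrix agParity ≤ LinearMap.ker evFree :=
  sInf_le ⟨isIdeal_ker_evFree, fun _ hx => hx.evFree⟩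

theorem mem_span_basElt_iff {K : Type*} [Field K] {f : DPAlg K} :
    f ∈ Submodule.span K (Set.range fun k : Fin 31 => basElt K k) ↔
      ∃ c : Fin 31 → K, f = ∑ k, c k • basElt K k := by
  rw [Submodule.mem_span_range_iff_exists_fun]
  exact exists_congr fun c => eq_comm

theorem contactBr_mem_span_basElt {K : Type*} [Field K] (h2 : (2 : K) ≠ 0) {f g : DPAlg K}
    (hf : f ∈ Submodule.span K (Set.range fun k : Fin 31 => basElt K k))
    (hg : g ∈ Submodule.span K (Set.range fun k : Fin 31 => basElt K k)) :
    contactBr K f g ∈ Submodule.span K (Set.range fun k : Fin 31 => basElt K k) := by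
  induction hf, hg using Submodule.span_induction₂ with
  | mem_mem x y hx hy =>
    obtain ⟨k, rfl⟩ := hx
    obtain ⟨l, rfl⟩ := hy
    exact mem_span_basElt_iff.2 ⟨_, contactBr_basElt h2 k.2 l.2⟩
  | zero_left => simp
  | zero_right => simp
  | add_left x y z _ _ _ hx hy => rw [map_add, LinearMap.add_apply]; exact add_mem hx hy
  | add_right x y z _ _ _ hx hy => rw [map_add]; exact add_mem hx hy
  | smul_left c x y _ _ h => rw [map_smul, LinearMap.smul_apply]; exact Submodule.smul_mem _ c h
  | smul_right c x y _ _ h => rw [map_smul]; exact Submodule.smul_mem _ c h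

theorem evFree_mem_span (x : FreeAlg 3) :
    evFree x ∈ Submodule.span ℂ (Set.range fun k : Fin 31 => basElt ℂ k) := by
  refine freeAlg_induction x (by simp) (fun x y hx hy => by rw [map_add]; exact add_mem hx hy)
    fun c w => ?_
  rw [map_smul, evFree_word]
  refine Submodule.smul_mem _ c ?_
  induction w with
  | ih1 g => exact Submodule.subset_span ⟨⟨genIdx g, (genIdx_lt g).trans (by norm_num)⟩, rfl⟩
  | ih2 a b ha hb => exact contactBr_mem_span_basElt two_ne_zero ha hb

/-- The `H_i` map to three of the basis elements, which are linearly independent; so a combination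
of the `H_i` in the kernel is zero. -/
theorem ker_evFree_mem : LinearMap.ker evFree ∈
    {J | IsIdeal J ∧ relIdeal agMatrix agParity ≤ J ∧
      J ⊓ (spanH 3 ⊔ relIdeal agMatrix agParity) ≤ relIdeal agMatrix agParity} := by
  refine ⟨isIdeal_ker_evFree, relIdeal_le_ker, ?_⟩
  rintro x ⟨hx, hx'⟩
  obtain ⟨h, hh, r, hr, rfl⟩ := Submodule.mem_sup.1 hx'
  have h0 : evFree h = 0 := by
    rwa [SetLike.mem_coe, LinearMap.mem_ker, map_add, LinearMap.mem_ker.1 (relIdeal_le_ker hr),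
      add_zero] at hx
  obtain ⟨c, rfl⟩ := (Submodule.mem_span_range_iff_exists_fun ℂ).1 hh
  rw [map_sum] at h0
  have hinj : Function.Injective fun i : Fin 3 =>
      (⟨cartanList.getD i 0, by fin_cases i <;> simp [cartanList]⟩ : Fin 31) := by
    intro i j h
    revert i j; decide
  have hc := Fintype.linearIndependent_iff.1
    ((linearIndependent_basElt (K := ℂ) two_ne_zero).comp _ hinj) c (by
      rw [← h0]
      exact Finset.sum_congr rfl fun i _ => by
        rw [map_smul, evFree_genH]; rfl)
  rw [Finset.sum_eq_zero fun i _ => by rw [hc i, zero_smul], zero_add]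
  exact hr

theorem agMatrix_mulVec_eq_zero (μ : Fin 3 → ℤ) (h : agMatrix.mulVec μ = 0) : μ = 0 := by
  have h0 := congrFun h 0
  have h1 := congrFun h 1
  have h2 := congrFun h 2
  simp [agMatrix, Matrix.mulVec, dotProduct, Fin.sum_univ_three] at h0 h1 h2
  funext i
  fin_cases i <;> simp <;> omega

theorem pivotFun_cartan {c : ℕ} (hc : c ∈ cartanList) (i : Fin 3) {f : DPAlg ℂ}
    (hf : f ∈ Submodule.span ℂ (Set.range fun k : Fin 31 => basElt ℂ k)) :
    pivotFun ℂ c (contactBr ℂ (basElt ℂ (cartanList.getD i 0)) f) = 0 := by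
  have hi : cartanList.getD i 0 ∈ cartanList := by fin_cases i <;> simp [cartanList]
  induction hf using Submodule.span_induction with
  | mem x hx =>
    obtain ⟨k, rfl⟩ := hx
    change pivotFun ℂ c (contactBr ℂ (eval ℂ (bas _)) (eval ℂ (bas k))) = 0
    rw [← eval_br two_ne_zero, pivotFun_eval, of_decide_eq_true (all_range
      (List.all_eq_true.1 (List.all_eq_true.1 cartan_check _ hi) _ hc) k.2), Int.cast_zero]
  | zero => simp
  | add x y _ _ hx hy => rw [map_add, map_add, hx, hy, add_zero]
  | smul a x _ hx => rw [map_smul, map_smul, hx, smul_zero]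

/-- A monomial of nonzero weight is an eigenvector of some `ad H_i` with nonzero eigenvalue, hence a
multiple of an element in the image of `ad H_i`. -/
theorem pivotFun_evWord {c : ℕ} (hc : c ∈ cartanList) {w : FreeMagma (Fin 3 × Bool)}
    (hw : wordWt w ≠ 0) : pivotFun ℂ c (evWord w) = 0 := by
  obtain ⟨i, hi⟩ : ∃ i, agMatrix.mulVec (wordWt w) i ≠ 0 := by
    by_contra! h
    exact hw (agMatrix_mulVec_eq_zero _ (funext h))
  have h := LinearMap.mem_ker.1
    (relIdeal_le_ker (genH_mul_word (A := agMatrix) (π := agParity) i w))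
  rw [map_sub, map_zsmul, evFree_mul, evFree_genH, evFree_word, sub_eq_zero] at h
  have := pivotFun_cartan hc i (evFree_mem_span (word w))
  rw [evFree_word, h, map_zsmul, ← Int.cast_smul_eq_zsmul ℂ, smul_eq_mul] at this
  exact (mul_eq_zero.1 this).resolve_left (Int.cast_ne_zero.2 hi)

/-- The Cartan functionals ignore all nonzero weights, and the weight zero part of an element of `J`
maps to zero by `zeroProj_mem`. -/
theorem pivotFun_ideal {c : ℕ} (hc : c ∈ cartanList) {J : Submodule ℂ (FreeAlg 3)}
    (hJ : J ∈ {J | IsIdeal J ∧ relIdeal agMatrix agParity ≤ J ∧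
      J ⊓ (spanH 3 ⊔ relIdeal agMatrix agParity) ≤ relIdeal agMatrix agParity}) {x : FreeAlg 3}
    (hx : x ∈ J) : pivotFun ℂ c (evFree x) = 0 := by
  have h0 := relIdeal_le_ker (zeroProj_mem agMatrix_mulVec_eq_zero hJ.1 hJ.2.1 hJ.2.2 hx)
  rw [LinearMap.mem_ker, zeroProj, Finsupp.sum, map_sum] at h0
  conv_lhs => rw [freeAlg_eq_sum x, Finsupp.sum, map_sum, map_sum]
  rw [← map_zero (pivotFun ℂ c), ← h0, map_sum]
  refine Finset.sum_congr rfl fun w _ => ?_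
  split_ifs with h
  · rfl
  · rw [map_smul, evFree_word, map_smul, pivotFun_evWord hc h, smul_zero, map_zero, map_zero]

theorem proj_surjective (x : CartanAlg agMatrix agParity) : ∃ y, proj agMatrix agParity y = x :=
  Submodule.mkQ_surjective _ x

theorem cartanDeg_br {k l : ℤ} {x y : CartanAlg agMatrix agParity}
    (hx : x ∈ cartanDeg agMatrix agParity agR k) (hy : y ∈ cartanDeg agMatrix agParity agR l) :
    cartanBr agMatrix agParity x y ∈ cartanDeg agMatrix agParity agR (k + l) := by
  induction hx, hy using Submodule.span_induction₂ with
  | mem_mem x y hx hy =>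
    obtain ⟨v, rfl, rfl⟩ := hx
    obtain ⟨w, rfl, rfl⟩ := hy
    rw [cartanBr_proj, word_mul_word]
    exact Submodule.subset_span ⟨v * w, rfl, rfl⟩
  | zero_left => simp
  | zero_right => simp
  | add_left x y z _ _ _ hx hy => rw [map_add, LinearMap.add_apply]; exact add_mem hx hy
  | add_right x y z _ _ _ hx hy => rw [map_add]; exact add_mem hx hy
  | smul_left c x y _ _ h => rw [map_smul, LinearMap.smul_apply]; exact Submodule.smul_mem _ c h
  | smul_right c x y _ _ h => rw [map_smul]; exact Submodule.smul_mem _ c h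

theorem cartanDeg_pow {k l : ℤ} {x y : CartanAlg agMatrix agParity}
    (hx : x ∈ cartanDeg agMatrix agParity agR k) (hy : y ∈ cartanDeg agMatrix agParity agR l)
    (m : ℕ) : ((cartanBr agMatrix agParity x) ^ m) y ∈
      cartanDeg agMatrix agParity agR (m * k + l) := by
  induction m with
  | zero => simpa using hy
  | succ m ih =>
    rw [pow_succ', Module.End.mul_apply, show ((m + 1 : ℕ) : ℤ) * k + l = k + (m * k + l) by
      push_cast; ring]
    exact cartanDeg_br hx ih

theorem exists_proj_pow (x y : FreeAlg 3) (m : ℕ) : ∃ z : FreeAlg 3,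
    proj agMatrix agParity z =
      ((cartanBr agMatrix agParity (proj agMatrix agParity x)) ^ m) (proj agMatrix agParity y) ∧
    evFree z = ((contactBr ℂ (evFree x)) ^ m) (evFree y) := by
  induction m with
  | zero => exact ⟨y, rfl, rfl⟩
  | succ m ih =>
    obtain ⟨z, h1, h2⟩ := ih
    refine ⟨x * z, ?_, ?_⟩
    · rw [pow_succ', Module.End.mul_apply, ← h1, cartanBr_proj]
    · rw [pow_succ', Module.End.mul_apply, ← h2, evFree_mul]

/-- The basis elements come from the `ℤ`-form. -/
theorem exists_zForm_preimage (k : ℕ) (hk : k < 31) : ∃ x : FreeAlg 3,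
    evFree x = basElt ℂ k ∧ proj agMatrix agParity x ∈ zForm agMatrix agParity ∧
      proj agMatrix agParity x ∈ cartanDeg agMatrix agParity agR (basDeg k) := by
  have gen : ∀ k, k < 6 → ∃ g, genIdx g = k := fun k hk => by
    refine ⟨(⟨k / 2, by omega⟩, decide (k % 2 = 0)), ?_⟩
    rw [genIdx]
    by_cases h : k % 2 = 0
    · simp [h]; omega
    · simp [h]; omega
  have genDeg : ∀ g : Fin 3 × Bool, proj agMatrix agParity (genX g.1 g.2) ∈
      cartanDeg agMatrix agParity agR (basDeg (genIdx g)) := fun g =>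
    Submodule.subset_span ⟨FreeMagma.of g, (basDeg_genIdx g).symm, rfl⟩
  induction k using Nat.strong_induction_on with
  | _ k ih =>
    rcases lt_or_ge k 6 with h6 | h6
    · obtain ⟨g, rfl⟩ := gen k h6
      exact ⟨genX g.1 g.2, evFree_genX _ _, (isAdmissible_zForm _ _).gen _ _, genDeg g⟩
    · obtain ⟨j, rfl⟩ := Nat.exists_eq_add_of_le' h6
      have hj : j < 25 := by omega
      have h := all_range step_check hj
      have hd := of_decide_eq_true (all_range step_degree_check hj)
      simp only [Bool.and_eq_true, decide_eq_true_eq] at h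
      generalize stepList.getD j (0, 0, 0) = s at h hd
      obtain ⟨⟨hg, hl⟩, hs⟩ := h
      obtain ⟨g, hg⟩ := gen _ hg
      obtain ⟨y, hy1, hy2, hy3⟩ := ih s.2.2 hl (by omega)
      obtain ⟨z, hz1, hz2⟩ := exists_proj_pow (genX g.1 g.2) y s.2.1
      have hs := eval_eq_zero (K := ℂ) (n := 0) Nat.cast_zero hs
      have hm : (s.2.1.factorial : ℂ) ≠ 0 := Nat.cast_ne_zero.2 (Nat.factorial_ne_zero _)
      rw [eval_append, eval_adPow two_ne_zero, eval_smul] at hs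
      refine ⟨(s.2.1.factorial : ℂ)⁻¹ • z, ?_, ?_, ?_⟩
      · rw [map_smul, hz2, evFree_genX, hy1, hg, basElt, basElt, eq_neg_of_add_eq_zero_left hs,
          Int.cast_neg, neg_smul, neg_neg, Int.cast_natCast, smul_smul, inv_mul_cancel₀ hm,
          one_smul, basElt]
      · rw [map_smul, hz1]
        exact (isAdmissible_zForm _ _).divPow g.1 g.2 s.2.1 _ hy2
      · rw [map_smul, hz1, ← hd]
        refine Submodule.smul_mem _ _ (cartanDeg_pow ?_ hy3 _)
        rw [← hg]
        exact genDeg g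

/-- Coordinates of the image of `x ∈ J` are read off inside `J`: a Cartan coordinate directly, any
other one after multiplying `x` by a preimage of the element of opposite weight. In both cases
`pivotFun_ideal` makes the coordinate vanish. -/
theorem ideal_le_ker {J : Submodule ℂ (FreeAlg 3)}
    (hJ : J ∈ {J | IsIdeal J ∧ relIdeal agMatrix agParity ≤ J ∧
      J ⊓ (spanH 3 ⊔ relIdeal agMatrix agParity) ≤ relIdeal agMatrix agParity}) :
    J ≤ LinearMap.ker evFree := by
  intro x hx
  obtain ⟨c, hc⟩ := mem_span_basElt_iff.1 (evFree_mem_span x)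
  suffices h : ∀ k, c k = 0 by
    rw [LinearMap.mem_ker, hc]
    exact Finset.sum_eq_zero fun k _ => by rw [h, zero_smul]
  intro k
  obtain ⟨i, hi, h⟩ := List.any_eq_true.1 (all_range opposite_check k.2)
  simp only [Bool.or_eq_true, decide_eq_true_eq, Bool.and_eq_true] at h
  rcases h with h | ⟨ho, h⟩
  · have := pivotFun_ideal hi hJ hx
    rw [hc, h, pivotFun_sum] at this
    exact (mul_eq_zero.1 this).resolve_right (pivotDen_ne_zero two_ne_zero k.2)
  · obtain ⟨y, hy, -⟩ := exists_zForm_preimage _ ho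
    have := pivotFun_ideal hi hJ (hJ.1 y x hx).1
    have hl : ∀ l : Fin 31, pivotFun ℂ i (contactBr ℂ (basElt ℂ (oppositeList.getD k 0))
        (basElt ℂ l)) = 0 ↔ (k : ℕ) ≠ l := fun l => by
      rw [basElt, basElt, ← eval_br two_ne_zero, pivotFun_eval, Int.cast_eq_zero]
      exact of_decide_eq_true (all_range h l.2)
    rw [evFree_mul, hy, hc, map_sum, map_sum, Finset.sum_eq_single k, map_smul, map_smul,
      smul_eq_mul] at this
    · exact (mul_eq_zero.1 this).resolve_right fun h' => (hl k).1 h' rfl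
    · intro l _ hlk
      rw [map_smul, map_smul, (hl l).2 fun h => hlk (Fin.ext h.symm), smul_zero]
    · simp

/-- Consequently the abstractly defined `𝔤(A)` is realized faithfully on the span of the 31
generating functions, and its dimension and structure constants become visible. -/
theorem ker_evFree : LinearMap.ker evFree = maxIdeal agMatrix agParity :=
  le_antisymm (le_sSup ker_evFree_mem) (sSup_le fun _ hJ => ideal_le_ker hJ)

/-- The realization of `𝔞𝔤(2)` over `ℂ`. -/
def realize : CartanAlg agMatrix agParity →ₗ[ℂ] DPAlg ℂ :=
  (maxIdeal agMatrix agParity).liftQ evFree ker_evFree.ge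

theorem realize_proj (x : FreeAlg 3) : realize (proj agMatrix agParity x) = evFree x :=
  Submodule.liftQ_apply _ _ _

theorem realize_injective : Function.Injective realize := by
  refine LinearMap.ker_eq_bot.1 (Submodule.ker_liftQ_eq_bot _ _ _ ker_evFree.le)

theorem realize_br (x y : CartanAlg agMatrix agParity) :
    realize (cartanBr agMatrix agParity x y) = contactBr ℂ (realize x) (realize y) := by
  obtain ⟨x, rfl⟩ := proj_surjective x
  obtain ⟨y, rfl⟩ := proj_surjective y
  rw [cartanBr_proj, realize_proj, realize_proj, realize_proj, evFree_mul]

end SuperLie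
end

noncomputable section

namespace SuperLie

open SuperBracket

/-! ### A basis of the Chevalley form -/

/-- The basis elements in the `ℤ`-form. -/
def zElt (k : Fin 31) : zForm agMatrix agParity :=
  ⟨_, (exists_zForm_preimage k k.2).choose_spec.2.1⟩

theorem realize_zElt (k : Fin 31) : realize (zElt k) = basElt ℂ k := by
  rw [zElt, realize_proj]
  exact (exists_zForm_preimage k k.2).choose_spec.1

theorem zElt_mem_cartanDeg (k : Fin 31) :
    (zElt k : CartanAlg agMatrix agParity) ∈ cartanDeg agMatrix agParity agR (basDeg k) :=
  (exists_zForm_preimage k k.2).choose_spec.2.2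

/-- The lattice spanned by the basis elements. -/
def zSpan : Submodule ℤ (CartanAlg agMatrix agParity) :=
  Submodule.span ℤ (Set.range fun k => (zElt k : CartanAlg agMatrix agParity))

theorem mem_zSpan_of_realize {x : CartanAlg agMatrix agParity} {c : Fin 31 → ℤ}
    (h : realize x = ∑ k, (c k : ℂ) • basElt ℂ k) : x ∈ zSpan := by
  refine (Submodule.mem_span_range_iff_exists_fun ℤ).2 ⟨c, realize_injective ?_⟩
  rw [h, map_sum]
  exact Finset.sum_congr rfl fun k _ => by
    rw [map_zsmul, realize_zElt, Int.cast_smul_eq_zsmul]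

theorem realize_genX (i : Fin 3) (s : Bool) :
    realize (proj agMatrix agParity (genX i s)) = basElt ℂ (genIdx (i, s)) := by
  rw [realize_proj, evFree_genX]

theorem realize_pow (x y : CartanAlg agMatrix agParity) (m : ℕ) :
    realize (((cartanBr agMatrix agParity x) ^ m) y) =
      ((contactBr ℂ (realize x)) ^ m) (realize y) := by
  induction m with
  | zero => rfl
  | succ m ih => rw [pow_succ', Module.End.mul_apply, realize_br, ih, pow_succ', Module.End.mul_apply]

theorem zElt_br_mem (k l : Fin 31) : cartanBr agMatrix agParity (zElt k) (zElt l) ∈ zSpan :=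
  mem_zSpan_of_realize (c := fun m => strCoeff k l m) (by
    rw [realize_br, realize_zElt, realize_zElt, contactBr_basElt two_ne_zero k.2 l.2])

theorem adPow_basElt_eq_zero {K : Type*} [Field K] (h2 : (2 : K) ≠ 0) {g l m : ℕ} (hg : g < 6)
    (hl : l < 31) (hm : 4 ≤ m) : ((contactBr K (basElt K g)) ^ m) (basElt K l) = 0 := by
  obtain ⟨m, rfl⟩ := Nat.exists_eq_add_of_le' hm
  have := eval_eq_zero (K := K) (n := 0) Nat.cast_zero (all_range (all_range adPow_check hg) hl)
  rw [eval_adPow h2] at this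
  rw [pow_add, Module.End.mul_apply, basElt, basElt, this, map_zero]

/-- Only `m = 2` and `m = 3` require a divisibility: `m = 0` and `m = 1` are the identity and the
bracket, and from `m = 4` on the powers vanish. -/
theorem zElt_divPow_mem (i : Fin 3) (s : Bool) (m : ℕ) (l : Fin 31) :
    ((m.factorial : ℂ)⁻¹) • (((cartanBr agMatrix agParity (proj agMatrix agParity (genX i s))) ^ m)
      (zElt l)) ∈ zSpan := by
  have key : ∀ c : Fin 31 → ℤ, ((contactBr ℂ (basElt ℂ (genIdx (i, s)))) ^ m) (basElt ℂ l) =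
      (m.factorial : ℂ) • ∑ k, (c k : ℂ) • basElt ℂ k →
      ((m.factorial : ℂ)⁻¹) • (((cartanBr agMatrix agParity
        (proj agMatrix agParity (genX i s))) ^ m) (zElt l)) ∈ zSpan := fun c hc => by
    refine mem_zSpan_of_realize (c := c) ?_
    rw [map_smul, realize_pow, realize_genX, realize_zElt, hc, smul_smul,
      inv_mul_cancel₀ (Nat.cast_ne_zero.2 (Nat.factorial_ne_zero _)), one_smul]
  have hg := genIdx_lt (i, s)
  rcases lt_or_ge m 4 with hm | hm
  · interval_cases m
    · rw [Nat.factorial_zero, Nat.cast_one, inv_one, one_smul, pow_zero, Module.End.one_apply]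
      exact Submodule.subset_span (Set.mem_range_self l)
    · refine key (fun m => strCoeff (genIdx (i, s)) l m) ?_
      rw [pow_one, contactBr_basElt two_ne_zero (hg.trans (by norm_num)) l.2]
      simp
    all_goals
      have h := all_range (all_range divPow_check hg) l.2
      simp only [List.all_cons, List.all_nil, Bool.and_true, Bool.and_eq_true] at h
    · have h := eval_eq_zero (K := ℂ) (n := 0) Nat.cast_zero h.1
      rw [eval_remainder, eval_adPow two_ne_zero, sub_eq_zero, Int.cast_natCast] at h
      exact key _ h
    · have h := eval_eq_zero (K := ℂ) (n := 0) Nat.cast_zero h.2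
      rw [eval_remainder, eval_adPow two_ne_zero, sub_eq_zero, Int.cast_natCast] at h
      exact key _ h
  · refine key 0 ?_
    rw [adPow_basElt_eq_zero two_ne_zero hg l.2 hm]
    simp

theorem isAdmissible_zSpan : IsAdmissible agMatrix agParity zSpan where
  gen i s := by
    have hg : genIdx (i, s) < 31 := (genIdx_lt (i, s)).trans (by norm_num)
    refine mem_zSpan_of_realize (c := Pi.single ⟨_, hg⟩ 1) ?_
    rw [realize_genX, Finset.sum_eq_single ⟨genIdx (i, s), hg⟩]
    · simp
    · intro k _ hk; simp [Pi.single_eq_of_ne hk]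
    · simp
  br x hx y hy := by
    induction hx, hy using Submodule.span_induction₂ with
    | mem_mem x y hx hy =>
      obtain ⟨k, rfl⟩ := hx
      obtain ⟨l, rfl⟩ := hy
      exact zElt_br_mem k l
    | zero_left => simp
    | zero_right => simp
    | add_left x y z _ _ _ hx hy => rw [map_add, LinearMap.add_apply]; exact add_mem hx hy
    | add_right x y z _ _ _ hx hy => rw [map_add]; exact add_mem hx hy
    | smul_left c x y _ _ h => rw [map_zsmul, LinearMap.smul_apply]; exact zsmul_mem h c
    | smul_right c x y _ _ h => rw [map_zsmul]; exact zsmul_mem h c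
  divPow i s m x hx := by
    induction hx using Submodule.span_induction with
    | mem x hx => obtain ⟨l, rfl⟩ := hx; exact zElt_divPow_mem i s m l
    | zero => simp
    | add x y _ _ hx hy => rw [map_add, smul_add]; exact add_mem hx hy
    | smul c x _ h => rw [map_zsmul, smul_comm]; exact zsmul_mem h c

/-- The `zElt` lie in the `ℤ`-form by construction, so this inclusion makes them a basis of it. -/
theorem zForm_le_zSpan : zForm agMatrix agParity ≤ zSpan := sInf_le isAdmissible_zSpan

theorem linearIndependent_zElt : LinearIndependent ℤ zElt := by
  refine Fintype.linearIndependent_iff.2 fun c hc k => ?_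
  have h := congrArg (fun x : zForm agMatrix agParity => realize (x : CartanAlg agMatrix agParity)) hc
  simp only [Submodule.coe_sum, Submodule.coe_smul, map_sum, map_zsmul, realize_zElt,
    Submodule.coe_zero, map_zero] at h
  simp only [← Int.cast_smul_eq_zsmul ℂ] at h
  exact Int.cast_eq_zero.1
    (Fintype.linearIndependent_iff.1 (linearIndependent_basElt (K := ℂ) two_ne_zero) _ h k)

/-- The basis of the `ℤ`-form. -/
def zBasis : Module.Basis (Fin 31) ℤ (zForm agMatrix agParity) :=
  Module.Basis.mk linearIndependent_zElt fun x _ => by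
    obtain ⟨c, hc⟩ := (Submodule.mem_span_range_iff_exists_fun ℤ).1 (zForm_le_zSpan x.2)
    refine (Submodule.mem_span_range_iff_exists_fun ℤ).2 ⟨c, Subtype.ext ?_⟩
    rw [← hc]; simp

theorem zBasis_apply (k : Fin 31) : zBasis k = zElt k := by simp [zBasis]

theorem constr_injective {K M N ι : Type*} [Field K] [AddCommGroup M] [Module K M]
    [AddCommGroup N] [Module K N] [Fintype ι] (b : Module.Basis ι K M) {v : ι → N}
    (hv : LinearIndependent K v) : Function.Injective (b.constr K v) := by
  refine LinearMap.ker_eq_bot.1 (LinearMap.ker_eq_bot'.2 fun x hx => ?_)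
  rw [b.constr_apply_fintype K] at hx
  have := Fintype.linearIndependent_iff.1 hv _ hx
  rw [← b.sum_repr x]
  exact Finset.sum_eq_zero fun k _ => by
    rw [← b.equivFun_apply, this k, zero_smul]

/-! ### Base change to `K` and the embedding. -/

section Embedding

variable (K : Type*) [Field K]

/-- The basis of `𝔞𝔤(2)` over `K`. -/
def agBasis : Module.Basis (Fin 31) K (AG2 K) := Algebra.TensorProduct.basis K zBasis

variable {K}

theorem agBasis_apply (k : Fin 31) : agBasis K k = 1 ⊗ₜ[ℤ] zElt k := by
  rw [agBasis, Algebra.TensorProduct.basis_apply, zBasis_apply]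

theorem zBr_zElt (k l : Fin 31) :
    zBr agMatrix agParity (zElt k) (zElt l) = ∑ m : Fin 31, strCoeff k l m • zElt m := by
  refine Subtype.ext (realize_injective ?_)
  change realize (cartanBr agMatrix agParity (zElt k) (zElt l)) = _
  rw [realize_br, realize_zElt, realize_zElt, contactBr_basElt two_ne_zero k.2 l.2,
    Submodule.coe_sum, map_sum]
  exact Finset.sum_congr rfl fun m _ => by
    rw [Submodule.coe_smul, map_zsmul, realize_zElt, Int.cast_smul_eq_zsmul]

theorem one_tmul_sum (c : Fin 31 → ℤ) :
    (1 : K) ⊗ₜ[ℤ] (∑ m, c m • zElt m) = ∑ m, (c m : K) • agBasis K m := by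
  rw [TensorProduct.tmul_sum]
  refine Finset.sum_congr rfl fun m _ => ?_
  rw [agBasis_apply, TensorProduct.tmul_smul, Int.cast_smul_eq_zsmul]

theorem agBr_agBasis (k l : Fin 31) :
    br (R := K) (agBasis K k) (agBasis K l) = ∑ m : Fin 31, (strCoeff k l m : K) • agBasis K m := by
  rw [agBasis_apply, agBasis_apply, ← one_tmul_sum, ← zBr_zElt]
  change LinearMap.BilinMap.baseChange K (zBr agMatrix agParity) _ _ = _
  rw [LinearMap.BilinMap.baseChange_tmul, mul_one]

variable (K) in
/-- The embedding of `𝔞𝔤(2)` into the contact superalgebra. -/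
def agEmb : AG2 K →ₗ[K] DPAlg K := (agBasis K).constr K fun k => basElt K k

theorem agEmb_agBasis (k : Fin 31) : agEmb K (agBasis K k) = basElt K k :=
  (agBasis K).constr_basis K _ k

theorem agEmb_injective (h2 : (2 : K) ≠ 0) : Function.Injective (agEmb K) :=
  constr_injective (agBasis K) (linearIndependent_basElt h2)

theorem agEmb_br (h2 : (2 : K) ≠ 0) (x y : AG2 K) :
    agEmb K (br (R := K) x y) = contactBr K (agEmb K x) (agEmb K y) := by
  have : (br (R := K) : AG2 K →ₗ[K] AG2 K →ₗ[K] AG2 K).compr₂ (agEmb K) =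
      (contactBr K).compl₁₂ (agEmb K) (agEmb K) := by
    refine (agBasis K).ext fun k => (agBasis K).ext fun l => ?_
    rw [LinearMap.compr₂_apply, LinearMap.compl₁₂_apply, agEmb_agBasis, agEmb_agBasis,
      contactBr_basElt h2 k.2 l.2, agBr_agBasis, map_sum]
    exact Finset.sum_congr rfl fun m _ => by rw [map_smul, agEmb_agBasis]
  exact LinearMap.congr_fun₂ this x y

theorem basElt_mem_par {k : ℕ} (hk : k < 31) :
    basElt K k ∈ (par (R := K) ((basDeg k : ℤ) : ZMod 2) : Submodule K (DPAlg K)) :=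
  par_of_contactDeg (basElt_mem_contactDeg hk)

theorem pivot_degree {k : ℕ} (hk : k < 31) {q : ℤ × ℕ × ℕ} (hq : q ∈ pivot k) :
    2 * (q.2.1 : ℤ) + (bits q.2.2).card - 2 = basDeg k := by
  have := of_decide_eq_true (List.all_eq_true.1 (all_range pivot_degree_check hk) q hq)
  rwa [card_bits]

theorem pivotFun_of_contactDeg {k : ℕ} (hk : k < 31) {d : ℤ} (hd : basDeg k ≠ d) {f : DPAlg K}
    (hf : f ∈ contactDeg K d) : pivotFun K k f = 0 :=
  pivotFun_eq_zero hf fun _ hq h => hd ((pivot_degree hk hq).symm.trans h)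

theorem pivotFun_of_par {k : ℕ} (hk : k < 31) {i : ZMod 2} (hd : ((basDeg k : ℤ) : ZMod 2) ≠ i)
    {f : DPAlg K} (hf : f ∈ (par (R := K) i : Submodule K (DPAlg K))) : pivotFun K k f = 0 := by
  refine pivotFun_eq_zero hf fun q hq h => hd ?_
  rw [← pivot_degree hk hq]
  push_cast
  rw [show (2 : ZMod 2) = 0 from rfl, zero_mul, zero_add, sub_zero]
  exact h

theorem realize_mem_contactDeg {d : ℤ} {x : CartanAlg agMatrix agParity}
    (hx : x ∈ cartanDeg agMatrix agParity agR d) : realize x ∈ contactDeg ℂ d := by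
  induction hx using Submodule.span_induction with
  | mem x hx =>
    obtain ⟨w, rfl, rfl⟩ := hx
    rw [realize_proj, evFree_word]
    exact evWord_mem_contactDeg w
  | zero => simp
  | add x y _ _ hx hy => rw [map_add]; exact add_mem hx hy
  | smul c x _ h => rw [map_smul]; exact Submodule.smul_mem _ c h

theorem realize_mem_par {i : ZMod 2} {x : CartanAlg agMatrix agParity}
    (hx : x ∈ (par (R := ℂ) i : Submodule ℂ (CartanAlg agMatrix agParity))) :
    realize x ∈ (par (R := ℂ) i : Submodule ℂ (DPAlg ℂ)) := by
  induction hx using Submodule.span_induction with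
  | mem x hx =>
    obtain ⟨w, rfl, rfl⟩ := hx
    rw [realize_proj, evFree_word]
    exact evWord_mem_par w
  | zero => simp
  | add x y _ _ hx hy => rw [map_add]; exact add_mem hx hy
  | smul c x _ h => rw [map_smul]; exact Submodule.smul_mem _ c h

/-- Degree and parity are defined over `ℂ`, while the conclusion is over `K`. The link is that
coordinates in the lattice are integers: one that vanishes over `ℂ` is zero already before it is
reduced to `K`. -/
theorem tmul_mem_span (x : zForm agMatrix agParity) (s : Set (Fin 31))
    (h : ∀ k ∉ s, pivotFun ℂ k (realize x) = 0) :
    (1 : K) ⊗ₜ[ℤ] x ∈ Submodule.span K (agBasis K '' s) := by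
  have hx := zBasis.sum_repr x
  simp only [zBasis_apply] at hx
  have hr : realize x = ∑ k, ((zBasis.repr x k : ℤ) : ℂ) • basElt ℂ k := by
    conv_lhs => rw [← hx]
    rw [Submodule.coe_sum, map_sum]
    exact Finset.sum_congr rfl fun k _ => by
      rw [Submodule.coe_smul, map_zsmul, realize_zElt, Int.cast_smul_eq_zsmul]
  rw [← hx, one_tmul_sum]
  refine sum_mem fun k _ => ?_
  by_cases hk : k ∈ s
  · exact Submodule.smul_mem _ _ (Submodule.subset_span ⟨k, hk, rfl⟩)
  · have := h k hk
    rw [hr, pivotFun_sum] at this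
    rw [Int.cast_eq_zero.1
      ((mul_eq_zero.1 this).resolve_right (pivotDen_ne_zero two_ne_zero k.2)), Int.cast_zero,
      zero_smul]
    exact zero_mem _

theorem agDeg_eq_span (d : ℤ) :
    agDeg K d = Submodule.span K (agBasis K '' {k | basDeg k = d}) := by
  refine le_antisymm (Submodule.span_le.2 ?_) (Submodule.span_le.2 ?_)
  · rintro _ ⟨x, hx, rfl⟩
    exact tmul_mem_span x _ fun k hk => pivotFun_of_contactDeg k.2 hk (realize_mem_contactDeg hx)
  · rintro _ ⟨k, rfl, rfl⟩
    exact Submodule.subset_span ⟨_, zElt_mem_cartanDeg k, agBasis_apply k⟩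

theorem agPar_le_span (i : ZMod 2) : (par (R := K) i : Submodule K (AG2 K)) ≤
    Submodule.span K (agBasis K '' {k | ((basDeg k : ℤ) : ZMod 2) = i}) := by
  refine Submodule.span_le.2 ?_
  rintro _ ⟨x, hx, rfl⟩
  exact tmul_mem_span x _ fun k hk => pivotFun_of_par k.2 hk (realize_mem_par hx)

/-- The span of the basis elements with the indices in a set. -/
def basSpan (K : Type*) [Field K] (s : Set (Fin 31)) : Submodule K (DPAlg K) :=
  Submodule.span K ((fun k : Fin 31 => basElt K k) '' s)

theorem map_span_agBasis (s : Set (Fin 31)) :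
    (Submodule.span K (agBasis K '' s)).map (agEmb K) = basSpan K s := by
  rw [Submodule.map_span, ← Set.image_comp, basSpan]
  congr 1
  exact Set.image_congr fun k _ => agEmb_agBasis k

theorem gPart_agEmb (d : ℤ) : gPart (agEmb K) d = basSpan K {k | basDeg k = d} := by
  rw [gPart, agDeg_eq_span, map_span_agBasis]

theorem range_agEmb : LinearMap.range (agEmb K) = basSpan K Set.univ := by
  rw [LinearMap.range_eq_map, ← (agBasis K).span_eq, ← Set.image_univ, map_span_agBasis]

theorem basSpan_le_contactDeg (d : ℤ) : basSpan K {k | basDeg k = d} ≤ contactDeg K d := by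
  refine Submodule.span_le.2 ?_
  rintro _ ⟨k, rfl, rfl⟩
  exact basElt_mem_contactDeg k.2

theorem theta_mem_basSpan (h2 : (2 : K) ≠ 0) (i : Fin 7) :
    mono K 0 {i} ∈ basSpan K {k | basDeg k = -1} := by
  obtain ⟨k, hk, c, hc, hb⟩ : ∃ k : Fin 31, basDeg k = -1 ∧ ∃ c : ℤ, (c = 1 ∨ c = -1) ∧
      bas k = [(0, 2 ^ (i : ℕ), c)] := by
    have h : ∀ i : Fin 7, ∃ k : Fin 31, basDeg k = -1 ∧ ∃ c ∈ [(1 : ℤ), -1],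
        bas k = [(0, 2 ^ (i : ℕ), c)] := by decide +kernel
    simpa using h i
  have hm : basElt K k ∈ basSpan K {k | basDeg k = -1} := Submodule.subset_span ⟨k, hk, rfl⟩
  rw [basElt, hb, eval_cons, eval_nil, add_zero, termValue, bits_two_pow] at hm
  refine (Submodule.smul_mem_iff _ (mul_ne_zero ?_ ?_)).1 hm
  · rcases hc with rfl | rfl <;> simp
  · rw [uFactor]; split_ifs
    · exact h2
    · exact one_ne_zero

theorem one_mem_basSpan : mono K 0 ∅ ∈ basSpan K {k | basDeg k = -2} := by
  have : basElt K 30 ∈ basSpan K {k | basDeg k = -2} :=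
    Submodule.subset_span ⟨30, by decide +kernel, rfl⟩
  rw [basElt, show bas 30 = [(0, 0, 1)] from rfl, eval_cons, eval_nil, add_zero, termValue,
    bits_zero] at this
  simpa [uFactor] using this

theorem basSpan_neg (h2 : (2 : K) ≠ 0) {d : ℤ} (hd : d < 0) :
    basSpan K {k | basDeg k = d} = contactDeg K d := by
  refine le_antisymm (basSpan_le_contactDeg d) fun f hf => ?_
  rcases lt_or_ge d (-2) with h3 | h3
  · rw [contactDeg_eq_bot h3, Submodule.mem_bot] at hf
    rw [hf]; exact zero_mem _
  obtain rfl | rfl : d = -1 ∨ d = -2 := by omega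
  · exact contactDeg_neg_one_induction hf (zero_mem _) (fun _ _ h h' => add_mem h h')
      fun x i => Submodule.smul_mem _ x (theta_mem_basSpan h2 i)
  · obtain ⟨x, rfl⟩ := contactDeg_neg_two hf
    exact Submodule.smul_mem _ x one_mem_basSpan

theorem isContactEmbedding_agEmb (h2 : (2 : K) ≠ 0) : IsContactEmbedding (agEmb K) where
  inj := agEmb_injective h2
  map_br := agEmb_br h2
  map_par i := by
    refine (Submodule.map_mono (agPar_le_span i)).trans ?_
    rw [map_span_agBasis, basSpan, Submodule.span_le]
    rintro _ ⟨k, rfl, rfl⟩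
    exact basElt_mem_par k.2
  map_deg d := by
    have := gPart_agEmb (K := K) d
    rw [gPart] at this
    rw [this]
    exact basSpan_le_contactDeg d
  map_neg d hd := by
    have := gPart_agEmb (K := K) d
    rw [gPart] at this
    rw [this, basSpan_neg h2 hd]

theorem basList_exponent_check : ((List.range 31).all fun k => (bas k).all fun e =>
    decide (e.1 < 3)) = true := by decide +kernel

theorem eval_mem_contactAlg {z : Code} {p N : ℕ} (h : p = 0 ∨ ∀ e ∈ z, e.1 < p ^ N) :
    eval K z ∈ contactAlg K p N := by
  induction z with
  | nil => simp
  | cons e z ih =>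
    rw [eval_cons]
    refine add_mem (Submodule.smul_mem _ _ (mono_mem_supported ?_))
      (ih (h.imp_right fun h e' he' => h e' (List.mem_cons_of_mem _ he')))
    exact h.imp_right fun h => h e List.mem_cons_self

/-- No power of `t` above `t^(2)` occurs in the basis, so `p ≥ 3` suffices already for `N = 1`. -/
theorem range_agEmb_le (p N : ℕ) (hp : p = 0 ∨ 3 ≤ p) (hN : 1 ≤ N) :
    LinearMap.range (agEmb K) ≤ contactAlg K p N := by
  rw [range_agEmb, basSpan, Submodule.span_le]
  rintro _ ⟨k, -, rfl⟩
  refine eval_mem_contactAlg (hp.imp_right fun h e he => ?_)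
  have h3 := of_decide_eq_true (List.all_eq_true.1 (all_range basList_exponent_check k.2) e he)
  calc e.1 < 3 := h3
    _ ≤ p := h
    _ = p ^ 1 := (pow_one p).symm
    _ ≤ p ^ N := Nat.pow_le_pow_right (by omega) hN

end Embedding

end SuperLie
end

noncomputable section

namespace SuperLie

/-! ### Linear systems for the coefficients -/

namespace Code

/-- A code as a linear functional, composed with a multiple of the operator `dOp`. -/
def funcD (i : ℕ) (z : Code) : Code := z.flatMap fun e =>
  (if e.2.1.testBit i then [(e.1 + 1, e.2.1 ^^^ 2 ^ i,
    sgn (inversions (2 ^ i) (e.2.1 ^^^ 2 ^ i)) ((if i = 6 then 2 else 1) * e.2.2))] else []) ++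
  (if e.2.1.testBit (dualN i) then [] else [(e.1, e.2.1 ||| 2 ^ dualN i,
    sgn (inversions (2 ^ dualN i) e.2.1) ((if i = 6 then -1 else 1) * e.2.2))])

/-- Delete the coordinates that are known to vanish. -/
def reduceKnown (known : List (ℕ × ℕ)) (z : Code) : Code :=
  (norm z).filter fun e => e.2.2 ≠ 0 && !known.contains (e.1, e.2.1)

/-- Equations with only one coordinate left show that it vanishes. -/
def propagate (n : ℤ) (eqs : List Code) (known : List (ℕ × ℕ)) : List (ℕ × ℕ) :=
  eqs.foldl (fun known z => match reduceKnown known z with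
    | [e] => if e.2.2 ∣ n then (e.1, e.2.1) :: known else known
    | _ => known) known

end Code

/-- A functional that vanishes on the basis elements. -/
def relFunc (a m : ℕ) : Code := (a, m, 8) :: (List.range 31).flatMap fun k =>
  Code.smul (-(Code.val (bas k) a m * (8 / pivotDen k)))
    ((pivot k).map fun q => (q.2.1, q.2.2, q.1))

/-- The monomials of degree `k ≤ 5`. -/
def monoList (k : ℤ) : List (ℕ × ℕ) := (List.range 4).flatMap fun (a : ℕ) =>
  (List.range 128).filterMap fun (m : ℕ) =>
    if 2 * (a : ℤ) + bitCard m - 2 = k then some (a, m) else none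

/-- The equations that say that `dOp` maps to the span of the basis elements; a triple `(a, m, l)` stands
for the coefficients of `t^(a) Θ_m` and the operators in the list `l`. -/
def prolongEqs (l : List (ℕ × ℕ × List ℕ)) : List Code :=
  l.flatMap fun q => q.2.2.map fun i => Code.funcD i (relFunc q.1 q.2.1)

/-- Equations in degree one. -/
def eqsOne : List (ℕ × ℕ × List ℕ) :=
  [(0, 3, [2, 3, 4, 6]), (0, 5, [1, 3, 5, 6]), (0, 6, [0, 4, 5, 6]), (0, 24, [3, 4, 5, 6]), (0,
   40, [3, 4, 5, 6]), (0, 48, [3, 4, 5, 6]), (0, 3, [0, 1]), (0, 5, [0, 2]), (0, 6, [1, 2])]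

/-- More equations in degree one. -/
def eqsOneRest : List (ℕ × ℕ × List ℕ) :=
  [(0, 3, [5]), (0, 5, [4]), (0, 6, [3]), (0, 24, [2])]

/-- Equations in degree two. -/
def eqsTwo : List (ℕ × ℕ × List ℕ) :=
  [(0, 7, [3, 4, 5, 6]), (0, 11, [0, 6]), (0, 13, [0, 6]), (0, 14, [1, 2, 6]), (0, 19, [1, 6]),
   (0, 21, [2, 6]), (0, 22, [1, 6]), (0, 25, [5]), (0, 28, [6]), (0, 35, [6]), (0, 37, [2, 6]),
   (0, 38, [2, 6]), (0, 41, [4]), (0, 42, [6]), (0, 49, [4, 6]), (0, 56, [0, 1, 2, 6]), (0, 67,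
   [0, 1, 5, 6]), (0, 69, [0, 4, 6]), (0, 70, [3, 6]), (0, 73, [1, 2]), (0, 74, [1]), (0, 76,
   [2]), (0, 82, [2]), (0, 84, [2]), (0, 7, [0, 1, 2]), (0, 11, [1]), (0, 13, [2]), (0, 22, [2]),
   (0, 25, [2]), (0, 26, [2]), (0, 28, [2])]

/-- Equations in degree three. -/
def eqsThree : List (ℕ × ℕ × List ℕ) :=
  [(0, 15, [0, 3, 6]), (0, 23, [1, 6]), (0, 29, [0, 6]), (0, 30, [6]), (0, 39, [2, 6]), (0, 43,
   [0, 6]), (0, 46, [6]), (0, 51, [1, 6]), (0, 53, [6]), (0, 57, [0, 6]), (0, 58, [6]), (0, 60,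
   [6]), (0, 71, [3, 4, 5, 6]), (0, 75, [0, 3, 6]), (0, 77, [0, 3, 6]), (0, 78, [3]), (0, 83, [1,
   6]), (0, 85, [0]), (0, 86, [6]), (0, 89, [0, 6]), (0, 90, [6]), (0, 99, [0, 1]), (0, 101, [6]),
   (0, 102, [6]), (0, 105, [0, 6]), (0, 108, [6]), (0, 113, [0]), (0, 114, [6]), (0, 116, [6]),
   (0, 120, [0, 1, 2]), (1, 9, [6]), (1, 18, [6]), (1, 36, [6]), (0, 15, [1, 2]), (0, 23, [2]),
   (0, 27, [2, 6]), (0, 29, [2]), (0, 30, [2]), (0, 45, [6]), (0, 54, [6])]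

/-! ### Soundness of the elimination, and the prolong outside characteristic three. -/

section Functionals

variable {K : Type*} [Field K]

/-- A code as a linear functional. -/
def funcApply (z : Code) (f : DPAlg K) : K := (z.map fun e => (e.2.2 : K) * f (e.1, bits e.2.1)).sum

@[simp] theorem funcApply_nil (f : DPAlg K) : funcApply [] f = 0 := rfl

@[simp] theorem funcApply_cons (e : ℕ × ℕ × ℤ) (z : Code) (f : DPAlg K) :
    funcApply (e :: z) f = (e.2.2 : K) * f (e.1, bits e.2.1) + funcApply z f := by simp [funcApply]

@[simp] theorem funcApply_append (z w : Code) (f : DPAlg K) :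
    funcApply (z ++ w) f = funcApply z f + funcApply w f := by simp [funcApply]

theorem funcApply_smul (c : ℤ) (z : Code) (f : DPAlg K) :
    funcApply (Code.smul c z) f = c * funcApply z f := by
  induction z with
  | nil => simp [Code.smul]
  | cons e z ih =>
    rw [Code.smul, List.map_cons, funcApply_cons, funcApply_cons, mul_add, ← ih, ← Code.smul]
    push_cast; ring

theorem funcApply_flatMap {α : Type*} (l : List α) (g : α → Code) (f : DPAlg K) :
    funcApply (l.flatMap g) f = (l.map fun x => funcApply (g x) f).sum := by
  induction l with
  | nil => rfl
  | cons e l ih => simp [ih]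

theorem funcApply_insert (e : ℕ × ℕ × ℤ) (z : Code) (f : DPAlg K) :
    funcApply (Code.insert e z) f = (e.2.2 : K) * f (e.1, bits e.2.1) + funcApply z f := by
  induction z with
  | nil => simp [Code.insert]
  | cons e' z ih =>
    rw [Code.insert]
    split_ifs with h
    · rw [funcApply_cons, funcApply_cons, ← h.1, ← h.2]; push_cast; ring
    · rw [funcApply_cons, funcApply_cons, ih]; ring

theorem funcApply_norm (z : Code) (f : DPAlg K) : funcApply (Code.norm z) f = funcApply z f := by
  induction z with
  | nil => rfl
  | cons e z ih => rw [Code.norm, List.foldr_cons, funcApply_insert, funcApply_cons, ← ih]; rfl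

theorem funcApply_reduceKnown {known : List (ℕ × ℕ)} {f : DPAlg K}
    (h : ∀ q ∈ known, f (q.1, bits q.2) = 0) (z : Code) :
    funcApply (Code.reduceKnown known z) f = funcApply z f := by
  rw [Code.reduceKnown, ← funcApply_norm z]
  generalize Code.norm z = w
  induction w with
  | nil => rfl
  | cons e w ih =>
    rw [List.filter_cons]
    split_ifs with h'
    · rw [funcApply_cons, ih, funcApply_cons]
    · rw [ih, funcApply_cons, right_eq_add]
      by_cases h0 : e.2.2 = 0
      · rw [h0]; simp
      · have : (e.1, e.2.1) ∈ known := by simpa [h0] using h'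
        rw [h _ this, mul_zero]

/-- A coefficient that divides `n` is invertible as soon as `n` is nonzero in `K`. With `n = 64` the
elimination therefore uses only the invertibility of 2. -/
theorem propagate_sound {n : ℤ} (hn : (n : K) ≠ 0) {f : DPAlg K} {eqs : List Code}
    (he : ∀ z ∈ eqs, funcApply z f = 0) {known : List (ℕ × ℕ)}
    (h : ∀ q ∈ known, f (q.1, bits q.2) = 0) :
    ∀ q ∈ Code.propagate n eqs known, f (q.1, bits q.2) = 0 := by
  induction eqs generalizing known with
  | nil => exact h
  | cons z eqs ih =>
    rw [Code.propagate, List.foldl_cons]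
    refine ih (fun z hz => he z (List.mem_cons_of_mem _ hz)) ?_
    have hz := he z List.mem_cons_self
    rw [← funcApply_reduceKnown h] at hz
    split
    · rename_i e heq
      rw [heq, funcApply_cons, funcApply_nil, add_zero] at hz
      split_ifs with hd
      · intro q hq
        rcases List.mem_cons.1 hq with rfl | hq
        · refine (mul_eq_zero.1 hz).resolve_left fun h0 => hn ?_
          obtain ⟨c, rfl⟩ := hd
          rw [Int.cast_mul, h0, zero_mul]
        · exact h q hq
      · exact h
    · exact h

/-- The extra factor 2 for the last variable clears the coefficient `½` and keeps the transposed
operator integral. -/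
theorem funcApply_funcD (h2 : (2 : K) ≠ 0) (i : Fin 7) (z : Code) (f : DPAlg K) :
    funcApply (Code.funcD i z) f = (if i = 6 then 2 else 1) * funcApply z (dOp K i f) := by
  induction z with
  | nil => simp [Code.funcD]
  | cons e z ih =>
    rw [Code.funcD, List.flatMap_cons, funcApply_append, ← Code.funcD, ih, funcApply_cons, mul_add]
    congr 1
    have hp : (if i = 6 then (2 : K) else 1) * -poissonCoeff K i = if i = 6 then -1 else 1 := by
      fin_cases i <;> simp [poissonCoeff, h2]
    have h6 : ((i : ℕ) = 6) = (i = 6) := by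
      rw [Fin.ext_iff]; rfl
    rw [dOp_coeff, funcApply_append, dualN_eq]
    simp only [mem_bits, h6]
    rw [mul_sub, mul_sub, sub_eq_add_neg]
    congr 1
    · split_ifs with hi h6
      · rw [funcApply_cons, funcApply_nil, cast_sgn, bits_xor hi, ← bits_two_pow i, ← bits_xor hi,
          shuffleSign_bits, bits_xor hi]
        push_cast; ring
      · rw [funcApply_cons, funcApply_nil, cast_sgn, bits_xor hi, ← bits_two_pow i, ← bits_xor hi,
          shuffleSign_bits, bits_xor hi]
        push_cast; ring
      · simp
      · simp
    · by_cases hi : e.2.1.testBit (dualIdx i) = true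
      · simp [hi]
      · rw [if_neg hi, if_neg hi, funcApply_cons, funcApply_nil, cast_sgn, bits_or, bits_two_pow,
          Finset.union_comm, ← Finset.insert_eq, ← bits_two_pow (dualIdx i), shuffleSign_bits]
        push_cast
        linear_combination (-(-1) ^ inversions (2 ^ (dualIdx i : ℕ)) e.2.1 * (e.2.2 : K) *
          f (e.1, insert (dualIdx i) (bits e.2.1))) * hp

theorem funcApply_pivot (k : ℕ) (f : DPAlg K) :
    funcApply ((pivot k).map fun q => (q.2.1, q.2.2, q.1)) f = pivotFun K k f := by
  rw [pivotFun_apply, funcApply, List.map_map]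
  rfl

/-- `relFunc a m` is eight times a coefficient minus its expansion in the functionals `pivotFun k`;
the factor 8 clears all `pivotDen k`. -/
theorem funcApply_relFunc {f : DPAlg K} (hf : f ∈ basSpan K Set.univ) (a m : ℕ) :
    funcApply (relFunc a m) f = 0 := by
  rw [basSpan, Set.image_univ] at hf
  obtain ⟨c, rfl⟩ := mem_span_basElt_iff.1 hf
  rw [relFunc, funcApply_cons, funcApply_flatMap, sum_map_range]
  simp only [funcApply_smul, funcApply_pivot, pivotFun_sum]
  simp only [Finsupp.coe_finsetSum,
    Finset.sum_apply, Finsupp.smul_apply, basElt, eval_val, smul_eq_mul]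
  rw [Finset.mul_sum, ← Finset.sum_add_distrib]
  refine Finset.sum_eq_zero fun k _ => ?_
  have hd := of_decide_eq_true (all_range pivotDen_check k.2)
  have := congrArg (Int.cast : ℤ → K) (Int.ediv_mul_cancel hd)
  push_cast at this ⊢
  linear_combination (-(c k * (Code.val (bas k) a m : K))) * this

theorem bits_mod (m : ℕ) : bits (m % 128) = bits m := by
  ext i
  rw [mem_bits, mem_bits, show 128 = 2 ^ 7 from rfl, Nat.testBit_mod_two_pow]
  simp [i.2]

theorem exists_bits (S : Finset (Fin 7)) : ∃ m < 128, bits m = S := by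
  induction S using Finset.induction_on with
  | empty => exact ⟨0, by norm_num, bits_zero⟩
  | insert i S _ ih =>
    obtain ⟨m, -, rfl⟩ := ih
    refine ⟨(2 ^ (i : ℕ) ||| m) % 128, Nat.mod_lt _ (by norm_num), ?_⟩
    rw [bits_mod, bits_or, bits_two_pow, Finset.insert_eq]

theorem eq_zero_of_monoList {k : ℤ} (hk : k ≤ 5) {f : DPAlg K} (hf : f ∈ contactDeg K k)
    (h : ∀ q ∈ monoList k, f (q.1, bits q.2) = 0) : f = 0 := by
  ext ⟨a, S⟩
  by_contra hne
  have hd : 2 * (a : ℤ) + (S.card : ℤ) - 2 = k := by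
    by_contra hd
    exact hne ((Finsupp.mem_supported' K f).1 hf (a, S) hd)
  obtain ⟨m, hm, rfl⟩ := exists_bits S
  rw [card_bits] at hd
  refine hne (h (a, m) ?_)
  refine List.mem_flatMap.2 ⟨a, List.mem_range.2 (by omega),
    List.mem_filterMap.2 ⟨m, List.mem_range.2 hm, ?_⟩⟩
  rw [if_pos hd]

theorem funcApply_funcD_relFunc (h2 : (2 : K) ≠ 0) {f : DPAlg K} {i : ℕ} (hi : i < 7)
    (h : ∀ i, dOp K i f ∈ basSpan K Set.univ) (a m : ℕ) :
    funcApply (Code.funcD i (relFunc a m)) f = 0 := by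
  have := funcApply_funcD h2 ⟨i, hi⟩ (relFunc a m) f
  rw [funcApply_relFunc (h _), mul_zero] at this
  exact this

theorem funcApply_prolongEqs (h2 : (2 : K) ≠ 0) {l : List (ℕ × ℕ × List ℕ)}
    (hl : (l.all fun q => q.2.2.all fun i => i < 7) = true) {f : DPAlg K}
    (h : ∀ i, dOp K i f ∈ basSpan K Set.univ) : ∀ z ∈ prolongEqs l, funcApply z f = 0 := by
  intro z hz
  obtain ⟨q, hq, hz⟩ := List.mem_flatMap.1 hz
  obtain ⟨i, hi, rfl⟩ := List.mem_map.1 hz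
  have hi' := of_decide_eq_true (List.all_eq_true.1 (List.all_eq_true.1 hl q hq) i hi)
  exact funcApply_funcD_relFunc h2 hi' h q.1 q.2.1

/-- Coordinates that vanish after subtracting basis elements. -/
def killedList (k : ℤ) : List (ℕ × ℕ) :=
  if k = 1 then (List.range 7).map fun i => (1, 2 ^ i) else if k = 2 then [(2, 0)] else []

theorem killedList_check : ([1, 2, 3].all fun k : ℤ => (killedList k).all fun q =>
    (List.range 31).any fun l => decide (basDeg l = k ∧ pivot l = [(1, q.1, q.2)])) = true := by
  decide +kernel

/-- A normalisation modulo `𝔤`: the coordinates that are themselves pivots can be made zero. The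
elimination then starts from them, and it has to show that all other coordinates vanish too. -/
theorem exists_sub_basSpan (h2 : (2 : K) ≠ 0) {k : ℤ} (hk : k ∈ [(1 : ℤ), 2, 3]) (f : DPAlg K) :
    ∃ g ∈ basSpan K {l | basDeg l = k}, ∀ q ∈ killedList k, (f - g) (q.1, bits q.2) = 0 := by
  classical
  refine ⟨∑ l : Fin 31, (if basDeg l = k then pivotFun K l f / (pivotDen l : K) else 0) • basElt K l,
    sum_mem fun l _ => ?_, fun q hq => ?_⟩
  · split_ifs with h
    · exact Submodule.smul_mem _ _ (Submodule.subset_span ⟨l, h, rfl⟩)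
    · rw [zero_smul]; exact zero_mem _
  · obtain ⟨l, hl, h⟩ := List.any_eq_true.1
      (List.all_eq_true.1 (List.all_eq_true.1 killedList_check k hk) q hq)
    obtain ⟨hd, hp⟩ := of_decide_eq_true h
    have hl := List.mem_range.1 hl
    have e : ∀ g : DPAlg K, pivotFun K l g = g (q.1, bits q.2) := fun g => by
      rw [pivotFun_apply, hp]; simp
    rw [← e, map_sub, pivotFun_sum (k := ⟨l, hl⟩)]
    simp only [hd, if_true]
    rw [div_mul_cancel₀ _ (pivotDen_ne_zero h2 hl), sub_self]

/-- The equations and their consequence in degree one outside characteristic three. -/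
def extraEq : Code :=
  Code.funcD 6 (relFunc 0 18) ++ (Code.smul (-2) (Code.funcD 5 (relFunc 0 3)) ++
    (Code.smul 2 (Code.funcD 4 (relFunc 0 5)) ++ Code.smul (-2) (Code.funcD 3 (relFunc 0 6))))

/-- The coordinates that are shown to vanish in degree one. -/
def knownOne : List (ℕ × ℕ) := Code.propagate 64 (prolongEqs eqsOne) (killedList 1)

/-- The only elimination step in which the pivot is allowed a factor 3, since `192 = 64 · 3`. The
coordinate in question is that of `v_1 v_3 v_4`. -/
theorem knownOne_check :
    (Code.propagate 192 [extraEq] knownOne).contains (0, 7) = true := by decide +kernel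

/-- Once the coordinate of `v_1 v_3 v_4` is zero, the invertibility of 2 forces all others to
vanish. So in any characteristic other than two, degree one exceeds `𝔤_1` by at most one dimension.
-/
theorem prolong_one_check : ((monoList 1).all fun q =>
    (Code.propagate 64 (prolongEqs eqsOneRest) ((0, 7) :: knownOne)).contains q) = true := by
  decide +kernel

/-- The systems in degrees two and three again need only the invertibility of 2. This is what keeps
the partial prolong inside `𝔞𝔤(2)` in characteristic three. -/
theorem prolong_two_check : ((monoList 2).all fun q =>
    (Code.propagate 64 (prolongEqs eqsTwo) (killedList 2)).contains q) = true := by decide +kernel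

theorem prolong_three_check : ((monoList 3).all fun q =>
    (Code.propagate 64 (prolongEqs eqsThree) (killedList 3)).contains q) = true := by decide +kernel

/-- The cubic element that is missing from the basis in characteristic three. -/
def cubicCode : Code := [(0, 7, 1), (0, 56, 1), (0, 73, 1), (0, 82, 1), (0, 100, 1)]

theorem basSpan_mono {s t : Set (Fin 31)} (h : s ⊆ t) : basSpan K s ≤ basSpan K t :=
  Submodule.span_mono (Set.image_mono h)

theorem dOp_mem_basSpan (h2 : (2 : K) ≠ 0) (i : Fin 7) {f : DPAlg K}
    (hf : f ∈ basSpan K Set.univ) : dOp K i f ∈ basSpan K Set.univ := by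
  have hi := basSpan_mono (Set.subset_univ _) (theta_mem_basSpan h2 i)
  rw [basSpan, Set.image_univ] at hf hi ⊢
  rw [← contactBr_theta]
  exact contactBr_mem_span_basElt h2 hi hf

theorem contains_iff {l : List (ℕ × ℕ)} {q : ℕ × ℕ} : l.contains q = true ↔ q ∈ l := by simp

theorem pow_two_ne_zero (h2 : (2 : K) ≠ 0) : ((64 : ℤ) : K) ≠ 0 := by
  have := pow_ne_zero 6 h2
  norm_num at this ⊢
  exact this

theorem knownOne_sound (h2 : (2 : K) ≠ 0) {f : DPAlg K}
    (h : ∀ i, dOp K i f ∈ basSpan K Set.univ)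
    (hk : ∀ q ∈ killedList 1, f (q.1, bits q.2) = 0) : ∀ q ∈ knownOne, f (q.1, bits q.2) = 0 :=
  propagate_sound (pow_two_ne_zero h2) (funcApply_prolongEqs h2 (by decide) h) hk

theorem eq_zero_of_dOp_mem_one (h2 : (2 : K) ≠ 0) {f : DPAlg K} (hf : f ∈ contactDeg K 1)
    (h : ∀ i, dOp K i f ∈ basSpan K Set.univ)
    (hk : ∀ q ∈ killedList 1, f (q.1, bits q.2) = 0) (h7 : f (0, bits 7) = 0) : f = 0 := by
  refine eq_zero_of_monoList (by norm_num) hf fun q hq => ?_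
  refine propagate_sound (pow_two_ne_zero h2)
    (funcApply_prolongEqs (l := eqsOneRest) h2 (by decide) h) ?_ q
    (contains_iff.1 (List.all_eq_true.1 prolong_one_check q hq))
  intro q hq
  rcases List.mem_cons.1 hq with rfl | hq
  · exact h7
  · exact knownOne_sound h2 h hk q hq

/-- The prolongation in degree one outside characteristic three. -/
theorem mem_of_dOp_mem_one (h2 : (2 : K) ≠ 0) (h3 : (3 : K) ≠ 0) {f : DPAlg K}
    (hf : f ∈ contactDeg K 1) (h : ∀ i, dOp K i f ∈ basSpan K Set.univ) :
    f ∈ basSpan K {l | basDeg l = 1} := by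
  obtain ⟨g, hg, hk⟩ := exists_sub_basSpan h2 (k := 1) (by simp) f
  have h' : ∀ i, dOp K i (f - g) ∈ basSpan K Set.univ := fun i => by
    rw [map_sub]
    exact sub_mem (h i) (dOp_mem_basSpan h2 i (basSpan_mono (Set.subset_univ _) hg))
  have h7 : (f - g) (0, bits 7) = 0 := by
    refine propagate_sound (n := 192) ?_ (eqs := [extraEq]) ?_ (knownOne_sound h2 h' hk) (0, 7)
      (contains_iff.1 knownOne_check)
    · have := mul_ne_zero (pow_ne_zero 6 h2) h3
      norm_num at this ⊢
      exact this
    · intro z hz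
      rw [List.mem_singleton.1 hz, extraEq]
      simp only [funcApply_append, funcApply_smul]
      rw [funcApply_funcD_relFunc h2 (by norm_num) h', funcApply_funcD_relFunc h2 (by norm_num) h',
        funcApply_funcD_relFunc h2 (by norm_num) h', funcApply_funcD_relFunc h2 (by norm_num) h']
      simp
  have := eq_zero_of_dOp_mem_one h2 (sub_mem hf (basSpan_le_contactDeg 1 hg)) h' hk h7
  rwa [sub_eq_zero.1 this]

/-- The prolongation in degree one in characteristic three. -/
theorem mem_of_dOp_mem_one_char_three (h2 : (2 : K) ≠ 0)
    (hc : ∀ i, dOp K i (eval K cubicCode) ∈ basSpan K Set.univ) {f : DPAlg K}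
    (hf : f ∈ contactDeg K 1) (h : ∀ i, dOp K i f ∈ basSpan K Set.univ) :
    f ∈ basSpan K {l | basDeg l = 1} ⊔ Submodule.span K {eval K cubicCode} := by
  obtain ⟨g, hg, hk⟩ := exists_sub_basSpan h2 (k := 1) (by simp) f
  -- The coordinate of `v_1 v_3 v_4` is free in characteristic three. The cubic element has
  -- coefficient one there, so subtracting `c` times it returns to the previous situation.
  set c := (f - g) (0, bits 7)
  have hdeg : eval K cubicCode ∈ contactDeg K 1 := eval_mem_contactDeg (by decide)
  have hv : ∀ a m, (f - g - c • eval K cubicCode) (a, bits m) =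
      (f - g) (a, bits m) - c * (Code.val cubicCode a m : K) := fun a m => by
    rw [Finsupp.sub_apply, Finsupp.smul_apply, eval_val, smul_eq_mul]
  have := eq_zero_of_dOp_mem_one h2 (f := f - g - c • eval K cubicCode)
    (sub_mem (sub_mem hf (basSpan_le_contactDeg 1 hg)) (Submodule.smul_mem _ c hdeg))
    (fun i => by
      rw [map_sub, map_sub, map_smul]
      exact sub_mem (sub_mem (h i) (dOp_mem_basSpan h2 i (basSpan_mono (Set.subset_univ _) hg)))
        (Submodule.smul_mem _ c (hc i)))
    (fun q hq => by
      have h0 : ∀ q ∈ killedList 1, Code.val cubicCode q.1 q.2 = 0 := by decide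
      rw [hv, hk q hq, h0 q hq]; simp)
    (by rw [hv, show Code.val cubicCode 0 7 = 1 by decide]; simp [c])
  rw [sub_eq_zero, sub_eq_iff_eq_add'] at this
  rw [this]
  exact Submodule.add_mem_sup hg (Submodule.smul_mem _ c (Submodule.mem_span_singleton_self _))

/-- The prolongation in degree two. -/
theorem mem_of_dOp_mem_two (h2 : (2 : K) ≠ 0) {f : DPAlg K}
    (hf : f ∈ contactDeg K 2) (h : ∀ i, dOp K i f ∈ basSpan K Set.univ) :
    f ∈ basSpan K {l | basDeg l = 2} := by
  obtain ⟨g, hg, hk⟩ := exists_sub_basSpan h2 (k := 2) (by simp) f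
  have h' : ∀ i, dOp K i (f - g) ∈ basSpan K Set.univ := fun i => by
    rw [map_sub]
    exact sub_mem (h i) (dOp_mem_basSpan h2 i (basSpan_mono (Set.subset_univ _) hg))
  have := eq_zero_of_monoList (by norm_num) (sub_mem hf (basSpan_le_contactDeg 2 hg)) fun q hq =>
    propagate_sound (pow_two_ne_zero h2)
      (funcApply_prolongEqs (l := eqsTwo) h2 (by decide) h') hk q
      (contains_iff.1 (List.all_eq_true.1 prolong_two_check q hq))
  rwa [sub_eq_zero.1 this]

/-- The prolongation in degree three. -/
theorem eq_zero_of_dOp_mem_three (h2 : (2 : K) ≠ 0) {f : DPAlg K}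
    (hf : f ∈ contactDeg K 3) (h : ∀ i, dOp K i f ∈ basSpan K Set.univ) : f = 0 :=
  eq_zero_of_monoList (by norm_num) hf fun q hq =>
    propagate_sound (pow_two_ne_zero h2)
      (funcApply_prolongEqs (l := eqsThree) h2 (by decide) h) (by simp [killedList]) q
      (contains_iff.1 (List.all_eq_true.1 prolong_three_check q hq))

theorem mem_basSpan_iff (h2 : (2 : K) ≠ 0) {s : Set (Fin 31)} {c : Fin 31 → K} :
    ∑ k, c k • basElt K k ∈ basSpan K s ↔ ∀ k ∉ s, c k = 0 := by
  constructor
  · intro h k hk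
    have : pivotFun K k (∑ k, c k • basElt K k) = 0 := by
      generalize ∑ k, c k • basElt K k = f at h
      induction h using Submodule.span_induction with
      | mem x hx =>
        obtain ⟨l, hl, rfl⟩ := hx
        have : (k : ℕ) ≠ l := fun h => hk (Fin.ext h ▸ hl)
        exact (pivotFun_basElt k.2 l.2).trans (if_neg this)
      | zero => rw [map_zero]
      | add x y _ _ hx hy => rw [map_add, hx, hy, add_zero]
      | smul a x _ hx => rw [map_smul, hx, smul_zero]
    rw [pivotFun_sum] at this
    exact (mul_eq_zero.1 this).resolve_right (pivotDen_ne_zero h2 k.2)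
  · intro h
    refine sum_mem fun k _ => ?_
    by_cases hk : k ∈ s
    · exact Submodule.smul_mem _ _ (Submodule.subset_span ⟨k, hk, rfl⟩)
    · rw [h k hk, zero_smul]; exact zero_mem _

theorem exists_of_mem_basSpan {s : Set (Fin 31)} {f : DPAlg K} (hf : f ∈ basSpan K s) :
    ∃ c : Fin 31 → K, f = ∑ k, c k • basElt K k := by
  refine mem_span_basElt_iff.1 ?_
  rw [← Set.image_univ]
  exact basSpan_mono (Set.subset_univ s) hf

theorem basSpan_inf (h2 : (2 : K) ≠ 0) (s t : Set (Fin 31)) :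
    basSpan K s ⊓ basSpan K t = basSpan K (s ∩ t) := by
  refine le_antisymm ?_ (le_inf (basSpan_mono Set.inter_subset_left)
    (basSpan_mono Set.inter_subset_right))
  rintro f ⟨hs, ht⟩
  obtain ⟨c, rfl⟩ := exists_of_mem_basSpan hs
  refine (mem_basSpan_iff h2).2 fun k hk => ?_
  rw [Set.mem_inter_iff, not_and_or] at hk
  exact hk.elim ((mem_basSpan_iff h2).1 hs k) ((mem_basSpan_iff h2).1 ht k)

theorem basSpan_inf_contactDeg (h2 : (2 : K) ≠ 0) (s : Set (Fin 31)) (d : ℤ) :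
    basSpan K s ⊓ contactDeg K d = basSpan K (s ∩ {l | basDeg l = d}) := by
  rw [← basSpan_inf h2]
  refine le_antisymm (le_inf inf_le_left ?_) (inf_le_inf_left _ (basSpan_le_contactDeg d))
  rintro f ⟨hs, hd⟩
  obtain ⟨c, rfl⟩ := exists_of_mem_basSpan hs
  refine (mem_basSpan_iff h2).2 fun k hk => ?_
  have := pivotFun_of_contactDeg k.2 hk hd
  rw [pivotFun_sum] at this
  exact (mul_eq_zero.1 this).resolve_right (pivotDen_ne_zero h2 k.2)

theorem basDeg_range : ∀ l : Fin 31, -2 ≤ basDeg l ∧ basDeg l ≤ 2 := by decide +kernel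

theorem basSpan_of_two_lt {d : ℤ} (hd : 2 < d) : basSpan K {l | basDeg l = d} = ⊥ := by
  have : {l : Fin 31 | basDeg l = d} = ∅ :=
    Set.eq_empty_of_forall_notMem fun l (hl : basDeg l = d) => by
      have := (basDeg_range l).2
      omega
  rw [this, basSpan, Set.image_empty, Submodule.span_empty]

theorem bracketClosed_basSpan_univ (h2 : (2 : K) ≠ 0) :
    BracketClosed (basSpan K Set.univ) := by
  rw [basSpan, Set.image_univ]
  exact fun x hx y hy => contactBr_mem_span_basElt h2 hx hy

theorem graded_basSpan (s : Set (Fin 31)) :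
    ⨆ k : ℤ, basSpan K s ⊓ contactDeg K k = basSpan K s := by
  refine le_antisymm (iSup_le fun k => inf_le_left) (Submodule.span_le.2 ?_)
  rintro _ ⟨k, hk, rfl⟩
  exact le_iSup (fun k : ℤ => basSpan K s ⊓ contactDeg K k) (basDeg k)
    ⟨Submodule.subset_span ⟨k, hk, rfl⟩, basElt_mem_contactDeg k.2⟩

/-- An upper bound for prolongs. -/
theorem HasNonpositivePart.le_of_step {V S P : Submodule K (DPAlg K)}
    {g : ℤ → Submodule K (DPAlg K)} (hS : HasNonpositivePart V g S)
    (hneg : ∀ k < 0, g k = contactDeg K k) (hP : ∀ k ≤ 0, g k ≤ P)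
    (hstep : ∀ k, 1 ≤ k → ∀ f ∈ V ⊓ contactDeg K k,
      (∀ i, dOp K i f ∈ P ⊓ contactDeg K (k - 1)) → f ∈ P) : S ≤ P := by
  -- The odd variables belong to `S`, so `dOp i` maps the component of `S` of degree `k` to that of
  -- degree `k - 1`, which lies in `P` by induction.
  have key : ∀ n : ℕ, ∀ k : ℤ, k ≤ n → S ⊓ contactDeg K k ≤ P := by
    intro n
    induction n with
    | zero => exact fun k hk => by rw [hS.nonpos k (by simpa using hk)]; exact hP k (by simpa using hk)
    | succ n ih =>
      intro k hk
      rcases lt_or_ge k 1 with h1 | h1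
      · rw [hS.nonpos k (by omega)]; exact hP k (by omega)
      rintro f ⟨hf, hd⟩
      refine hstep k h1 f ⟨hS.le hf, hd⟩ fun i => ⟨?_, dOp_mem_contactDeg i hd⟩
      refine ih (k - 1) (by push_cast at hk; omega) ⟨?_, dOp_mem_contactDeg i hd⟩
      rw [← contactBr_theta]
      refine hS.closed _ ?_ _ hf
      have : mono K 0 {i} ∈ S ⊓ contactDeg K (-1) := by
        rw [hS.nonpos (-1) (by norm_num), hneg (-1) (by norm_num)]
        exact theta_mem_contactDeg i
      exact this.1
  rw [← hS.graded]
  exact iSup_le fun k => key k.toNat k (Int.self_le_toNat k)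

/-- The prolong outside characteristic three. -/
theorem isCTSProlong_agEmb (h2 : (2 : K) ≠ 0) (h3 : (3 : K) ≠ 0) {V : Submodule K (DPAlg K)}
    (hV : LinearMap.range (agEmb K) ≤ V) :
    IsCTSProlong V (gPart (agEmb K)) (LinearMap.range (agEmb K)) := by
  refine ⟨⟨hV, ?_, ?_, fun k _ => ?_⟩, fun S hS => hS.le_of_step (fun k hk => ?_) (fun k _ => ?_)
    fun k hk f hf h => ?_⟩
  · rw [range_agEmb]; exact bracketClosed_basSpan_univ h2
  · rw [range_agEmb]; exact graded_basSpan _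
  · rw [range_agEmb, basSpan_inf_contactDeg h2, Set.univ_inter, gPart_agEmb]
  · rw [gPart_agEmb, basSpan_neg h2 hk]
  · rw [gPart_agEmb, range_agEmb]; exact basSpan_mono (Set.subset_univ _)
  · rw [range_agEmb] at h ⊢
    have h' := fun i => (h i).1
    rcases lt_or_ge k 4 with h4 | h4
    · obtain rfl | rfl | rfl : k = 1 ∨ k = 2 ∨ k = 3 := by omega
      · exact basSpan_mono (Set.subset_univ _) (mem_of_dOp_mem_one h2 h3 hf.2 h')
      · exact basSpan_mono (Set.subset_univ _) (mem_of_dOp_mem_two h2 hf.2 h')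
      · rw [eq_zero_of_dOp_mem_three h2 hf.2 h']; exact zero_mem _
    -- From degree four on there is nothing in degree `k - 1 ≥ 3`; all `dOp i f` are zero, and
    -- transitivity applies.
    · rw [eq_zero_of_dOp_eq_zero h2 (by omega) hf.2 fun i => ?_]
      · exact zero_mem _
      · have := h i
        rwa [basSpan_inf_contactDeg h2, Set.univ_inter, basSpan_of_two_lt (by omega),
          Submodule.mem_bot] at this

end Functionals

end SuperLie
end

noncomputable section

namespace SuperLie

/-! ### The families of elements in characteristic three -/

section Waves

variable {K : Type*} [Field K]

variable (K) in
/-- The linear map `t^(k) θ_S ↦ t^(a-k) θ_S`. -/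
def waveMap (a : ℕ) : DPAlg K →ₗ[K] DPAlg K :=
  Finsupp.linearCombination K fun q => if q.1 ≤ a then mono K (a - q.1) q.2 else 0

variable (K) in
/-- Multiplication of exponents by `t`, without divided powers. -/
def raise : DPAlg K →ₗ[K] DPAlg K := Finsupp.linearCombination K fun q => mono K (q.1 + 1) q.2

variable (K) in
/-- The operator that corresponds to `dOp` under `waveMap`. -/
def waveOp (i : Fin 7) : DPAlg K →ₗ[K] DPAlg K :=
  mulTheta K i ∘ₗ raise K - poissonCoeff K i • dTheta K (dualIdx i)

theorem waveMap_mono (a k : ℕ) (S : Finset (Fin 7)) :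
    waveMap K a (mono K k S) = if k ≤ a then mono K (a - k) S else 0 := by
  rw [waveMap, mono, Finsupp.linearCombination_single, one_smul]

theorem raise_mono (k : ℕ) (S : Finset (Fin 7)) : raise K (mono K k S) = mono K (k + 1) S := by
  rw [raise, mono, Finsupp.linearCombination_single, one_smul]

theorem waveOp_apply (i : Fin 7) (f : DPAlg K) : waveOp K i f =
    mulTheta K i (raise K f) - poissonCoeff K i • dTheta K (dualIdx i) f := rfl

theorem waveMap_apply (a b : ℕ) (S : Finset (Fin 7)) (f : DPAlg K) :
    waveMap K a f (b, S) = if b ≤ a then f (a - b, S) else 0 := by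
  refine dp_induction f (by simp) (fun f g hf hg => ?_) fun x k T => ?_
  · rw [map_add, Finsupp.add_apply, hf, hg]; split_ifs <;> simp
  · rw [map_smul, waveMap_mono]
    by_cases hk : k ≤ a
    · simp only [hk, if_true, mono, Finsupp.smul_apply, Finsupp.single_apply, Prod.mk.injEq]
      have : (a - k = b ∧ T = S) ↔ b ≤ a ∧ (k = a - b ∧ T = S) := by
        constructor
        · rintro ⟨rfl, h⟩; exact ⟨by omega, by omega, h⟩
        · rintro ⟨h1, h2, h⟩; exact ⟨by omega, h⟩
      simp only [this]
      split_ifs <;> simp_all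
    · rw [if_neg hk, smul_zero]
      simp only [mono, Finsupp.smul_apply, Finsupp.single_apply, Prod.mk.injEq]
      split_ifs with h1 h2
      · omega
      · simp
      · simp

/-- Exponents are counted backwards from `a`, so one code describes a whole sequence of elements on
which `dT` is the shift in `a`. -/
theorem dT_waveMap_succ (a : ℕ) (f : DPAlg K) : dT K (waveMap K (a + 1) f) = waveMap K a f := by
  ext ⟨b, S⟩
  rw [dT_apply, waveMap_apply, waveMap_apply]
  simp

theorem dT_waveMap_zero (f : DPAlg K) : dT K (waveMap K 0 f) = 0 := by
  ext ⟨b, S⟩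
  rw [dT_apply, waveMap_apply]
  simp

theorem waveMap_raise (a : ℕ) (f : DPAlg K) : waveMap K a (raise K f) = dT K (waveMap K a f) := by
  refine dp_induction f (by simp) (fun f g hf hg => by simp only [map_add, hf, hg]) fun x k S => ?_
  rw [map_smul, map_smul, map_smul, map_smul, raise_mono, waveMap_mono, waveMap_mono]
  rcases lt_trichotomy k a with h | rfl | h
  · rw [if_pos (by omega), if_pos h.le, dT_mono, if_neg (by omega)]; rfl
  · rw [if_neg (by omega), if_pos le_rfl, Nat.sub_self, dT_mono_zero]
  · rw [if_neg (by omega), if_neg (by omega), map_zero]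

theorem mulTheta_waveMap (i : Fin 7) (a : ℕ) (f : DPAlg K) :
    mulTheta K i (waveMap K a f) = waveMap K a (mulTheta K i f) := by
  ext ⟨b, S⟩
  rw [mulTheta_apply, waveMap_apply, waveMap_apply, mulTheta_apply]
  split_ifs <;> simp

theorem dTheta_waveMap (i : Fin 7) (a : ℕ) (f : DPAlg K) :
    dTheta K i (waveMap K a f) = waveMap K a (dTheta K i f) := by
  ext ⟨b, S⟩
  rw [dTheta_apply, waveMap_apply, waveMap_apply, dTheta_apply]
  split_ifs <;> simp

/-- The operator on the right does not depend on `a`. This reduces the action of `dOp i` on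
infinitely many elements to one finite computation for each family. -/
theorem dOp_waveMap (i : Fin 7) (a : ℕ) (f : DPAlg K) :
    dOp K i (waveMap K a f) = waveMap K a (waveOp K i f) := by
  rw [dOp_apply, ← waveMap_raise, mulTheta_waveMap, dTheta_waveMap, waveOp_apply, map_sub, map_smul]

end Waves

/-- The operators `waveOp` on codes. -/
def Code.waveOp (i : ℕ) (z : Code) : Code := z.flatMap fun e =>
  mulMono 0 (2 ^ i) (e.1 + 1) e.2.1 e.2.2 ++
  (if e.2.1.testBit (dualN i) then [(e.1, e.2.1 ^^^ 2 ^ dualN i,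
    sgn (inversions (2 ^ dualN i) (e.2.1 ^^^ 2 ^ dualN i)) ((if i = 6 then -2 else 1) * e.2.2))]
    else [])

theorem eval_waveOp {K : Type*} [Field K] (h2 : (2 : K) ≠ 0) (i : Fin 7) (z : Code) :
    eval K (Code.waveOp i z) = (if i = 6 then 2 else 1 : K) • waveOp K i (eval K z) := by
  induction z with
  | nil => simp [Code.waveOp]
  | cons e z ih =>
    rw [Code.waveOp, List.flatMap_cons, eval_append, ← Code.waveOp, ih, eval_cons, map_add, smul_add]
    congr 1
    have hu : uFactor K (2 ^ (i : ℕ)) = if i = 6 then 2 else 1 := by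
      fin_cases i <;> simp [uFactor, Nat.testBit]
    rw [eval_append, eval_mulMono, dualN_eq, termValue, map_smul, waveOp_apply, raise_mono,
      smul_sub, smul_sub, bits_two_pow, hu]
    rw [sub_eq_add_neg]
    congr 1
    · rw [mulTheta, smul_smul]
      congr 1
      ring
    · rw [dTheta_mono]
      simp only [mem_bits]
      by_cases hi : e.2.1.testBit (dualIdx i) = true
      · rw [if_pos hi, if_pos hi, eval_cons, eval_nil, add_zero, termValue, cast_sgn, ← bits_xor hi,
          ← bits_two_pow (dualIdx i), shuffleSign_bits]
        simp only [smul_smul, ← neg_smul]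
        congr 1
        have key : (((if (i : ℕ) = 6 then -2 else 1 : ℤ) : ℤ) : K) *
            uFactor K (e.2.1 ^^^ 2 ^ (dualIdx i : ℕ)) =
            -((if i = 6 then 2 else 1 : K) * poissonCoeff K i * uFactor K e.2.1) := by
          by_cases h6 : i = 6
          · subst h6
            change e.2.1.testBit 6 = true at hi
            change _ * uFactor K (e.2.1 ^^^ 2 ^ 6) = -(_ * (2 : K)⁻¹ * _)
            have h64 : Nat.testBit 64 6 = true := rfl
            simp [uFactor, hi, Nat.testBit_xor, h2, h64]
          · have h6' : (i : ℕ) ≠ 6 := fun e => h6 (Fin.ext e)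
            have h6'' : (dualIdx i : ℕ) ≠ 6 := by
              intro e
              have : dualIdx i = 6 := Fin.ext e
              apply h6; rw [← dualIdx_dualIdx i, this]; rfl
            have hp : poissonCoeff K i = -1 := by
              fin_cases i <;> first | rfl | exact absurd rfl h6
            rw [if_neg h6', if_neg h6, uFactor_xor h6'', hp]; push_cast; ring
        push_cast at key ⊢
        linear_combination ((-1) ^ inversions (2 ^ (dualIdx i : ℕ))
          (e.2.1 ^^^ 2 ^ (dualIdx i : ℕ)) * (e.2.2 : K)) * key
      · simp [hi]

/-- Codes for the families; the exponents have to be subtracted from the leading one. -/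
def famList : List Code :=
  [[(0, 0, 1), (2, 27, -1), (2, 45, -1), (2, 54, -1), (2, 71, -1), (2, 120, 1)],
   [(0, 1, 1), (1, 19, -1), (1, 37, -1), (1, 112, 1), (2, 55, -1), (2, 121, 1)],
   [(0, 2, 1), (1, 11, 1), (1, 38, -1), (1, 104, -1), (2, 47, 1), (2, 122, 1)],
   [(0, 4, 1), (1, 13, 1), (1, 22, 1), (1, 88, 1), (2, 31, -1), (2, 124, 1)],
   [(0, 8, 1), (1, 26, -1), (1, 44, -1), (1, 70, -1), (2, 62, -1), (2, 79, 1)],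
   [(0, 16, 1), (1, 25, 1), (1, 52, -1), (1, 69, 1), (2, 61, 1), (2, 87, 1)],
   [(0, 32, 1), (1, 41, 1), (1, 50, 1), (1, 67, -1), (2, 59, -1), (2, 103, 1)],
   [(0, 64, 1), (1, 7, 1), (1, 56, -1), (2, 91, -1), (2, 109, -1), (2, 118, -1)],
   [(0, 3, 1), (0, 96, 1), (1, 39, -1), (1, 105, 1), (1, 114, 1), (2, 123, -1)],
   [(0, 5, 1), (0, 80, -1), (1, 23, 1), (1, 89, -1), (1, 116, 1), (2, 125, -1)],
   [(0, 9, 1), (0, 18, 1), (0, 36, 1), (1, 71, -1), (1, 120, -1), (2, 63, -1)],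
   [(0, 48, 1), (0, 65, -1), (1, 57, 1), (1, 83, 1), (1, 101, 1), (2, 119, 1)],
   [(0, 6, 1), (0, 72, 1), (1, 15, -1), (1, 90, -1), (1, 108, -1), (2, 126, -1)],
   [(0, 40, 1), (0, 66, 1), (1, 58, -1), (1, 75, 1), (1, 102, -1), (2, 111, 1)],
   [(0, 24, 1), (0, 68, -1), (1, 60, 1), (1, 77, -1), (1, 86, -1), (2, 95, 1)],
   [(0, 73, 1), (0, 7, 1), (0, 56, 1), (0, 82, 1), (0, 100, 1), (2, 127, -1)]]

/-- The leading terms of the families. -/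
def famPivot : List ℕ := [0, 1, 2, 4, 8, 16, 32, 64, 3, 5, 9, 48, 6, 40, 24, 73]

/-- The code of a family. -/
def famCode (j : ℕ) : Code := famList.getD j []

/-- The leading term of a family. -/
def famLead (j : ℕ) : ℕ := famPivot.getD j 0

/-- The coefficients of the operators `dOp` with respect to the families. -/
def famTerms (i j : ℕ) : Code := (Code.clean (Code.waveOp i (famCode j))).filterMap fun e =>
  if famPivot.idxOf e.2.1 < 16 then some (e.1, famPivot.idxOf e.2.1, e.2.2) else none

/-- Increase the exponents. -/
def Code.raise (n : ℕ) (z : Code) : Code := z.map fun e => (e.1 + n, e.2)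

/-- The leading product of odd variables of a family occurs in no other family, and in its own only
once, with coefficient one and the highest power of `t`. So the coefficient there is a coordinate
functional. -/
theorem famLead_check : ((List.range 16).all fun j => (List.range 16).all fun l =>
    decide ((famCode j).filter (fun e => e.2.1 % 128 = famLead l % 128) =
      if j = l then [(0, famLead j, 1)] else [])) = true := by decide +kernel

theorem famDegree_check : ((List.range 16).all fun j => (famCode j).all fun e =>
    decide (bitCard e.2.1 = 2 * e.1 + bitCard (famLead j))) = true := by decide +kernel

/-- Here characteristic three enters: modulo 3 each `dOp i` sends a family to a combination of
families with raised exponents in the code, that is, of their `∂_t`-derivatives. -/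
theorem famOp_check : ((List.range 7).all fun i => (List.range 16).all fun j =>
    (famTerms i j).all (fun e => e.2.1 < 16) &&
    Code.isZeroMod 3 (Code.clean (Code.waveOp i (famCode j)) ++ (famTerms i j).flatMap fun e =>
      Code.smul (-e.2.2) (Code.raise e.1 (famCode e.2.1)))) = true := by decide +kernel

section Families

variable (K : Type*) [Field K]

/-- The elements of the families. -/
def fam (a j : ℕ) : DPAlg K := waveMap K a (eval K (famCode j))

/-- Coordinate functionals for the families. -/
def famDual (a j : ℕ) : DPAlg K →ₗ[K] K :=
  uFactor K (famLead j) • Finsupp.lapply (a, bits (famLead j))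

variable {K}

theorem famDual_apply (a j : ℕ) (f : DPAlg K) :
    famDual K a j f = uFactor K (famLead j) * f (a, bits (famLead j)) := rfl

theorem two_ne_zero_of_three (h3 : (3 : K) = 0) : (2 : K) ≠ 0 := fun h =>
  one_ne_zero (α := K) (by linear_combination h3 - h)

theorem coeff_eq_filter (z : Code) (a m : ℕ) : Code.coeff z a m =
    ((z.filter fun e => e.2.1 % 128 = m % 128).map fun e => if e.1 = a then e.2.2 else 0).sum := by
  induction z with
  | nil => rfl
  | cons e z ih =>
    rw [Code.coeff, List.map_cons, List.sum_cons, ← Code.coeff, ih, List.filter_cons]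
    by_cases h : e.2.1 % 128 = m % 128
    · simp [h]
    · simp [h]

theorem famDual_fam (h3 : (3 : K) = 0) {a b j l : ℕ} (hj : j < 16) (hl : l < 16) :
    famDual K a l (fam K b j) = if a = b ∧ l = j then 1 else 0 := by
  rw [famDual_apply, fam, waveMap_apply, eval_apply, coeff_eq_filter,
    of_decide_eq_true (all_range (all_range famLead_check hj) hl)]
  -- The factor is 1 or 2, and `4 = 1` in characteristic three.
  have hu : uFactor K (famLead l) * uFactor K (famLead l) = 1 := by
    rw [uFactor]; split_ifs
    · linear_combination h3
    · ring
  by_cases hjl : j = l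
  · subst hjl
    by_cases hab : a ≤ b
    · by_cases h : a = b
      · subst h; simp [hu]
      · have : ¬ 0 = b - a := by omega
        simp [h, this]
    · simp [hab, show a ≠ b by omega]
  · simp [hjl, Ne.symm hjl]

theorem dT_fam_succ (a j : ℕ) : dT K (fam K (a + 1) j) = fam K a j := dT_waveMap_succ a _

theorem dT_fam_zero (j : ℕ) : dT K (fam K 0 j) = 0 := dT_waveMap_zero _

theorem famDual_dT (a j : ℕ) (f : DPAlg K) : famDual K a j (dT K f) = famDual K (a + 1) j f := by
  rw [famDual_apply, famDual_apply, dT_apply]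

theorem eval_raise (n : ℕ) (z : Code) : eval K (Code.raise n z) = ((raise K) ^ n) (eval K z) := by
  have h : ∀ (k : ℕ) (S : Finset (Fin 7)), ((raise K) ^ n) (mono K k S) = mono K (k + n) S := by
    induction n with
    | zero => exact fun k S => rfl
    | succ n ih =>
      intro k S
      rw [pow_succ', Module.End.mul_apply, ih, raise_mono, add_assoc]
  induction z with
  | nil => simp [Code.raise]
  | cons e z ih =>
    rw [Code.raise, List.map_cons, eval_cons, ← Code.raise, ih, eval_cons, map_add, termValue,
      termValue, map_smul, h]

theorem waveMap_raise_pow (a n : ℕ) (f : DPAlg K) :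
    waveMap K a (((raise K) ^ n) f) = ((dT K) ^ n) (waveMap K a f) := by
  induction n with
  | zero => rfl
  | succ n ih => rw [pow_succ', Module.End.mul_apply, waveMap_raise, ih, pow_succ', Module.End.mul_apply]

theorem dOp_fam (h3 : (3 : K) = 0) (i : Fin 7) {j : ℕ} (hj : j < 16) (a : ℕ) :
    (if i = 6 then 2 else 1 : K) • dOp K i (fam K a j) =
      ((famTerms i j).map fun e => (e.2.2 : K) • ((dT K) ^ e.1) (fam K a e.2.1)).sum := by
  have h := all_range (all_range famOp_check i.2) hj
  rw [Bool.and_eq_true] at h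
  have h := eval_eq_zero (K := K) (n := 3) (by exact_mod_cast h3) h.2
  rw [eval_append, eval_clean, eval_waveOp (two_ne_zero_of_three h3)] at h
  rw [fam, dOp_waveMap, ← map_smul, eq_neg_of_add_eq_zero_left h]
  generalize famTerms i j = l
  clear h
  induction l with
  | nil => simp
  | cons e l ih =>
    rw [List.flatMap_cons, eval_append, neg_add, map_add, ih, List.map_cons, List.sum_cons,
      eval_smul, eval_raise, Int.cast_neg, neg_smul, neg_neg, map_smul, waveMap_raise_pow]
    rfl

/-- The degree of an element of a family. -/
def famDeg (a j : ℕ) : ℤ := 2 * a + bitCard (famLead j) - 2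

theorem fam_mem_contactDeg {j : ℕ} (hj : j < 16) (a : ℕ) : fam K a j ∈ contactDeg K (famDeg a j) := by
  have h := all_range famDegree_check hj
  rw [fam]
  generalize famCode j = z at h
  induction z with
  | nil => simp
  | cons e z ih =>
    simp only [List.all_cons, Bool.and_eq_true, decide_eq_true_eq] at h
    rw [eval_cons, map_add]
    refine add_mem ?_ (ih h.2)
    rw [termValue, map_smul, waveMap_mono]
    refine Submodule.smul_mem _ _ ?_
    split_ifs with hk
    · refine mono_mem_contactDeg ?_
      rw [card_bits, famDeg, h.1]
      push_cast [Nat.cast_sub hk]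
      ring
    · exact zero_mem _

theorem fam_mem_contactAlg (p N : ℕ) (a j : ℕ) (h : p = 0 ∨ a < p ^ N) :
    fam K a j ∈ contactAlg K p N := by
  refine (Finsupp.mem_supported' K _).2 fun q hq => ?_
  rw [fam, waveMap_apply, if_neg]
  intro hle
  exact hq (h.imp_right fun h => lt_of_le_of_lt hle h)

variable (K) in
/-- Spans of elements of the families. -/
def famSpan (s : Set (ℕ × Fin 16)) : Submodule K (DPAlg K) :=
  Submodule.span K ((fun q : ℕ × Fin 16 => fam K q.1 q.2) '' s)

theorem famSpan_mono {s t : Set (ℕ × Fin 16)} (h : s ⊆ t) : famSpan K s ≤ famSpan K t :=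
  Submodule.span_mono (Set.image_mono h)

theorem fam_mem_famSpan {s : Set (ℕ × Fin 16)} {a : ℕ} {j : Fin 16} (h : (a, j) ∈ s) :
    fam K a j ∈ famSpan K s := Submodule.subset_span ⟨_, h, rfl⟩

theorem famDual_eq_zero (h3 : (3 : K) = 0) {s : Set (ℕ × Fin 16)} {f : DPAlg K}
    (hf : f ∈ famSpan K s) {a : ℕ} {j : Fin 16} (h : (a, j) ∉ s) : famDual K a j f = 0 := by
  induction hf using Submodule.span_induction with
  | mem x hx =>
    obtain ⟨⟨b, l⟩, hb, rfl⟩ := hx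
    refine (famDual_fam h3 l.2 j.2).trans (if_neg ?_)
    rintro ⟨rfl, hjl⟩
    exact h (Fin.ext hjl ▸ hb)
  | zero => rw [map_zero]
  | add x y _ _ hx hy => rw [map_add, hx, hy, add_zero]
  | smul c x _ hx => rw [map_smul, hx, smul_zero]

theorem exists_of_mem_famSpan (h3 : (3 : K) = 0) {s : Set (ℕ × Fin 16)} {f : DPAlg K}
    (hf : f ∈ famSpan K s) : ∃ t : Finset (ℕ × Fin 16),
      f = ∑ q ∈ t, famDual K q.1 q.2 f • fam K q.1 q.2 := by
  classical
  rw [famSpan, Finsupp.mem_span_image_iff_linearCombination] at hf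
  obtain ⟨c, -, rfl⟩ := hf
  refine ⟨c.support, ?_⟩
  rw [Finsupp.linearCombination_apply, Finsupp.sum]
  refine Finset.sum_congr rfl fun q hq => ?_
  congr 1
  rw [map_sum, Finset.sum_eq_single q]
  · rw [map_smul, famDual_fam h3 q.2.2 q.2.2]; simp
  · intro q' _ hne
    rw [map_smul, famDual_fam h3 q'.2.2 q.2.2, if_neg, smul_zero]
    rintro ⟨h1, h2⟩
    exact hne (Prod.ext h1.symm (Fin.ext h2.symm))
  · intro h; exact absurd hq h

theorem mem_famSpan_iff (h3 : (3 : K) = 0) {s t : Set (ℕ × Fin 16)} {f : DPAlg K}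
    (hf : f ∈ famSpan K t) : f ∈ famSpan K s ↔ ∀ a j, (a, j) ∉ s → famDual K a j f = 0 := by
  refine ⟨fun h a j hq => famDual_eq_zero h3 h hq, fun h => ?_⟩
  obtain ⟨u, hu⟩ := exists_of_mem_famSpan h3 hf
  rw [hu]
  refine sum_mem fun q _ => ?_
  by_cases hq : q ∈ s
  · exact Submodule.smul_mem _ _ (fam_mem_famSpan hq)
  · rw [h q.1 q.2 hq, zero_smul]; exact zero_mem _

theorem linearIndependent_fam (h3 : (3 : K) = 0) :
    LinearIndependent K fun q : ℕ × Fin 16 => fam K q.1 q.2 := by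
  refine linearIndependent_iff'.2 fun s c hc q hq => ?_
  have := congrArg (famDual K q.1 q.2) hc
  rw [map_sum, map_zero, Finset.sum_eq_single q] at this
  · rw [map_smul, famDual_fam h3 q.2.2 q.2.2] at this
    simpa using this
  · intro q' _ hne
    rw [map_smul, famDual_fam h3 q'.2.2 q.2.2, if_neg, smul_zero]
    rintro ⟨h1, h2⟩
    exact hne (Prod.ext h1.symm (Fin.ext h2.symm))
  · intro h; exact absurd hq h

theorem famDual_of_contactDeg {a : ℕ} {j : Fin 16} {k : ℤ} (h : famDeg a j ≠ k) {f : DPAlg K}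
    (hf : f ∈ contactDeg K k) : famDual K a j f = 0 := by
  rw [famDual_apply, (Finsupp.mem_supported' K f).1 hf, mul_zero]
  intro h'
  refine h ?_
  rw [famDeg, ← card_bits]
  exact h'

theorem famSpan_inf_contactDeg (h3 : (3 : K) = 0) (s : Set (ℕ × Fin 16)) (k : ℤ) :
    famSpan K s ⊓ contactDeg K k = famSpan K (s ∩ {q | famDeg q.1 q.2 = k}) := by
  refine le_antisymm ?_ (le_inf (famSpan_mono Set.inter_subset_left) (Submodule.span_le.2 ?_))
  · rintro f ⟨hf, hk⟩
    refine (mem_famSpan_iff h3 hf).2 fun a j hq => ?_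
    rw [Set.mem_inter_iff, not_and_or] at hq
    rcases hq with hq | hq
    · exact famDual_eq_zero h3 hf hq
    · exact famDual_of_contactDeg hq hk
  · rintro _ ⟨q, ⟨-, rfl⟩, rfl⟩
    exact fam_mem_contactDeg q.2.2 q.1

theorem famSpan_inf_contactAlg (h3 : (3 : K) = 0) (s : Set (ℕ × Fin 16)) {p : ℕ} (hp : p ≠ 0)
    (N : ℕ) : famSpan K s ⊓ contactAlg K p N = famSpan K (s ∩ {q | q.1 < p ^ N}) := by
  refine le_antisymm ?_ (le_inf (famSpan_mono Set.inter_subset_left) (Submodule.span_le.2 ?_))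
  · rintro f ⟨hf, hk⟩
    refine (mem_famSpan_iff h3 hf).2 fun a j hq => ?_
    rw [Set.mem_inter_iff, not_and_or] at hq
    rcases hq with hq | hq
    · exact famDual_eq_zero h3 hf hq
    · rw [famDual_apply, (Finsupp.mem_supported' K f).1 hk, mul_zero]
      rintro (h | h)
      · exact hp h
      · exact hq h
  · rintro _ ⟨q, ⟨-, hq⟩, rfl⟩
    exact fam_mem_contactAlg p N _ _ (Or.inr hq)

theorem graded_famSpan (s : Set (ℕ × Fin 16)) :
    ⨆ k : ℤ, famSpan K s ⊓ contactDeg K k = famSpan K s := by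
  refine le_antisymm (iSup_le fun k => inf_le_left) (Submodule.span_le.2 ?_)
  rintro _ ⟨q, hq, rfl⟩
  exact le_iSup (fun k : ℤ => famSpan K s ⊓ contactDeg K k) (famDeg q.1 q.2)
    ⟨fam_mem_famSpan hq, fam_mem_contactDeg q.2.2 q.1⟩

/-- The elements of the families whose exponents belong to a set. -/
def expSet (s : Set ℕ) : Set (ℕ × Fin 16) := {q | q.1 ∈ s}

theorem dT_mem_famSpan {s : Set ℕ} (hs : IsLowerSet s) {f : DPAlg K} (hf : f ∈ famSpan K (expSet s)) :
    dT K f ∈ famSpan K (expSet s) := by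
  induction hf using Submodule.span_induction with
  | mem x hx =>
    obtain ⟨⟨a, j⟩, hq, rfl⟩ := hx
    cases a with
    | zero => rw [dT_fam_zero]; exact zero_mem _
    | succ a => rw [dT_fam_succ]; exact fam_mem_famSpan (hs (Nat.le_succ a) hq)
  | zero => rw [map_zero]; exact zero_mem _
  | add x y _ _ hx hy => rw [map_add]; exact add_mem hx hy
  | smul c x _ hx => rw [map_smul]; exact Submodule.smul_mem _ c hx

theorem famTerms_lt {i j : ℕ} (hi : i < 7) (hj : j < 16) {e : ℕ × ℕ × ℤ} (he : e ∈ famTerms i j) :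
    e.2.1 < 16 := by
  have h := all_range (all_range famOp_check hi) hj
  rw [Bool.and_eq_true] at h
  exact of_decide_eq_true (List.all_eq_true.1 h.1 e he)

/-- The expansion of `dOp i (fam a j)` involves only families with the same `a` and their
`∂_t`-derivatives, so exponents never increase; a lower set of exponents is what is needed. -/
theorem dOp_mem_famSpan (h3 : (3 : K) = 0) (i : Fin 7) {s : Set ℕ} (hs : IsLowerSet s) {f : DPAlg K}
    (hf : f ∈ famSpan K (expSet s)) : dOp K i f ∈ famSpan K (expSet s) := by
  induction hf using Submodule.span_induction with
  | mem x hx =>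
    obtain ⟨⟨a, j⟩, hq, rfl⟩ := hx
    have hu : (if i = 6 then 2 else 1 : K) ≠ 0 := by
      split_ifs
      · exact two_ne_zero_of_three h3
      · exact one_ne_zero
    refine (Submodule.smul_mem_iff _ hu).1 ?_
    rw [dOp_fam h3 i j.2]
    have hp : ∀ n : ℕ, ∀ f ∈ famSpan K (expSet s), ((dT K) ^ n) f ∈ famSpan K (expSet s) := by
      intro n
      induction n with
      | zero => exact fun f hf => hf
      | succ n ih =>
        intro f hf
        rw [pow_succ', Module.End.mul_apply]
        exact dT_mem_famSpan hs (ih f hf)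
    refine list_sum_mem fun x hx => ?_
    obtain ⟨e, he, rfl⟩ := List.mem_map.1 hx
    exact Submodule.smul_mem _ _ (hp _ _ (fam_mem_famSpan (j := ⟨_, famTerms_lt i.2 j.2 he⟩) hq))
  | zero => rw [map_zero]; exact zero_mem _
  | add x y _ _ hx hy => rw [map_add]; exact add_mem hx hy
  | smul c x _ hx => rw [map_smul]; exact Submodule.smul_mem _ c hx

end Families

end SuperLie
end

noncomputable section

namespace SuperLie

open SuperBracket

/-! ### The prolongs in characteristic three -/

/-- The indices of the basis elements that survive in the smaller algebra. -/
def bjSet : Set (Fin 31) := {k | (k : ℕ) ∉ [4, 5, 13, 15, 16, 21, 24]}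

instance : DecidablePred (· ∈ bjSet) := fun k =>
  inferInstanceAs (Decidable ((k : ℕ) ∉ [4, 5, 13, 15, 16, 21, 24]))

/-- Codes for the elements of the families. -/
def famEval (a j : ℕ) : Code :=
  (famCode j).flatMap fun e => if e.1 ≤ a then [(a - e.1, e.2)] else []

/-- The elements of the families in the algebra of dimension 31. -/
def lowList : List (ℕ × ℕ) :=
  (List.range 15).map (fun j => (0, j)) ++ (List.range 8).map fun j => (1, j)

/-- The seven excluded indices are the six long root vectors of `𝔤(2)` and `H_3`. The other 24 basis
elements are, modulo 3, combinations of families with exponent below 3. -/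
theorem bas_fam_check : ((List.range 31).all fun k => decide (k ∈ [4, 5, 13, 15, 16, 21, 24]) ||
    Code.isZeroMod 3 (bas k ++ (List.range 3).flatMap fun a => (List.range 16).flatMap fun j =>
      if Code.coeff (bas k) a (famLead j) = 0 then [] else
        Code.smul (-Code.coeff (bas k) a (famLead j)) (famEval a j))) = true := by decide +kernel

theorem fam_bas_check : (lowList.all fun q =>
    Code.isZeroMod 3 (famEval q.1 q.2 ++ (List.range 31).flatMap fun k =>
      if k ∉ [4, 5, 13, 15, 16, 21, 24] ∧ basDeg k = 2 * q.1 + bitCard (famLead q.2) - 2 then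
        Code.smul (-(pivotVal k (famEval q.1 q.2) * pivotDen k)) (bas k) else [])) = true := by
  decide +kernel

theorem dOp_cubic_check : ((List.range 7).all fun i =>
    decide (Code.val (Code.br [(0, 2 ^ i, 1)] cubicCode) 0
      ([48, 40, 24, 6, 5, 3, 9].getD i 0) ∈ [(1 : ℤ), -1, 2, -2])) = true := by
  decide +kernel

/-- In characteristic three the short root vectors of `𝔤(2)` generate an ideal; here this appears as
the divisibility by 3 of all structure constants that lead back to the long roots or to `H_3`. -/
theorem strCoeff_bjSet_check : ((List.range 31).all fun k => (List.range 31).all fun l =>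
    decide (basDeg k ≠ 0) || decide (basDeg l ≠ 0) || decide (l ∈ [4, 5, 13, 15, 16, 21, 24]) ||
      [4, 5, 13, 15, 16, 21, 24].all fun m => decide (strCoeff k l m % 3 = 0)) = true := by
  decide +kernel

end SuperLie
end

noncomputable section

namespace SuperLie

open SuperBracket

section CharThree

variable {K : Type*} [Field K]

theorem eval_famEval (a j : ℕ) : eval K (famEval a j) = fam K a j := by
  rw [fam, famEval]
  generalize famCode j = z
  induction z with
  | nil => simp
  | cons e z ih =>
    rw [List.flatMap_cons, eval_append, ih, eval_cons, map_add, termValue, map_smul, waveMap_mono]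
    congr 1
    split_ifs
    · rw [eval_cons, eval_nil, add_zero, termValue]
    · rw [eval_nil, smul_zero]

theorem basElt_mem_famSpan (h3 : (3 : K) = 0) {k : Fin 31} (hk : k ∈ bjSet) :
    basElt K k ∈ famSpan K (expSet (Set.Iio 3)) := by
  have h := all_range bas_fam_check k.2
  rw [Bool.or_eq_true] at h
  have h := eval_eq_zero (K := K) (n := 3) (by exact_mod_cast h3)
    (h.resolve_left fun h => hk (of_decide_eq_true h))
  rw [eval_append, ← basElt] at h
  rw [eq_neg_of_add_eq_zero_left h, eval_flatMap]
  refine neg_mem (list_sum_mem fun x hx => ?_)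
  obtain ⟨a, ha, rfl⟩ := List.mem_map.1 hx
  rw [eval_flatMap]
  refine list_sum_mem fun x hx => ?_
  obtain ⟨j, hj, rfl⟩ := List.mem_map.1 hx
  split_ifs
  · rw [eval_nil]; exact zero_mem _
  · rw [eval_smul, eval_famEval]
    exact Submodule.smul_mem _ _ (fam_mem_famSpan (j := ⟨j, List.mem_range.1 hj⟩)
      (List.mem_range.1 ha))

/-- Up to degree one the families contain nothing outside `𝔤` except `fam 0 15`, which is the cubic
element. In particular their nonpositive part is the prescribed one. -/
theorem fam_mem_basSpan (h3 : (3 : K) = 0) {a : ℕ} {j : Fin 16} (hd : famDeg a j ≤ 1)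
    (hne : (a, j) ≠ (0, 15)) : fam K a j ∈ basSpan K (bjSet ∩ {k | basDeg k = famDeg a j}) := by
  have hq : (a, (j : ℕ)) ∈ lowList := by
    have h0 : ∀ j : Fin 16, j ≠ 15 → (0, (j : ℕ)) ∈ lowList := by decide
    have h1 : ∀ j : Fin 16, (bitCard (famLead j) : ℤ) ≤ 1 → (1, (j : ℕ)) ∈ lowList := by decide
    rw [famDeg] at hd
    rcases Nat.lt_or_ge a 2 with ha | ha
    · interval_cases a
      · exact h0 j fun h => hne (by rw [h])
      · exact h1 j (by push_cast at hd; omega)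
    · omega
  have h := eval_eq_zero (K := K) (n := 3) (by exact_mod_cast h3)
    (List.all_eq_true.1 fam_bas_check _ hq)
  rw [eval_append, eval_famEval] at h
  rw [eq_neg_of_add_eq_zero_left h, eval_flatMap]
  refine neg_mem (list_sum_mem fun x hx => ?_)
  obtain ⟨k, hk, rfl⟩ := List.mem_map.1 hx
  dsimp only
  split_ifs with hc
  · rw [eval_smul]
    exact Submodule.smul_mem _ _
      (Submodule.subset_span ⟨⟨k, List.mem_range.1 hk⟩, hc, rfl⟩)
  · rw [eval_nil]; exact zero_mem _

theorem fam_zero_fifteen : fam K 0 15 = eval K cubicCode := by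
  rw [← eval_famEval, ← sub_eq_zero, sub_eq_add_neg, ← one_smul K (eval K cubicCode), ← neg_smul]
  have := eval_smul (K := K) (-1) cubicCode
  rw [Int.cast_neg, Int.cast_one] at this
  rw [← this, ← eval_append]
  exact eval_eq_zero (n := 0) Nat.cast_zero (by decide +kernel)

/-- Every `i` is needed separately: in degree two this excludes elements whose image under a single
`dOp i` would be a multiple of the cubic. -/
theorem dOp_cubic_ne_zero (h3 : (3 : K) = 0) (i : Fin 7) : dOp K i (eval K cubicCode) ≠ 0 := by
  have h2 := two_ne_zero_of_three h3
  intro h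
  have hc := of_decide_eq_true (all_range dOp_cubic_check i.2)
  set m := [48, 40, 24, 6, 5, 3, 9].getD (i : ℕ) 0
  have e := eval_val (K := K) (Code.br [(0, 2 ^ (i : ℕ), 1)] cubicCode) 0 m
  rw [eval_br h2, eval_cons, eval_nil, add_zero, termValue, bits_two_pow, map_smul,
    LinearMap.smul_apply, contactBr_theta, h, smul_zero, Finsupp.zero_apply] at e
  have h1 := one_ne_zero (α := K)
  simp only [List.mem_cons, List.not_mem_nil, or_false] at hc
  rcases hc with hc | hc | hc | hc <;> rw [hc] at e <;> push_cast at e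
  · exact h1 e.symm
  · exact h1 (by linear_combination e)
  · exact h2 e.symm
  · exact h2 (by linear_combination e)

/-- The components of nonpositive degree. -/
theorem famSpan_inf_contactDeg_of_nonpos (h3 : (3 : K) = 0) {s : Set ℕ} (hs : Set.Iio 3 ⊆ s) {d : ℤ}
    (hd : d ≤ 0) : famSpan K (expSet s) ⊓ contactDeg K d = basSpan K (bjSet ∩ {k | basDeg k = d}) := by
  refine le_antisymm ?_ (le_inf ?_ ((basSpan_mono Set.inter_subset_right).trans
    (basSpan_le_contactDeg d)))
  · rw [famSpan_inf_contactDeg h3]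
    refine Submodule.span_le.2 ?_
    rintro _ ⟨⟨a, j⟩, ⟨-, rfl⟩, rfl⟩
    refine fam_mem_basSpan h3 (hd.trans zero_le_one) fun h => ?_
    obtain ⟨rfl, rfl⟩ := Prod.ext_iff.1 h
    exact absurd hd (by decide)
  · refine Submodule.span_le.2 ?_
    rintro _ ⟨k, ⟨hk, -⟩, rfl⟩
    exact famSpan_mono (fun q hq => hs hq) (basElt_mem_famSpan h3 hk)

theorem mem_bjSet_of_basDeg : ∀ k : Fin 31, basDeg k ≠ 0 → k ∈ bjSet := by decide +kernel

/-- The component of degree one. -/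
theorem famSpan_inf_contactDeg_one (h3 : (3 : K) = 0) {s : Set ℕ} (hs : Set.Iio 3 ⊆ s) :
    famSpan K (expSet s) ⊓ contactDeg K 1 =
      Submodule.span K {eval K cubicCode} ⊔ basSpan K {k | basDeg k = 1} := by
  refine le_antisymm ?_ (sup_le (le_inf ?_ ?_) (le_inf ?_ (basSpan_le_contactDeg 1)))
  · rw [famSpan_inf_contactDeg h3]
    refine Submodule.span_le.2 ?_
    rintro _ ⟨⟨a, j⟩, ⟨-, hq⟩, rfl⟩
    by_cases h : (a, j) = (0, 15)
    · obtain ⟨rfl, rfl⟩ := Prod.ext_iff.1 h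
      refine Submodule.mem_sup_left ?_
      dsimp only
      rw [show ((15 : Fin 16) : ℕ) = 15 from rfl, fam_zero_fifteen]
      exact Submodule.mem_span_singleton_self _
    · refine Submodule.mem_sup_right ?_
      have := fam_mem_basSpan h3 (le_of_eq hq) h
      rw [show famDeg a j = 1 from hq] at this
      exact basSpan_mono Set.inter_subset_right this
  · rw [Submodule.span_singleton_le_iff_mem, ← fam_zero_fifteen]
    exact fam_mem_famSpan (j := 15) (hs (by norm_num : (0 : ℕ) ∈ Set.Iio 3))
  · rw [Submodule.span_singleton_le_iff_mem]
    exact eval_mem_contactDeg (by decide)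
  · refine Submodule.span_le.2 ?_
    rintro _ ⟨k, hk, rfl⟩
    refine famSpan_mono (fun q hq => hs hq) (basElt_mem_famSpan h3 (mem_bjSet_of_basDeg k ?_))
    rw [show basDeg k = 1 from hk]; norm_num

theorem basSpan_le_famSpan (h3 : (3 : K) = 0) {s : Set ℕ} (hs : Set.Iio 3 ⊆ s) :
    basSpan K bjSet ≤ famSpan K (expSet s) := by
  refine Submodule.span_le.2 ?_
  rintro _ ⟨k, hk, rfl⟩
  exact famSpan_mono (fun q hq => hs hq) (basElt_mem_famSpan h3 hk)

theorem dOp_cubic_mem (h3 : (3 : K) = 0) (i : Fin 7) :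
    dOp K i (eval K cubicCode) ∈ basSpan K Set.univ := by
  have h : eval K cubicCode ∈ famSpan K (expSet Set.univ) := by
    rw [← fam_zero_fifteen]
    exact fam_mem_famSpan (j := 15) (Set.mem_univ 0)
  have h1 := dOp_mem_famSpan h3 i isLowerSet_univ h
  have h0 : dOp K i (eval K cubicCode) ∈ contactDeg K (1 - 1) :=
    dOp_mem_contactDeg i (eval_mem_contactDeg (by decide))
  exact basSpan_mono (Set.subset_univ _) (((famSpan_inf_contactDeg_of_nonpos h3 (Set.subset_univ _)
    (by norm_num : (1 - 1 : ℤ) ≤ 0)).le ⟨h1, h0⟩))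

theorem dT_dOp (i : Fin 7) (f : DPAlg K) : dT K (dOp K i f) = dOp K i (dT K f) := by
  rw [dOp_apply, dOp_apply, map_sub, map_smul, dT_mulTheta, dT_dTheta]

/-- Integration in `t`: raise the exponent of each family by one. The exponents are unbounded here;
the bound by `3 ^ N` is imposed later through `contactAlg`. -/
theorem exists_dT_eq {k : ℤ} {f : DPAlg K} (hf : f ∈ famSpan K {q | famDeg q.1 q.2 = k - 2}) :
    ∃ g ∈ famSpan K {q | famDeg q.1 q.2 = k}, dT K g = f := by
  have : famSpan K {q | famDeg q.1 q.2 = k - 2} ≤ (famSpan K {q | famDeg q.1 q.2 = k}).map (dT K) := by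
    refine Submodule.span_le.2 ?_
    rintro _ ⟨⟨a, j⟩, hq, rfl⟩
    refine ⟨fam K (a + 1) j, fam_mem_famSpan ?_, dT_fam_succ a j⟩
    have hq : famDeg a j = k - 2 := hq
    rw [famDeg] at hq
    rw [Set.mem_ofPred_eq, famDeg]
    push_cast
    linarith
  exact this hf

theorem mem_famSpan_of_dOp_mem_one (h3 : (3 : K) = 0) {f : DPAlg K} (hf : f ∈ contactDeg K 1)
    (h : ∀ i, dOp K i f ∈ basSpan K Set.univ) : f ∈ famSpan K (expSet Set.univ) := by
  have := mem_of_dOp_mem_one_char_three (two_ne_zero_of_three h3) (dOp_cubic_mem h3) hf h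
  rw [sup_comm, ← famSpan_inf_contactDeg_one h3 (Set.subset_univ _)] at this
  exact this.1

/-- `dT` shifts the exponents down by one, so the coordinates of an element of its kernel at
exponents above zero vanish. -/
theorem famSpan_inf_ker_dT (h3 : (3 : K) = 0) {f : DPAlg K} (hf : f ∈ famSpan K (expSet Set.univ))
    {k : ℤ} (hk : f ∈ contactDeg K k) (h : dT K f = 0) :
    f ∈ famSpan K {q | q.1 = 0 ∧ famDeg 0 q.2 = k} := by
  refine (mem_famSpan_iff h3 hf).2 fun a j hq => ?_
  cases a with
  | zero =>
    refine famDual_of_contactDeg (fun h => hq ⟨rfl, h⟩) hk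
  | succ a => rw [← famDual_dT, h, map_zero]

/-- Degree one is the linear system. For `k ≥ 2` the function `∂_t f` lies in the span of the
families and can be integrated there to some `g`. Then each `dOp i (f - g)` is a combination of
families with exponent zero. These have degree at most one, so for `k ≥ 3` it is zero, and for `k =
2` it is a multiple of the cubic, which the relation for `dOp i` applied twice forbids. Transitivity
gives `f = g`. -/
theorem mem_famSpan_of_dOp_mem (h3 : (3 : K) = 0) {k : ℤ} (hk : 1 ≤ k) {f : DPAlg K}
    (hf : f ∈ contactDeg K k) (h : ∀ i, dOp K i f ∈ famSpan K (expSet Set.univ)) :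
    f ∈ famSpan K (expSet Set.univ) := by
  have h2 := two_ne_zero_of_three h3
  rcases hk.lt_or_eq with hk | rfl
  swap
  · refine mem_famSpan_of_dOp_mem_one h3 hf fun i => ?_
    exact basSpan_mono (Set.subset_univ _) ((famSpan_inf_contactDeg_of_nonpos h3 (Set.subset_univ _)
      (by norm_num : (1 - 1 : ℤ) ≤ 0)).le ⟨h i, dOp_mem_contactDeg i hf⟩)
  -- `dT` is a nonzero multiple of the anticommutator of the operators for `v_1` and `w_1`.
  have hT : dT K f ∈ famSpan K (expSet Set.univ) := by
    have e := dOp_dOp 0 3 f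
    rw [if_pos (show dualIdx 0 = 3 from rfl)] at e
    refine (Submodule.smul_mem_iff _ (neg_ne_zero.2 (mul_ne_zero h2 (poissonCoeff_ne_zero h2 0)))).1
      (e ▸ add_mem (dOp_mem_famSpan h3 0 isLowerSet_univ (h 3))
        (dOp_mem_famSpan h3 3 isLowerSet_univ (h 0)))
  obtain ⟨g, hg, hgf⟩ := exists_dT_eq (K := K) (k := k) (f := dT K f) (by
    have := (famSpan_inf_contactDeg h3 (expSet Set.univ) (k - 2)).le ⟨hT, dT_mem_contactDeg hf⟩
    exact famSpan_mono Set.inter_subset_right this)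
  have hgk : g ∈ famSpan K (expSet Set.univ) ⊓ contactDeg K k := by
    rw [famSpan_inf_contactDeg h3]
    exact famSpan_mono (Set.subset_inter (Set.subset_univ _) subset_rfl) hg
  have hd : ∀ i, dOp K i (f - g) ∈ famSpan K {q | q.1 = 0 ∧ famDeg 0 q.2 = k - 1} := fun i => by
    refine famSpan_inf_ker_dT h3 ?_ (dOp_mem_contactDeg i (sub_mem hf hgk.2)) ?_
    · rw [map_sub]
      exact sub_mem (h i) (dOp_mem_famSpan h3 i isLowerSet_univ hgk.1)
    · rw [dT_dOp, map_sub, hgf, sub_self, map_zero]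
  suffices ∀ i, dOp K i (f - g) = 0 by
    have := eq_zero_of_dOp_eq_zero h2 (by omega) (sub_mem hf hgk.2) this
    rw [sub_eq_zero.1 this]
    exact hgk.1
  intro i
  have hmem := hd i
  rcases lt_or_ge k 3 with hk3 | hk3
  · obtain rfl : k = 2 := by omega
    have hle : famSpan K {q | q.1 = 0 ∧ famDeg 0 q.2 = 2 - 1} ≤
        Submodule.span K {eval K cubicCode} := by
      refine Submodule.span_le.2 ?_
      rintro _ ⟨⟨a, j⟩, ⟨rfl, hq⟩, rfl⟩
      have : ∀ j : Fin 16, famDeg 0 j = 2 - 1 → j = 15 := by decide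
      obtain rfl := this j hq
      rw [← fam_zero_fifteen]
      exact Submodule.mem_span_singleton_self _
    obtain ⟨c, hc⟩ := Submodule.mem_span_singleton.1 (hle hmem)
    -- The square of `dOp i` is a multiple of `dT`, which kills `f - g`; so `c` times `dOp i` of the
    -- cubic is zero, and `c = 0`.
    have e := dOp_dOp i i (f - g)
    rw [map_sub (dT K), hgf, sub_self, smul_zero, ite_self, ← two_smul K, ← hc, map_smul,
      smul_eq_zero, smul_eq_zero] at e
    rw [← hc, (e.resolve_left h2).resolve_right (dOp_cubic_ne_zero h3 i), zero_smul]
  · have : {q : ℕ × Fin 16 | q.1 = 0 ∧ famDeg 0 q.2 = k - 1} = ∅ := by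
      refine Set.eq_empty_of_forall_notMem fun q hq => ?_
      have : ∀ j : Fin 16, famDeg 0 j ≤ 1 := by decide
      have := this q.2
      have := hq.2
      omega
    rw [this, famSpan, Set.image_empty, Submodule.span_empty, Submodule.mem_bot] at hmem
    exact hmem

theorem strCoeff_bjSet (h3 : (3 : K) = 0) {k l m : Fin 31} (hk : basDeg k = 0) (hl : basDeg l = 0)
    (hl' : l ∈ bjSet) (hm : m ∉ bjSet) : (strCoeff k l m : K) = 0 := by
  have h := all_range (all_range strCoeff_bjSet_check k.2) l.2
  simp only [Bool.or_eq_true, decide_eq_true_eq, hk, hl, ne_eq, not_true_eq_false, false_or] at h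
  have h := of_decide_eq_true (List.all_eq_true.1 (h.resolve_left hl') m (not_not.1 hm))
  obtain ⟨c, hc⟩ := Int.dvd_of_emod_eq_zero h
  rw [hc]; push_cast; rw [h3, zero_mul]

theorem basSpan_induction₂ {s t : Set (Fin 31)} {W : Submodule K (DPAlg K)}
    (h : ∀ k ∈ s, ∀ l ∈ t, contactBr K (basElt K k) (basElt K l) ∈ W) {f g : DPAlg K}
    (hf : f ∈ basSpan K s) (hg : g ∈ basSpan K t) : contactBr K f g ∈ W := by
  induction hf, hg using Submodule.span_induction₂ with
  | mem_mem x y hx hy =>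
    obtain ⟨k, hk, rfl⟩ := hx
    obtain ⟨l, hl, rfl⟩ := hy
    exact h k hk l hl
  | zero_left => simp
  | zero_right => simp
  | add_left x y z _ _ _ hx hy => rw [map_add, LinearMap.add_apply]; exact add_mem hx hy
  | add_right x y z _ _ _ hx hy => rw [map_add]; exact add_mem hx hy
  | smul_left c x y _ _ h => rw [map_smul, LinearMap.smul_apply]; exact Submodule.smul_mem _ c h
  | smul_right c x y _ _ h => rw [map_smul]; exact Submodule.smul_mem _ c h

/-- The degree zero part of the smaller algebra is an ideal in the degree zero part. -/
theorem contactBr_mem_basSpan_bjSet (h3 : (3 : K) = 0) {f g : DPAlg K}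
    (hf : f ∈ basSpan K {k | basDeg k = 0}) (hg : g ∈ basSpan K (bjSet ∩ {k | basDeg k = 0})) :
    contactBr K f g ∈ basSpan K bjSet := by
  have h2 := two_ne_zero_of_three h3
  refine basSpan_induction₂ (fun k hk l hl => ?_) hf hg
  rw [contactBr_basElt h2 k.2 l.2, mem_basSpan_iff h2]
  exact fun m hm => strCoeff_bjSet h3 hk hl.2 hl.1 hm

theorem contactBr_mem_of_neg (h3 : (3 : K) = 0) {s : Set ℕ} (hs : IsLowerSet s) {k : ℤ} (hk : k < 0)
    {f g : DPAlg K} (hf : f ∈ contactDeg K k) (hg : g ∈ famSpan K (expSet s)) :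
    contactBr K f g ∈ famSpan K (expSet s) := by
  rcases lt_or_ge k (-2) with hk2 | hk2
  · rw [contactDeg_eq_bot hk2, Submodule.mem_bot] at hf
    rw [hf]; simp
  obtain rfl | rfl : k = -1 ∨ k = -2 := by omega
  · refine contactDeg_neg_one_induction (P := fun f => contactBr K f g ∈ famSpan K (expSet s)) hf
      (by simp) (fun f f' h h' => ?_) fun x i => ?_
    · rw [map_add, LinearMap.add_apply]; exact add_mem h h'
    · rw [map_smul, LinearMap.smul_apply, contactBr_theta]
      exact Submodule.smul_mem _ _ (dOp_mem_famSpan h3 i hs hg)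
  · obtain ⟨x, rfl⟩ := contactDeg_neg_two hf
    rw [map_smul, LinearMap.smul_apply, contactBr_one]
    exact Submodule.smul_mem _ _ (Submodule.smul_mem _ _ (dT_mem_famSpan hs hg))

theorem contactDeg_le_famSpan (h3 : (3 : K) = 0) {s : Set ℕ} (hs : Set.Iio 3 ⊆ s) {d : ℤ}
    (hd : d < 0) : contactDeg K d ≤ famSpan K (expSet s) := by
  rw [← basSpan_neg (two_ne_zero_of_three h3) hd]
  refine le_trans (basSpan_mono fun k hk => mem_bjSet_of_basDeg k ?_) (basSpan_le_famSpan h3 hs)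
  rw [show basDeg k = d from hk]; exact hd.ne

variable (K) in
/-- The components of the larger prolong. -/
def prolongPart (d : ℤ) : Submodule K (DPAlg K) :=
  if d = 0 then basSpan K {k | basDeg k = 0} else famSpan K (expSet Set.univ) ⊓ contactDeg K d

theorem prolongPart_le_contactDeg (d : ℤ) : prolongPart K d ≤ contactDeg K d := by
  rw [prolongPart]
  split_ifs with h
  · rw [h]; exact basSpan_le_contactDeg 0
  · exact inf_le_right

theorem famSpan_inf_le_prolongPart (h3 : (3 : K) = 0) (d : ℤ) :
    famSpan K (expSet Set.univ) ⊓ contactDeg K d ≤ prolongPart K d := by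
  rw [prolongPart]
  split_ifs with h
  · rw [h, famSpan_inf_contactDeg_of_nonpos h3 (Set.subset_univ _) le_rfl]
    exact basSpan_mono Set.inter_subset_right
  · exact le_rfl

theorem dOp_mem_prolongPart (h3 : (3 : K) = 0) (i : Fin 7) {d : ℤ} {f : DPAlg K}
    (hf : f ∈ prolongPart K d) : dOp K i f ∈ prolongPart K (d - 1) := by
  have hd := dOp_mem_contactDeg i (prolongPart_le_contactDeg d hf)
  refine famSpan_inf_le_prolongPart h3 _ ⟨?_, hd⟩
  rw [prolongPart] at hf
  split_ifs at hf with h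
  · rw [h] at hd
    exact contactDeg_le_famSpan h3 (Set.subset_univ _) (by norm_num) hd
  · exact dOp_mem_famSpan h3 i isLowerSet_univ hf.1

/-- Induction on the total degree. Negative arguments act through `dOp` and `dT`; in degree zero the
smaller part is an ideal. In positive degree the criterion `mem_famSpan_of_dOp_mem` applies, because
`dOp i` distributes over the bracket and lowers the degree of one factor. Letting `f` range over the
larger prolong gives closure and the ideal property at once. -/
theorem contactBr_mem_of_prolongPart (h3 : (3 : K) = 0) {k l : ℤ} {f g : DPAlg K}
    (hf : f ∈ prolongPart K k) (hg : g ∈ famSpan K (expSet Set.univ)) (hgl : g ∈ contactDeg K l) :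
    contactBr K f g ∈ famSpan K (expSet Set.univ) := by
  obtain ⟨n, hn⟩ : ∃ n : ℕ, k + l ≤ n := ⟨(k + l).toNat, Int.self_le_toNat _⟩
  induction n using Nat.strong_induction_on generalizing k l f g with
  | h n ih =>
  have hfk := prolongPart_le_contactDeg k hf
  rcases lt_or_ge k 0 with hk | hk
  · exact contactBr_mem_of_neg h3 isLowerSet_univ hk hfk hg
  rcases lt_or_ge l 0 with hl | hl
  · rw [contactBr_skew hfk hgl]
    refine neg_mem (zsmul_mem ?_ _)
    rcases hk.lt_or_eq with hk | rfl
    · rw [prolongPart, if_neg hk.ne'] at hf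
      exact contactBr_mem_of_neg h3 isLowerSet_univ hl hgl hf.1
    · have := contactBr_mem_contactDeg hgl hfk
      exact contactDeg_le_famSpan h3 (Set.subset_univ _) (by omega) this
  rcases eq_or_lt_of_le (add_nonneg hk hl) with h0 | h0
  · obtain rfl : k = 0 := by omega
    obtain rfl : l = 0 := by omega
    rw [prolongPart, if_pos rfl] at hf
    exact basSpan_le_famSpan h3 (Set.subset_univ _) (contactBr_mem_basSpan_bjSet h3 hf
      ((famSpan_inf_contactDeg_of_nonpos h3 (Set.subset_univ _) le_rfl).le ⟨hg, hgl⟩))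
  · refine mem_famSpan_of_dOp_mem h3 (by omega) (contactBr_mem_contactDeg hfk hgl) fun i => ?_
    rw [dOp_contactBr_of_mem i hfk]
    refine add_mem (ih (n - 1) (by omega) (dOp_mem_prolongPart h3 i hf) hg hgl (by omega))
      (zsmul_mem (ih (n - 1) (by omega) hf (dOp_mem_famSpan h3 i isLowerSet_univ hg)
        (dOp_mem_contactDeg i hgl) (by omega)) _)

end CharThree

end SuperLie
end

noncomputable section

namespace SuperLie

open SuperBracket

/-! ### Closure of the contact algebras -/

section Closure

variable {K : Type*} [Field K]

/-- Kummer's theorem: for `a, b < p ^ N ≤ a + b` the addition of `a` and `b` in base `p` carries out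
of the `N` lowest digits, so `p` divides the binomial coefficient. -/
theorem cast_choose_eq_zero {p : ℕ} (hp : p.Prime) [CharP K p] {N a b : ℕ} (hN : 1 ≤ N)
    (ha : a < p ^ N) (hb : b < p ^ N) (h : p ^ N ≤ a + b) : ((a + b).choose a : K) = 0 := by
  have := Fact.mk hp
  rw [CharP.cast_eq_zero_iff K p]
  refine dvd_of_one_le_padicValNat ?_
  rw [add_comm, padicValNat_choose' (lt_add_one _), Nat.one_le_iff_ne_zero, ← Nat.pos_iff_ne_zero,
    Finset.card_pos]
  refine ⟨N, Finset.mem_filter.2 ⟨Finset.mem_Ico.2 ⟨hN, ?_⟩, ?_⟩⟩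
  · exact Nat.lt_succ_of_le (Nat.le_log_of_pow_le hp.one_lt (by omega))
  · rwa [Nat.mod_eq_of_lt ha, Nat.mod_eq_of_lt hb]

theorem mono_mem_contactAlg {p N a : ℕ} (S : Finset (Fin 7)) (h : p = 0 ∨ a < p ^ N) :
    mono K a S ∈ contactAlg K p N := mono_mem_supported h

theorem dpMul_mem_contactAlg {p : ℕ} (hp : p.Prime) [CharP K p] {N : ℕ} (hN : 1 ≤ N) {f g : DPAlg K}
    (hf : f ∈ contactAlg K p N) (hg : g ∈ contactAlg K p N) : dpMul K f g ∈ contactAlg K p N := by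
  refine supported_induction hf (by simp) (fun f f' h h' => ?_) fun x a S ha => ?_
  · rw [map_add, LinearMap.add_apply]; exact add_mem h h'
  rw [map_smul, LinearMap.smul_apply]
  refine Submodule.smul_mem _ _ (supported_induction hg (by simp) (fun f f' h h' => ?_)
    fun x b T hb => ?_)
  · rw [map_add]; exact add_mem h h'
  rw [map_smul]
  refine Submodule.smul_mem _ _ ?_
  have ha := ha.resolve_left hp.ne_zero
  have hb := hb.resolve_left hp.ne_zero
  rw [dpMul_mono]
  split_ifs
  · rcases lt_or_ge (a + b) (p ^ N) with h | h
    · exact Submodule.smul_mem _ _ (mono_mem_contactAlg _ (Or.inr h))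
    · rw [cast_choose_eq_zero hp hN ha hb h, mul_zero, zero_smul]; exact zero_mem _
  · exact zero_mem _

theorem contactAlg_map_mem {p N : ℕ} {A : DPAlg K →ₗ[K] DPAlg K}
    (hA : ∀ a S, (p = 0 ∨ a < p ^ N) → A (mono K a S) ∈ contactAlg K p N) {f : DPAlg K}
    (hf : f ∈ contactAlg K p N) : A f ∈ contactAlg K p N := by
  refine supported_induction hf (by simp) (fun f f' h h' => ?_) fun x a S ha => ?_
  · rw [map_add]; exact add_mem h h'
  · rw [map_smul]; exact Submodule.smul_mem _ _ (hA a S ha)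

/-- The contact superalgebras are closed under the bracket. -/
theorem bracketClosed_contactAlg {p : ℕ} (hp : p.Prime) [CharP K p] {N : ℕ} (hN : 1 ≤ N) :
    BracketClosed (contactAlg K p N) := by
  intro f hf g hg
  have hT : ∀ f ∈ contactAlg K p N, dT K f ∈ contactAlg K p N := fun f hf =>
    contactAlg_map_mem (fun a S ha => by
      rw [dT_mono]
      split_ifs
      · exact zero_mem _
      · exact mono_mem_contactAlg _ (ha.imp_right fun h => by omega)) hf
  have hE : ∀ f ∈ contactAlg K p N, euler K f ∈ contactAlg K p N := fun f hf =>
    contactAlg_map_mem (fun a S ha => by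
      rw [euler_mono]
      exact Submodule.smul_mem _ _ (mono_mem_contactAlg _ ha)) hf
  have hs : ∀ f ∈ contactAlg K p N, signOp K f ∈ contactAlg K p N := fun f hf =>
    contactAlg_map_mem (fun a S ha => by
      rw [signOp_mono]
      exact Submodule.smul_mem _ _ (mono_mem_contactAlg _ ha)) hf
  have hθ : ∀ i, ∀ f ∈ contactAlg K p N, dTheta K i f ∈ contactAlg K p N := fun i f hf =>
    contactAlg_map_mem (fun a S ha => by
      rw [dTheta_mono]
      split_ifs
      · exact Submodule.smul_mem _ _ (mono_mem_contactAlg _ ha)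
      · exact zero_mem _) hf
  change contactBr K f g ∈ _
  rw [contactBr_apply]
  refine add_mem (sub_mem ?_ ?_) (sum_mem fun i _ => Submodule.smul_mem _ _ ?_)
  · exact dpMul_mem_contactAlg hp hN (sub_mem (Submodule.smul_mem _ _ hf) (hE f hf)) (hT g hg)
  · exact dpMul_mem_contactAlg hp hN (hT f hf) (sub_mem (Submodule.smul_mem _ _ hg) (hE g hg))
  · exact dpMul_mem_contactAlg hp hN (hθ _ _ (hs f hf)) (hθ _ _ hg)

variable (K) in
/-- The homogeneous component of degree `d`. -/
def degProj (d : ℤ) : DPAlg K →ₗ[K] DPAlg K :=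
  Submodule.subtype _ ∘ₗ Finsupp.restrictDom K K
    {m : ℕ × Finset (Fin 7) | 2 * (m.1 : ℤ) + (m.2.card : ℤ) - 2 = d}

theorem degProj_of_mem {d : ℤ} {f : DPAlg K} (hf : f ∈ contactDeg K d) : degProj K d f = f := by
  change Finsupp.filter _ f = f
  exact Finsupp.filter_eq_self_iff _ _ |>.2 fun m hm => by
    by_contra h
    exact hm ((Finsupp.mem_supported' K f).1 hf m h)

theorem degProj_of_ne {d e : ℤ} (h : d ≠ e) {f : DPAlg K} (hf : f ∈ contactDeg K d) :
    degProj K e f = 0 := by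
  change Finsupp.filter _ f = 0
  exact Finsupp.filter_eq_zero_iff _ _ |>.2 fun m hm =>
    (Finsupp.mem_supported' K f).1 hf m fun h' => h (h'.symm.trans hm)

theorem degProj_mem {S : Submodule K (DPAlg K)} (hS : ⨆ k : ℤ, S ⊓ contactDeg K k = S) (d : ℤ)
    {f : DPAlg K} (hf : f ∈ S) : degProj K d f ∈ S := by
  rw [← hS] at hf
  induction hf using Submodule.iSup_induction' with
  | mem k x hx =>
    by_cases h : k = d
    · subst h; rw [degProj_of_mem hx.2]; exact hx.1
    · rw [degProj_of_ne h hx.2]; exact zero_mem _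
  | zero => rw [map_zero]; exact zero_mem _
  | add x y _ _ hx hy => rw [map_add]; exact add_mem hx hy

theorem sup_inf_contactDeg {X S : Submodule K (DPAlg K)} (hX : X ≤ contactDeg K 0)
    (hS : ⨆ k : ℤ, S ⊓ contactDeg K k = S) (d : ℤ) : (X ⊔ S) ⊓ contactDeg K d =
      if d = 0 then X ⊔ S ⊓ contactDeg K 0 else S ⊓ contactDeg K d := by
  split_ifs with h
  · subst h
    exact sup_inf_assoc_of_le S hX
  · refine le_antisymm ?_ (inf_le_inf_right _ le_sup_right)
    rintro f ⟨hf, hd⟩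
    obtain ⟨x, hx, y, hy, rfl⟩ := Submodule.mem_sup.1 hf
    refine ⟨?_, hd⟩
    rw [← degProj_of_mem hd, map_add, degProj_of_ne (Ne.symm h) (hX hx), zero_add]
    exact degProj_mem hS d hy

theorem bracketClosed_of_span {ι : Type*} {v : ι → DPAlg K} {s : Set ι} {T : Submodule K (DPAlg K)}
    {f : DPAlg K} (hf : f ∈ Submodule.span K (v '' s)) {W : Submodule K (DPAlg K)}
    (h : ∀ i ∈ s, ∀ g ∈ T, contactBr K (v i) g ∈ W) {g : DPAlg K} (hg : g ∈ T) :
    contactBr K f g ∈ W := by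
  induction hf using Submodule.span_induction with
  | mem x hx => obtain ⟨i, hi, rfl⟩ := hx; exact h i hi g hg
  | zero => simp
  | add x y _ _ hx hy => rw [map_add, LinearMap.add_apply]; exact add_mem hx hy
  | smul c x _ hx => rw [map_smul, LinearMap.smul_apply]; exact Submodule.smul_mem _ _ hx

end Closure

/-! ### The two prolongs for a given `N`. -/

section CharThree

variable {K : Type*} [Field K]

variable (K) in
/-- The prolong in characteristic three. -/
def bjN (N : ℕ) : Submodule K (DPAlg K) := famSpan K (expSet (Set.Iio (3 ^ N)))

theorem Iio_three_subset {N : ℕ} (hN : 1 ≤ N) : Set.Iio 3 ⊆ Set.Iio (3 ^ N) :=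
  Set.Iio_subset_Iio (le_trans (by norm_num) (Nat.pow_le_pow_right (by norm_num : 0 < 3) hN))

/-- Bounding the exponent of the families is the same as bounding the powers of `t`, since the
leading term of `fam a j` contains `t^(a)`. Closure then follows from closure of the two intersected
subalgebras. -/
theorem bjN_eq (h3 : (3 : K) = 0) (N : ℕ) :
    bjN K N = famSpan K (expSet Set.univ) ⊓ contactAlg K 3 N := by
  rw [famSpan_inf_contactAlg h3 _ (by norm_num), bjN]
  congr 1
  ext q
  simp [expSet]

theorem contactBr_mem_of_prolongPart' (h3 : (3 : K) = 0) {k : ℤ} {f g : DPAlg K}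
    (hf : f ∈ prolongPart K k) (hg : g ∈ famSpan K (expSet Set.univ)) :
    contactBr K f g ∈ famSpan K (expSet Set.univ) := by
  rw [← graded_famSpan] at hg
  induction hg using Submodule.iSup_induction' with
  | mem k x hx => exact contactBr_mem_of_prolongPart h3 hf hx.1 hx.2
  | zero => simp
  | add x y _ _ hx hy => rw [map_add]; exact add_mem hx hy

theorem contactBr_mem_famSpan (h3 : (3 : K) = 0) {f g : DPAlg K}
    (hf : f ∈ famSpan K (expSet Set.univ)) (hg : g ∈ famSpan K (expSet Set.univ)) :
    contactBr K f g ∈ famSpan K (expSet Set.univ) := by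
  rw [← graded_famSpan] at hf
  induction hf using Submodule.iSup_induction' with
  | mem k x hx => exact contactBr_mem_of_prolongPart' h3 (famSpan_inf_le_prolongPart h3 k hx) hg
  | zero => simp
  | add x y _ _ hx hy => rw [map_add, LinearMap.add_apply]; exact add_mem hx hy

theorem three_eq_zero [CharP K 3] : (3 : K) = 0 := by exact_mod_cast CharP.cast_eq_zero K 3

theorem bracketClosed_bjN [CharP K 3] {N : ℕ} (hN : 1 ≤ N) : BracketClosed (bjN K N) := by
  intro f hf g hg
  rw [bjN_eq three_eq_zero] at hf hg ⊢
  exact ⟨contactBr_mem_famSpan three_eq_zero hf.1 hg.1,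
    bracketClosed_contactAlg Nat.prime_three hN f hf.2 g hg.2⟩

theorem basSpan_le_contactAlg [CharP K 3] {N : ℕ} (hN : 1 ≤ N) (s : Set (Fin 31)) :
    basSpan K s ≤ contactAlg K 3 N := by
  refine le_trans (basSpan_mono (Set.subset_univ s)) ?_
  rw [← range_agEmb]
  exact range_agEmb_le 3 N (Or.inr le_rfl) hN

/-- The degree zero component of `prolongPart` is all of `𝔤_0`, so the closure lemma already
contains this ideal property. -/
theorem stableUnder_bjN [CharP K 3] {N : ℕ} (hN : 1 ≤ N) :
    StableUnder (basSpan K {k | basDeg k = 0} ⊔ bjN K N) (bjN K N) := by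
  intro x hx g hg
  obtain ⟨f, hf, y, hy, rfl⟩ := Submodule.mem_sup.1 hx
  rw [map_add, LinearMap.add_apply]
  refine add_mem ?_ (bracketClosed_bjN hN y hy g hg)
  rw [bjN_eq three_eq_zero] at hg ⊢
  refine ⟨contactBr_mem_of_prolongPart' three_eq_zero (k := 0) (by rwa [prolongPart, if_pos rfl]) hg.1,
    bracketClosed_contactAlg Nat.prime_three hN f (basSpan_le_contactAlg hN _ hf) g hg.2⟩

theorem contactBr_bjN_mem [CharP K 3] {N : ℕ} (hN : 1 ≤ N) {f g : DPAlg K} (hf : f ∈ bjN K N)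
    (hg : g ∈ basSpan K {k | basDeg k = 0}) : contactBr K f g ∈ bjN K N := by
  have hf' : f ∈ ⨆ k : ℤ, bjN K N ⊓ contactDeg K k := (graded_famSpan _).ge hf
  clear hf
  induction hf' using Submodule.iSup_induction' with
  | mem k f hf =>
    rw [contactBr_skew hf.2 (basSpan_le_contactDeg 0 hg)]
    exact neg_mem (zsmul_mem (stableUnder_bjN hN g (Submodule.mem_sup_left hg) f hf.1) _)
  | zero => simp
  | add x y _ _ hx hy => rw [map_add, LinearMap.add_apply]; exact add_mem hx hy

/-- The prolong of the smaller nonpositive part in characteristic three. -/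
theorem isCTSProlong_bjN [CharP K 3] {N : ℕ} (hN : 1 ≤ N) :
    IsCTSProlong (contactAlg K 3 N) (fun d => basSpan K (bjSet ∩ {k | basDeg k = d})) (bjN K N) := by
  have h3 : (3 : K) = 0 := three_eq_zero
  refine ⟨⟨?_, bracketClosed_bjN hN, graded_famSpan _, fun k hk =>
    famSpan_inf_contactDeg_of_nonpos h3 (Iio_three_subset hN) hk⟩, fun S hS => ?_⟩
  · rw [bjN_eq h3]; exact inf_le_right
  · refine hS.le_of_step (fun k hk => ?_) (fun k _ => ?_) fun k hk f hf h => ?_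
    · rw [← basSpan_neg (two_ne_zero_of_three h3) hk]
      congr 1
      refine Set.inter_eq_right.2 fun l hl => mem_bjSet_of_basDeg l ?_
      rw [show basDeg l = k from hl]; exact hk.ne
    · exact (basSpan_mono Set.inter_subset_left).trans (basSpan_le_famSpan h3 (Iio_three_subset hN))
    · rw [bjN_eq h3]
      refine ⟨mem_famSpan_of_dOp_mem h3 hk hf.2 fun i => ?_, hf.1⟩
      exact famSpan_mono (fun q _ => Set.mem_univ q.1) (h i).1

/-- The prolong of the nonpositive part in characteristic three. -/
theorem isCTSProlong_sup_bjN [CharP K 3] {N : ℕ} (hN : 1 ≤ N) :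
    IsCTSProlong (contactAlg K 3 N) (gPart (agEmb K)) (gPart (agEmb K) 0 ⊔ bjN K N) := by
  have h3 : (3 : K) = 0 := three_eq_zero
  have h2 := two_ne_zero_of_three h3
  have hdeg := basSpan_le_contactDeg (K := K) 0
  have hgr : ⨆ k : ℤ, bjN K N ⊓ contactDeg K k = bjN K N := graded_famSpan _
  have hneg : ∀ k : ℤ, k < 0 → gPart (agEmb K) k = contactDeg K k := fun k hk => by
    rw [gPart_agEmb, basSpan_neg h2 hk]
  have hle : ∀ {k : ℤ}, k ≠ 0 → (basSpan K {k | basDeg k = 0} ⊔ bjN K N) ⊓ contactDeg K k =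
      bjN K N ⊓ contactDeg K k := fun {k} hk => by
    rw [sup_inf_contactDeg hdeg hgr, if_neg hk]
  have hzero : (basSpan K {k | basDeg k = 0} ⊔ bjN K N) ⊓ contactDeg K 0 =
      basSpan K {k | basDeg k = 0} := by
    rw [sup_inf_contactDeg hdeg hgr, if_pos rfl, sup_eq_left, bjN,
      famSpan_inf_contactDeg_of_nonpos h3 (Iio_three_subset hN) le_rfl]
    exact basSpan_mono Set.inter_subset_right
  have hnonpos : ∀ k ≤ 0, (basSpan K {k | basDeg k = 0} ⊔ bjN K N) ⊓ contactDeg K k =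
      gPart (agEmb K) k := fun k hk => by
    rcases hk.lt_or_eq with hk | rfl
    · rw [hle hk.ne, hneg k hk]
      exact inf_eq_right.2 (contactDeg_le_famSpan h3 (Iio_three_subset hN) hk)
    · rw [hzero, gPart_agEmb]
  have hbj : bjN K N ≤ contactAlg K 3 N := by rw [bjN_eq h3]; exact inf_le_right
  rw [gPart_agEmb]
  refine ⟨⟨sup_le (basSpan_le_contactAlg hN _) hbj, ?_, ?_, hnonpos⟩, fun S hS => ?_⟩
  · intro x hx y hy
    obtain ⟨f, hf, w, hw, rfl⟩ := Submodule.mem_sup.1 hy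
    rw [map_add]
    refine add_mem ?_ (Submodule.mem_sup_right (stableUnder_bjN hN x hx w hw))
    obtain ⟨g, hg, z, hz, rfl⟩ := Submodule.mem_sup.1 hx
    rw [map_add, LinearMap.add_apply]
    refine add_mem (Submodule.mem_sup_left ?_)
      (Submodule.mem_sup_right (contactBr_bjN_mem hN hz hf))
    have h := bracketClosed_basSpan_univ h2 g (basSpan_mono (Set.subset_univ _) hg) f
      (basSpan_mono (Set.subset_univ _) hf)
    have := (basSpan_inf_contactDeg h2 _ _).le ⟨h, contactBr_mem_contactDeg (hdeg hg) (hdeg hf)⟩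
    rwa [Set.univ_inter] at this
  · refine le_antisymm (iSup_le fun k => inf_le_left) (sup_le ?_ ?_)
    · exact le_trans (le_inf le_sup_left hdeg) (le_iSup
        (fun k : ℤ => (basSpan K {k | basDeg k = 0} ⊔ bjN K N) ⊓ contactDeg K k) 0)
    · exact hgr.ge.trans (iSup_mono fun k => inf_le_inf_right _ le_sup_right)
  · refine hS.le_of_step hneg (fun k hk => ?_) fun k hk f hf h => ?_
    · rw [← hnonpos k hk]; exact inf_le_left
    · refine Submodule.mem_sup_right ?_
      rw [bjN_eq h3]
      refine ⟨?_, hf.1⟩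
      rcases hk.lt_or_eq with hk | rfl
      · refine mem_famSpan_of_dOp_mem h3 hk.le hf.2 fun i => ?_
        exact famSpan_mono (fun q _ => Set.mem_univ q.1) ((hle (by omega)).le (h i)).1
      -- In degree one the `dOp i f` are only known to lie in the whole of `𝔤_0`. The linear system
      -- in degree one allows this, so enlarging the degree zero part adds nothing in positive
      -- degree.
      · refine mem_famSpan_of_dOp_mem_one h3 hf.2 fun i => ?_
        exact basSpan_mono (Set.subset_univ _) (hzero.le (h i))

end CharThree

end SuperLie
end

noncomputable section

namespace SuperLie

open SuperBracket

/-! ### Simplicity of the prolong in characteristic three -/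

section Ideals

variable {K : Type*} [Field K]

/-- A nonzero subspace that is stable under the operators `dOp` contains the constants. -/
theorem one_mem_of_dOp_stable (h2 : (2 : K) ≠ 0) {I : Submodule K (DPAlg K)} (hI : I ≠ ⊥)
    (h : ∀ i, ∀ f ∈ I, dOp K i f ∈ I) : mono K 0 ∅ ∈ I := by
  -- The number `n` bounds `2a + |S|` over the monomials of `f`. Every `dOp i` lowers this bound by
  -- one, so applying nonzero ones repeatedly ends at a nonzero constant.
  have key : ∀ n : ℕ, ∀ f ∈ I, f ≠ 0 → (∀ a S, n < 2 * a + S.card → f (a, S) = 0) →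
      mono K 0 ∅ ∈ I := by
    intro n
    induction n with
    | zero =>
      intro f hf hne hs
      have e : f = f (0, ∅) • mono K 0 ∅ := by
        refine eq_smul_one_of_dOp_eq_zero h2 fun i => ?_
        ext ⟨a, S⟩
        rw [dOp_coeff, hs (a + 1) _ (by omega), hs a (insert _ _)
          (by have := Finset.card_pos.2 (Finset.insert_nonempty (dualIdx i) S); omega)]
        simp
      refine (Submodule.smul_mem_iff I fun h0 => hne ?_).1 (e ▸ hf)
      rw [e, h0, zero_smul]
    | succ n ih =>
      intro f hf hne hs
      by_cases hd : ∀ i, dOp K i f = 0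
      · have e := eq_smul_one_of_dOp_eq_zero h2 hd
        refine (Submodule.smul_mem_iff I fun h0 => hne ?_).1 (e ▸ hf)
        rw [e, h0, zero_smul]
      · obtain ⟨i, hi⟩ := not_forall.1 hd
        refine ih _ (h i f hf) hi fun a S hS => ?_
        rw [dOp_coeff]
        have h1 : (if i ∈ S then (shuffleSign {i} (S.erase i) : K) * f (a + 1, S.erase i) else 0)
            = 0 := by
          split_ifs with hiS
          · rw [hs, mul_zero]
            rw [Finset.card_erase_of_mem hiS]; omega
          · rfl
        have h2 : (if dualIdx i ∈ S then 0 else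
            (shuffleSign {dualIdx i} S : K) * f (a, insert (dualIdx i) S)) = 0 := by
          split_ifs with hiS
          · rfl
          · rw [hs, mul_zero]
            rw [Finset.card_insert_of_notMem hiS]; omega
        rw [h1, h2, mul_zero, sub_zero]
  obtain ⟨f, hf, hne⟩ := Submodule.exists_mem_ne_zero_of_ne_bot hI
  refine key (f.support.sup fun m => 2 * m.1 + m.2.card) f hf hne fun a S hS => ?_
  by_contra hne
  exact absurd (Finset.le_sup (f := fun m : ℕ × Finset (Fin 7) => 2 * m.1 + m.2.card)
    (Finsupp.mem_support_iff.2 hne)) (not_le.2 hS)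

/-- The function `t` is the grading element. -/
theorem contactBr_t {k : ℤ} {f : DPAlg K} (hf : f ∈ contactDeg K k) :
    contactBr K (mono K 1 ∅) f = (k : K) • f := by
  refine supported_induction hf (by simp) (fun f g h h' => ?_) fun x a S ha => ?_
  · rw [map_add, h, h', smul_add]
  · rw [map_smul, smul_comm]
    congr 1
    have ha : 2 * (a : ℤ) + S.card - 2 = k := ha
    rw [contactBr_apply, euler_mono, Finset.card_empty, Nat.cast_zero, zero_smul, sub_zero,
      show dT K (mono K 1 ∅) = mono K 0 ∅ from dT_mono_succ 0 ∅, signOp_mono, Finset.sum_eq_zero,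
      dpMul_one, map_smul, LinearMap.smul_apply, dT_mono, euler_mono, add_zero, ← ha]
    · split_ifs with h0
      · subst h0; push_cast; rw [map_zero]; module
      · rw [dpMul_mono, if_pos (Finset.disjoint_empty_left _), Finset.empty_union,
          show 1 + (a - 1) = a by omega, Nat.choose_one_right]
        have : shuffleSign ∅ S = 1 := by simp [shuffleSign]
        rw [this]; push_cast; module
    · intro i _
      rw [map_smul, dTheta_mono, if_neg (Finset.notMem_empty i), smul_zero, map_zero,
        LinearMap.zero_apply, smul_zero]

theorem dT_mem_of_ideal (h2 : (2 : K) ≠ 0) {S I : Submodule K (DPAlg K)}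
    (hI : ∀ x ∈ S, ∀ y ∈ I, contactBr K x y ∈ I) (h1 : mono K 0 ∅ ∈ I) {k : ℤ} {f : DPAlg K}
    (hf : f ∈ S) (hk : f ∈ contactDeg K k) : dT K f ∈ I := by
  have := hI f hf _ h1
  rw [contactBr_skew hk one_mem_contactDeg, contactBr_one, Int.negOnePow_even _ (by simp),
    Units.val_one, one_zsmul, neg_mem_iff] at this
  exact (Submodule.smul_mem_iff I h2).1 this

/-- As `t` acts by the degree, an ideal that contains `t` contains every element of `S` whose degree
is nonzero in `K`. -/
theorem contactDeg_smul_mem_of_ideal {S I : Submodule K (DPAlg K)}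
    (hI : ∀ x ∈ S, ∀ y ∈ I, contactBr K x y ∈ I) (ht : mono K 1 ∅ ∈ I) {k : ℤ} {f : DPAlg K}
    (hf : f ∈ S) (hk : f ∈ contactDeg K k) (hk0 : (k : K) ≠ 0) : f ∈ I := by
  have := hI f hf _ ht
  have ht0 : mono K 1 ∅ ∈ contactDeg K 0 := mono_mem_contactDeg (by simp)
  rw [contactBr_skew hk ht0, contactBr_t hk, mul_zero, Int.negOnePow_zero,
    Units.val_one, one_zsmul, neg_mem_iff] at this
  exact (Submodule.smul_mem_iff I hk0).1 this

theorem sup_par_of_graded {S : Submodule K (DPAlg K)}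
    (hS : ⨆ k : ℤ, S ⊓ contactDeg K k = S) : (S ⊓ par 0) ⊔ (S ⊓ par 1) = S := by
  refine le_antisymm (sup_le inf_le_left inf_le_left) (hS.ge.trans (iSup_le fun k => ?_))
  rintro f ⟨hf, hk⟩
  have := par_of_contactDeg hk
  have h01 : ∀ i : ZMod 2, i = 0 ∨ i = 1 := by decide
  rcases h01 (k : ZMod 2) with h | h <;> rw [h] at this
  · exact Submodule.mem_sup_left ⟨hf, this⟩
  · exact Submodule.mem_sup_right ⟨hf, this⟩

end Ideals

/-- For each family, an operator and a higher family that it maps to this family. -/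
def descentList : List (ℕ × ℕ) :=
  [(0, 4), (0, 10), (1, 10), (2, 10), (1, 14), (0, 14), (0, 13), (0, 12), (5, 15), (4, 15), (6, 15),
    (0, 15), (3, 15), (1, 15), (2, 15)]

/-- Up to terms with at least one `∂_t`, the chosen operator maps a family of higher index to a
multiple of the family `l`. The coefficient is prime to 3, and since the index always increases, the
chain ends at 15. -/
theorem descent_check : ((List.range 15).all fun l =>
    let q := descentList.getD l (0, 0)
    decide (q.1 < 7 ∧ q.2 < 16 ∧ l < q.2) &&
      decide ((famTerms q.1 q.2).filter (fun e => e.1 = 0) ∈ [[(0, l, 1)], [(0, l, -1)],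
        [(0, l, 2)], [(0, l, -2)]])) = true := by decide +kernel

section Simple

variable {K : Type*} [Field K]

theorem list_sum_sub_filter_mem {V α : Type*} [AddCommGroup V] [Module K V] {I : Submodule K V}
    (p : α → Prop) [DecidablePred p] (g : α → V) (l : List α) (h : ∀ e ∈ l, ¬ p e → g e ∈ I) :
    (l.map g).sum - ((l.filter fun e => p e).map g).sum ∈ I := by
  induction l with
  | nil => simp
  | cons e l ih =>
    have ih := ih fun e he => h e (List.mem_cons_of_mem _ he)
    rw [List.filter_cons]
    by_cases hp : p e
    · rw [if_pos (by simpa using hp), List.map_cons, List.sum_cons, List.map_cons, List.sum_cons,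
        add_sub_add_left_eq_sub]
      exact ih
    · rw [if_neg (by simpa using hp), List.map_cons, List.sum_cons, add_sub_assoc]
      exact add_mem (h e List.mem_cons_self hp) ih

/-- The families are generated by the highest one. -/
theorem fam_mem_of_stable (h3 : (3 : K) = 0) {I : Submodule K (DPAlg K)}
    (hI : ∀ i, ∀ f ∈ I, dOp K i f ∈ I) {a : ℕ}
    (hT : ∀ j, j < 16 → ∀ n, n ≠ 0 → ((dT K) ^ n) (fam K a j) ∈ I) (h15 : fam K a 15 ∈ I) {l : ℕ}
    (hl : l < 16) : fam K a l ∈ I := by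
  obtain ⟨n, hn⟩ : ∃ n, 15 - l = n := ⟨_, rfl⟩
  induction n using Nat.strong_induction_on generalizing l with
  | h n ih =>
  rcases Nat.lt_or_ge l 15 with hl15 | hl15
  swap
  · obtain rfl : l = 15 := by omega
    exact h15
  have h := all_range descent_check hl15
  simp only [Bool.and_eq_true, decide_eq_true_eq] at h
  generalize descentList.getD l (0, 0) = q at h
  obtain ⟨i, j⟩ := q
  obtain ⟨⟨hi, hj, hlj⟩, hc⟩ := h
  dsimp only at hi hj hlj hc
  have hd := Submodule.smul_mem I (if (⟨i, hi⟩ : Fin 7) = 6 then 2 else 1 : K)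
    (hI ⟨i, hi⟩ _ (ih (15 - j) (by omega) hj rfl))
  rw [dOp_fam h3 _ hj] at hd
  -- The terms with a `∂_t` lie in `I` by assumption, so they can be dropped and only the term of
  -- the family `l` remains.
  have hs := list_sum_sub_filter_mem (I := I) (fun e : ℕ × ℕ × ℤ => e.1 = 0)
    (fun e => (e.2.2 : K) • ((dT K) ^ e.1) (fam K a e.2.1)) (famTerms i j) fun e he h0 =>
      Submodule.smul_mem _ _ (hT _ (famTerms_lt hi hj he) _ h0)
  have hd := (Submodule.sub_mem_iff_right I hd).1 hs
  obtain ⟨c, hc0, hc⟩ : ∃ c : ℤ, (c : K) ≠ 0 ∧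
      (famTerms i j).filter (fun e => e.1 = 0) = [(0, l, c)] := by
    have h2 := two_ne_zero_of_three h3
    simp only [List.mem_cons, List.not_mem_nil, or_false] at hc
    rcases hc with hc | hc | hc | hc
    · exact ⟨1, by simp, hc⟩
    · exact ⟨-1, by simp, hc⟩
    · exact ⟨2, by simpa using h2, hc⟩
    · exact ⟨-2, by simpa using h2, hc⟩
  rw [hc, List.map_singleton, List.sum_singleton, pow_zero, Module.End.one_apply] at hd
  exact (Submodule.smul_mem_iff I hc0).1 hd

theorem fam_one_zero : fam K 1 0 = mono K 1 ∅ := by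
  rw [← eval_famEval, show famEval 1 0 = [(1, 0, 1)] by decide +kernel, eval_cons, eval_nil,
    add_zero, termValue, bits_zero]
  simp [uFactor]

theorem fam_zero_zero : fam K 0 0 = mono K 0 ∅ := by
  rw [← eval_famEval, show famEval 0 0 = [(0, 0, 1)] by decide +kernel, eval_cons, eval_nil,
    add_zero, termValue, bits_zero]
  simp [uFactor]

theorem dT_pow_fam_mem {I : Submodule K (DPAlg K)} {a j : ℕ} (h : ∀ b < a, fam K b j ∈ I) {n : ℕ}
    (hn : n ≠ 0) : ((dT K) ^ n) (fam K a j) ∈ I := by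
  induction n generalizing a with
  | zero => exact absurd rfl hn
  | succ n ih =>
    rw [pow_succ, Module.End.mul_apply]
    cases a with
    | zero => rw [dT_fam_zero, map_zero]; exact zero_mem _
    | succ a =>
      rw [dT_fam_succ]
      by_cases h0 : n = 0
      · subst h0; exact h a (Nat.lt_succ_self a)
      · exact ih (fun b hb => h b (by omega)) h0

/-- An ideal that contains `1` contains all `∂_t f`, hence every `fam a j` with `a` below the top
exponent, and in particular `t`. At the top exponent the highest family is obtained from the grading
element `t`, and the other fifteen from it by `fam_mem_of_stable`. -/
theorem isSimple_bjN [CharP K 3] {N : ℕ} (hN : 1 ≤ N) : IsSimpleLieSuperalgebra (bjN K N) := by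
  have h3 : (3 : K) = 0 := three_eq_zero
  have h2 := two_ne_zero_of_three h3
  have hpow : 3 ≤ 3 ^ N := le_trans (by norm_num) (Nat.pow_le_pow_right (by norm_num : 0 < 3) hN)
  have hmem : ∀ {a : ℕ} (j : Fin 16), a < 3 ^ N → fam K a j ∈ bjN K N := fun j h =>
    fam_mem_famSpan h
  have hone : mono K 0 ∅ ∈ bjN K N := by
    rw [← fam_zero_zero]; exact hmem 0 (by omega)
  have ht : mono K 1 ∅ ∈ bjN K N := by
    rw [← fam_one_zero]; exact hmem 0 (by omega)
  refine ⟨isLieSuperalgebra_of_closed h2 (bracketClosed_bjN hN) (sup_par_of_graded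
    (graded_famSpan _)), ⟨_, hone, _, ht, ?_⟩, fun I hle _ hI => ?_⟩
  · change contactBr K _ _ ≠ 0
    rw [contactBr_one, show dT K (mono K 1 ∅) = mono K 0 ∅ from dT_mono_succ 0 ∅]
    exact smul_ne_zero h2 (by simp [mono])
  · refine or_iff_not_imp_left.2 fun hbot => le_antisymm hle ?_
    have hstable : ∀ i, ∀ f ∈ I, dOp K i f ∈ I := fun i f hf => by
      rw [← contactBr_theta]
      exact hI _ (contactDeg_le_famSpan h3 (Iio_three_subset hN) (by norm_num)
        (theta_mem_contactDeg i)) f hf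
    have h1 := one_mem_of_dOp_stable h2 hbot hstable
    have hlow : ∀ (a : ℕ) (j : Fin 16), a + 1 < 3 ^ N → fam K a j ∈ I := fun a j ha => by
      rw [← dT_fam_succ]
      exact dT_mem_of_ideal h2 hI h1 (hmem j ha) (fam_mem_contactDeg j.2 _)
    have htI : mono K 1 ∅ ∈ I := by
      rw [← fam_one_zero]; exact hlow 1 0 (by omega)
    -- Its degree is `2 (3 ^ N - 1) + 3 - 2 = 2 · 3 ^ N - 1`, which is `-1` in `K` and hence
    -- nonzero.
    have h15 : fam K (3 ^ N - 1) 15 ∈ I := by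
      refine contactDeg_smul_mem_of_ideal hI htI (hmem 15 (by omega)) (fam_mem_contactDeg
        (by norm_num) _) ?_
      rw [famDeg, show bitCard (famLead 15) = 3 by decide]
      push_cast [Nat.cast_sub (show 1 ≤ 3 ^ N by omega)]
      rw [h3, zero_pow (by omega)]
      intro h
      exact one_ne_zero (α := K) (by linear_combination -h - h3)
    refine Submodule.span_le.2 ?_
    rintro _ ⟨⟨a, j⟩, ha, rfl⟩
    have ha : a < 3 ^ N := ha
    rcases Nat.lt_or_ge (a + 1) (3 ^ N) with h | h
    · exact hlow a j h
    · obtain rfl : a = 3 ^ N - 1 := by omega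
      exact fam_mem_of_stable h3 hstable (fun j hj n hn =>
        dT_pow_fam_mem (fun b hb => hlow b ⟨j, hj⟩ (by omega)) hn) h15 j.2

/-! ### Superdimensions -/

theorem finrank_span_image {V ι : Type*} [AddCommGroup V] [Module K V] {v : ι → V}
    (hv : LinearIndependent K v) (s : Finset ι) :
    Module.finrank K (Submodule.span K (v '' (s : Set ι))) = s.card := by
  have := finrank_span_eq_card (hv.comp (Subtype.val : s → ι) Subtype.val_injective)
  rw [Set.range_comp, Subtype.range_coe_subtype, Fintype.card_coe] at this
  exact this

theorem finrank_famSpan (h3 : (3 : K) = 0) (s : Finset (ℕ × Fin 16)) :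
    Module.finrank K (famSpan K s) = s.card :=
  finrank_span_image (v := fun q : ℕ × Fin 16 => fam K q.1 q.2) (linearIndependent_fam h3) s

theorem famSpan_inf_par (h3 : (3 : K) = 0) (s : Set (ℕ × Fin 16)) (i : ZMod 2) :
    famSpan K s ⊓ (par (R := K) i : Submodule K (DPAlg K)) =
      famSpan K (s ∩ {q | ((bitCard (famLead q.2) : ℕ) : ZMod 2) = i}) := by
  refine le_antisymm ?_ (le_inf (famSpan_mono Set.inter_subset_left) (Submodule.span_le.2 ?_))
  · rintro f ⟨hf, hk⟩
    refine (mem_famSpan_iff h3 hf).2 fun a j hq => ?_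
    rw [Set.mem_inter_iff, not_and_or] at hq
    rcases hq with hq | hq
    · exact famDual_eq_zero h3 hf hq
    · rw [famDual_apply, (Finsupp.mem_supported' K f).1 hk, mul_zero]
      rw [Set.mem_ofPred_eq, card_bits]
      exact hq
  · rintro _ ⟨q, ⟨-, rfl⟩, rfl⟩
    have := par_of_contactDeg (fam_mem_contactDeg (K := K) q.2.2 q.1)
    rw [famDeg] at this
    push_cast at this
    rw [show (2 : ZMod 2) = 0 from rfl, zero_mul, zero_add, sub_zero] at this
    exact this

/-- Eight of the sixteen leading products of odd variables have even length and eight have odd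
length; each family contributes `3 ^ N` elements. -/
theorem hasSdim_bjN [CharP K 3] (N : ℕ) : HasSdim (bjN K N) (8 * 3 ^ N) (8 * 3 ^ N) := by
  have h3 : (3 : K) = 0 := three_eq_zero
  have e : ∀ i : ZMod 2, expSet (Set.Iio (3 ^ N)) ∩ {q | ((bitCard (famLead q.2) : ℕ) : ZMod 2) = i} =
      ((Finset.range (3 ^ N) ×ˢ Finset.univ.filter fun j : Fin 16 =>
        ((bitCard (famLead j) : ℕ) : ZMod 2) = i : Finset (ℕ × Fin 16)) : Set (ℕ × Fin 16)) := by
    intro i; ext q; simp [expSet]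
  have hc : ∀ i : ZMod 2, (Finset.univ.filter fun j : Fin 16 =>
      ((bitCard (famLead j) : ℕ) : ZMod 2) = i).card = 8 := by decide +kernel
  have hr : ∀ i : ZMod 2, Module.finrank K (bjN K N ⊓ par i : Submodule K (DPAlg K)) = 8 * 3 ^ N := by
    intro i
    rw [bjN, famSpan_inf_par h3, e]
    rw [finrank_famSpan h3, Finset.card_product, hc, Finset.card_range, mul_comm]
  refine ⟨?_, hr 0, hr 1⟩
  rw [bjN, famSpan]
  refine FiniteDimensional.span_of_finite K (Set.Finite.image _ ?_)
  refine ((Finset.range (3 ^ N) ×ˢ (Finset.univ : Finset (Fin 16))).finite_toSet).subset fun q hq => ?_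
  simpa [expSet] using hq

end Simple

end SuperLie
end

noncomputable section

namespace SuperLie

open SuperBracket

/-! ### Multiplication tables in characteristic three -/

/-- The bracket of two basis elements is the given combination modulo 3. -/
def brCheck (k l : ℕ) (r : List (ℕ × ℤ)) : Bool :=
  Code.isZeroMod 3 (Code.br (bas k) (bas l) ++ r.flatMap fun e => Code.smul (-e.2) (bas e.1))

/-- Iterated brackets with basis elements. -/
def Code.adList (l : List ℕ) (z : Code) : Code :=
  l.foldl (fun z k => Code.clean (Code.br (bas k) z)) z

/-- Operators that isolate a coordinate in degree one, and the resulting coefficient. -/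
def isolateList : List (ℕ × List ℕ) :=
  [(17, [2, 2, 3]), (20, [3, 3, 2]), (6, [9, 9, 11]), (25, [11, 11, 9]), (0, [12, 12, 14]),
    (27, [14, 14, 12]), (19, [2, 3, 3, 2])]

/-- As weights of `𝔤(2)`, the seven vectors of degree one have the short roots and zero as weights,
with element 19 in weight zero. A root vector for a short root `α` applied twice survives only on
weight `-α`; the opposite root vector then leads back to weight zero. For element 19 itself the word
goes up, down twice, and up again. -/
theorem isolate_check : (isolateList.all fun q => isolateList.all fun s =>
    if q.1 = s.1 then
      Code.isZeroMod 3 (Code.adList q.2 (bas s.1) ++ bas 19) ||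
      Code.isZeroMod 3 (Code.adList q.2 (bas s.1) ++ Code.smul (-1) (bas 19))
    else Code.isZeroMod 3 (Code.adList q.2 (bas s.1))) = true := by decide +kernel

theorem spread_check : ([(3, 17, -1), (2, 20, -1), (11, 6, -1), (9, 25, -1), (14, 0, 1),
    (12, 27, 1)].all fun q : ℕ × ℕ × ℤ => brCheck q.1 19 [(q.2.1, q.2.2)]) = true := by
  decide +kernel

/-- The basis elements of degree zero as brackets. -/
theorem bracket_check : ([(0, 8, [(3, 1)]), (0, 18, [(11, 1)]), (0, 22, [(14, 1)]), (0, 1, [(7, 1)]),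
    (6, 1, [(2, -1)]), (17, 1, [(9, -1)]), (19, 1, [(12, -1)]), (6, 8, [(7, -1), (10, 1)])].all
      fun q : ℕ × ℕ × List (ℕ × ℤ) => brCheck q.1 q.2.1 q.2.2) = true := by decide +kernel

theorem cubic_check : ([2, 3, 7, 9, 10, 11, 12, 14].all fun k =>
    Code.isZeroMod 3 (Code.br (bas k) cubicCode ++
      Code.smul (-Code.coeff (Code.br (bas k) cubicCode) 0 7) cubicCode)) = true := by decide +kernel

theorem pivot_cubic_check : ((List.range 31).all fun k =>
    decide (basDeg k = 1 → pivotVal k cubicCode = 0)) = true := by decide +kernel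

/-- The lowest and the highest basis element bracket to `t` up to sign. An ideal that contains `1`
thus contains the grading element, and the sign is irrelevant. -/
theorem grading_check : Code.isZeroMod 3 (Code.br (bas 30) (bas 29) ++ [(1, 0, 1)]) = true ∨
    Code.isZeroMod 3 (Code.br (bas 30) (bas 29) ++ [(1, 0, -1)]) = true := by decide +kernel

section BJ

variable {K : Type*} [Field K]

theorem contactBr_of_brCheck (h3 : (3 : K) = 0) {k l : ℕ} {r : List (ℕ × ℤ)}
    (h : brCheck k l r = true) : contactBr K (basElt K k) (basElt K l) =
      (r.map fun e => (e.2 : K) • basElt K e.1).sum := by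
  have h := eval_eq_zero (K := K) (n := 3) (by exact_mod_cast h3) h
  rw [eval_append, eval_br (two_ne_zero_of_three h3), eval_flatMap] at h
  refine (eq_neg_of_add_eq_zero_left h).trans ?_
  clear h ‹brCheck k l r = true›
  induction r with
  | nil => simp
  | cons e r ih =>
    rw [List.map_cons, List.sum_cons, neg_add, ih, List.map_cons, List.sum_cons, eval_smul,
      Int.cast_neg, neg_smul, neg_neg]
    rfl

variable (K) in
/-- The partial prolong. -/
def bjAlg : Submodule K (DPAlg K) := basSpan K bjSet

variable (K) in
/-- The seven-dimensional component of degree one. -/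
def degOne : Submodule K (DPAlg K) := basSpan K {k | basDeg k = 1}

theorem basElt_mem_basSpan {s : Set (Fin 31)} {k : ℕ} (hk : k < 31)
    (h : (⟨k, hk⟩ : Fin 31) ∈ s) : basElt K k ∈ basSpan K s :=
  Submodule.subset_span ⟨_, h, rfl⟩

theorem bjSet_inter {d : ℤ} (hd : d ≠ 0) :
    bjSet ∩ {k | basDeg k = d} = {k : Fin 31 | basDeg k = d} := by
  refine Set.inter_eq_right.2 fun l hl => mem_bjSet_of_basDeg l ?_
  rw [show basDeg l = d from hl]; exact hd

theorem bracketClosed_bjAlg (h3 : (3 : K) = 0) : BracketClosed (bjAlg K) := by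
  have h2 := two_ne_zero_of_three h3
  intro f hf g hg
  refine basSpan_induction₂ (fun k hk l hl => ?_) hf hg
  have hB : ∀ {k : Fin 31}, k ∈ bjSet → basElt K k ∈ famSpan K (expSet Set.univ) := fun hk =>
    famSpan_mono (fun q _ => Set.mem_univ q.1) (basElt_mem_famSpan h3 hk)
  have h := contactBr_mem_famSpan h3 (hB hk) (hB hl)
  have hd := contactBr_mem_contactDeg (basElt_mem_contactDeg (K := K) k.2) (basElt_mem_contactDeg l.2)
  rcases eq_or_ne (basDeg k + basDeg l) 0 with h0 | h0
  · rw [h0] at hd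
    exact basSpan_mono Set.inter_subset_left
      ((famSpan_inf_contactDeg_of_nonpos h3 (Set.subset_univ _) le_rfl).le ⟨h, hd⟩)
  · have hu := bracketClosed_basSpan_univ h2 _ (basElt_mem_basSpan k.2 (Set.mem_univ k)) _
      (basElt_mem_basSpan l.2 (Set.mem_univ l))
    have := (basSpan_inf_contactDeg h2 _ _).le ⟨hu, hd⟩
    rw [Set.univ_inter, ← bjSet_inter h0] at this
    exact basSpan_mono Set.inter_subset_left this

theorem basSpan_zero_eq_span (h3 : (3 : K) = 0) : Submodule.span K {z | ∃ x ∈ degOne K,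
    ∃ y ∈ basSpan K {k | basDeg k = -1}, z = contactBr K x y} =
      basSpan K (bjSet ∩ {k | basDeg k = 0}) := by
  refine le_antisymm (Submodule.span_le.2 ?_) (Submodule.span_le.2 ?_)
  · rintro _ ⟨x, hx, y, hy, rfl⟩
    have hle : ∀ {d : ℤ}, d ≠ 0 → basSpan K {k | basDeg k = d} ≤ bjAlg K := fun hd => by
      rw [← bjSet_inter hd]; exact basSpan_mono Set.inter_subset_left
    have h := bracketClosed_bjAlg h3 x (hle (by norm_num) hx) y (hle (by norm_num) hy)
    have hd := contactBr_mem_contactDeg (basSpan_le_contactDeg _ hx) (basSpan_le_contactDeg _ hy)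
    exact (basSpan_inf_contactDeg (two_ne_zero_of_three h3) _ _).le ⟨h, hd⟩
  · set Z := Submodule.span K {z | ∃ x ∈ degOne K,
      ∃ y ∈ basSpan K {k | basDeg k = -1}, z = contactBr K x y}
    have hb : ∀ {k l : ℕ} {r : List (ℕ × ℤ)} (hk : k < 31) (hl : l < 31), basDeg k = 1 →
        basDeg l = -1 → brCheck k l r = true → (r.map fun e => (e.2 : K) • basElt K e.1).sum ∈ Z :=
      fun {k l r} hk hl hk1 hl1 h => by
        rw [← contactBr_of_brCheck h3 h]
        exact Submodule.subset_span ⟨_, basElt_mem_basSpan hk hk1, _, basElt_mem_basSpan hl hl1, rfl⟩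
    have hc := bracket_check
    simp only [List.all_cons, List.all_nil, Bool.and_true, Bool.and_eq_true] at hc
    obtain ⟨c3, c11, c14, c7, c2, c9, c12, c10⟩ := hc
    have c3 := hb (by norm_num) (by norm_num) (by decide) (by decide) c3
    have c11 := hb (by norm_num) (by norm_num) (by decide) (by decide) c11
    have c14 := hb (by norm_num) (by norm_num) (by decide) (by decide) c14
    have c7 := hb (by norm_num) (by norm_num) (by decide) (by decide) c7
    have c2 := hb (by norm_num) (by norm_num) (by decide) (by decide) c2
    have c9 := hb (by norm_num) (by norm_num) (by decide) (by decide) c9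
    have c12 := hb (by norm_num) (by norm_num) (by decide) (by decide) c12
    have c10 := hb (by norm_num) (by norm_num) (by decide) (by decide) c10
    simp only [List.map_cons, List.map_nil, List.sum_cons, List.sum_nil, add_zero, Int.cast_one,
      Int.cast_neg, one_smul, neg_smul, neg_mem_iff] at c3 c11 c14 c7 c2 c9 c12 c10
    -- `H_2` is reached only in the combination `-H_1 + H_2`, so it is separated with the help of
    -- `H_1`.
    have c10 := (Submodule.add_mem_iff_right Z (neg_mem c7)).1 c10
    rintro _ ⟨k, ⟨hk, hd⟩, rfl⟩
    have : ∀ k : Fin 31, k ∈ bjSet → basDeg k = 0 →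
        (k : ℕ) ∈ [3, 11, 14, 7, 2, 9, 12, 10] := by decide +kernel
    have := this k hk hd
    simp only [List.mem_cons, List.not_mem_nil, or_false] at this
    dsimp only
    rcases this with h | h | h | h | h | h | h | h <;> rw [h] <;> assumption

theorem contactBr_basSpan_mem_degOne (h2 : (2 : K) ≠ 0) {d e : ℤ} (h : d + e = 1) {f g : DPAlg K}
    (hf : f ∈ basSpan K {k | basDeg k = d}) (hg : g ∈ basSpan K {k | basDeg k = e}) :
    contactBr K f g ∈ degOne K := by
  have hu := bracketClosed_basSpan_univ h2 _ (basSpan_mono (Set.subset_univ _) hf) _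
      (basSpan_mono (Set.subset_univ _) hg)
  have hd := contactBr_mem_contactDeg (basSpan_le_contactDeg _ hf) (basSpan_le_contactDeg _ hg)
  have := (basSpan_inf_contactDeg h2 _ _).le ⟨hu, hd⟩
  rwa [Set.univ_inter, h] at this

/-- The components of the partial prolong. -/
theorem partialComp_bjN [CharP K 3] {N : ℕ} (hN : 1 ≤ N) (n : ℕ) :
    partialComp (bjN K N) (degOne K) n = basSpan K {k | basDeg k = (n : ℤ) + 1} := by
  have h3 : (3 : K) = 0 := three_eq_zero
  have h2 := two_ne_zero_of_three h3
  induction n with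
  | zero => rw [partialComp, degOne, Nat.cast_zero, zero_add]
  | succ n ih =>
    refine le_antisymm ?_ ?_
    · rintro D ⟨⟨-, hD⟩, h⟩
      have hd : ∀ i, dOp K i D ∈ basSpan K {k | basDeg k = (n : ℤ) + 1} := fun i => by
        rw [← ih, ← contactBr_theta, contactBr_skew (theta_mem_contactDeg i) hD]
        exact neg_mem (zsmul_mem (h _ ⟨contactDeg_le_famSpan h3 (Iio_three_subset hN) (by norm_num)
          (theta_mem_contactDeg i), theta_mem_contactDeg i⟩) _)
      have hu := fun i => basSpan_mono (Set.subset_univ _) (hd i)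
      -- The stage `n + 1` has degree `n + 2`. With the cubic excluded in degree one, all `dOp i D`
      -- lie in `𝔤`, so degrees two and three are governed by the linear systems, and beyond that
      -- all `dOp i D` vanish.
      match n with
      | 0 => exact mem_of_dOp_mem_two h2 hD hu
      | 1 => rw [eq_zero_of_dOp_mem_three h2 hD hu]; exact zero_mem _
      | n + 2 =>
        rw [eq_zero_of_dOp_eq_zero h2 (by omega) hD fun i => ?_]
        · exact zero_mem _
        · have := hd i
          rwa [basSpan_of_two_lt (by push_cast; omega), Submodule.mem_bot] at this
    · rcases Nat.lt_or_ge n 1 with h0 | h0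
      swap
      · rw [basSpan_of_two_lt (by push_cast; omega)]; exact bot_le
      obtain rfl : n = 0 := by omega
      intro D hD
      have hD2 : D ∈ basSpan K {k | basDeg k = 2} := hD
      refine ⟨⟨?_, basSpan_le_contactDeg 2 hD2⟩, fun x hx => ?_⟩
      · rw [← bjSet_inter two_ne_zero] at hD2
        exact basSpan_le_famSpan h3 (Iio_three_subset hN) (basSpan_mono Set.inter_subset_left hD2)
      · rw [ih]
        have hx := hx.2
        rw [← basSpan_neg h2 (by norm_num)] at hx
        exact contactBr_basSpan_mem_degOne h2 (by norm_num) hD2 hx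

theorem bjAlg_eq_partialProlong [CharP K 3] {N : ℕ} (hN : 1 ≤ N) :
    bjAlg K = partialProlong (bjN K N) (degOne K) := by
  have h3 : (3 : K) = 0 := three_eq_zero
  have hnp : ∀ k ≤ 0, bjN K N ⊓ contactDeg K k = basSpan K (bjSet ∩ {l | basDeg l = k}) :=
    fun k hk => famSpan_inf_contactDeg_of_nonpos h3 (Iio_three_subset hN) hk
  refine le_antisymm (Submodule.span_le.2 ?_) (sup_le (iSup₂_le fun k hk => ?_) (iSup_le fun n => ?_))
  · rintro _ ⟨k, hk, rfl⟩
    rcases le_or_gt (basDeg k) 0 with h | h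
    · refine Submodule.mem_sup_left ?_
      refine Submodule.mem_iSup_of_mem (basDeg k) (Submodule.mem_iSup_of_mem h ?_)
      rw [hnp _ h]
      exact Submodule.subset_span ⟨k, ⟨hk, rfl⟩, rfl⟩
    · refine Submodule.mem_sup_right (Submodule.mem_iSup_of_mem (basDeg k - 1).toNat ?_)
      rw [partialComp_bjN hN]
      refine Submodule.subset_span ⟨k, ?_, rfl⟩
      change basDeg k = _
      omega
  · rw [hnp k hk]; exact basSpan_mono Set.inter_subset_left
  · rw [partialComp_bjN hN, ← bjSet_inter (show (n : ℤ) + 1 ≠ 0 by omega)]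
    exact basSpan_mono Set.inter_subset_left

/-- A nonzero ideal contains `1`, hence `t` as the bracket of `1` with the highest element up to
sign. The degrees `±1` and `±2` are nonzero in `K`, so all components outside degree zero follow;
degree zero is spanned by brackets of degrees `1` and `-1`. -/
theorem isSimple_bjAlg (h3 : (3 : K) = 0) : IsSimpleLieSuperalgebra (bjAlg K) := by
  have h2 := two_ne_zero_of_three h3
  have hle : ∀ {d : ℤ}, d ≠ 0 → basSpan K {k | basDeg k = d} ≤ bjAlg K := fun hd => by
    rw [← bjSet_inter hd]; exact basSpan_mono Set.inter_subset_left
  have hneg : ∀ {d : ℤ}, d < 0 → contactDeg K d ≤ bjAlg K := fun hd => by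
    rw [← basSpan_neg h2 hd]; exact hle hd.ne
  have hb : ∀ {k : ℕ} (hk : k < 31), basDeg k ≠ 0 → basElt K k ∈ bjAlg K := fun hk h =>
    hle h (basElt_mem_basSpan hk rfl)
  have h30 : basElt K 30 = mono K 0 ∅ := by
    rw [basElt, show bas 30 = [(0, 0, 1)] from rfl, eval_cons, eval_nil, add_zero, termValue,
      bits_zero]
    simp [uFactor]
  have ht : (2 : K) • dT K (basElt K 29) = mono K 1 ∅ ∨ (2 : K) • dT K (basElt K 29) = -mono K 1 ∅ := by
    rw [← contactBr_one, ← h30, basElt, basElt, ← eval_br h2]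
    have e : ∀ c : ℤ, eval K [(1, 0, c)] = (c : K) • mono K 1 ∅ := fun c => by
      rw [eval_cons, eval_nil, add_zero, termValue, bits_zero]; simp [uFactor]
    rcases grading_check with h | h
    · right
      have h := eval_eq_zero (K := K) (n := 3) (by exact_mod_cast h3) h
      rw [eval_append, e, Int.cast_one, one_smul] at h
      exact eq_neg_of_add_eq_zero_left h
    · left
      have h := eval_eq_zero (K := K) (n := 3) (by exact_mod_cast h3) h
      rw [eval_append, e, Int.cast_neg, Int.cast_one, neg_smul, one_smul, ← sub_eq_add_neg,
        sub_eq_zero] at h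
      exact h
  have ht0 : (mono K 1 ∅ : DPAlg K) ≠ 0 := by simp [mono]
  refine ⟨isLieSuperalgebra_of_closed h2 (bracketClosed_bjAlg h3) (sup_par_of_graded
    (graded_basSpan _)), ⟨_, hb (k := 30) (by norm_num) (by decide), _,
      hb (k := 29) (by norm_num) (by decide), ?_⟩, fun I hIle _ hI => ?_⟩
  · change contactBr K _ _ ≠ 0
    rw [h30, contactBr_one]
    rcases ht with ht | ht <;> rw [ht]
    · exact ht0
    · exact neg_ne_zero.2 ht0
  · refine or_iff_not_imp_left.2 fun hbot => le_antisymm hIle ?_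
    have h1 : mono K 0 ∅ ∈ I := one_mem_of_dOp_stable h2 hbot fun i f hf => by
      rw [← contactBr_theta]
      exact hI _ (hneg (by norm_num) (theta_mem_contactDeg i)) f hf
    have htI : mono K 1 ∅ ∈ I := by
      have h := Submodule.smul_mem I (2 : K) (dT_mem_of_ideal h2 hI h1 (hb (k := 29) (by norm_num)
        (by decide)) (basElt_mem_contactDeg (by norm_num)))
      rcases ht with ht | ht <;> rw [ht] at h
      · exact h
      · exact neg_mem_iff.1 h
    have hne : ∀ {k : ℕ} (hk : k < 31), basDeg k ≠ 0 → basElt K k ∈ I := fun {k} hk h => by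
      refine contactDeg_smul_mem_of_ideal hI htI (hb hk h) (basElt_mem_contactDeg hk) ?_
      have := basDeg_range ⟨k, hk⟩
      generalize basDeg k = d at h this
      obtain rfl | rfl | rfl | rfl : d = -2 ∨ d = -1 ∨ d = 1 ∨ d = 2 := by omega
      all_goals simp [h2]
    refine Submodule.span_le.2 ?_
    rintro _ ⟨k, hk, rfl⟩
    by_cases h : basDeg k = 0
    · have hk : basElt K k ∈ basSpan K (bjSet ∩ {k | basDeg k = 0}) :=
        Submodule.subset_span ⟨k, ⟨hk, h⟩, rfl⟩
      rw [← basSpan_zero_eq_span h3] at hk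
      refine Submodule.span_le.2 ?_ hk
      rintro _ ⟨x, hx, y, hy, rfl⟩
      refine hI x (hle (by norm_num) hx) y (Submodule.span_le.2 ?_ hy)
      rintro _ ⟨l, hl, rfl⟩
      exact hne l.2 (by rw [show basDeg l = -1 from hl]; norm_num)
    · exact hne k.2 h

theorem basSpan_inf_par (h2 : (2 : K) ≠ 0) (s : Set (Fin 31)) (i : ZMod 2) :
    basSpan K s ⊓ (par (R := K) i : Submodule K (DPAlg K)) =
      basSpan K (s ∩ {k | ((basDeg k : ℤ) : ZMod 2) = i}) := by
  refine le_antisymm ?_ (le_inf (basSpan_mono Set.inter_subset_left) (Submodule.span_le.2 ?_))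
  · rintro f ⟨hs, hd⟩
    obtain ⟨c, rfl⟩ := exists_of_mem_basSpan hs
    refine (mem_basSpan_iff h2).2 fun k hk => ?_
    rw [Set.mem_inter_iff, not_and_or] at hk
    rcases hk with hk | hk
    · exact (mem_basSpan_iff h2).1 hs k hk
    · have := pivotFun_of_par k.2 hk hd
      rw [pivotFun_sum] at this
      exact (mul_eq_zero.1 this).resolve_right (pivotDen_ne_zero h2 k.2)
  · rintro _ ⟨k, ⟨-, rfl⟩, rfl⟩
    exact basElt_mem_par k.2

theorem finrank_basSpan (h2 : (2 : K) ≠ 0) (s : Finset (Fin 31)) :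
    Module.finrank K (basSpan K s) = s.card :=
  finrank_span_image (v := fun k : Fin 31 => basElt K k) (linearIndependent_basElt h2) s

theorem hasSdim_bjAlg (h3 : (3 : K) = 0) : HasSdim (bjAlg K) 10 14 := by
  have h2 := two_ne_zero_of_three h3
  have e : ∀ i : ZMod 2, Module.finrank K (bjAlg K ⊓ par i : Submodule K (DPAlg K)) =
      (Finset.univ.filter fun k : Fin 31 => k ∈ bjSet ∧ ((basDeg k : ℤ) : ZMod 2) = i).card := by
    intro i
    rw [bjAlg, basSpan_inf_par h2, ← finrank_basSpan h2, Finset.coe_filter_univ]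
    rfl
  refine ⟨FiniteDimensional.span_of_finite K (Set.toFinite _), ?_, ?_⟩
  · rw [e]; decide +kernel
  · rw [e]; decide +kernel

/-! ### The component of degree one -/

theorem degOne_eq : degOne K = basSpan K (({0, 6, 17, 19, 20, 25, 27} : Finset (Fin 31)) :
    Set (Fin 31)) := by
  rw [degOne]
  congr 1
  ext k
  have : ∀ k : Fin 31, basDeg k = 1 ↔ k ∈ ({0, 6, 17, 19, 20, 25, 27} : Finset (Fin 31)) := by
    decide +kernel
  exact this k

theorem finrank_degOne (h2 : (2 : K) ≠ 0) : Module.finrank K (degOne K) = 7 := by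
  rw [degOne_eq, finrank_basSpan h2]; rfl

theorem cubic_ne_zero (h3 : (3 : K) = 0) : eval K cubicCode ≠ 0 := fun h =>
  dOp_cubic_ne_zero h3 0 (by rw [h, map_zero])

theorem finrank_cubic (h3 : (3 : K) = 0) :
    Module.finrank K (Submodule.span K {eval K cubicCode}) = 1 :=
  finrank_span_singleton (cubic_ne_zero h3)

theorem disjoint_cubic_degOne (h3 : (3 : K) = 0) :
    Disjoint (Submodule.span K {eval K cubicCode}) (degOne K) := by
  have h2 := two_ne_zero_of_three h3
  rw [Submodule.disjoint_def]
  intro f hf hd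
  obtain ⟨c, rfl⟩ := Submodule.mem_span_singleton.1 hf
  obtain ⟨d, hd'⟩ := exists_of_mem_basSpan hd
  rw [hd'] at hd ⊢
  refine Finset.sum_eq_zero fun k _ => ?_
  by_cases hk : basDeg k = 1
  · have := congrArg (pivotFun K k) hd'
    rw [pivotFun_sum, map_smul, pivotFun_eval,
      of_decide_eq_true (all_range pivot_cubic_check k.2) hk, Int.cast_zero, smul_zero] at this
    rw [(mul_eq_zero.1 this.symm).resolve_right (pivotDen_ne_zero h2 k.2), zero_smul]
  · rw [(mem_basSpan_iff h2).1 hd k hk, zero_smul]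

theorem irreducible_cubic (h3 : (3 : K) = 0) :
    IrreducibleUnder (basSpan K (bjSet ∩ {k | basDeg k = 0}))
      (Submodule.span K {eval K cubicCode}) := by
  have h2 := two_ne_zero_of_three h3
  refine ⟨fun x hx v hv => ?_, fun h => cubic_ne_zero h3 (Submodule.span_singleton_eq_bot.1 h),
    fun W hW _ => (nonzero_span_atom _ (cubic_ne_zero h3)).le_iff.1 hW⟩
  refine bracketClosed_of_span hx (T := Submodule.span K {eval K cubicCode}) (fun k hk g hg => ?_) hv
  obtain ⟨c, rfl⟩ := Submodule.mem_span_singleton.1 hg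
  have : ∀ k : Fin 31, k ∈ bjSet → basDeg k = 0 →
      (k : ℕ) ∈ [2, 3, 7, 9, 10, 11, 12, 14] := by decide +kernel
  have h := eval_eq_zero (K := K) (n := 3) (by exact_mod_cast h3)
    (List.all_eq_true.1 cubic_check _ (this k hk.1 hk.2))
  rw [eval_append, eval_br h2, eval_smul] at h
  rw [map_smul]
  refine Submodule.smul_mem _ c ?_
  change contactBr K (eval K (bas k)) _ ∈ _
  rw [eq_neg_of_add_eq_zero_left h]
  exact neg_mem (Submodule.smul_mem _ _ (Submodule.mem_span_singleton_self _))

theorem eval_adList (h2 : (2 : K) ≠ 0) (l : List ℕ) (z : Code) : eval K (Code.adList l z) =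
    l.foldl (fun f k => contactBr K (basElt K k) f) (eval K z) := by
  induction l generalizing z with
  | nil => rfl
  | cons k l ih =>
    have := ih (Code.clean (Code.br (bas k) z))
    rw [eval_clean, eval_br h2] at this
    exact this

/-- Take a nonzero vector of a submodule and one of its nonzero coordinates. The isolating word for
that coordinate kills all others and produces element 19 up to a factor; the root vectors then
spread element 19 to the remaining six weights. -/
theorem irreducible_degOne (h3 : (3 : K) = 0) :
    IrreducibleUnder (basSpan K (bjSet ∩ {k | basDeg k = 0})) (degOne K) := by
  have h2 := two_ne_zero_of_three h3
  have hidx : ∀ k : Fin 31, basDeg k = 1 → ∃ q ∈ isolateList, q.1 = k := by decide +kernel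
  have hops : ∀ q ∈ isolateList, ∀ i ∈ q.2, ∃ k : Fin 31, (k : ℕ) = i ∧ k ∈ bjSet ∧ basDeg k = 0 := by
    decide +kernel
  refine ⟨fun x hx v hv => contactBr_basSpan_mem_degOne h2 (zero_add 1)
    (basSpan_mono Set.inter_subset_right hx) hv, fun h => ?_, fun W hW hs => ?_⟩
  · have := finrank_degOne h2
    rw [h, finrank_bot] at this
    exact absurd this (by norm_num)
  refine or_iff_not_imp_left.2 fun hbot => le_antisymm hW ?_
  have hop : ∀ {k : ℕ} (hk : k < 31), (⟨k, hk⟩ : Fin 31) ∈ bjSet → basDeg k = 0 → ∀ w ∈ W,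
      contactBr K (basElt K k) w ∈ W := fun hk h h0 w hw =>
    hs _ (basElt_mem_basSpan hk ⟨h, h0⟩) w hw
  obtain ⟨w, hw, hne⟩ := Submodule.exists_mem_ne_zero_of_ne_bot hbot
  obtain ⟨c, rfl⟩ := exists_of_mem_basSpan (hW hw)
  have hc := (mem_basSpan_iff h2).1 (hW hw)
  obtain ⟨k, hk⟩ : ∃ k, c k ≠ 0 := by
    by_contra! h
    exact hne (Finset.sum_eq_zero fun k _ => by rw [h k, zero_smul])
  have hk1 : basDeg k = 1 := by by_contra h; exact hk (hc k h)
  obtain ⟨⟨k', l⟩, hq, rfl⟩ := hidx k hk1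
  have hfold : ∀ l : List ℕ, (∀ i ∈ l, ∃ k : Fin 31, (k : ℕ) = i ∧ k ∈ bjSet ∧ basDeg k = 0) →
      ∃ A : DPAlg K →ₗ[K] DPAlg K, (∀ f, A f = l.foldl (fun f k => contactBr K (basElt K k) f) f) ∧
        ∀ w ∈ W, A w ∈ W := by
    intro l
    induction l with
    | nil => exact fun _ => ⟨LinearMap.id, fun f => rfl, fun w hw => hw⟩
    | cons i l ih =>
      intro h
      obtain ⟨A, hA, hAW⟩ := ih fun i hi => h i (List.mem_cons_of_mem _ hi)
      obtain ⟨k, rfl, hk, hd⟩ := h i List.mem_cons_self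
      exact ⟨A ∘ₗ contactBr K (basElt K k), fun f => hA _, fun w hw => hAW _ (hop k.2 hk hd w hw)⟩
  obtain ⟨A, hA, hAW⟩ := hfold l (hops _ hq)
  have h19 : basElt K 19 ∈ W := by
    have h := hAW _ hw
    rw [map_sum, Finset.sum_eq_single k] at h
    · have hcheck := List.all_eq_true.1 (List.all_eq_true.1 isolate_check _ hq) _ hq
      rw [if_pos rfl, Bool.or_eq_true] at hcheck
      rw [map_smul, Submodule.smul_mem_iff W hk, hA] at h
      have h := (congrArg (· ∈ W) (eval_adList (K := K) h2 l (bas k))).mpr h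
      rcases hcheck with e | e
      · have e := eval_eq_zero (K := K) (n := 3) (by exact_mod_cast h3) e
        rw [eval_append] at e
        rw [eq_neg_of_add_eq_zero_left e] at h
        exact neg_mem_iff.1 h
      · have e := eval_eq_zero (K := K) (n := 3) (by exact_mod_cast h3) e
        rw [eval_append, eval_smul, Int.cast_neg, Int.cast_one, neg_smul, one_smul] at e
        rw [add_neg_eq_zero.1 e] at h
        exact h
    · intro k₂ _ hne
      by_cases h0 : c k₂ = 0
      · rw [h0, zero_smul, map_zero]
      have hk₂ : basDeg k₂ = 1 := by by_contra h; exact h0 (hc k₂ h)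
      obtain ⟨s, hs, hs'⟩ := hidx k₂ hk₂
      have hcheck := List.all_eq_true.1 (List.all_eq_true.1 isolate_check _ hq) s hs
      rw [if_neg (by rw [hs']; exact fun h => hne (Fin.ext h.symm)), hs'] at hcheck
      have e := eval_eq_zero (K := K) (n := 3) (by exact_mod_cast h3) hcheck
      rw [eval_adList h2, ← hA] at e
      rw [map_smul, basElt, e, smul_zero]
    · simp
  have hsp := spread_check
  simp only [List.all_cons, List.all_nil, Bool.and_true, Bool.and_eq_true] at hsp
  obtain ⟨c17, c20, c6, c25, c0, c27⟩ := hsp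
  have hb : ∀ {k l : ℕ} {e : ℤ} (hk : k < 31), (⟨k, hk⟩ : Fin 31) ∈ bjSet → basDeg k = 0 →
      (e : K) ≠ 0 → brCheck k 19 [(l, e)] = true → basElt K l ∈ W := fun {k l e} hk h h0 he hb => by
    have := hop hk h h0 _ h19
    rw [contactBr_of_brCheck h3 hb, List.map_singleton, List.sum_singleton] at this
    exact (Submodule.smul_mem_iff W he).1 this
  have c17 := hb (by norm_num) (by decide) (by decide) (by simp) c17
  have c20 := hb (by norm_num) (by decide) (by decide) (by simp) c20
  have c6 := hb (by norm_num) (by decide) (by decide) (by simp) c6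
  have c25 := hb (by norm_num) (by decide) (by decide) (by simp) c25
  have c0 := hb (by norm_num) (by decide) (by decide) (by simp) c0
  have c27 := hb (by norm_num) (by decide) (by decide) (by simp) c27
  rw [degOne_eq]
  refine Submodule.span_le.2 ?_
  rintro _ ⟨k, hk, rfl⟩
  simp only [Finset.coe_insert, Finset.coe_singleton, Set.mem_insert_iff,
    Set.mem_singleton_iff] at hk
  rcases hk with rfl | rfl | rfl | rfl | rfl | rfl | rfl <;> assumption

end BJ

end SuperLie
end

noncomputable section

namespace SuperLie

open SuperBracket

/-! ### The subalgebra of short roots and the centre in characteristic three -/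

/-- The indices of the subalgebra that is generated by the short root vectors. -/
def shortSet : Set (Fin 31) := {k | (k : ℕ) ∈ [2, 3, 9, 10, 11, 12, 14]}

instance : DecidablePred (· ∈ shortSet) := fun k =>
  inferInstanceAs (Decidable ((k : ℕ) ∈ [2, 3, 9, 10, 11, 12, 14]))

/-- The nonzero brackets of the short root vectors. -/
def shortTable : List (ℕ × ℕ × List (ℕ × ℤ)) :=
  [(2, 3, [(10, 1)]), (2, 9, [(12, 1)]), (2, 10, [(2, 1)]), (2, 11, []), (2, 12, []),
    (2, 14, [(11, 1)]), (3, 9, []), (3, 10, [(3, -1)]), (3, 11, [(14, 1)]), (3, 12, [(9, 1)]),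
    (3, 14, []), (9, 10, [(9, 1)]), (9, 11, [(10, -1)]), (9, 12, []), (9, 14, [(3, 1)]),
    (10, 11, [(11, 1)]), (10, 12, [(12, 1)]), (10, 14, [(14, -1)]), (11, 12, [(2, 1)]), (11, 14, []),
    (12, 14, [(10, -1)]), (2, 2, []), (3, 3, []), (9, 9, []), (10, 10, []), (11, 11, []),
    (12, 12, []), (14, 14, [])]

theorem shortTable_check : (shortTable.all fun q => brCheck q.1 q.2.1 q.2.2) = true := by
  decide +kernel

theorem simple_root_check : brCheck 2 4 [(9, -1)] = true ∧ brCheck 3 5 [(11, -1)] = true := by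
  decide +kernel

/-- Brackets that detect the coordinates in degree zero. -/
theorem detect_check : ([(2, 16, 2), (3, 16, 3), (4, 16, 4), (5, 16, 5), (9, 16, 9), (11, 16, 11),
    (12, 10, 12), (13, 16, 13), (14, 10, 14), (15, 16, 15), (16, 4, 4), (21, 16, 21), (24, 16, 24)].all
      fun q : ℕ × ℕ × ℕ => (List.range 31).all fun k => decide (basDeg k ≠ 0) ||
        decide (strCoeff k q.2.1 q.2.2 % 3 = 0 ↔ k ≠ q.1)) = true := by decide +kernel

/-- Modulo 3 the element `H_1 + H_2` is central in degree zero: it acts on `X_2^±` and `X_3^±` by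
`±(a_12 + a_22) = ±3` and `±(a_13 + a_23) = ∓3`. -/
theorem centre_check : ((List.range 31).all fun l => decide (basDeg l ≠ 0) ||
    Code.isZeroMod 3 (Code.br (bas 7 ++ bas 10) (bas l))) = true := by decide +kernel

theorem centre_root_check : brCheck 7 2 [(2, 1)] = true ∧ brCheck 10 2 [(2, -1)] = true := by
  decide +kernel

section Short

variable {K : Type*} [Field K]

theorem contactBr_short (h3 : (3 : K) = 0) {k l : ℕ} {r : List (ℕ × ℤ)}
    (h : (k, l, r) ∈ shortTable) : contactBr K (basElt K k) (basElt K l) =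
      (r.map fun e => (e.2 : K) • basElt K e.1).sum :=
  contactBr_of_brCheck h3 (List.all_eq_true.1 shortTable_check _ h)

theorem contactBr_comm_zero {f g : DPAlg K} (hf : f ∈ contactDeg K 0) (hg : g ∈ contactDeg K 0) :
    contactBr K f g = -contactBr K g f := by
  rw [contactBr_skew hf hg, mul_zero, Int.negOnePow_zero, Units.val_one, one_zsmul]

/-- The linear combinations of the short root vectors and of their coroot. -/
def shortElt (a b c d e f h : K) : DPAlg K :=
  a • basElt K 2 + b • basElt K 9 + c • basElt K 12 + d • basElt K 3 + e • basElt K 11 +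
    f • basElt K 14 + h • basElt K 10

/-- The multiplication table in coordinates. In this form closure is evident, and the comparison
with commutators of matrices becomes a set of polynomial identities. -/
theorem contactBr_shortElt (h3 : (3 : K) = 0) (a b c d e f h a' b' c' d' e' f' h' : K) :
    contactBr K (shortElt a b c d e f h) (shortElt a' b' c' d' e' f' h') =
      shortElt (a * h' - h * a' + e * c' - c * e') (d * c' - c * d' + b * h' - h * b')
        (a * b' - b * a' + h * c' - c * h') (h * d' - d * h' + b * f' - f * b')
        (a * f' - f * a' + h * e' - e * h') (d * e' - e * d' + f * h' - h * f')
        (a * d' - d * a' + e * b' - b * e' + f * c' - c * f') := by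
  have T := fun {k l : ℕ} {r : List (ℕ × ℤ)} => contactBr_short (K := K) h3 (k := k) (l := l) (r := r)
  have hd : ∀ {k : ℕ}, k ∈ [2, 3, 9, 10, 11, 12, 14] → basElt K k ∈ contactDeg K 0 := by
    intro k hk
    have : ∀ k ∈ [2, 3, 9, 10, 11, 12, 14], k < 31 ∧ basDeg k = 0 := by decide
    rw [← (this k hk).2]
    exact basElt_mem_contactDeg (this k hk).1
  -- The table lists each pair in one order only; in degree zero the bracket is antisymmetric, which
  -- supplies the other order.
  have T' : ∀ {k l : ℕ} {r : List (ℕ × ℤ)}, (k, l, r) ∈ shortTable →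
      contactBr K (basElt K l) (basElt K k) = -(r.map fun e => (e.2 : K) • basElt K e.1).sum := by
    intro k l r hm
    have : ∀ q ∈ shortTable, q.1 ∈ [2, 3, 9, 10, 11, 12, 14] ∧
        q.2.1 ∈ [2, 3, 9, 10, 11, 12, 14] := by decide
    rw [contactBr_comm_zero (hd (this _ hm).2) (hd (this _ hm).1), contactBr_short h3 hm]
  have t1 := T (k := 2) (l := 3) (r := [(10, 1)]) (by decide)
  have t2 := T (k := 2) (l := 9) (r := [(12, 1)]) (by decide)
  have t3 := T (k := 2) (l := 10) (r := [(2, 1)]) (by decide)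
  have t4 := T (k := 2) (l := 11) (r := []) (by decide)
  have t5 := T (k := 2) (l := 12) (r := []) (by decide)
  have t6 := T (k := 2) (l := 14) (r := [(11, 1)]) (by decide)
  have t7 := T (k := 3) (l := 9) (r := []) (by decide)
  have t8 := T (k := 3) (l := 10) (r := [(3, -1)]) (by decide)
  have t9 := T (k := 3) (l := 11) (r := [(14, 1)]) (by decide)
  have t10 := T (k := 3) (l := 12) (r := [(9, 1)]) (by decide)
  have t11 := T (k := 3) (l := 14) (r := []) (by decide)
  have t12 := T (k := 9) (l := 10) (r := [(9, 1)]) (by decide)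
  have t13 := T (k := 9) (l := 11) (r := [(10, -1)]) (by decide)
  have t14 := T (k := 9) (l := 12) (r := []) (by decide)
  have t15 := T (k := 9) (l := 14) (r := [(3, 1)]) (by decide)
  have t16 := T (k := 10) (l := 11) (r := [(11, 1)]) (by decide)
  have t17 := T (k := 10) (l := 12) (r := [(12, 1)]) (by decide)
  have t18 := T (k := 10) (l := 14) (r := [(14, -1)]) (by decide)
  have t19 := T (k := 11) (l := 12) (r := [(2, 1)]) (by decide)
  have t20 := T (k := 11) (l := 14) (r := []) (by decide)
  have t21 := T (k := 12) (l := 14) (r := [(10, -1)]) (by decide)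
  have s1 := T' (k := 2) (l := 3) (r := [(10, 1)]) (by decide)
  have s2 := T' (k := 2) (l := 9) (r := [(12, 1)]) (by decide)
  have s3 := T' (k := 2) (l := 10) (r := [(2, 1)]) (by decide)
  have s4 := T' (k := 2) (l := 11) (r := []) (by decide)
  have s5 := T' (k := 2) (l := 12) (r := []) (by decide)
  have s6 := T' (k := 2) (l := 14) (r := [(11, 1)]) (by decide)
  have s7 := T' (k := 3) (l := 9) (r := []) (by decide)
  have s8 := T' (k := 3) (l := 10) (r := [(3, -1)]) (by decide)
  have s9 := T' (k := 3) (l := 11) (r := [(14, 1)]) (by decide)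
  have s10 := T' (k := 3) (l := 12) (r := [(9, 1)]) (by decide)
  have s11 := T' (k := 3) (l := 14) (r := []) (by decide)
  have s12 := T' (k := 9) (l := 10) (r := [(9, 1)]) (by decide)
  have s13 := T' (k := 9) (l := 11) (r := [(10, -1)]) (by decide)
  have s14 := T' (k := 9) (l := 12) (r := []) (by decide)
  have s15 := T' (k := 9) (l := 14) (r := [(3, 1)]) (by decide)
  have s16 := T' (k := 10) (l := 11) (r := [(11, 1)]) (by decide)
  have s17 := T' (k := 10) (l := 12) (r := [(12, 1)]) (by decide)
  have s18 := T' (k := 10) (l := 14) (r := [(14, -1)]) (by decide)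
  have s19 := T' (k := 11) (l := 12) (r := [(2, 1)]) (by decide)
  have s20 := T' (k := 11) (l := 14) (r := []) (by decide)
  have s21 := T' (k := 12) (l := 14) (r := [(10, -1)]) (by decide)
  have d2 := T (k := 2) (l := 2) (r := []) (by decide)
  have d3 := T (k := 3) (l := 3) (r := []) (by decide)
  have d9 := T (k := 9) (l := 9) (r := []) (by decide)
  have d10 := T (k := 10) (l := 10) (r := []) (by decide)
  have d11 := T (k := 11) (l := 11) (r := []) (by decide)
  have d12 := T (k := 12) (l := 12) (r := []) (by decide)
  have d14 := T (k := 14) (l := 14) (r := []) (by decide)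
  clear T T' hd
  simp only [List.map_cons, List.map_nil, List.sum_cons, List.sum_nil, add_zero, Int.cast_one,
    Int.cast_neg, one_smul, neg_smul, neg_neg, neg_zero] at *
  simp only [shortElt, map_add, LinearMap.add_apply, map_smul, LinearMap.smul_apply, *]
  module

end Short

end SuperLie
end

noncomputable section

namespace SuperLie

open SuperBracket

section ShortSubalgebra

variable {K : Type*} [Field K]

theorem agEmb_agX (i : Fin 3) (s : Bool) : agEmb K (agX K i s) = basElt K (genIdx (i, s)) := by
  have h : genIdx (i, s) < 31 := (genIdx_lt (i, s)).trans (by norm_num)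
  rw [← agEmb_agBasis ⟨_, h⟩, agX, agBasis_apply]
  congr 2
  refine Subtype.ext (realize_injective ?_)
  rw [realize_zElt]
  exact realize_genX i s

theorem subset_generatedBy {L : Type*} [AddCommGroup L] [Module K L] [SuperBracket K L] (X : Set L) :
    X ⊆ (generatedBy (R := K) X : Submodule K L) := fun _ hx =>
  Submodule.mem_sInf.2 fun _ hS => hS.1 hx

theorem bracketClosed_generatedBy {L : Type*} [AddCommGroup L] [Module K L] [SuperBracket K L]
    (X : Set L) : BracketClosed (generatedBy (R := K) X) := fun x hx y hy =>
  Submodule.mem_sInf.2 fun S hS =>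
    hS.2 x (Submodule.mem_sInf.1 hx S hS) y (Submodule.mem_sInf.1 hy S hS)

theorem shortElt_mem (a b c d e f h : K) : shortElt a b c d e f h ∈ basSpan K shortSet := by
  have m : ∀ {k : ℕ} (hk : k < 31) (x : K), (⟨k, hk⟩ : Fin 31) ∈ shortSet →
      x • basElt K k ∈ basSpan K shortSet := fun hk x h =>
    Submodule.smul_mem _ _ (basElt_mem_basSpan hk h)
  exact add_mem (add_mem (add_mem (add_mem (add_mem (add_mem (m (by norm_num) a (by decide))
    (m (by norm_num) b (by decide))) (m (by norm_num) c (by decide))) (m (by norm_num) d (by decide)))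
    (m (by norm_num) e (by decide))) (m (by norm_num) f (by decide))) (m (by norm_num) h (by decide))

theorem exists_shortElt {x : DPAlg K} (hx : x ∈ basSpan K shortSet) :
    ∃ a b c d e f h : K, x = shortElt a b c d e f h := by
  induction hx using Submodule.span_induction with
  | mem x hx =>
    obtain ⟨k, hk, rfl⟩ := hx
    have hk : (k : ℕ) ∈ [2, 3, 9, 10, 11, 12, 14] := hk
    simp only [List.mem_cons, List.not_mem_nil, or_false] at hk
    dsimp only
    rcases hk with hk | hk | hk | hk | hk | hk | hk <;> rw [hk]
    · exact ⟨1, 0, 0, 0, 0, 0, 0, by simp [shortElt]⟩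
    · exact ⟨0, 0, 0, 1, 0, 0, 0, by simp [shortElt]⟩
    · exact ⟨0, 1, 0, 0, 0, 0, 0, by simp [shortElt]⟩
    · exact ⟨0, 0, 0, 0, 0, 0, 1, by simp [shortElt]⟩
    · exact ⟨0, 0, 0, 0, 1, 0, 0, by simp [shortElt]⟩
    · exact ⟨0, 0, 1, 0, 0, 0, 0, by simp [shortElt]⟩
    · exact ⟨0, 0, 0, 0, 0, 1, 0, by simp [shortElt]⟩
  | zero => exact ⟨0, 0, 0, 0, 0, 0, 0, by simp [shortElt]⟩
  | add x y _ _ hx hy =>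
    obtain ⟨a, b, c, d, e, f, h, rfl⟩ := hx
    obtain ⟨a', b', c', d', e', f', h', rfl⟩ := hy
    exact ⟨a + a', b + b', c + c', d + d', e + e', f + f', h + h', by simp only [shortElt]; module⟩
  | smul r x _ hx =>
    obtain ⟨a, b, c, d, e, f, h, rfl⟩ := hx
    exact ⟨r * a, r * b, r * c, r * d, r * e, r * f, r * h, by simp only [shortElt]; module⟩

/-- The image of the subalgebra that is generated by the short root vectors. -/
theorem map_agShort (h3 : (3 : K) = 0) : (agShort K).map (agEmb K) = basSpan K shortSet := by
  have h2 := two_ne_zero_of_three h3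
  have i2 : genIdx (1, true) = 2 := rfl
  have i3 : genIdx (1, false) = 3 := rfl
  have i4 : genIdx (2, true) = 4 := rfl
  have i5 : genIdx (2, false) = 5 := rfl
  have e9 := contactBr_of_brCheck h3 simple_root_check.1
  have e11 := contactBr_of_brCheck h3 simple_root_check.2
  simp only [List.map_cons, List.map_nil, List.sum_cons, List.sum_nil, add_zero, Int.cast_neg,
    Int.cast_one, neg_smul, one_smul] at e9 e11
  have hs : ∀ {k : ℕ} (hk : k < 31), (⟨k, hk⟩ : Fin 31) ∈ shortSet → basElt K k ∈ basSpan K shortSet :=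
    fun hk h => basElt_mem_basSpan hk h
  refine le_antisymm (Submodule.map_le_iff_le_comap.2 (sInf_le ⟨?_, fun x hx y hy => ?_⟩)) ?_
  · rintro x ⟨s, rfl | rfl⟩
    · rw [SetLike.mem_coe, Submodule.mem_comap, agEmb_agX]
      cases s
      · exact hs (k := 3) (by norm_num) (by decide)
      · exact hs (k := 2) (by norm_num) (by decide)
    · rw [SetLike.mem_coe, Submodule.mem_comap, agEmb_br h2, agEmb_agX, agEmb_agX]
      cases s
      · rw [i3, i5, e11]; exact neg_mem (hs (by norm_num) (by decide))
      · rw [i2, i4, e9]; exact neg_mem (hs (by norm_num) (by decide))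
  · rw [Submodule.mem_comap, agEmb_br h2]
    obtain ⟨a, b, c, d, e, f, h, hx⟩ := exists_shortElt hx
    obtain ⟨a', b', c', d', e', f', h', hy⟩ := exists_shortElt hy
    rw [hx, hy, contactBr_shortElt h3]
    exact shortElt_mem _ _ _ _ _ _ _
  · set M := (agShort K).map (agEmb K)
    have hM : ∀ x ∈ M, ∀ y ∈ M, contactBr K x y ∈ M := by
      rintro _ ⟨x, hx, rfl⟩ _ ⟨y, hy, rfl⟩
      exact ⟨_, bracketClosed_generatedBy _ x hx y hy, agEmb_br h2 x y⟩
    have g2 : basElt K 2 ∈ M := ⟨_, subset_generatedBy _ ⟨true, Or.inl rfl⟩, agEmb_agX 1 true⟩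
    have g3 : basElt K 3 ∈ M := ⟨_, subset_generatedBy _ ⟨false, Or.inl rfl⟩, agEmb_agX 1 false⟩
    have g9 : basElt K 9 ∈ M := by
      rw [← neg_mem_iff, ← e9]
      exact ⟨_, subset_generatedBy _ ⟨true, Or.inr rfl⟩, by
        rw [agEmb_br h2, agEmb_agX, agEmb_agX, i2, i4]⟩
    have g11 : basElt K 11 ∈ M := by
      rw [← neg_mem_iff, ← e11]
      exact ⟨_, subset_generatedBy _ ⟨false, Or.inr rfl⟩, by
        rw [agEmb_br h2, agEmb_agX, agEmb_agX, i3, i5]⟩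
    have hT : ∀ {k l m : ℕ}, (k, l, [(m, 1)]) ∈ shortTable → basElt K k ∈ M → basElt K l ∈ M →
        basElt K m ∈ M := fun h hk hl => by
      have := hM _ hk _ hl
      rwa [contactBr_short h3 h, List.map_singleton, List.sum_singleton, Int.cast_one,
        one_smul] at this
    have g12 : basElt K 12 ∈ M := hT (by decide) g2 g9
    have g14 : basElt K 14 ∈ M := hT (by decide) g3 g11
    have g10 : basElt K 10 ∈ M := hT (by decide) g2 g3
    refine Submodule.span_le.2 ?_
    rintro _ ⟨k, hk, rfl⟩
    have hk : (k : ℕ) ∈ [2, 3, 9, 10, 11, 12, 14] := hk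
    simp only [List.mem_cons, List.not_mem_nil, or_false] at hk
    dsimp only
    rcases hk with hk | hk | hk | hk | hk | hk | hk <;> rw [hk] <;> assumption

theorem pivotFun_of_notMem (h2 : (2 : K) ≠ 0) {s : Set (Fin 31)} {f : DPAlg K}
    (hf : f ∈ basSpan K s) {k : Fin 31} (hk : k ∉ s) : pivotFun K k f = 0 := by
  obtain ⟨c, rfl⟩ := exists_of_mem_basSpan hf
  rw [pivotFun_sum, (mem_basSpan_iff h2).1 hf k hk, zero_mul]

/-- The central element. -/
def centreElt (K : Type*) [Field K] : DPAlg K := basElt K 7 + basElt K 10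

theorem pivotFun_centreElt : pivotFun K 7 (centreElt K) = (pivotDen 7 : K) := by
  rw [centreElt, map_add, pivotFun_basElt (by norm_num) (by norm_num),
    pivotFun_basElt (by norm_num) (by norm_num)]
  simp

theorem centreElt_ne_zero (h2 : (2 : K) ≠ 0) : centreElt K ≠ 0 := fun h =>
  pivotDen_ne_zero h2 (k := 7) (by norm_num) (by rw [← pivotFun_centreElt, h, map_zero])

theorem contactBr_centreElt (h3 : (3 : K) = 0) {g : DPAlg K} (hg : g ∈ basSpan K {k | basDeg k = 0}) :
    contactBr K (centreElt K) g = 0 := by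
  induction hg using Submodule.span_induction with
  | mem x hx =>
    obtain ⟨l, hl, rfl⟩ := hx
    have h := all_range centre_check l.2
    rw [Bool.or_eq_true] at h
    have h := eval_eq_zero (K := K) (n := 3) (by exact_mod_cast h3)
      (h.resolve_left fun h => of_decide_eq_true h hl)
    rw [eval_br (two_ne_zero_of_three h3), eval_append] at h
    exact h
  | zero => simp
  | add x y _ _ hx hy => rw [map_add, hx, hy, add_zero]
  | smul c x _ hx => rw [map_smul, hx, smul_zero]

/-- For every index `k` other than 7 and 10, `detect_check` names `l` and `m` such that among degree
zero elements only `b_k` contributes to the coefficient of `b_m` in the bracket with `b_l`;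
commuting with `b_l` forces `c k = 0`. The two remaining coordinates are compared on `X_2^+`, where
the Cartan elements 7 and 10 have the eigenvalues `1` and `-1`. -/
theorem centre_coeff (h3 : (3 : K) = 0) {c : Fin 31 → K} (hc : ∀ k : Fin 31, basDeg k ≠ 0 → c k = 0)
    (h : ∀ l : Fin 31, basDeg l = 0 → contactBr K (∑ k, c k • basElt K k) (basElt K l) = 0) :
    (∀ k : Fin 31, k ≠ 7 → k ≠ 10 → c k = 0) ∧ c 7 = c 10 := by
  have h2 := two_ne_zero_of_three h3
  have key : ∀ l m : Fin 31, basDeg l = 0 → ∑ k : Fin 31, c k * (strCoeff k l m : K) = 0 := by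
    intro l m hl
    have e : contactBr K (∑ k, c k • basElt K k) (basElt K l) =
        ∑ m : Fin 31, (∑ k : Fin 31, c k * (strCoeff k l m : K)) • basElt K m := by
      rw [map_sum, LinearMap.sum_apply]
      simp only [map_smul, LinearMap.smul_apply, contactBr_basElt h2 (Fin.is_lt _) l.2,
        Finset.smul_sum, smul_smul, Finset.sum_smul]
      exact Finset.sum_comm
    rw [h l hl] at e
    have := congrArg (pivotFun K m) e
    rw [map_zero, pivotFun_sum] at this
    exact (mul_eq_zero.1 this.symm).resolve_right (pivotDen_ne_zero h2 m.2)
  have hne : ∀ {n : ℤ}, n % 3 ≠ 0 → (n : K) ≠ 0 := fun {n} hn h => by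
    have : n % 3 = 1 ∨ n % 3 = 2 := by omega
    have e : (n : K) = 3 * ((n / 3 : ℤ) : K) + ((n % 3 : ℤ) : K) := by
      exact_mod_cast congrArg (Int.cast (R := K)) (Int.mul_ediv_add_emod n 3).symm
    rw [h, h3, zero_mul, zero_add] at e
    rcases this with h' | h' <;> rw [h'] at e
    · simp at e
    · exact h2 (by exact_mod_cast e.symm)
  have hz : ∀ {n : ℤ}, n % 3 = 0 → (n : K) = 0 := fun {n} hn => by
    obtain ⟨m, rfl⟩ := Int.dvd_of_emod_eq_zero hn
    push_cast; rw [h3, zero_mul]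
  have hzero : ∀ k : Fin 31, k ≠ 7 → k ≠ 10 → c k = 0 := by
    intro k h7 h10
    by_cases hk : basDeg k = 0
    swap
    · exact hc k hk
    obtain ⟨l, m, hl, hlm⟩ : ∃ l m : Fin 31, basDeg l = 0 ∧ ((k : ℕ), (l : ℕ), (m : ℕ)) ∈
        [(2, 16, 2), (3, 16, 3), (4, 16, 4), (5, 16, 5), (9, 16, 9), (11, 16, 11),
        (12, 10, 12), (13, 16, 13), (14, 10, 14), (15, 16, 15), (16, 4, 4), (21, 16, 21),
        (24, 16, 24)] := by
      have : ∀ k : Fin 31, k ≠ 7 → k ≠ 10 → basDeg k = 0 → ∃ q ∈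
          [(2, 16, 2), (3, 16, 3), (4, 16, 4), (5, 16, 5), (9, 16, 9), (11, 16, 11),
          (12, 10, 12), (13, 16, 13), (14, 10, 14), (15, 16, 15), (16, 4, 4), (21, 16, 21),
          (24, 16, 24)], q.1 = (k : ℕ) ∧ q.2.1 < 31 ∧ q.2.2 < 31 ∧ basDeg q.2.1 = 0 := by
        decide +kernel
      obtain ⟨⟨k', l, m⟩, hq, e, hl, hm, h0⟩ := this k h7 h10 hk
      dsimp only at e hl hm h0
      subst e
      exact ⟨⟨l, hl⟩, ⟨m, hm⟩, h0, hq⟩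
    have hd := fun k' : Fin 31 => all_range (List.all_eq_true.1 detect_check _ hlm) k'.2
    have := key l m hl
    rw [Finset.sum_eq_single k] at this
    · refine (mul_eq_zero.1 this).resolve_right (hne ?_)
      have h := hd k
      rw [Bool.or_eq_true] at h
      intro h0
      exact (of_decide_eq_true (h.resolve_left fun h => of_decide_eq_true h hk)).1 h0 rfl
    · intro k' _ hne'
      by_cases hk' : basDeg k' = 0
      · have h := hd k'
        rw [Bool.or_eq_true] at h
        rw [hz ((of_decide_eq_true (h.resolve_left fun h => of_decide_eq_true h hk')).2
          fun e => hne' (Fin.ext e)), mul_zero]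
      · rw [hc k' hk', zero_mul]
    · simp
  refine ⟨hzero, ?_⟩
  have h := h 2 (by decide)
  have e : ∑ k, c k • basElt K k = c 7 • basElt K 7 + c 10 • basElt K 10 :=
    Finset.sum_eq_add (7 : Fin 31) 10 (by decide) (fun k _ hk => by
      rw [hzero k hk.1 hk.2, zero_smul]) (by simp) (by simp)
  have e7 := contactBr_of_brCheck h3 centre_root_check.1
  have e10 := contactBr_of_brCheck h3 centre_root_check.2
  simp only [List.map_cons, List.map_nil, List.sum_cons, List.sum_nil, add_zero, Int.cast_neg,
    Int.cast_one, neg_smul, one_smul] at e7 e10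
  rw [e, map_add, LinearMap.add_apply, map_smul, map_smul, LinearMap.smul_apply,
    LinearMap.smul_apply, show ((2 : Fin 31) : ℕ) = 2 from rfl, e7, e10, smul_neg, ← sub_eq_add_neg,
    ← sub_smul] at h
  refine sub_eq_zero.1 ((smul_eq_zero.1 h).resolve_right ?_)
  exact (linearIndependent_basElt h2).ne_zero (2 : Fin 31)

/-- The image of the centre of the degree zero part. -/
theorem map_agCentre (h3 : (3 : K) = 0) :
    (agCentre K).map (agEmb K) = Submodule.span K {centreElt K} := by
  have h2 := two_ne_zero_of_three h3
  have hbas : ∀ l : Fin 31, basDeg l = 0 → agBasis K l ∈ agDeg K 0 := fun l hl => by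
    rw [agDeg_eq_span]; exact Submodule.subset_span ⟨l, hl, rfl⟩
  refine le_antisymm ?_ ((Submodule.span_singleton_le_iff_mem _ _).2 ?_)
  · rintro _ ⟨x, ⟨hx, hx0⟩, rfl⟩
    have hm : agEmb K x ∈ basSpan K {k | basDeg k = 0} := by
      rw [← gPart_agEmb]; exact ⟨x, hx, rfl⟩
    have hl : ∀ l : Fin 31, basDeg l = 0 → contactBr K (agEmb K x) (basElt K l) = 0 := fun l hl => by
      rw [← agEmb_agBasis, ← agEmb_br h2, hx0 _ (hbas l hl), map_zero]
    obtain ⟨c, hc⟩ := exists_of_mem_basSpan hm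
    rw [hc] at hm hl ⊢
    obtain ⟨h0, h7⟩ := centre_coeff h3 ((mem_basSpan_iff h2).1 hm) hl
    rw [Finset.sum_eq_add (7 : Fin 31) 10 (by decide) (fun k _ hk => by
      rw [h0 k hk.1 hk.2, zero_smul]) (by simp) (by simp), ← h7, ← smul_add]
    exact Submodule.smul_mem _ _ (Submodule.mem_span_singleton_self _)
  · refine ⟨agBasis K 7 + agBasis K 10, ⟨add_mem (hbas 7 (by decide)) (hbas 10 (by decide)),
      fun y hy => agEmb_injective h2 ?_⟩, ?_⟩
    · rw [agEmb_br h2, map_add, agEmb_agBasis, agEmb_agBasis, map_zero]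
      refine contactBr_centreElt h3 ?_
      rw [← gPart_agEmb]; exact ⟨y, hy, rfl⟩
    · rw [map_add, agEmb_agBasis, agEmb_agBasis]; rfl

theorem finrank_agCentre (h3 : (3 : K) = 0) : Module.finrank K (agCentre K) = 1 := by
  have h2 := two_ne_zero_of_three h3
  rw [(Submodule.equivMapOfInjective _ (agEmb_injective h2) (agCentre K)).finrank_eq,
    map_agCentre h3]
  exact finrank_span_singleton (centreElt_ne_zero h2)

theorem disjoint_agShort_agCentre (h3 : (3 : K) = 0) : Disjoint (agShort K) (agCentre K) := by
  have h2 := two_ne_zero_of_three h3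
  rw [Submodule.disjoint_def]
  intro x hs hc
  have hs : agEmb K x ∈ basSpan K shortSet := by rw [← map_agShort h3]; exact ⟨x, hs, rfl⟩
  have hc : agEmb K x ∈ Submodule.span K {centreElt K} := by
    rw [← map_agCentre h3]; exact ⟨x, hc, rfl⟩
  obtain ⟨r, hr⟩ := Submodule.mem_span_singleton.1 hc
  have := pivotFun_of_notMem h2 hs (k := 7) (by decide)
  rw [← hr, map_smul, show ((7 : Fin 31) : ℕ) = 7 from rfl, pivotFun_centreElt] at this
  refine agEmb_injective h2 ?_
  rw [map_zero, ← hr, (mul_eq_zero.1 this).resolve_right (pivotDen_ne_zero h2 (by norm_num)),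
    zero_smul]

/-- The components of the smaller nonpositive part. -/
theorem gTilde_agEmb (h3 : (3 : K) = 0) (d : ℤ) :
    gTilde (agEmb K) d = basSpan K (bjSet ∩ {k | basDeg k = d}) := by
  rw [gTilde]
  split_ifs with hd
  · subst hd
    rw [Submodule.map_sup, map_agShort h3, map_agCentre h3]
    have hsub : ∀ k : Fin 31, k ∈ shortSet → k ∈ bjSet ∧ basDeg k = 0 := by decide +kernel
    have h7 : basElt K 7 ∈ basSpan K (bjSet ∩ {k | basDeg k = 0}) :=
      basElt_mem_basSpan (by norm_num) (by exact ⟨by decide, by decide⟩)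
    have h10 : basElt K 10 ∈ basSpan K shortSet := basElt_mem_basSpan (by norm_num) (by decide)
    have hle := basSpan_mono (K := K) (s := shortSet) (t := bjSet ∩ {k | basDeg k = 0}) hsub
    refine le_antisymm (sup_le hle ?_) (Submodule.span_le.2 ?_)
    · rw [Submodule.span_singleton_le_iff_mem]
      exact add_mem h7 (hle h10)
    · rintro _ ⟨k, ⟨hk, hd⟩, rfl⟩
      have : ∀ k : Fin 31, k ∈ bjSet → basDeg k = 0 → k ∈ shortSet ∨ k = 7 := by decide +kernel
      rcases this k hk hd with h | rfl
      · exact Submodule.mem_sup_left (basElt_mem_basSpan k.2 h)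
      · refine (Submodule.add_mem_iff_left _ (Submodule.mem_sup_left h10)).1
          (Submodule.mem_sup_right (Submodule.mem_span_singleton_self _))
  · rw [gPart_agEmb, bjSet_inter hd]

end ShortSubalgebra

end SuperLie
end

noncomputable section

namespace SuperLie

open SuperBracket

/-! ### Isomorphisms with matrix algebras -/

theorem sl_two_check : brCheck 29 29 [] = true ∧ brCheck 30 30 [] = true ∧
    brCheck 29 30 [(7, 1), (10, 1)] = true ∧ brCheck 30 29 [(7, -1), (10, -1)] = true ∧
    brCheck 7 29 [(29, 1)] = true ∧ brCheck 10 29 [] = true ∧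
    brCheck 7 30 [(30, -1)] = true ∧ brCheck 10 30 [] = true ∧
    brCheck 29 7 [(29, -1)] = true ∧ brCheck 29 10 [] = true ∧
    brCheck 30 7 [(30, 1)] = true ∧ brCheck 30 10 [] = true := by decide +kernel

theorem sl_two_short_check : ([2, 3, 9, 10, 11, 12, 14].all fun k =>
    brCheck 29 k [] && brCheck k 29 [] && brCheck 30 k [] && brCheck k 30 []) = true := by
  decide +kernel

section Matrices

variable {K : Type*} [Field K]

theorem sl_add_apply {m : ℕ} (A B : SL K m) (i j : Fin m) : (A + B).1 i j = A.1 i j + B.1 i j := rfl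

theorem sl_smul_apply {m : ℕ} (c : K) (A : SL K m) (i j : Fin m) : (c • A).1 i j = c * A.1 i j := rfl

variable (K) in
/-- The map from `𝔰𝔩(3)` onto the subalgebra of the short roots. -/
def slThreeMap : SL K 3 →ₗ[K] DPAlg K where
  toFun A := shortElt (A.1 0 1) (A.1 1 2) (A.1 0 2) (A.1 1 0) (-A.1 2 1) (A.1 2 0)
    (A.1 1 1 - A.1 0 0)
  map_add' A B := by
    simp only [shortElt, sl_add_apply]
    module
  map_smul' c A := by
    simp only [shortElt, sl_smul_apply, RingHom.id_apply]
    module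

theorem slThreeMap_apply (A : SL K 3) : slThreeMap K A =
    shortElt (A.1 0 1) (A.1 1 2) (A.1 0 2) (A.1 1 0) (-A.1 2 1) (A.1 2 0) (A.1 1 1 - A.1 0 0) := rfl

theorem trace_eq_zero_of_sl {m : ℕ} (A : SL K m) : A.1.trace = 0 := LinearMap.mem_ker.1 A.2

/-- The coordinates agree modulo the traces of the two matrices and multiples of 3. The diagonal
enters only through `A_11 - A_00`, which determines a traceless matrix up to scalars just because 3
vanishes. -/
theorem slThreeMap_lie (h3 : (3 : K) = 0) (A B : SL K 3) :
    slThreeMap K ⁅A, B⁆ = contactBr K (slThreeMap K A) (slThreeMap K B) := by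
  have hA := trace_eq_zero_of_sl A
  have hB := trace_eq_zero_of_sl B
  rw [Matrix.trace_fin_three] at hA hB
  rw [slThreeMap_apply, slThreeMap_apply, slThreeMap_apply, contactBr_shortElt h3,
    LieAlgebra.SpecialLinear.sl_bracket]
  obtain ⟨A, _⟩ := A
  obtain ⟨B, _⟩ := B
  simp only [Matrix.sub_apply, Matrix.mul_apply, Fin.sum_univ_three] at hA hB ⊢
  congr 1
  · ring
  · linear_combination A 1 2 * hB - B 1 2 * hA + (-B 1 1 * A 1 2 + A 1 1 * B 1 2) * h3
  · linear_combination A 0 2 * hB - B 0 2 * hA + (-B 0 0 * A 0 2 + A 0 0 * B 0 2) * h3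
  · ring
  · linear_combination A 2 1 * hB - B 2 1 * hA + (-A 2 1 * B 1 1 + B 2 1 * A 1 1) * h3
  · linear_combination -A 2 0 * hB + B 2 0 * hA + (A 2 0 * B 0 0 - B 2 0 * A 0 0) * h3
  · linear_combination (A 1 0 * B 0 1 - A 0 1 * B 1 0) * h3

theorem shortElt_eq_zero (h2 : (2 : K) ≠ 0) {a b c d e f h : K} (hz : shortElt a b c d e f h = 0) :
    a = 0 ∧ b = 0 ∧ c = 0 ∧ d = 0 ∧ e = 0 ∧ f = 0 ∧ h = 0 := by
  have key : ∀ k : ℕ, k < 31 → pivotFun K k (shortElt a b c d e f h) = 0 := fun k _ => by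
    rw [hz, map_zero]
  have hd : ∀ {k : ℕ}, k < 31 → (pivotDen k : K) ≠ 0 := fun hk => pivotDen_ne_zero h2 hk
  have p2 := key 2 (by norm_num)
  have p9 := key 9 (by norm_num)
  have p12 := key 12 (by norm_num)
  have p3 := key 3 (by norm_num)
  have p11 := key 11 (by norm_num)
  have p14 := key 14 (by norm_num)
  have p10 := key 10 (by norm_num)
  simp only [shortElt, map_add, map_smul, pivotFun_basElt, Nat.reduceLT, Nat.reduceEqDiff, if_true,
    if_false, smul_eq_mul, mul_zero, add_zero, zero_add, mul_eq_zero, hd, or_false] at p2 p9 p12 p3 p11 p14 p10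
  exact ⟨p2, p9, p12, p3, p11, p14, p10⟩

theorem ker_slThreeMap (h3 : (3 : K) = 0) :
    LinearMap.ker (slThreeMap K) = (LieAlgebra.center K (SL K 3)).toSubmodule := by
  ext A
  rw [LinearMap.mem_ker, LieSubmodule.mem_toSubmodule, LieModule.mem_maxTrivSubmodule]
  constructor
  · intro h B
    rw [slThreeMap_apply] at h
    obtain ⟨h01, h12, h02, h10, h21, h20, hd⟩ := shortElt_eq_zero (two_ne_zero_of_three h3) h
    have htr := trace_eq_zero_of_sl A
    rw [Matrix.trace_fin_three] at htr
    have hA : A.1 = Matrix.scalar (Fin 3) (A.1 0 0) := by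
      ext i j
      fin_cases i <;> fin_cases j
      · simp
      · simpa using h01
      · simpa using h02
      · simpa using h10
      · simpa using sub_eq_zero.1 hd
      · simpa using h12
      · simpa using h20
      · simpa using h21
      · change A.1 2 2 = _
        simp
        -- From `A_11 = A_00` and vanishing trace, `A_22 = -2 A_00`, which is `A_00` in
        -- characteristic three.
        linear_combination htr - hd - A.1 0 0 * h3
    refine Subtype.ext ?_
    rw [LieAlgebra.SpecialLinear.sl_bracket, hA]
    refine sub_eq_zero.2 ?_
    exact ((Matrix.scalar_commute _ (fun r => Commute.all _ r) _).eq).symm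
  · intro h
    obtain ⟨c, hc⟩ := Matrix.mem_range_scalar_of_commute_single (M := A.1) fun i j hij => by
      have := congrArg Subtype.val (h (LieAlgebra.SpecialLinear.single i j hij 1))
      rw [LieAlgebra.SpecialLinear.sl_bracket, LieAlgebra.SpecialLinear.val_single] at this
      exact sub_eq_zero.1 this
    rw [slThreeMap_apply, ← hc]
    simp [shortElt]

variable (K) in
/-- The embedding of `𝔭𝔰𝔩(3)`. -/
def pslMap (h3 : (3 : K) = 0) : PSL3 K →ₗ[K] DPAlg K :=
  (LieAlgebra.center K (SL K 3)).toSubmodule.liftQ (slThreeMap K) (ker_slThreeMap h3).ge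

theorem pslMap_injective (h3 : (3 : K) = 0) : Function.Injective (pslMap K h3) :=
  LinearMap.ker_eq_bot.1 (Submodule.ker_liftQ_eq_bot _ _ _ (ker_slThreeMap h3).le)

theorem range_pslMap (h3 : (3 : K) = 0) : LinearMap.range (pslMap K h3) = basSpan K shortSet := by
  refine (Submodule.range_liftQ _ _ _).trans (le_antisymm ?_ fun x hx => ?_)
  · rintro _ ⟨A, rfl⟩
    exact shortElt_mem _ _ _ _ _ _ _
  · obtain ⟨a, b, c, d, e, f, h, rfl⟩ := exists_shortElt hx
    -- The diagonal only has to be traceless with prescribed difference of the first two entries;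
    -- other choices differ from this one by scalar matrices.
    refine ⟨⟨!![0, a, c; d, h, b; f, -e, -h], ?_⟩, ?_⟩
    · refine LinearMap.mem_ker.2 ?_
      simp [Matrix.trace_fin_three]
    · rw [slThreeMap_apply]; simp

theorem pslMap_lie (h3 : (3 : K) = 0) (x y : PSL3 K) :
    pslMap K h3 ⁅x, y⁆ = contactBr K (pslMap K h3 x) (pslMap K h3 y) := by
  obtain ⟨A, rfl⟩ := LieSubmodule.Quotient.surjective_mk' _ x
  obtain ⟨B, rfl⟩ := LieSubmodule.Quotient.surjective_mk' _ y
  exact slThreeMap_lie h3 A B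

theorem isIsoToLie_map_agShort (h3 : (3 : K) = 0) :
    IsIsoToLie ((agShort K).map (agEmb K)) (PSL3 K) :=
  ⟨pslMap K h3, pslMap_injective h3, by rw [range_pslMap, map_agShort h3], pslMap_lie h3⟩

variable (K) in
/-- The embedding of `𝔰𝔩(2)`. -/
def slTwoMap : SL K 2 →ₗ[K] DPAlg K where
  toFun A := A.1 0 1 • basElt K 30 - A.1 1 0 • basElt K 29 + A.1 0 0 • centreElt K
  map_add' A B := by
    simp only [sl_add_apply]
    module
  map_smul' c A := by
    simp only [sl_smul_apply, RingHom.id_apply]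
    module

theorem slTwoMap_apply (A : SL K 2) : slTwoMap K A =
    A.1 0 1 • basElt K 30 - A.1 1 0 • basElt K 29 + A.1 0 0 • centreElt K := rfl

theorem centreElt_mem : centreElt K ∈ basSpan K {k | basDeg k = 0} :=
  add_mem (basElt_mem_basSpan (by norm_num) (by exact (by decide : basDeg 7 = 0)))
    (basElt_mem_basSpan (by norm_num) (by exact (by decide : basDeg 10 = 0)))

/-- The lowest and highest elements and the central element of degree zero form an `𝔰𝔩(2)`-triple
modulo 3: the central element acts on the lowest one by `-1`, which equals the eigenvalue `2` of the
standard triple because `3 = 0`. -/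
theorem slTwoMap_lie (h3 : (3 : K) = 0) (A B : SL K 2) :
    slTwoMap K ⁅A, B⁆ = contactBr K (slTwoMap K A) (slTwoMap K B) := by
  have hA := trace_eq_zero_of_sl A
  have hB := trace_eq_zero_of_sl B
  rw [Matrix.trace_fin_two] at hA hB
  obtain ⟨c1, c2, c3, c4, c5, c6, c7, c8, c9, c10, c11, c12⟩ := sl_two_check
  have T := fun {k l : ℕ} {r : List (ℕ × ℤ)} => contactBr_of_brCheck (K := K) h3 (k := k) (l := l)
    (r := r)
  have c1 := T c1
  have c2 := T c2
  have c3 := T c3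
  have c4 := T c4
  have c5 := T c5
  have c6 := T c6
  have c7 := T c7
  have c8 := T c8
  have c9 := T c9
  have c10 := T c10
  have c11 := T c11
  have c12 := T c12
  have c0 := contactBr_centreElt h3 (centreElt_mem (K := K))
  simp only [List.map_cons, List.map_nil, List.sum_cons, List.sum_nil, add_zero, Int.cast_one,
    Int.cast_neg, one_smul, neg_smul] at c1 c2 c3 c4 c5 c6 c7 c8 c9 c10 c11 c12
  have d1 : contactBr K (centreElt K) (basElt K 29) = basElt K 29 := by
    rw [centreElt, map_add, LinearMap.add_apply, c5, c6, add_zero]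
  have d2 : contactBr K (centreElt K) (basElt K 30) = -basElt K 30 := by
    rw [centreElt, map_add, LinearMap.add_apply, c7, c8, add_zero]
  have d3 : contactBr K (basElt K 29) (centreElt K) = -basElt K 29 := by
    rw [centreElt, map_add, c9, c10, add_zero]
  have d4 : contactBr K (basElt K 30) (centreElt K) = basElt K 30 := by
    rw [centreElt, map_add, c11, c12, add_zero]
  have c4 : contactBr K (basElt K 30) (basElt K 29) = -centreElt K := by
    rw [c4, centreElt, neg_add]
  change contactBr K (basElt K 29) (basElt K 30) = centreElt K at c3
  rw [slTwoMap_apply, slTwoMap_apply, slTwoMap_apply, LieAlgebra.SpecialLinear.sl_bracket]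
  simp only [map_add, map_sub, LinearMap.add_apply, LinearMap.sub_apply, map_smul,
    LinearMap.smul_apply, c0, c1, c2, c3, c4, d1, d2, d3, d4]
  obtain ⟨A, _⟩ := A
  obtain ⟨B, _⟩ := B
  simp only [Matrix.sub_apply, Matrix.mul_apply, Fin.sum_univ_two] at hA hB ⊢
  have e1 : A 0 0 * B 0 1 + A 0 1 * B 1 1 - (B 0 0 * A 0 1 + B 0 1 * A 1 1) =
      A 0 1 * B 0 0 - A 0 0 * B 0 1 := by
    linear_combination A 0 1 * hB - B 0 1 * hA + (A 0 0 * B 0 1 - A 0 1 * B 0 0) * h3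
  have e2 : A 1 0 * B 0 0 + A 1 1 * B 1 0 - (B 1 0 * A 0 0 + B 1 1 * A 1 0) =
      A 0 0 * B 1 0 - A 1 0 * B 0 0 := by
    linear_combination B 1 0 * hA - A 1 0 * hB + (A 1 0 * B 0 0 - A 0 0 * B 1 0) * h3
  rw [e1, e2]
  module

theorem contactBr_slTwoMap_short (h3 : (3 : K) = 0) (A : SL K 2) {g : DPAlg K}
    (hg : g ∈ basSpan K shortSet) :
    contactBr K (slTwoMap K A) g = 0 ∧ contactBr K g (slTwoMap K A) = 0 := by
  induction hg using Submodule.span_induction with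
  | mem x hx =>
    obtain ⟨k, hk, rfl⟩ := hx
    have h := List.all_eq_true.1 sl_two_short_check k hk
    simp only [Bool.and_eq_true] at h
    obtain ⟨⟨⟨h1, h2⟩, h3'⟩, h4⟩ := h
    have h1 := contactBr_of_brCheck h3 h1
    have h2 := contactBr_of_brCheck h3 h2
    have h3' := contactBr_of_brCheck h3 h3'
    have h4 := contactBr_of_brCheck h3 h4
    rw [List.map_nil, List.sum_nil] at h1 h2 h3' h4
    have hk0 : basElt K k ∈ basSpan K {k | basDeg k = 0} := by
      refine basElt_mem_basSpan k.2 ?_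
      have : ∀ k : Fin 31, k ∈ shortSet → basDeg k = 0 := by decide +kernel
      exact this k hk
    have h5 := contactBr_centreElt h3 hk0
    have h6 := contactBr_comm_zero (basSpan_le_contactDeg 0 hk0)
      (basSpan_le_contactDeg 0 (centreElt_mem (K := K)))
    rw [h5, neg_zero] at h6
    rw [slTwoMap_apply]
    simp only [map_add, map_sub, LinearMap.add_apply, LinearMap.sub_apply, map_smul,
      LinearMap.smul_apply, h1, h2, h3', h4, h5, h6]
    simp
  | zero => simp
  | add x y _ _ hx hy => simp [hx.1, hx.2, hy.1, hy.2]
  | smul c x _ hx => simp [hx.1, hx.2]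

theorem slTwoMap_add_pslMap_injective (h3 : (3 : K) = 0) :
    Function.Injective ((slTwoMap K).coprod (pslMap K h3)) := by
  have h2 := two_ne_zero_of_three h3
  refine LinearMap.ker_eq_bot.1 (LinearMap.ker_eq_bot'.2 ?_)
  rintro ⟨A, y⟩ h
  rw [LinearMap.coprod_apply] at h
  have hy : pslMap K h3 y ∈ basSpan K shortSet := by rw [← range_pslMap h3]; exact ⟨y, rfl⟩
  have key : ∀ k : Fin 31, k ∉ shortSet → pivotFun K k (slTwoMap K A) = 0 := fun k hk => by
    have := congrArg (pivotFun K k) h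
    rwa [map_add, pivotFun_of_notMem h2 hy hk, add_zero, map_zero] at this
  have hd : ∀ {k : ℕ}, k < 31 → (pivotDen k : K) ≠ 0 := fun hk => pivotDen_ne_zero h2 hk
  have p7 : pivotFun K 7 (slTwoMap K A) = 0 := key 7 (by decide)
  have p29 : pivotFun K 29 (slTwoMap K A) = 0 := key 29 (by decide)
  have p30 : pivotFun K 30 (slTwoMap K A) = 0 := key 30 (by decide)
  simp only [slTwoMap_apply, centreElt, map_add, map_sub, map_smul, pivotFun_basElt, Nat.reduceLT,
    Nat.reduceEqDiff, if_true, if_false, smul_eq_mul, mul_zero, add_zero, zero_add, sub_zero, zero_sub,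
    neg_eq_zero, mul_eq_zero, hd, or_false] at p7 p29 p30
  have htr := trace_eq_zero_of_sl A
  rw [Matrix.trace_fin_two, p7, zero_add] at htr
  have hA : A = 0 := by
    refine Subtype.ext (Matrix.ext fun i j => ?_)
    fin_cases i <;> fin_cases j
    · exact p7
    · exact p30
    · exact p29
    · exact htr
  rw [hA, map_zero, zero_add] at h
  rw [hA, show y = 0 from pslMap_injective h3 (h.trans (map_zero _).symm)]
  rfl

theorem range_slTwoMap_add_pslMap (h3 : (3 : K) = 0) :
    LinearMap.range ((slTwoMap K).coprod (pslMap K h3)) = bjAlg K ⊓ par 0 := by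
  have h2 := two_ne_zero_of_three h3
  rw [LinearMap.range_coprod, range_pslMap, bjAlg, basSpan_inf_par h2]
  set T : Set (Fin 31) := bjSet ∩ {k | ((basDeg k : ℤ) : ZMod 2) = 0}
  have hT : ∀ k : Fin 31, k ∈ shortSet ∨ k = 7 ∨ k = 29 ∨ k = 30 → k ∈ bjSet ∧
      ((basDeg k : ℤ) : ZMod 2) = 0 := by decide +kernel
  have hT' : ∀ k : Fin 31, k ∈ bjSet ∧ ((basDeg k : ℤ) : ZMod 2) = 0 →
      k ∈ shortSet ∨ k = 7 ∨ k = 29 ∨ k = 30 := by decide +kernel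
  have hm : ∀ k : Fin 31, k ∈ shortSet ∨ k = 7 ∨ k = 29 ∨ k = 30 → basElt K k ∈ basSpan K T :=
    fun k hk => basElt_mem_basSpan k.2 (hT k hk)
  have h10 : basElt K 10 ∈ basSpan K shortSet := basElt_mem_basSpan (by norm_num) (by decide)
  refine le_antisymm (sup_le ?_ (basSpan_mono fun k hk => hT k (Or.inl hk))) (Submodule.span_le.2 ?_)
  · rintro _ ⟨A, rfl⟩
    rw [slTwoMap_apply]
    exact add_mem (sub_mem (Submodule.smul_mem _ _ (hm 30 (by decide)))
      (Submodule.smul_mem _ _ (hm 29 (by decide))))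
      (Submodule.smul_mem _ _ (add_mem (hm 7 (by decide)) (hm 10 (by decide))))
  · have hr : ∀ a b c : K, a • basElt K 30 - b • basElt K 29 + c • centreElt K ∈
        LinearMap.range (slTwoMap K) := fun a b c =>
      ⟨⟨!![c, a; b, -c], LinearMap.mem_ker.2 (by simp [Matrix.trace_fin_two])⟩, by
        rw [slTwoMap_apply]; simp⟩
    rintro _ ⟨k, hk, rfl⟩
    rcases hT' k hk with h | rfl | rfl | rfl
    · exact Submodule.mem_sup_right (basElt_mem_basSpan k.2 h)
    · have := hr 0 0 1
      simp only [zero_smul, one_smul, sub_zero, zero_add] at this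
      exact (Submodule.add_mem_iff_left _ (Submodule.mem_sup_right h10)).1
        (Submodule.mem_sup_left this)
    · have := hr 0 (-1) 0
      simp only [zero_smul, neg_smul, one_smul, sub_neg_eq_add, zero_add, add_zero] at this
      exact Submodule.mem_sup_left this
    · have := hr 1 0 0
      simp only [zero_smul, one_smul, sub_zero, add_zero] at this
      exact Submodule.mem_sup_left this

/-- The even part of the partial prolong. -/
theorem isIsoToLie_bjAlg_even (h3 : (3 : K) = 0) :
    IsIsoToLie (bjAlg K ⊓ par 0) (SL K 2 × PSL3 K) := by
  refine ⟨(slTwoMap K).coprod (pslMap K h3), slTwoMap_add_pslMap_injective h3,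
    range_slTwoMap_add_pslMap h3, ?_⟩
  rintro ⟨A, x⟩ ⟨B, y⟩
  have hp : ∀ x, pslMap K h3 x ∈ basSpan K shortSet := fun x => by
    rw [← range_pslMap h3]; exact ⟨x, rfl⟩
  change (slTwoMap K).coprod (pslMap K h3) (⁅A, B⁆, ⁅x, y⁆) = contactBr K _ _
  rw [LinearMap.coprod_apply, LinearMap.coprod_apply, LinearMap.coprod_apply, slTwoMap_lie h3,
    pslMap_lie, map_add, map_add, LinearMap.add_apply, LinearMap.add_apply,
    (contactBr_slTwoMap_short h3 A (hp y)).1, (contactBr_slTwoMap_short h3 B (hp x)).2, add_zero,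
    zero_add]

end Matrices

end SuperLie
end

/-! ### The theorem. -/

theorem theorem4p2 (K : Type*) [Field K] (p : ℕ) [CharP K p] (hp : p ≠ 2) :
    ∃ φ : AG2 K →ₗ[K] DPAlg K, IsContactEmbedding φ ∧
      (∀ N : ℕ, 1 ≤ N → LinearMap.range φ ≤ contactAlg K p N) ∧
      (p ≠ 3 → ∀ N : ℕ, 1 ≤ N → IsCTSProlong (contactAlg K p N) (gPart φ) (LinearMap.range φ)) ∧
      (p = 3 →
        IsIsoToLie ((agShort K).map φ) (PSL3 K) ∧
        Disjoint (agShort K) (agCentre K) ∧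
        Module.finrank K (agCentre K) = 1 ∧
        ∃ Bj : ℕ → Submodule K (DPAlg K), ∃ V₁ V₂ bj : Submodule K (DPAlg K),
          (∀ N : ℕ, 1 ≤ N →
            IsCTSProlong (contactAlg K p N) (gTilde φ) (Bj N) ∧
            IsSimpleLieSuperalgebra (Bj N) ∧
            HasSdim (Bj N) (8 * 3 ^ N) (8 * 3 ^ N) ∧
            IsCTSProlong (contactAlg K p N) (gPart φ) (gPart φ 0 ⊔ Bj N) ∧
            StableUnder (gPart φ 0 ⊔ Bj N) (Bj N) ∧
            V₁ ⊔ V₂ = Bj N ⊓ contactDeg K 1) ∧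
          Disjoint V₁ V₂ ∧
          IrreducibleUnder (gTilde φ 0) V₁ ∧ Module.finrank K V₁ = 1 ∧
          IrreducibleUnder (gTilde φ 0) V₂ ∧ Module.finrank K V₂ = 7 ∧
          Submodule.span K {z | ∃ x ∈ V₂, ∃ y ∈ gTilde φ (-1),
            z = SuperBracket.br (R := K) x y} = gTilde φ 0 ∧
          (∀ N : ℕ, 1 ≤ N → bj = partialProlong (Bj N) V₂) ∧
          IsSimpleLieSuperalgebra bj ∧
          HasSdim bj 10 14 ∧
          IsIsoToLie (bj ⊓ SuperBracket.par 0) (SL K 2 × PSL3 K)) := by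
  have hchar := CharP.char_is_prime_or_zero K p
  have hne : ∀ q : ℕ, q.Prime → p ≠ q → (q : K) ≠ 0 := fun q hq hpq h => by
    have hd := (CharP.cast_eq_zero_iff K p q).1 h
    rcases hchar with hp' | rfl
    · exact hpq ((Nat.prime_dvd_prime_iff_eq hp' hq).1 hd)
    · exact hq.ne_zero (Nat.eq_zero_of_zero_dvd hd)
  have h2 : (2 : K) ≠ 0 := by exact_mod_cast hne 2 Nat.prime_two hp
  have hp3 : p = 0 ∨ 3 ≤ p := by
    rcases hchar with hp' | rfl
    · have := hp'.two_le; omega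
    · exact Or.inl rfl
  refine ⟨agEmb K, isContactEmbedding_agEmb h2, fun N hN => range_agEmb_le p N hp3 hN,
    fun h N hN => isCTSProlong_agEmb h2 (by exact_mod_cast hne 3 Nat.prime_three h)
      (range_agEmb_le p N hp3 hN), ?_⟩
  rintro rfl
  have h3 : (3 : K) = 0 := three_eq_zero
  have hg : gTilde (agEmb K) = fun d => basSpan K (bjSet ∩ {k | basDeg k = d}) :=
    funext (gTilde_agEmb h3)
  have hg0 := gTilde_agEmb h3 0
  refine ⟨isIsoToLie_map_agShort h3, disjoint_agShort_agCentre h3, finrank_agCentre h3, bjN K,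
    Submodule.span K {eval K cubicCode}, degOne K, bjAlg K, fun N hN => ⟨?_, isSimple_bjN hN,
      hasSdim_bjN N, isCTSProlong_sup_bjN hN, ?_, ?_⟩, disjoint_cubic_degOne h3, ?_,
    finrank_cubic h3, ?_, finrank_degOne h2, ?_, fun N hN => bjAlg_eq_partialProlong hN,
    isSimple_bjAlg h3, hasSdim_bjAlg h3, isIsoToLie_bjAlg_even h3⟩
  · rw [hg]; exact isCTSProlong_bjN hN
  · rw [gPart_agEmb]; exact stableUnder_bjN hN
  · exact (famSpan_inf_contactDeg_one h3 (Iio_three_subset hN)).symm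
  · rw [hg0]; exact irreducible_cubic h3
  · rw [hg0]; exact irreducible_degOne h3
  · rw [hg0, gTilde_agEmb h3, bjSet_inter (by norm_num)]
    exact basSpan_zero_eq_span h3
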